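/- **Setting.** Write $\mathbb C\,\mathfrak t^{\mathbb R}$ for the semiring of symbols $c\,\mathfrak t^{x}$ ($c\in\mathbb C$, $x\in\mathbb R$) with $c\mathfrak t^x\cdot c'\mathfrak t^{x'}=cc'\mathfrak t^{x+x'}$, and with $c\mathfrak t^x+c'\mathfrak t^{x'}$ equal to the summand with the smaller exponent, or to $(c+c')\mathfrak t^x$ if $x=x'$. For $x\ge 0$ the smooth part of $c\mathfrak t^x$ is $c$ if $x=0$ and $0$ if $x>0$. An *abstract exploded space* is a (possibly non-Hausdorff) topological space with a sheaf $\mathcal E^\times$ of abelian groups of $\mathbb C^*\mathfrak t^{\mathbb R}$-valued functions (*exploded functions*) containing the constants; a *map* is a continuous map which pulls exploded functions back to exploded functions. For an integral affine polytope $P\subset\mathbb R^m$ (nonempty interior, defined by finitely many weak or strict inequalities $a+\alpha\cdot x\ge 0$ or $a+\alpha\cdot x>0$ with $a\in\mathbb R$, $\alpha\in\mathbb Z^m$), the model $\mathbb R^n\times\mathbf T^m_P$ is the set of points $(x,\tilde z)$ with $x\in\mathbb R^n$ and $\tilde z=(c_1\mathfrak t^{y_1},\dots,c_m\mathfrak t^{y_m})$,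 $c_i\in\mathbb C^*$, $y\in P$. Its topology is pulled back from the real coordinates $x$ and the smooth monomials $\zeta$, i.e. the smooth parts of those $\mathfrak t^a\tilde z^\alpha$ with $a+\alpha\cdot y\ge0$ on $P$. Its exploded functions are locally of the form $F(x,\zeta_1,\dots,\zeta_N)\,\mathfrak t^a\tilde z^\alpha$ with $F$ smooth and $\mathbb C^*$-valued, and the $\zeta_j$ smooth monomials. A *smooth exploded manifold* is an abstract exploded space locally isomorphic to open subsets of such models. Its *smooth part* is its quotient by topological indistinguishability. A smooth real function on an open set is a map to $\mathbb R$, whose exploded functions are $g\,\mathfrak t^a$ with $g$ smooth and $\mathbb C^*$-valued and $a$ locally constant. An exploded tropical function is locally a finite sum of exploded functions. A *tangent vector* $v$ at $p$ is a pair of additive maps, from germs at $p$ of smooth functions to $\mathbb R$ and from germs at $p$ of exploded tropical functions to $\mathbb C\,\mathfrak t^{\mathbb R}$, which satisfy $v(fg)=v(f)g(p)+f(p)v(g)$, $v(c\mathfrak t^yf)=c\mathfrak t^y v(f)$ and $v(f\,\mathfrak t^0)=v(f)\,\mathfrak t^0$ for smooth $f$. It is *integral* if $v(f)f(p)^{-1}\in\mathbb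 Z$ (that is, it equals $k\,\mathfrak t^0$ with $k\in\mathbb Z$) for every exploded function $f$ near $p$. Write $T_p$ for the set of tangent vectors and ${}^{\mathbb Z}T_p$ for the set of integral vectors at $p$. The differential of a map $h$ is given by $dh(v)(g)=v(g\circ h)$. For $0<l<\infty$ write $\mathbf T^1_{(0,l)}$ and $\mathbf T^1_{[0,l]}$ for the models with $n=0$, $m=1$ and $P=(0,l)$, resp. $P=[0,l]$. A map $h:\mathbf A\to\mathbf B$ of smooth exploded manifolds is *complete* if the induced map of smooth parts is proper and, for every $l>0$, a map $\gamma:\mathbf T^1_{(0,l)}\to\mathbf A$ extends to a map $\mathbf T^1_{[0,l]}\to\mathbf A$ if and only if $h\circ\gamma$ extends to a map $\mathbf T^1_{[0,l]}\to\mathbf B$. The map $h$ is a *family* if it is complete and, for every $p\in\mathbf A$, both $dh:T_p\mathbf A\to T_{h(p)}\mathbf B$ and $dh:{}^{\mathbb Z}T_p\mathbf A\to{}^{\mathbb Z}T_{h(p)}\mathbf B$ are surjective. **Lemma.** Let $\pi:\mathbf C\to\mathbf F$ be a family and let $f:\mathbf G\to\mathbf F$ be any map of smooth exploded manifolds. Then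 the fiber product $\mathbf C\times_{\mathbf F}\mathbf G$ exists in the category of smooth exploded manifolds, and its projection $\pi':\mathbf C\times_{\mathbf F}\mathbf G\to\mathbf G$ is a family. -/

import Mathlib

universe u v w

namespace Exploded

open CategoryTheory TopologicalSpace Topology

open scoped ContDiff

noncomputable section

/-! ### The exploded semiring -/

/-- The exploded semiring `ℂ t^ℝ`: `⟨c, x⟩` stands for `c t^x`. -/
@[ext]
structure Number where
  /-- the coefficient `c` of `c t^x` -/
  coeff : ℂ
  /-- the exponent `x` of `c t^x`; the tropical part of `c t^x` is `t^x` -/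
  order : ℝ

namespace Number

instance : Mul Number := ⟨fun a b => ⟨a.coeff * b.coeff, a.order + b.order⟩⟩

/-- Only the terms with the smallest exponent survive in a sum. -/
instance : Add Number :=
  ⟨fun a b =>
    if a.order < b.order then a
    else if b.order < a.order then b
    else ⟨a.coeff + b.coeff, a.order⟩⟩

/-- The inverse `c⁻¹ t^(-x)`; it is only used where `c ≠ 0`. -/
instance : Inv Number := ⟨fun a => ⟨a.coeff⁻¹, -a.order⟩⟩

/-- The inclusion `c ↦ c t^0`. -/
def ofComplex (c : ℂ) : Number := ⟨c, 0⟩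

/-- The smooth part of `c t^x` for `x ≥ 0`: it is `c` if `x = 0`, and `0` if `x > 0`. -/
def smoothPart (a : Number) : ℂ := if a.order = 0 then a.coeff else 0

@[simp] theorem mul_coeff (a b : Number) : (a * b).coeff = a.coeff * b.coeff := rfl
@[simp] theorem mul_order (a b : Number) : (a * b).order = a.order + b.order := rfl
@[simp] theorem inv_coeff (a : Number) : (a⁻¹).coeff = (a.coeff)⁻¹ := rfl
@[simp] theorem inv_order (a : Number) : (a⁻¹).order = -a.order := rfl

end Number

/-! ### Abstract exploded spaces and their morphisms -/

/-- An abstract exploded space: a topological space with a sheaf of abelian groups consisting of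
`ℂ^* t^ℝ`-valued functions, under pointwise multiplication, that contains the constants.
A section over `U` is given by a function on the whole space, of which only the restriction to `U`
matters (`congr`). -/
structure Space : Type (u + 1) where
  /-- the set of points -/
  carrier : Type u
  [top : TopologicalSpace carrier]
  /-- `IsExploded U f`: the restriction of `f` to `U` is an exploded function on `U` -/
  IsExploded : Opens carrier → (carrier → Number) → Prop
  coeff_ne_zero : ∀ {U f}, IsExploded U f → ∀ x ∈ U, (f x).coeff ≠ 0
  congr : ∀ {U f g}, (∀ x ∈ U, f x = g x) → IsExploded U f → IsExploded U g
  restrict : ∀ {U V f}, V ≤ U → IsExploded U f → IsExploded V f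
  glue : ∀ {U f}, (∀ x ∈ U, ∃ V, x ∈ V ∧ V ≤ U ∧ IsExploded V f) → IsExploded U f
  const : ∀ U (c : Number), c.coeff ≠ 0 → IsExploded U fun _ => c
  mul : ∀ {U f g}, IsExploded U f → IsExploded U g → IsExploded U fun x => f x * g x
  inv : ∀ {U f}, IsExploded U f → IsExploded U fun x => (f x)⁻¹

instance : CoeSort Space.{u} (Type u) := ⟨Space.carrier⟩

instance (X : Space.{u}) : TopologicalSpace X := X.top

/-- A morphism of abstract exploded spaces: a continuous map that pulls exploded functions back to
exploded functions. -/
@[ext]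
structure Hom (X : Space.{u}) (Y : Space.{v}) where
  toFun : X → Y
  continuous : Continuous toFun
  pullback : ∀ {V : Opens Y} {g : Y → Number}, Y.IsExploded V g →
    X.IsExploded (V.comap ⟨toFun, continuous⟩) (fun x => g (toFun x))

instance (X : Space.{u}) (Y : Space.{v}) : CoeFun (Hom X Y) (fun _ => X → Y) := ⟨Hom.toFun⟩

/-- The identity morphism. -/
def Hom.id (X : Space.{u}) : Hom X X where
  toFun x := x
  continuous := continuous_id
  pullback h := h

/-- Composition of morphisms: first `f`, then `g`. -/
def Hom.comp {X : Space.{u}} {Y : Space.{v}} {Z : Space.{w}} (f : Hom X Y) (g : Hom Y Z) :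
    Hom X Z where
  toFun x := g (f x)
  continuous := g.continuous.comp f.continuous
  pullback h := f.pullback (g.pullback h)

/-- Two abstract exploded spaces (possibly in different universes) are isomorphic. -/
def Isomorphic (X : Space.{u}) (Y : Space.{v}) : Prop :=
  ∃ (f : Hom X Y) (g : Hom Y X), (∀ x, g (f x) = x) ∧ ∀ y, f (g y) = y

/-- An open subset of `U`, regarded as an open subset of the ambient space. -/
def imageOpens {X : Space.{u}} {U : Opens X} (V : Opens U) : Opens X :=
  ⟨Subtype.val '' (V : Set U), U.isOpen.isOpenMap_subtype_val _ V.isOpen⟩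

/-- An open subset of an abstract exploded space, as an abstract exploded space. -/
def Space.onOpen (X : Space.{u}) (U : Opens X) : Space.{u} where
  carrier := U
  IsExploded V g := ∃ h, X.IsExploded (imageOpens V) h ∧ ∀ x ∈ V, g x = h x
  coeff_ne_zero := by
    rintro V g ⟨h, hh, e⟩ x hx
    rw [e x hx]
    exact X.coeff_ne_zero hh _ ⟨x, hx, rfl⟩
  congr := by
    rintro V f g e ⟨h, hh, e'⟩
    exact ⟨h, hh, fun x hx => (e x hx).symm.trans (e' x hx)⟩
  restrict := by
    rintro V W f hVW ⟨h, hh, e⟩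
    exact ⟨h, X.restrict (Set.image_mono hVW) hh, fun x hx => e x (hVW hx)⟩
  glue := by
    classical
    intro V f H
    refine ⟨fun x => if hx : x ∈ U then f ⟨x, hx⟩ else ⟨1, 0⟩, X.glue ?_, ?_⟩
    · rintro _ ⟨x, hx, rfl⟩
      obtain ⟨W, hxW, hWV, h, hh, e⟩ := H x hx
      refine ⟨imageOpens W, ⟨x, hxW, rfl⟩, Set.image_mono hWV, X.congr ?_ hh⟩
      rintro _ ⟨y, hy, rfl⟩
      simp [e y hy]
    · intro x _
      simp
  const U c hc := ⟨_, X.const _ c hc, fun _ _ => rfl⟩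
  mul := by
    rintro V f g ⟨h, hh, e⟩ ⟨h', hh', e'⟩
    exact ⟨_, X.mul hh hh', fun x hx => by simp only [e x hx, e' x hx]⟩
  inv := by
    rintro V f ⟨h, hh, e⟩
    exact ⟨_, X.inv hh, fun x hx => by simp only [e x hx]⟩

/-! ### The real line as an exploded manifold -/

/-- The real line as an abstract exploded space: the exploded functions are `f t^a` with `f` smooth
and `ℂ^*`-valued and `a` locally constant. -/
def realLine : Space.{0} where
  carrier := ℝ
  IsExploded U g := ∀ x ∈ U, (g x).coeff ≠ 0 ∧ ContDiffAt ℝ ∞ (fun y => (g y).coeff) x ∧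
    ∀ᶠ y in 𝓝 x, (g y).order = (g x).order
  coeff_ne_zero h x hx := (h x hx).1
  congr := by
    intro U f g e h x hx
    have e' : ∀ᶠ y in 𝓝 x, f y = g y := Filter.mem_of_superset (U.isOpen.mem_nhds hx) e
    refine ⟨e x hx ▸ (h x hx).1, (h x hx).2.1.congr_of_eventuallyEq ?_, ?_⟩
    · filter_upwards [e'] with y hy
      rw [hy]
    · filter_upwards [e', (h x hx).2.2] with y hy hy'
      rw [← hy, hy', e x hx]
  restrict hVU h x hx := h x (hVU hx)
  glue := by
    intro U f H x hx
    obtain ⟨V, hxV, -, h⟩ := H x hx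
    exact h x hxV
  const U c hc x _ := ⟨hc, contDiffAt_const, Filter.Eventually.of_forall fun _ => rfl⟩
  mul := by
    intro U f g hf hg x hx
    refine ⟨mul_ne_zero (hf x hx).1 (hg x hx).1, (hf x hx).2.1.mul (hg x hx).2.1, ?_⟩
    filter_upwards [(hf x hx).2.2, (hg x hx).2.2] with y h h'
    simp [h, h']
  inv := by
    intro U f hf x hx
    refine ⟨inv_ne_zero (hf x hx).1, (hf x hx).2.1.inv (hf x hx).1, ?_⟩
    filter_upwards [(hf x hx).2.2] with y h
    simp [h]

/-! ### The local models `ℝⁿ × T^m_P` -/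

/-- The integral affine function `x ↦ a + ∑ αᵢ xᵢ`. -/
def affine {m : ℕ} (a : ℝ) (α : Fin m → ℤ) (x : Fin m → ℝ) : ℝ := a + ∑ i, (α i : ℝ) * x i

/-- An integral affine polytope: a subset of `ℝ^m` with nonempty interior, defined by finitely many
weak and strict integral affine inequalities. (Here `t^x ≤ t^0` means `0 ≤ x`.) -/
def IsPolytope {m : ℕ} (P : Set (Fin m → ℝ)) : Prop :=
  (interior P).Nonempty ∧
    ∃ s s' : Finset (ℝ × (Fin m → ℤ)),
      P = {x | (∀ c ∈ s, 0 ≤ affine c.1 c.2 x) ∧ ∀ c ∈ s', 0 < affine c.1 c.2 x}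

/-- The points of `T^m_P`: tuples `(c₁ t^{x₁}, …, c_m t^{x_m})` with all `cᵢ ≠ 0` and `x ∈ P`. -/
@[ext]
structure TorusPoint (m : ℕ) (P : Set (Fin m → ℝ)) : Type where
  /-- the coordinates -/
  z : Fin m → Number
  coeff_ne_zero : ∀ i, (z i).coeff ≠ 0
  order_mem : (fun i => (z i).order) ∈ P

/-- The exploded monomial `c t^a z^α`. -/
def monomial {m : ℕ} (c : ℂ) (a : ℝ) (α : Fin m → ℤ) (z : Fin m → Number) : Number :=
  ⟨c * ∏ i, (z i).coeff ^ α i, affine a α fun i => (z i).order⟩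

/-- The exponents `(a, α)` for which the tropical part of `t^a z^α` is at most `t^0` on `P`. -/
@[ext]
structure SmoothExponent {m : ℕ} (P : Set (Fin m → ℝ)) : Type where
  /-- the constant `a` -/
  a : ℝ
  /-- the exponents `α` -/
  α : Fin m → ℤ
  nonneg : ∀ x ∈ P, 0 ≤ affine a α x

/-- The smooth monomial `⌊t^a z^α⌋`. -/
def smoothMonomial {m : ℕ} {P : Set (Fin m → ℝ)} (e : SmoothExponent P) (z : TorusPoint m P) : ℂ :=
  (monomial 1 e.a e.α z.z).smoothPart

/-- The points `(x, z)` of `ℝⁿ × T^m_P`. -/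
@[ext]
structure ModelPoint (n m : ℕ) (P : Set (Fin m → ℝ)) : Type where
  /-- the real coordinates -/
  x : Fin n → ℝ
  /-- the point of `T^m_P` -/
  pt : TorusPoint m P

/-- The topology pulled back by the real coordinates and the smooth monomials. All smooth
monomials are used; each of them is a constant times a product of elements of any finite generating
set, so that such a set gives the same topology. -/
instance (n m : ℕ) (P : Set (Fin m → ℝ)) : TopologicalSpace (ModelPoint n m P) :=
  TopologicalSpace.induced
    (fun q => ((q.x, fun e => smoothMonomial e q.pt) : (Fin n → ℝ) × (SmoothExponent P → ℂ)))
    inferInstance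

/-- `h` is of the form `F(x, ζ₁, …, ζ_N) t^a z^α` on the set `V`, where the `ζⱼ` are smooth
monomials, `F` is smooth and `ℂ^*`-valued, and `a`, `α` are constant. -/
def HasStandardForm {n m : ℕ} {P : Set (Fin m → ℝ)} (V : Set (ModelPoint n m P))
    (h : ModelPoint n m P → Number) : Prop :=
  ∃ (N : ℕ) (ζ : Fin N → SmoothExponent P) (F : (Fin n → ℝ) × (Fin N → ℂ) → ℂ)
    (a : ℝ) (α : Fin m → ℤ), ContDiff ℝ ∞ F ∧ (∀ y, F y ≠ 0) ∧
      ∀ q ∈ V, h q = monomial (F (q.x, fun j => smoothMonomial (ζ j) q.pt)) a α q.pt.z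

theorem HasStandardForm.mul {n m : ℕ} {P : Set (Fin m → ℝ)} {V W : Set (ModelPoint n m P)}
    {f g : ModelPoint n m P → Number} (hf : HasStandardForm V f) (hg : HasStandardForm W g) :
    HasStandardForm (V ∩ W) fun q => f q * g q := by
  obtain ⟨N, ζ, F, a, α, hF, hF0, hf⟩ := hf
  obtain ⟨N', ζ', F', a', α', hF', hF0', hg⟩ := hg
  refine ⟨N + N', Fin.append ζ ζ', fun y => F (y.1, fun j => y.2 (Fin.castAdd N' j)) *
    F' (y.1, fun j => y.2 (Fin.natAdd N j)), a + a', α + α', ?_, ?_, ?_⟩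
  · exact (hF.comp (by fun_prop)).mul (hF'.comp (by fun_prop))
  · exact fun y => mul_ne_zero (hF0 _) (hF0' _)
  · intro q hq
    simp only [hf q hq.1, hg q hq.2]
    ext1
    · simp only [Number.mul_coeff, monomial, Fin.append_left, Fin.append_right, Pi.add_apply]
      simp_rw [zpow_add₀ (q.pt.coeff_ne_zero _), Finset.prod_mul_distrib]
      ring
    · simp only [Number.mul_order, monomial, affine, Pi.add_apply, Int.cast_add, add_mul,
        Finset.sum_add_distrib]
      ring

theorem HasStandardForm.inv {n m : ℕ} {P : Set (Fin m → ℝ)} {V : Set (ModelPoint n m P)}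
    {f : ModelPoint n m P → Number} (hf : HasStandardForm V f) :
    HasStandardForm V fun q => (f q)⁻¹ := by
  obtain ⟨N, ζ, F, a, α, hF, hF0, hf⟩ := hf
  refine ⟨N, ζ, fun y => (F y)⁻¹, -a, -α, hF.inv hF0, fun y => inv_ne_zero (hF0 y), ?_⟩
  intro q hq
  simp only [hf q hq]
  ext1
  · simp [monomial, mul_comm]
  · simp [monomial, affine, add_comm]

/-- The abstract exploded space `ℝⁿ × T^m_P`. Its exploded functions are locally of the form
`F(x, ζ₁, …, ζ_N) t^a z^α`. -/
def model (n m : ℕ) (P : Set (Fin m → ℝ)) : Space.{0} where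
  carrier := ModelPoint n m P
  IsExploded U h := ∀ q ∈ U, ∃ V : Opens (ModelPoint n m P), q ∈ V ∧ V ≤ U ∧
    HasStandardForm (V : Set (ModelPoint n m P)) h
  coeff_ne_zero := by
    intro U h H q hq
    obtain ⟨V, hqV, -, N, ζ, F, a, α, -, hF, e⟩ := H q hq
    rw [e q hqV]
    exact mul_ne_zero (hF _) (Finset.prod_ne_zero_iff.2 fun i _ => zpow_ne_zero _ (q.pt.coeff_ne_zero i))
  congr := by
    intro U f g e H q hq
    obtain ⟨V, hqV, hVU, N, ζ, F, a, α, hF, hF0, e'⟩ := H q hq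
    exact ⟨V, hqV, hVU, N, ζ, F, a, α, hF, hF0, fun x hx => (e x (hVU hx)).symm.trans (e' x hx)⟩
  restrict := by
    intro U W f hWU H q hq
    obtain ⟨V, hqV, -, N, ζ, F, a, α, hF, hF0, e⟩ := H q (hWU hq)
    exact ⟨V ⊓ W, ⟨hqV, hq⟩, inf_le_right, N, ζ, F, a, α, hF, hF0, fun x hx => e x hx.1⟩
  glue := by
    intro U f H q hq
    obtain ⟨V, hqV, hVU, h⟩ := H q hq
    obtain ⟨W, hqW, hWV, h'⟩ := h q hqV
    exact ⟨W, hqW, hWV.trans hVU, h'⟩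
  const := by
    intro U c hc q hq
    refine ⟨U, hq, le_rfl, 0, Fin.elim0, fun _ => c.coeff, c.order, 0, contDiff_const,
      fun _ => hc, fun x _ => ?_⟩
    ext1 <;> simp [monomial, affine]
  mul := by
    intro U f g hf hg q hq
    obtain ⟨V, hqV, hVU, h⟩ := hf q hq
    obtain ⟨W, hqW, -, h'⟩ := hg q hq
    exact ⟨V ⊓ W, ⟨hqV, hqW⟩, inf_le_left.trans hVU, h.mul h'⟩
  inv := by
    intro U f hf q hq
    obtain ⟨V, hqV, hVU, h⟩ := hf q hq
    exact ⟨V, hqV, hVU, h.inv⟩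

/-! ### Exploded manifolds -/

/-- A smooth exploded manifold: an abstract exploded space that is locally isomorphic to open
subsets of the models `ℝⁿ × T^m_P`. -/
structure Manifold : Type (u + 1) extends Space.{u} where
  locally_model : ∀ p : toSpace, ∃ U : Opens toSpace, p ∈ U ∧
    ∃ (n m : ℕ) (P : Set (Fin m → ℝ)) (Ω : Opens (model n m P)), IsPolytope P ∧
      Isomorphic (toSpace.onOpen U) ((model n m P).onOpen Ω)

instance : CoeSort Manifold.{u} (Type u) := ⟨fun X => X.carrier⟩

/-- The category of smooth exploded manifolds; a map is a morphism of abstract exploded spaces. -/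
instance : Category Manifold.{u} where
  Hom X Y := Hom X.toSpace Y.toSpace
  id X := Hom.id X.toSpace
  comp f g := Hom.comp f g

/-- The smooth part of an exploded manifold: its quotient by topological indistinguishability. -/
abbrev SmoothPart (X : Space.{u}) : Type u := SeparationQuotient X

/-- The map between smooth parts induced by a morphism. -/
def Hom.smoothPart {X : Space.{u}} {Y : Space.{v}} (f : Hom X Y) : SmoothPart X → SmoothPart Y :=
  SeparationQuotient.lift (fun x => SeparationQuotient.mk (f x)) fun _ _ h =>
    SeparationQuotient.mk_eq_mk.2 (h.map f.continuous)

/-! ### Tangent vectors -/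

/-- `f` is a smooth real function on `U`: a morphism from `U` to the real line. -/
def Space.IsSmooth (X : Space.{u}) (U : Opens X) (f : X → ℝ) : Prop :=
  ∃ φ : Hom (X.onOpen U) realLine, ∀ x : U, φ x = f x

/-- `f` is an exploded tropical function on `U`: it is locally a finite (nonempty) pointwise sum of
exploded functions. -/
def Space.IsTropical (X : Space.{u}) (U : Opens X) (f : X → Number) : Prop :=
  ∀ x ∈ U, ∃ V : Opens X, x ∈ V ∧ V ≤ U ∧
    ∃ h ∈ AddSubsemigroup.closure {g : X → Number | X.IsExploded V g}, ∀ y ∈ V, f y = h y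

/-- Representatives of germs at `p` of smooth real functions. -/
@[ext]
structure SmoothAt (X : Space.{u}) (p : X) : Type u where
  /-- the function -/
  fn : X → ℝ
  smooth : ∃ U : Opens X, p ∈ U ∧ X.IsSmooth U fn

/-- Representatives of germs at `p` of exploded tropical functions. -/
@[ext]
structure TropicalAt (X : Space.{u}) (p : X) : Type u where
  /-- the function -/
  fn : X → Number
  tropical : ∃ U : Opens X, p ∈ U ∧ X.IsTropical U fn

/-- A tangent vector at `p`: a pair of derivations, on germs at `p` of smooth functions and of
exploded tropical functions, that are compatible with multiplication by constants and with the
inclusion of smooth functions in exploded tropical functions. -/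
@[ext]
structure TangentVector (X : Space.{u}) (p : X) where
  /-- the action on smooth functions -/
  onSmooth : SmoothAt X p → ℝ
  /-- the action on exploded tropical functions -/
  onTropical : TropicalAt X p → Number
  smooth_germ : ∀ f g, f.fn =ᶠ[𝓝 p] g.fn → onSmooth f = onSmooth g
  tropical_germ : ∀ f g, f.fn =ᶠ[𝓝 p] g.fn → onTropical f = onTropical g
  smooth_add : ∀ f g h, (∀ x, h.fn x = f.fn x + g.fn x) → onSmooth h = onSmooth f + onSmooth g
  tropical_add : ∀ f g h, (∀ x, h.fn x = f.fn x + g.fn x) →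
    onTropical h = onTropical f + onTropical g
  smooth_mul : ∀ f g h, (∀ x, h.fn x = f.fn x * g.fn x) →
    onSmooth h = onSmooth f * g.fn p + f.fn p * onSmooth g
  tropical_mul : ∀ f g h, (∀ x, h.fn x = f.fn x * g.fn x) →
    onTropical h = onTropical f * g.fn p + f.fn p * onTropical g
  tropical_const_mul : ∀ (c : Number) f h, (∀ x, h.fn x = c * f.fn x) →
    onTropical h = c * onTropical f
  compatible : ∀ (f : SmoothAt X p) (h : TropicalAt X p),
    (∀ x, h.fn x = Number.ofComplex (f.fn x)) →
      onTropical h = Number.ofComplex (onSmooth f)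

/-- An integral vector at `p`: a tangent vector `v` with `v(f) f⁻¹ ∈ ℤ` for every exploded function
`f` near `p`. -/
def TangentVector.IsIntegral {X : Space.{u}} {p : X} (v : TangentVector X p) : Prop :=
  ∀ f : TropicalAt X p, (∃ U : Opens X, p ∈ U ∧ X.IsExploded U f.fn) →
    ∃ k : ℤ, v.onTropical f * (f.fn p)⁻¹ = Number.ofComplex k

/-- The restriction of a morphism to the preimage of an open set. -/
def Hom.onOpen {X : Space.{u}} {Y : Space.{v}} (φ : Hom X Y) (V : Opens Y) :
    Hom (X.onOpen (V.comap ⟨φ, φ.continuous⟩)) (Y.onOpen V) where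
  toFun x := ⟨φ x.1, x.2⟩
  continuous := Continuous.subtype_mk (φ.continuous.comp continuous_subtype_val) _
  pullback := by
    rintro W g ⟨h, hh, e⟩
    refine ⟨_, X.restrict ?_ (φ.pullback hh), fun x hx => e _ hx⟩
    rintro _ ⟨x, hx, rfl⟩
    exact ⟨_, hx, rfl⟩

/-- The pullback `f ∘ φ` of a germ of smooth functions. -/
def SmoothAt.comp {X : Space.{u}} {Y : Space.{v}} (φ : Hom X Y) {p : X} (f : SmoothAt Y (φ p)) :
    SmoothAt X p :=
  ⟨fun x => f.fn (φ x), by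
    obtain ⟨U, hU, ψ, hψ⟩ := f.smooth
    exact ⟨U.comap ⟨φ, φ.continuous⟩, hU, (φ.onOpen U).comp ψ, fun x => hψ ⟨φ x.1, x.2⟩⟩⟩

/-- The pullback `f ∘ φ` of a germ of exploded tropical functions. -/
def TropicalAt.comp {X : Space.{u}} {Y : Space.{v}} (φ : Hom X Y) {p : X}
    (f : TropicalAt Y (φ p)) : TropicalAt X p :=
  ⟨fun x => f.fn (φ x), by
    obtain ⟨U, hU, h⟩ := f.tropical
    refine ⟨U.comap ⟨φ, φ.continuous⟩, hU, fun x hx => ?_⟩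
    obtain ⟨V, hxV, hVU, g, hg, e⟩ := h (φ x) hx
    refine ⟨V.comap ⟨φ, φ.continuous⟩, hxV, fun y hy => hVU hy, fun x => g (φ x), ?_,
      fun y hy => e (φ y) hy⟩
    clear e
    induction hg using AddSubsemigroup.closure_induction with
    | mem g hg => exact AddSubsemigroup.subset_closure (φ.pullback hg)
    | add a b _ _ ha hb => exact AddSubsemigroup.add_mem _ ha hb⟩

/-- The differential `dφ : T_p X → T_{φ(p)} Y`, given by `dφ(v) g = v(g ∘ φ)`. -/
def Hom.differential {X : Space.{u}} {Y : Space.{v}} (φ : Hom X Y) (p : X)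
    (w : TangentVector X p) : TangentVector Y (φ p) where
  onSmooth f := w.onSmooth (f.comp φ)
  onTropical f := w.onTropical (f.comp φ)
  smooth_germ _ _ h := w.smooth_germ _ _ (φ.continuous.continuousAt.eventually h)
  tropical_germ _ _ h := w.tropical_germ _ _ (φ.continuous.continuousAt.eventually h)
  smooth_add _ _ _ h := w.smooth_add _ _ _ fun x => h (φ x)
  tropical_add _ _ _ h := w.tropical_add _ _ _ fun x => h (φ x)
  smooth_mul f g _ h := w.smooth_mul (f.comp φ) (g.comp φ) _ fun x => h (φ x)
  tropical_mul f g _ h := w.tropical_mul (f.comp φ) (g.comp φ) _ fun x => h (φ x)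
  tropical_const_mul _ _ _ h := w.tropical_const_mul _ _ _ fun x => h (φ x)
  compatible _ _ h := w.compatible _ _ fun x => h (φ x)

/-! ### Complete maps and families -/

/-- `T^1_S` for a subset `S` of the real line. -/
def interval (S : Set ℝ) : Space.{0} := model 0 1 {x | x 0 ∈ S}

/-- The inclusion of the points of `T^1_S` in those of `T^1_{S'}`. -/
def interval.incl {S S' : Set ℝ} (h : S ⊆ S') (q : interval S) : interval S' :=
  ⟨ModelPoint.x q, ⟨(ModelPoint.pt q).z, (ModelPoint.pt q).coeff_ne_zero,
    h (ModelPoint.pt q).order_mem⟩⟩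

/-- A morphism `γ` from `T^1_{(0,l)}` to `X` extends to a morphism from `T^1_{[0,l]}` to `X`. -/
def Extends {X : Space.{u}} {l : ℝ} (γ : Hom (interval (Set.Ioo 0 l)) X) : Prop :=
  ∃ γ' : Hom (interval (Set.Icc 0 l)) X, ∀ q, γ' (interval.incl Set.Ioo_subset_Icc_self q) = γ q

/-- A morphism is proper if the induced map between smooth parts is proper. -/
def Hom.IsProper {X : Space.{u}} {Y : Space.{v}} (f : Hom X Y) : Prop := IsProperMap f.smoothPart

/-- A morphism `f : X → Y` is complete if it is proper and every morphism `γ` from `T^1_{(0,l)}` to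
`X` extends to `T^1_{[0,l]}` if and only if `f ∘ γ` does. -/
def Hom.IsComplete {X : Space.{u}} {Y : Space.{v}} (f : Hom X Y) : Prop :=
  f.IsProper ∧ ∀ (l : ℝ), 0 < l → ∀ γ : Hom (interval (Set.Ioo 0 l)) X,
    Extends γ ↔ Extends (γ.comp f)

/-- A family of exploded manifolds over `Y`: a complete map `f : X → Y` whose differential is
surjective at every point, on tangent vectors and on integral vectors. -/
def IsFamily {X Y : Manifold.{u}} (f : X ⟶ Y) : Prop :=
  Hom.IsComplete f ∧ ∀ p : X,
    Function.Surjective (Hom.differential f p) ∧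
    Set.SurjOn (Hom.differential f p) {v | v.IsIntegral} {v | v.IsIntegral}

end

end Exploded

namespace Exploded
open CategoryTheory TopologicalSpace Topology Filter
open scoped ContDiff
noncomputable section

/-! ### Arithmetic of the exploded semiring -/

namespace Number

/-! The proof has three ingredients: charts centered at a given point, a normal form for submersions
in such charts, and convex geometry of polytopes.

Centered charts (`IsModeled.exists_centered_chart`). The exponents of the inequalities active at a
point span a sublattice of `ℤ^m`. Near the point, monomials with exponent in its saturation have
constant order, so their coefficients are ordinary `ℂ^*`-valued smooth functions and can be traded
for real coordinates. What remains is a chart in which the tropical part of the point is interior to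
the polytope. There every nonconstant smooth monomial vanishes, and every tangent vector kills all
smooth monomials (`TangentVector.dS_mon`). With Hadamard's lemma, a tangent vector is therefore the
same as an arbitrary choice of derivatives of the real coordinates and of complex logarithmic
derivatives of the exploded coordinates (`TangentVector.ext_coords`,
`TangentVector.exists_of_coords`). It is integral exactly when the former vanish and the latter are
integers. The vanishing holds because an order-zero exploded function has local `N`-th roots for all
`N`, so that its logarithmic derivative is an integer divisible by every `N`.

Normal form (`exists_normal_form`). Surjectivity on tangent vectors makes the real Jacobian of `π`
surjective, and surjectivity on integral vectors makes the integer matrix of exponents of `π`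
surjective over `ℤ`. Both can be completed to isomorphisms, and the inverse function theorem then
gives charts in which `π` is a coordinate projection.

Existence. The set-theoretic fiber product carries the final structure for test maps from models,
which makes the universal property nearly formal (`isPullback_fibManifold`). It is a manifold
because, over a chart of `G` centered at `g` and a normal form of `π` at `c`, the coordinates of `G`
and the fiber coordinates of `C` form a chart (`LocalData.chart`). Its polytope is the fiber product
of the two polytopes, and it has nonempty interior because both charts are centered.

The projection is a family. Tangent vectors lift by adding zero fiber components
(`IsFib.exists_tangentVector`). The points of `T_(0,l)` are topologically indistinguishable, so a
curve from it stays in one chart and is monomial there; it extends to `T_[0,l]` exactly when the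
corresponding closed segment stays in the polytope (`Extends.affMap_mem`, `Extends.of_affMap_mem`).
A segment stays in a fiber product of polytopes when both of its images stay in theirs.

Properness is the delicate point. If an ultrafilter on the fiber product converges to `g` in `G`,
properness of `π` provides a limit `c` in `C`, but only with `π c` indistinguishable from `f g`. One
has to replace `c` by an indistinguishable point exactly over `f g` (`exists_inseparable_lift`),
that is, to show that the interior of the polytope of `C` maps onto the interior of the polytope of
`F`. The image is open. It is also relatively closed: Farkas' lemma lifts a limit point to the
closed polyhedron, completeness of `π` puts the lift in the polytope itself
(`mem_of_baseCoords_mem`), and integral vectors at that boundary point lift, which allows it to be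
moved back to the interior (`exists_interior_baseCoords_eq`). Convexity of the base interior
finishes the argument. Finally, convergence of the two components implies convergence in the fiber
product (`IsFib.tendsto_of_tendsto`), since near a centered point the topology is controlled by the
real coordinates and the monomials of the defining inequalities, again by Farkas. -/

instance : One Number := ⟨⟨1, 0⟩⟩

@[simp] theorem one_coeff : (1 : Number).coeff = 1 := rfl
@[simp] theorem one_order : (1 : Number).order = 0 := rfl

/-- Elements with coefficient `0` are not invertible, so this is not a group; the weaker structure
is enough for integral powers and finite products. -/
instance : DivisionCommMonoid Number where
  mul_assoc a b c := by ext1 <;> simp [mul_assoc, add_assoc]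
  one_mul a := by ext1 <;> simp
  mul_one a := by ext1 <;> simp
  mul_comm a b := by ext1 <;> simp [mul_comm, add_comm]
  inv_inv a := by ext1 <;> simp
  mul_inv_rev a b := by ext1 <;> simp [mul_comm, add_comm]
  inv_eq_of_mul a b h := by
    have h1 := congrArg coeff h
    have h2 := congrArg order h
    simp only [mul_coeff, mul_order, one_coeff, one_order] at h1 h2
    ext1
    · exact inv_eq_of_mul_eq_one_right h1
    · simp only [inv_order]; linarith

@[simp] theorem pow_coeff (a : Number) (n : ℕ) : (a ^ n).coeff = a.coeff ^ n := by
  induction n with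
  | zero => simp
  | succ n ih => simp [pow_succ, ih]

@[simp] theorem pow_order (a : Number) (n : ℕ) : (a ^ n).order = n * a.order := by
  induction n with
  | zero => simp
  | succ n ih => simp [pow_succ, ih]; ring

@[simp] theorem zpow_coeff (a : Number) (n : ℤ) : (a ^ n).coeff = a.coeff ^ n := by
  cases n <;> simp [zpow_natCast, zpow_negSucc]

@[simp] theorem zpow_order (a : Number) (n : ℤ) : (a ^ n).order = n * a.order := by
  cases n with
  | ofNat n => simp
  | negSucc n => simp only [zpow_negSucc, inv_order, pow_order]; push_cast; ring

@[simp] theorem prod_coeff {ι : Type*} (s : Finset ι) (f : ι → Number) :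
    (∏ i ∈ s, f i).coeff = ∏ i ∈ s, (f i).coeff := by
  classical
  induction s using Finset.induction_on with
  | empty => simp
  | insert a s h ih => simp [h, ih]

@[simp] theorem prod_order {ι : Type*} (s : Finset ι) (f : ι → Number) :
    (∏ i ∈ s, f i).order = ∑ i ∈ s, (f i).order := by
  classical
  induction s using Finset.induction_on with
  | empty => simp
  | insert a s h ih => simp [h, ih]

theorem smoothPart_of_order_eq_zero {a : Number} (h : a.order = 0) : a.smoothPart = a.coeff :=
  if_pos h

theorem smoothPart_of_order_ne_zero {a : Number} (h : a.order ≠ 0) : a.smoothPart = 0 :=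
  if_neg h

theorem add_def (a b : Number) : a + b = if a.order < b.order then a
    else if b.order < a.order then b else ⟨a.coeff + b.coeff, a.order⟩ := rfl

theorem add_of_lt {a b : Number} (h : a.order < b.order) : a + b = a := by simp [add_def, h]

theorem add_of_gt {a b : Number} (h : b.order < a.order) : a + b = b := by
  simp [add_def, h, h.le.not_gt]

theorem add_of_eq {a b : Number} (h : a.order = b.order) :
    a + b = ⟨a.coeff + b.coeff, a.order⟩ := by
  simp [add_def, h]

theorem add_order (a b : Number) : (a + b).order = min a.order b.order := by
  rcases lt_trichotomy a.order b.order with h | h | h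
  · rw [add_of_lt h, min_eq_left h.le]
  · rw [add_of_eq h, h, min_self]
  · rw [add_of_gt h, min_eq_right h.le]

end Number

theorem monomial_eq {m : ℕ} (c : ℂ) (a : ℝ) (α : Fin m → ℤ) (z : Fin m → Number) :
    monomial c a α z = ⟨c, a⟩ * ∏ i, z i ^ α i := by
  ext1 <;> simp [monomial, affine]

@[simp] theorem monomial_coeff {m : ℕ} (c : ℂ) (a : ℝ) (α : Fin m → ℤ) (z : Fin m → Number) :
    (monomial c a α z).coeff = c * ∏ i, (z i).coeff ^ α i := rfl

@[simp] theorem monomial_order {m : ℕ} (c : ℂ) (a : ℝ) (α : Fin m → ℤ) (z : Fin m → Number) :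
    (monomial c a α z).order = affine a α fun i => (z i).order := rfl

/-! ### Germs of exploded functions and of morphisms -/

/-- `h` is an exploded function near `p`. -/
def ExplAt (X : Space.{u}) (p : X) (h : X → Number) : Prop :=
  ∃ U : Opens X, p ∈ U ∧ X.IsExploded U h

namespace ExplAt

variable {X : Space.{u}} {p : X} {f g : X → Number}

theorem congr (hf : ExplAt X p f) (e : f =ᶠ[𝓝 p] g) : ExplAt X p g := by
  obtain ⟨U, hU, h⟩ := hf
  obtain ⟨V, hV, hVo, hpV⟩ := mem_nhds_iff.1 e
  exact ⟨U ⊓ ⟨V, hVo⟩, ⟨hU, hpV⟩, X.congr (fun x hx => hV hx.2) (X.restrict inf_le_left h)⟩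

theorem eventually (hf : ExplAt X p f) : ∀ᶠ q in 𝓝 p, ExplAt X q f := by
  obtain ⟨U, hU, h⟩ := hf
  exact mem_of_superset (U.isOpen.mem_nhds hU) fun q hq => ⟨U, hq, h⟩

theorem coeff_ne_zero (hf : ExplAt X p f) : (f p).coeff ≠ 0 := by
  obtain ⟨U, hU, h⟩ := hf
  exact X.coeff_ne_zero h p hU

theorem const (X : Space.{u}) (p : X) {c : Number} (hc : c.coeff ≠ 0) : ExplAt X p fun _ => c :=
  ⟨⊤, trivial, X.const _ c hc⟩

theorem mul (hf : ExplAt X p f) (hg : ExplAt X p g) : ExplAt X p fun x => f x * g x := by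
  obtain ⟨U, hU, h⟩ := hf
  obtain ⟨V, hV, h'⟩ := hg
  exact ⟨U ⊓ V, ⟨hU, hV⟩, X.mul (X.restrict inf_le_left h) (X.restrict inf_le_right h')⟩

theorem inv (hf : ExplAt X p f) : ExplAt X p fun x => (f x)⁻¹ := by
  obtain ⟨U, hU, h⟩ := hf
  exact ⟨U, hU, X.inv h⟩

theorem pow (hf : ExplAt X p f) (n : ℕ) : ExplAt X p fun x => f x ^ n := by
  induction n with
  | zero => simpa using const X p (c := 1) one_ne_zero
  | succ n ih => simpa only [pow_succ] using ih.mul hf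

theorem zpow (hf : ExplAt X p f) (n : ℤ) : ExplAt X p fun x => f x ^ n := by
  cases n with
  | ofNat n => simpa using hf.pow n
  | negSucc n => simpa only [zpow_negSucc] using (hf.pow (n + 1)).inv

theorem prod {ι : Type*} (s : Finset ι) {f : ι → X → Number} (hf : ∀ i ∈ s, ExplAt X p (f i)) :
    ExplAt X p fun x => ∏ i ∈ s, f i x := by
  classical
  induction s using Finset.induction_on with
  | empty => simpa using const X p (c := 1) one_ne_zero
  | insert a s h ih =>
    simp only [Finset.prod_insert h]
    exact (hf a (by simp)).mul (ih fun i hi => hf i (by simp [hi]))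

theorem monomial {m : ℕ} {c : ℂ} (hc : c ≠ 0) (a : ℝ) (α : Fin m → ℤ) {z : Fin m → X → Number}
    (hz : ∀ i, ExplAt X p (z i)) :
    ExplAt X p fun x => Exploded.monomial c a α fun i => z i x := by
  simp only [monomial_eq]
  exact (const X p hc).mul (prod _ fun i _ => (hz i).zpow _)

end ExplAt

/-- By the sheaf axioms exploded functions are determined by their germs, so everything below can be
argued pointwise. -/
theorem isExploded_iff {X : Space.{u}} {U : Opens X} {h : X → Number} :
    X.IsExploded U h ↔ ∀ p ∈ U, ExplAt X p h := by
  refine ⟨fun H p hp => ⟨U, hp, H⟩, fun H => X.glue fun p hp => ?_⟩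
  obtain ⟨V, hV, h'⟩ := H p hp
  exact ⟨U ⊓ V, ⟨hp, hV⟩, inf_le_left, X.restrict inf_le_right h'⟩

/-- `φ` is a morphism at the point `p`. -/
def MorphAt {X : Space.{u}} {Y : Space.{v}} (φ : X → Y) (p : X) : Prop :=
  ContinuousAt φ p ∧ ∀ h, ExplAt Y (φ p) h → ExplAt X p fun x => h (φ x)

theorem MorphAt.congr {X : Space.{u}} {Y : Space.{v}} {φ ψ : X → Y} {p : X} (hφ : MorphAt φ p)
    (e : φ =ᶠ[𝓝 p] ψ) : MorphAt ψ p := by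
  refine ⟨hφ.1.congr e, fun h hh => (hφ.2 h (e.eq_of_nhds ▸ hh)).congr ?_⟩
  filter_upwards [e] with x hx
  rw [hx]

theorem MorphAt.comp {X : Space.{u}} {Y : Space.{v}} {Z : Space.{w}} {ψ : Y → Z} {φ : X → Y}
    {p : X} (hψ : MorphAt ψ (φ p)) (hφ : MorphAt φ p) : MorphAt (fun x => ψ (φ x)) p :=
  ⟨hψ.1.comp (f := φ) hφ.1, fun _ hh => hφ.2 _ (hψ.2 _ hh)⟩

theorem MorphAt.const {X : Space.{u}} {Y : Space.{v}} (y : Y) (p : X) :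
    MorphAt (fun _ : X => y) p :=
  ⟨continuousAt_const, fun _ h => ExplAt.const X p h.coeff_ne_zero⟩

theorem Hom.morphAt {X : Space.{u}} {Y : Space.{v}} (φ : Hom X Y) (p : X) : MorphAt φ p := by
  refine ⟨φ.continuous.continuousAt, ?_⟩
  rintro h ⟨U, hU, H⟩
  exact ⟨_, hU, φ.pullback H⟩

/-- A function that is a morphism at every point is a morphism. -/
def Hom.ofMorphAt {X : Space.{u}} {Y : Space.{v}} (φ : X → Y) (H : ∀ p, MorphAt φ p) :
    Hom X Y where
  toFun := φ
  continuous := continuous_iff_continuousAt.2 fun p => (H p).1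
  pullback h := isExploded_iff.2 fun p hp => (H p).2 _ (isExploded_iff.1 h _ hp)

theorem explAt_onOpen {X : Space.{u}} {U : Opens X} {q : X} (hq : q ∈ U)
    {g : X.onOpen U → Number} {h : X → Number} (e : ∀ (x : X) (hx : x ∈ U), g ⟨x, hx⟩ = h x) :
    ExplAt (X.onOpen U) ⟨q, hq⟩ g ↔ ExplAt X q h := by
  constructor
  · rintro ⟨V, hV, h', hh', e'⟩
    refine ⟨imageOpens V, ⟨⟨q, hq⟩, hV, rfl⟩, X.congr ?_ hh'⟩
    rintro _ ⟨y, hy, rfl⟩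
    rw [← e' y hy, ← e y.1 y.2]
  · rintro ⟨V, hV, hh⟩
    refine ⟨V.comap ⟨Subtype.val, continuous_subtype_val⟩, hV, h, X.restrict ?_ hh,
      fun x _ => e x.1 x.2⟩
    rintro _ ⟨y, hy, rfl⟩
    exact hy

/-- A function that is a morphism at every point of `U` and maps `U` to `V` is a morphism from `U`
to `V`. -/
def Hom.restrict {X : Space.{u}} {Y : Space.{v}} {U : Opens X} {V : Opens Y} (φ : X → Y)
    (hφ : ∀ x ∈ U, φ x ∈ V) (H : ∀ x ∈ U, MorphAt φ x) : Hom (X.onOpen U) (Y.onOpen V) :=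
  Hom.ofMorphAt (fun x => ⟨φ x.1, hφ x.1 x.2⟩) fun p => by
    classical
    refine ⟨?_, fun h hh => ?_⟩
    · refine Topology.IsInducing.subtypeVal.continuousAt_iff.2 ?_
      exact ((H p.1 p.2).1.comp (f := Subtype.val) continuous_subtype_val.continuousAt)
    · let h' : Y → Number := fun y => if hy : y ∈ V then h ⟨y, hy⟩ else 1
      have e : ∀ (y : Y) (hy : y ∈ V), h ⟨y, hy⟩ = h' y := fun y hy => by simp [h', hy]
      exact (explAt_onOpen (h := fun x => h' (φ x)) p.2 fun x hx => e _ (hφ x hx)).2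
        ((H p.1 p.2).2 _ ((explAt_onOpen (hφ p.1 p.2) e).1 hh))

theorem Hom.morphAt_of_onOpen {X : Space.{u}} {Y : Space.{v}} {U : Opens X} {V : Opens Y}
    (f : Hom (X.onOpen U) (Y.onOpen V)) {φ : X → Y}
    (e : ∀ (x : X) (hx : x ∈ U), φ x = (f ⟨x, hx⟩).1) {x : X} (hx : x ∈ U) : MorphAt φ x := by
  have c : ContinuousAt φ x := by
    have h1 : ContinuousOn φ U := by
      rw [continuousOn_iff_continuous_domRestrict]
      have h2 : (U : Set X).domRestrict φ = fun y => (f y).1 := funext fun y => e y.1 y.2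
      rw [h2]
      exact continuous_subtype_val.comp f.continuous
    exact h1.continuousAt (U.isOpen.mem_nhds hx)
  refine ⟨c, fun h hh => ?_⟩
  have hx' : φ x ∈ V := e x hx ▸ (f ⟨x, hx⟩).2
  have e1 : (⟨φ x, hx'⟩ : Y.onOpen V) = f ⟨x, hx⟩ := Subtype.ext (e x hx)
  have h1 := (explAt_onOpen (g := fun y : Y.onOpen V => h y.1) hx' fun _ _ => rfl).2 hh
  rw [e1] at h1
  exact (explAt_onOpen (g := fun y => h (f y).1) hx fun y hy => by rw [e y hy]).1
    ((f.morphAt _).2 _ h1)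

/-! ### Charts -/

/-- A local isomorphism at `p` from `X` to `Y`, given by functions on the whole spaces of which only
the restrictions to the open sets `U` and `V` matter. -/
structure Chart (X : Space.{u}) (p : X) (Y : Space.{v}) where
  /-- the source -/
  U : Opens X
  /-- the target -/
  V : Opens Y
  /-- the map -/
  map : X → Y
  /-- its inverse -/
  symm : Y → X
  mem : p ∈ U
  map_mem : ∀ x ∈ U, map x ∈ V
  symm_mem : ∀ y ∈ V, symm y ∈ U
  left : ∀ x ∈ U, symm (map x) = x
  right : ∀ y ∈ V, map (symm y) = y
  morph_map : ∀ x ∈ U, MorphAt map x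
  morph_symm : ∀ y ∈ V, MorphAt symm y

theorem isOpen_preimage_of_morphAt {X : Space.{u}} {Y : Space.{v}} {U : Opens X} {φ : X → Y}
    (h : ∀ x ∈ U, MorphAt φ x) (V : Opens Y) : IsOpen {x | x ∈ U ∧ φ x ∈ V} :=
  ContinuousOn.isOpen_inter_preimage (fun x hx => (h x hx).1.continuousWithinAt) U.isOpen V.isOpen

namespace Chart

variable {X : Space.{u}} {Y : Space.{v}} {Z : Space.{w}} {p : X}

/-- The chart with a smaller source. -/
def restrict (κ : Chart X p Y) (W : Opens X) (hW : p ∈ W) : Chart X p Y where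
  U := κ.U ⊓ W
  V := ⟨{y | y ∈ κ.V ∧ κ.symm y ∈ W}, isOpen_preimage_of_morphAt κ.morph_symm W⟩
  map := κ.map
  symm := κ.symm
  mem := ⟨κ.mem, hW⟩
  map_mem x hx := ⟨κ.map_mem x hx.1, by rw [κ.left x hx.1]; exact hx.2⟩
  symm_mem y hy := ⟨κ.symm_mem y hy.1, hy.2⟩
  left x hx := κ.left x hx.1
  right y hy := κ.right y hy.1
  morph_map x hx := κ.morph_map x hx.1
  morph_symm y hy := κ.morph_symm y hy.1

/-- The composition of two charts. -/
def trans (κ : Chart X p Y) (μ : Chart Y (κ.map p) Z) : Chart X p Z where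
  U := ⟨{x | x ∈ κ.U ∧ κ.map x ∈ μ.U}, isOpen_preimage_of_morphAt κ.morph_map μ.U⟩
  V := ⟨{z | z ∈ μ.V ∧ μ.symm z ∈ κ.V}, isOpen_preimage_of_morphAt μ.morph_symm κ.V⟩
  map x := μ.map (κ.map x)
  symm z := κ.symm (μ.symm z)
  mem := ⟨κ.mem, μ.mem⟩
  map_mem x hx := ⟨μ.map_mem _ hx.2, by rw [μ.left _ hx.2]; exact κ.map_mem _ hx.1⟩
  symm_mem z hz := ⟨κ.symm_mem _ hz.2, by rw [κ.right _ hz.2]; exact μ.symm_mem _ hz.1⟩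
  left x hx := by rw [μ.left _ hx.2, κ.left _ hx.1]
  right z hz := by rw [κ.right _ hz.2, μ.right _ hz.1]
  morph_map x hx := (μ.morph_map _ hx.2).comp (κ.morph_map _ hx.1)
  morph_symm z hz := (κ.morph_symm _ hz.2).comp (μ.morph_symm _ hz.1)

/-- A chart at `p` is also a chart at the other points of its source. -/
def at' (κ : Chart X p Y) (q : X) (hq : q ∈ κ.U) : Chart X q Y where
  U := κ.U
  V := κ.V
  map := κ.map
  symm := κ.symm
  mem := hq
  map_mem := κ.map_mem
  symm_mem := κ.symm_mem
  left := κ.left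
  right := κ.right
  morph_map := κ.morph_map
  morph_symm := κ.morph_symm

theorem map_mem' (κ : Chart X p Y) : κ.map p ∈ κ.V := κ.map_mem _ κ.mem

theorem left' (κ : Chart X p Y) : κ.symm (κ.map p) = p := κ.left _ κ.mem

theorem eventually_left (κ : Chart X p Y) : ∀ᶠ x in 𝓝 p, κ.symm (κ.map x) = x :=
  mem_of_superset (κ.U.isOpen.mem_nhds κ.mem) κ.left

theorem eventually_right (κ : Chart X p Y) : ∀ᶠ y in 𝓝 (κ.map p), κ.map (κ.symm y) = y :=
  mem_of_superset (κ.V.isOpen.mem_nhds κ.map_mem') κ.right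

theorem tendsto_symm (κ : Chart X p Y) : Tendsto κ.symm (𝓝 (κ.map p)) (𝓝 p) := by
  have := (κ.morph_symm _ κ.map_mem').1
  rwa [ContinuousAt, κ.left'] at this

theorem tendsto_map (κ : Chart X p Y) : Tendsto κ.map (𝓝 p) (𝓝 (κ.map p)) :=
  (κ.morph_map _ κ.mem).1

theorem explAt_symm (κ : Chart X p Y) {h : X → Number} :
    ExplAt Y (κ.map p) (fun y => h (κ.symm y)) ↔ ExplAt X p h := by
  constructor
  · intro H
    refine ((κ.morph_map _ κ.mem).2 _ H).congr ?_
    filter_upwards [κ.eventually_left] with x hx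
    simp only [hx]
  · intro H
    exact (κ.morph_symm _ κ.map_mem').2 _ (κ.left'.symm ▸ H)

theorem nonempty_of_isomorphic {U : Opens X} (hp : p ∈ U) {V : Opens Y}
    (H : Isomorphic (X.onOpen U) (Y.onOpen V)) : Nonempty (Chart X p Y) := by
  classical
  obtain ⟨f, g, hfg, hgf⟩ := H
  let φ : X → Y := fun x => if hx : x ∈ U then (f ⟨x, hx⟩).1 else (f ⟨p, hp⟩).1
  let ψ : Y → X := fun y => if hy : y ∈ V then (g ⟨y, hy⟩).1 else p
  have hφ : ∀ (x : X) (hx : x ∈ U), φ x = (f ⟨x, hx⟩).1 := fun x hx => by simp [φ, hx]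
  have hψ : ∀ (y : Y) (hy : y ∈ V), ψ y = (g ⟨y, hy⟩).1 := fun y hy => by simp [ψ, hy]
  refine ⟨⟨U, V, φ, ψ, hp, fun x hx => by rw [hφ x hx]; exact (f ⟨x, hx⟩).2, fun y hy => by rw [hψ y hy]; exact (g ⟨y, hy⟩).2,
    fun x hx => ?_, fun y hy => ?_, fun x hx => f.morphAt_of_onOpen hφ hx,
    fun y hy => g.morphAt_of_onOpen hψ hy⟩⟩
  · have h1 : φ x ∈ V := hφ x hx ▸ (f ⟨x, hx⟩).2
    have h2 : (⟨φ x, h1⟩ : Y.onOpen V) = f ⟨x, hx⟩ := Subtype.ext (hφ x hx)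
    rw [hψ _ h1, h2]
    exact congrArg Subtype.val (hfg _)
  · have h1 : ψ y ∈ U := hψ y hy ▸ (g ⟨y, hy⟩).2
    have h2 : (⟨ψ y, h1⟩ : X.onOpen U) = g ⟨y, hy⟩ := Subtype.ext (hψ y hy)
    rw [hφ _ h1, h2]
    exact congrArg Subtype.val (hgf _)

theorem isomorphic (κ : Chart X p Y) : Isomorphic (X.onOpen κ.U) (Y.onOpen κ.V) :=
  ⟨Hom.restrict κ.map κ.map_mem κ.morph_map, Hom.restrict κ.symm κ.symm_mem κ.morph_symm,
    fun x => Subtype.ext (κ.left x.1 x.2), fun y => Subtype.ext (κ.right y.1 y.2)⟩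

/-- The chart given by an isomorphism of spaces. -/
def ofIso (f : Hom X Y) (g : Hom Y X) (hfg : ∀ x, g (f x) = x) (hgf : ∀ y, f (g y) = y) :
    Chart X p Y where
  U := ⊤
  V := ⊤
  map := f
  symm := g
  mem := trivial
  map_mem _ _ := trivial
  symm_mem _ _ := trivial
  left x _ := hfg x
  right y _ := hgf y
  morph_map x _ := f.morphAt x
  morph_symm y _ := g.morphAt y

end Chart

theorem Manifold.exists_chart (X : Manifold.{u}) (p : X) :
    ∃ (n m : ℕ) (P : Set (Fin m → ℝ)), IsPolytope P ∧ Nonempty (Chart X.toSpace p (model n m P)) := by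
  obtain ⟨U, hp, n, m, P, Ω, hP, h⟩ := X.locally_model p
  exact ⟨n, m, P, hP, Chart.nonempty_of_isomorphic hp h⟩

/-! ### The Farkas lemma -/

/-- Induction on the number of inequalities. If `f a` is really needed, some `x₀` satisfies the
other inequalities but has `g x₀ < 0`, which forces `f a x₀ < 0`. Projecting along `x₀` to the
kernel of `f a` removes this inequality, and the induction hypothesis applies to the remaining forms
composed with the projection. -/
theorem farkas {V ι : Type*} [AddCommGroup V] [Module ℝ V] (s : Finset ι) (f : ι → V →ₗ[ℝ] ℝ)
    (g : V →ₗ[ℝ] ℝ) (h : ∀ x, (∀ i ∈ s, 0 ≤ f i x) → 0 ≤ g x) :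
    ∃ c : ι → ℝ, (∀ i, 0 ≤ c i) ∧ g = ∑ i ∈ s, c i • f i := by
  classical
  induction s using Finset.induction_on generalizing f g with
  | empty =>
    refine ⟨0, fun _ => le_rfl, LinearMap.ext fun x => ?_⟩
    have h1 := h x (by simp)
    have h2 := h (-x) (by simp)
    rw [map_neg] at h2
    simp only [Finset.sum_empty, LinearMap.zero_apply]
    linarith
  | insert a s ha ih =>
    by_cases H : ∀ x, (∀ i ∈ s, 0 ≤ f i x) → 0 ≤ g x
    · obtain ⟨c, hc, e⟩ := ih f g H
      refine ⟨fun i => if i ∈ s then c i else 0, fun i => ?_, ?_⟩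
      · dsimp only; split_ifs; exacts [hc i, le_rfl]
      · simp only [Finset.sum_insert ha, if_neg ha, zero_smul, zero_add]
        rw [e]
        exact Finset.sum_congr rfl fun i hi => by rw [if_pos hi]
    · push Not at H
      obtain ⟨x₀, hx₀, hg⟩ := H
      have ha0 : f a x₀ < 0 := by
        by_contra hh
        push Not at hh
        exact absurd (h x₀ fun i hi => by
          rcases Finset.mem_insert.1 hi with rfl | hi
          exacts [hh, hx₀ i hi]) (not_le.2 hg)
      set r : ℝ := (-(f a x₀))⁻¹ with hr
      have hr0 : 0 < r := inv_pos.2 (by linarith)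
      have hr1 : r * f a x₀ = -1 := by rw [hr, inv_neg, neg_mul, inv_mul_cancel₀ ha0.ne]
      obtain ⟨c, hc, e⟩ := ih (fun i => f i + (r * f i x₀) • f a) (g + (r * g x₀) • f a) (by
        intro x hx
        have key := h (x + (r * f a x) • x₀) (by
          intro i hi
          rcases Finset.mem_insert.1 hi with rfl | hi
          · simp only [map_add, map_smul, smul_eq_mul]
            have : r * f i x * f i x₀ = f i x * (r * f i x₀) := by ring
            rw [this, hr1]
            linarith
          · have := hx i hi
            simp only [LinearMap.add_apply, LinearMap.smul_apply, smul_eq_mul] at this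
            simp only [map_add, map_smul, smul_eq_mul]
            linarith)
        simp only [map_add, map_smul, smul_eq_mul] at key
        simp only [LinearMap.add_apply, LinearMap.smul_apply, smul_eq_mul]
        linarith)
      -- This is the multiple of `f a` that remains when the projected identity is solved for `g`;
      -- it is nonnegative because `g x₀ < 0`.
      set d : ℝ := (∑ i ∈ s, c i * (r * f i x₀)) - r * g x₀ with hd
      have hd0 : 0 ≤ d := by
        have : 0 ≤ ∑ i ∈ s, c i * (r * f i x₀) := Finset.sum_nonneg fun i hi =>
          mul_nonneg (hc i) (mul_nonneg hr0.le (hx₀ i hi))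
        nlinarith
      refine ⟨fun i => if i = a then d else c i, fun i => ?_, ?_⟩
      · dsimp only; split_ifs; exacts [hd0, hc i]
      · have e1 : ∑ i ∈ s, (if i = a then d else c i) • f i = ∑ i ∈ s, c i • f i :=
          Finset.sum_congr rfl fun i hi => by rw [if_neg (fun h : i = a => ha (h ▸ hi))]
        rw [Finset.sum_insert ha]
        simp only [if_true]
        rw [e1]
        ext x
        have e2 := LinearMap.congr_fun e x
        simp only [LinearMap.add_apply, LinearMap.smul_apply, smul_eq_mul, LinearMap.sum_apply,
          mul_add, Finset.sum_add_distrib] at e2 ⊢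
        rw [hd, sub_mul, Finset.sum_mul]
        simp only [← mul_assoc] at e2 ⊢
        linarith

/-- The affine Farkas lemma, for consistent systems of inequalities. -/
theorem affine_farkas {V ι : Type*} [AddCommGroup V] [Module ℝ V] (s : Finset ι) (a : ι → ℝ)
    (f : ι → V →ₗ[ℝ] ℝ) (b : ℝ) (g : V →ₗ[ℝ] ℝ) (x₀ : V) (hx₀ : ∀ i ∈ s, 0 ≤ a i + f i x₀)
    (h : ∀ x, (∀ i ∈ s, 0 ≤ a i + f i x) → 0 ≤ b + g x) :
    ∃ (c₀ : ℝ) (c : ι → ℝ), 0 ≤ c₀ ∧ (∀ i, 0 ≤ c i) ∧ b = c₀ + ∑ i ∈ s, c i * a i ∧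
      g = ∑ i ∈ s, c i • f i := by
  classical
  -- Homogenization: the extra coordinate `t` replaces the constant `1`, and the index `none` is the
  -- inequality `0 ≤ t`.
  let F : Option ι → (ℝ × V) →ₗ[ℝ] ℝ := fun o => match o with
    | none => LinearMap.fst ℝ ℝ V
    | some i => a i • LinearMap.fst ℝ ℝ V + (f i).comp (LinearMap.snd ℝ ℝ V)
  obtain ⟨c, hc, e⟩ := farkas (Finset.insertNone s) F
    (b • LinearMap.fst ℝ ℝ V + g.comp (LinearMap.snd ℝ ℝ V)) (by
      rintro ⟨t, x⟩ hx
      have ht : 0 ≤ t := hx none (by simp)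
      have hx' : ∀ i ∈ s, 0 ≤ a i * t + f i x := fun i hi => by
        simpa [F] using hx (some i) (by simpa using hi)
      simp only [LinearMap.add_apply, LinearMap.smul_apply, LinearMap.fst_apply, smul_eq_mul,
        LinearMap.comp_apply, LinearMap.snd_apply]
      -- For `t > 0` rescale by `t⁻¹`. For `t = 0` the vector is a recession direction: adding large
      -- multiples of it to `x₀` keeps the inequalities but would make `b + g` negative.
      rcases ht.eq_or_lt with rfl | ht
      · by_contra hneg
        push Not at hneg
        simp only [mul_zero, zero_add] at hneg hx'
        have h1 : ∀ r : ℝ, 0 ≤ r → 0 ≤ b + (g x₀ + r * g x) := fun r hr => by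
          have := h (x₀ + r • x) fun i hi => by
            rw [map_add, map_smul, smul_eq_mul]
            have := mul_nonneg hr (hx' i hi)
            linarith [hx₀ i hi]
          simpa using this
        have h2 := h1 ((|b + g x₀| + 1) / (-(g x))) (div_nonneg (by positivity) (by linarith))
        have h3 : (|b + g x₀| + 1) / (-(g x)) * g x = -(|b + g x₀| + 1) := by
          have : g x ≠ 0 := hneg.ne
          field_simp
        have h4 := le_abs_self (b + g x₀)
        linarith
      · have := h (t⁻¹ • x) fun i hi => by
          have h1 := mul_nonneg (inv_pos.2 ht).le (hx' i hi)
          rw [map_smul, smul_eq_mul]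
          have h2 : t⁻¹ * (a i * t + f i x) = a i + t⁻¹ * f i x := by field_simp
          linarith
        rw [map_smul, smul_eq_mul] at this
        have h2 : b * t + g x = t * (b + t⁻¹ * g x) := by field_simp
        rw [h2]
        exact mul_nonneg ht.le this)
  have e' : ∀ t x, b * t + g x = c none * t + ∑ i ∈ s, c (some i) * (a i * t + f i x) := by
    intro t x
    have := LinearMap.congr_fun e (t, x)
    simpa [F, mul_add] using this
  refine ⟨c none, fun i => c (some i), hc _, fun i => hc _, by simpa using e' 1 0, ?_⟩
  ext x
  simpa using e' 0 x

/-- The affine Farkas lemma, for inconsistent systems of inequalities. -/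
theorem affine_farkas_empty {V ι : Type*} [AddCommGroup V] [Module ℝ V] (s : Finset ι) (a : ι → ℝ)
    (f : ι → V →ₗ[ℝ] ℝ) (h : ¬ ∃ x, ∀ i ∈ s, 0 ≤ a i + f i x) :
    ∃ c : ι → ℝ, (∀ i, 0 ≤ c i) ∧ ∑ i ∈ s, c i * a i = -1 ∧ ∑ i ∈ s, c i • f i = 0 := by
  obtain ⟨c, hc, e⟩ := farkas s
    (fun i => a i • LinearMap.fst ℝ ℝ V + (f i).comp (LinearMap.snd ℝ ℝ V))
    (-LinearMap.fst ℝ ℝ V) (by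
      rintro ⟨t, x⟩ hx
      simp only [LinearMap.add_apply, LinearMap.smul_apply, LinearMap.fst_apply, smul_eq_mul,
        LinearMap.comp_apply, LinearMap.snd_apply, LinearMap.neg_apply] at hx ⊢
      by_contra hneg
      push Not at hneg
      have ht : 0 < t := by linarith
      refine h ⟨t⁻¹ • x, fun i hi => ?_⟩
      have h1 := mul_nonneg (inv_pos.2 ht).le (hx i hi)
      rw [map_smul, smul_eq_mul]
      have h2 : t⁻¹ * (a i * t + f i x) = a i + t⁻¹ * f i x := by field_simp
      linarith)
  have e' : ∀ t x, -t = ∑ i ∈ s, c i * (a i * t + f i x) := by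
    intro t x
    have := LinearMap.congr_fun e (t, x)
    simpa [mul_add] using this
  refine ⟨c, hc, by simpa using (e' 1 0).symm, ?_⟩
  ext x
  simpa using (e' 0 x).symm

/-! ### Polyhedra and integral affine functions -/

/-- The linear form `x ↦ ∑ αᵢ xᵢ`. -/
def linForm {m : ℕ} (α : Fin m → ℤ) : (Fin m → ℝ) →ₗ[ℝ] ℝ := ∑ i, (α i : ℝ) • LinearMap.proj i

theorem linForm_apply {m : ℕ} (α : Fin m → ℤ) (x : Fin m → ℝ) :
    linForm α x = ∑ i, (α i : ℝ) * x i := by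
  simp [linForm]

theorem affine_eq {m : ℕ} (a : ℝ) (α : Fin m → ℤ) (x : Fin m → ℝ) :
    affine a α x = a + linForm α x := by
  rw [affine, linForm_apply]

theorem linForm_add_left {m : ℕ} (α β : Fin m → ℤ) : linForm (α + β) = linForm α + linForm β := by
  refine LinearMap.ext fun x => ?_
  simp [linForm_apply, add_mul, Finset.sum_add_distrib]

theorem linForm_nsmul {m : ℕ} (N : ℕ) (α : Fin m → ℤ) :
    linForm (N • α) = (N : ℝ) • linForm α := by
  refine LinearMap.ext fun x => ?_
  simp [linForm_apply, Finset.mul_sum, mul_assoc]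

theorem continuous_affine {m : ℕ} (a : ℝ) (α : Fin m → ℤ) : Continuous (affine a α) := by
  unfold affine
  fun_prop

theorem affine_add_exponent {m : ℕ} (a b : ℝ) (α β : Fin m → ℤ) (x : Fin m → ℝ) :
    affine (a + b) (α + β) x = affine a α x + affine b β x := by
  simp only [affine_eq, linForm_add_left, LinearMap.add_apply]
  ring

theorem affine_nsmul {m : ℕ} (N : ℕ) (a : ℝ) (α : Fin m → ℤ) (x : Fin m → ℝ) :
    affine (N * a) (N • α) x = N * affine a α x := by
  simp only [affine_eq, linForm_nsmul, LinearMap.smul_apply, smul_eq_mul]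
  ring

theorem affine_add_smul_sub {m : ℕ} (a : ℝ) (α : Fin m → ℤ) (x y : Fin m → ℝ) (t : ℝ) :
    affine a α (x + t • (y - x)) = affine a α x + t * (affine a α y - affine a α x) := by
  simp only [affine_eq, map_add, map_smul, map_sub, smul_eq_mul]
  ring

/-- The set defined by the weak inequalities in `s` and the strict ones in `s'`. -/
def polyhedron {m : ℕ} (s s' : Finset (ℝ × (Fin m → ℤ))) : Set (Fin m → ℝ) :=
  {x | (∀ c ∈ s, 0 ≤ affine c.1 c.2 x) ∧ ∀ c ∈ s', 0 < affine c.1 c.2 x}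

theorem affine_comp_continuous {m : ℕ} (a : ℝ) (α : Fin m → ℤ) (x y : Fin m → ℝ) :
    Continuous fun t : ℝ => affine a α (x + t • (y - x)) :=
  (continuous_affine a α).comp (by fun_prop)

theorem eventually_mem_polyhedron {m : ℕ} {s s' : Finset (ℝ × (Fin m → ℤ))} {x y : Fin m → ℝ}
    (hx : x ∈ polyhedron s s')
    (hy : ∀ c ∈ s, affine c.1 c.2 x = 0 → 0 ≤ affine c.1 c.2 y) :
    ∀ᶠ t : ℝ in 𝓝[>] 0, x + t • (y - x) ∈ polyhedron s s' := by
  have key : ∀ c : ℝ × (Fin m → ℤ), 0 < affine c.1 c.2 x →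
      ∀ᶠ t : ℝ in 𝓝[>] 0, 0 < affine c.1 c.2 (x + t • (y - x)) := fun c hc => by
    have h0 : Tendsto (fun t : ℝ => affine c.1 c.2 (x + t • (y - x))) (𝓝 0)
        (𝓝 (affine c.1 c.2 x)) := by
      simpa using (affine_comp_continuous c.1 c.2 x y).tendsto 0
    exact (h0.mono_left nhdsWithin_le_nhds).eventually (lt_mem_nhds hc)
  have h1 : ∀ᶠ t : ℝ in 𝓝[>] 0, ∀ c ∈ s, 0 ≤ affine c.1 c.2 (x + t • (y - x)) := by
    refine (Filter.eventually_all_finset s).2 fun c hc => ?_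
    rcases (hx.1 c hc).eq_or_lt with h | h
    · filter_upwards [self_mem_nhdsWithin] with t ht
      rw [affine_add_smul_sub, ← h]
      have := mul_nonneg (le_of_lt ht) (hy c hc h.symm)
      linarith
    · exact (key c h).mono fun t ht => ht.le
  have h2 : ∀ᶠ t : ℝ in 𝓝[>] 0, ∀ c ∈ s', 0 < affine c.1 c.2 (x + t • (y - x)) :=
    (Filter.eventually_all_finset s').2 fun c hc => key c (hx.2 c hc)
  filter_upwards [h1, h2] with t a b using ⟨a, b⟩

/-- An affine function that is nonnegative on a polyhedron and vanishes at a point `x` vanishes on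
the smallest face that contains `x`. -/
theorem affine_eq_zero_of_face {m : ℕ} {s s' : Finset (ℝ × (Fin m → ℤ))} {x y : Fin m → ℝ}
    (hx : x ∈ polyhedron s s') (hy : y ∈ polyhedron s s')
    (hxy : ∀ c ∈ s, affine c.1 c.2 x = 0 → affine c.1 c.2 y = 0) {a : ℝ} {α : Fin m → ℤ}
    (h : ∀ z ∈ polyhedron s s', 0 ≤ affine a α z) (h0 : affine a α x = 0) : affine a α y = 0 := by
  have h1 := eventually_mem_polyhedron (y := x + (-1 : ℝ) • (y - x)) hx fun c hc h => by
    rw [affine_add_smul_sub, h, hxy c hc h]; simp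
  obtain ⟨t, ht, ht0⟩ := (h1.and self_mem_nhdsWithin).exists
  have h2 := h _ ht
  rw [affine_add_smul_sub, affine_add_smul_sub, h0] at h2
  have h3 := h y hy
  have ht0' : (0 : ℝ) < t := ht0
  nlinarith

theorem affine_sum {m : ℕ} (A : Finset (ℝ × (Fin m → ℤ))) (y : Fin m → ℝ) :
    affine (∑ c ∈ A, c.1) (∑ c ∈ A, c.2) y = ∑ c ∈ A, affine c.1 c.2 y := by
  classical
  induction A using Finset.induction_on with
  | empty => simp [affine]
  | insert c A hc ih => rw [Finset.sum_insert hc, Finset.sum_insert hc, Finset.sum_insert hc,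
      affine_add_exponent, ih]

/-- The sum of the defining functions in `s` that vanish at `x`. -/
def faceExponent {m : ℕ} (s s' : Finset (ℝ × (Fin m → ℤ))) (x : Fin m → ℝ) :
    SmoothExponent (polyhedron s s') where
  a := ∑ c ∈ s with affine c.1 c.2 x = 0, c.1
  α := ∑ c ∈ s with affine c.1 c.2 x = 0, c.2
  nonneg y hy := by
    rw [affine_sum]
    exact Finset.sum_nonneg fun c hc => hy.1 c (Finset.mem_filter.1 hc).1

theorem affine_faceExponent {m : ℕ} (s s' : Finset (ℝ × (Fin m → ℤ))) (x y : Fin m → ℝ) :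
    affine (faceExponent s s' x).a (faceExponent s s' x).α y =
      ∑ c ∈ s with affine c.1 c.2 x = 0, affine c.1 c.2 y :=
  affine_sum _ _

theorem affine_faceExponent_self {m : ℕ} (s s' : Finset (ℝ × (Fin m → ℤ))) (x : Fin m → ℝ) :
    affine (faceExponent s s' x).a (faceExponent s s' x).α x = 0 := by
  rw [affine_faceExponent]
  exact Finset.sum_eq_zero fun c hc => (Finset.mem_filter.1 hc).2

theorem eq_zero_of_affine_faceExponent {m : ℕ} {s s' : Finset (ℝ × (Fin m → ℤ))} {x y : Fin m → ℝ}
    (hy : ∀ c ∈ s, 0 ≤ affine c.1 c.2 y)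
    (h : affine (faceExponent s s' x).a (faceExponent s s' x).α y ≤ 0) :
    ∀ c ∈ s, affine c.1 c.2 x = 0 → affine c.1 c.2 y = 0 := by
  rw [affine_faceExponent] at h
  have h1 : ∀ c ∈ s.filter fun c => affine c.1 c.2 x = 0, 0 ≤ affine c.1 c.2 y :=
    fun c hc => hy c (Finset.mem_filter.1 hc).1
  have h2 := (Finset.sum_eq_zero_iff_of_nonneg h1).1 (le_antisymm h (Finset.sum_nonneg h1))
  exact fun c hc hx => h2 c (Finset.mem_filter.2 ⟨hc, hx⟩)

/-- An affine function that is nonnegative on the relative interior of the face of `x` becomes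
nonnegative on the polyhedron after adding a multiple of the face function. -/
theorem exists_add_faceExponent_nonneg {m : ℕ} {s s' : Finset (ℝ × (Fin m → ℤ))} {x : Fin m → ℝ}
    (hx : x ∈ polyhedron s s') {a : ℝ} {α : Fin m → ℤ}
    (h : ∀ y ∈ polyhedron s s', (∀ c ∈ s, affine c.1 c.2 x = 0 ↔ affine c.1 c.2 y = 0) →
      0 ≤ affine a α y) :
    ∃ N : ℕ, ∀ y ∈ polyhedron s s', 0 ≤ affine a α y +
      N * affine (faceExponent s s' x).a (faceExponent s s' x).α y := by
  classical
  set g := faceExponent s s' x with hg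
  have closed : ∀ y, (∀ c ∈ s ∪ s', 0 ≤ affine c.1 c.2 y) → affine g.a g.α y ≤ 0 →
      0 ≤ affine a α y := by
    intro y hy hgy
    have hy0 := eq_zero_of_affine_faceExponent (fun c hc => hy c (by simp [hc])) hgy
    have hA : 0 ≤ affine a α x := h x hx fun _ _ => Iff.rfl
    by_contra hneg
    push Not at hneg
    set D := affine a α x - affine a α y with hD
    have hDpos : 0 < D := by linarith
    -- Mixing a proportion `δ` of `x` into `y` gives a point in the relative interior of the face of
    -- `x`, and this `δ` makes the value there half of the negative value at `y`.
    set δ := -(affine a α y) / (2 * D) with hδ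
    have hδ0 : 0 < δ := div_pos (by linarith) (by linarith)
    have hδ1 : δ < 1 := by rw [hδ, div_lt_one (by linarith)]; linarith
    have hδD : δ * D = -(affine a α y) / 2 := by rw [hδ]; field_simp
    have val : ∀ (b : ℝ) (β : Fin m → ℤ), affine b β (x + (1 - δ) • (y - x)) =
        δ * affine b β x + (1 - δ) * affine b β y := fun b β => by
      rw [affine_add_smul_sub]; ring
    have hmem : x + (1 - δ) • (y - x) ∈ polyhedron s s' := by
      refine ⟨fun c hc => ?_, fun c hc => ?_⟩
      · rw [val]
        exact add_nonneg (mul_nonneg hδ0.le (hx.1 c hc))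
          (mul_nonneg (by linarith) (hy c (by simp [hc])))
      · rw [val]
        exact add_pos_of_pos_of_nonneg (mul_pos hδ0 (hx.2 c hc))
          (mul_nonneg (by linarith) (hy c (by simp [hc])))
    have := h _ hmem fun c hc => ⟨fun h0 => by rw [val, h0, hy0 c hc h0]; simp, fun h0 => by
      rw [val] at h0
      have h1 := mul_nonneg hδ0.le (hx.1 c hc)
      have h2 := mul_nonneg (sub_nonneg.2 hδ1.le) (hy c (by simp [hc]))
      have h3 : δ * affine c.1 c.2 x = 0 := by linarith
      exact (mul_eq_zero.1 h3).resolve_left hδ0.ne'⟩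
    rw [val] at this
    nlinarith
  -- The index `none` adds the inequality that the face function is at most `0`. Its Farkas
  -- multiplier, rounded up, is the required `N`.
  let A : Option (ℝ × (Fin m → ℤ)) → ℝ := fun o => o.elim (-g.a) fun c => c.1
  let f : Option (ℝ × (Fin m → ℤ)) → (Fin m → ℝ) →ₗ[ℝ] ℝ :=
    fun o => o.elim (-linForm g.α) fun c => linForm c.2
  obtain ⟨c₀, c, hc₀, hc, e1, e2⟩ := affine_farkas (Finset.insertNone (s ∪ s')) A f a (linForm α) x
    (by
      intro i hi
      cases i with
      | none =>
        have := affine_faceExponent_self s s' x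
        rw [← hg, affine_eq] at this
        simp only [A, f, Option.elim, LinearMap.neg_apply]
        linarith
      | some c =>
        have hc : c ∈ s ∪ s' := by simpa using hi
        simp only [A, f, Option.elim]
        rw [← affine_eq]
        rcases Finset.mem_union.1 hc with hc | hc
        exacts [hx.1 c hc, (hx.2 c hc).le])
    (by
      intro y hy
      rw [← affine_eq]
      refine closed y (fun c hc => ?_) ?_
      · have := hy (some c) (by simpa using hc)
        simpa only [A, f, Option.elim, ← affine_eq] using this
      · have := hy none (by simp)
        simp only [A, f, Option.elim, LinearMap.neg_apply] at this
        rw [affine_eq]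
        linarith)
  refine ⟨⌈c none⌉₊, fun y hy => ?_⟩
  have e3 : affine a α y = c₀ - c none * affine g.a g.α y +
      ∑ i ∈ s ∪ s', c (some i) * affine i.1 i.2 y := by
    have e4 := LinearMap.congr_fun e2 y
    simp only [Finset.sum_insertNone, A, f, Option.elim, LinearMap.add_apply, LinearMap.smul_apply,
      LinearMap.neg_apply, smul_eq_mul, LinearMap.sum_apply] at e1 e4
    simp only [affine_eq, mul_add, Finset.sum_add_distrib]
    linarith
  have h1 : 0 ≤ ∑ i ∈ s ∪ s', c (some i) * affine i.1 i.2 y := Finset.sum_nonneg fun i hi => by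
    refine mul_nonneg (hc _) ?_
    rcases Finset.mem_union.1 hi with hi | hi
    exacts [hy.1 i hi, (hy.2 i hi).le]
  have h2 : 0 ≤ affine g.a g.α y := g.nonneg y hy
  have h3 := Nat.le_ceil (c none)
  nlinarith

/-! ### The topology of the models -/

namespace ModelPoint

variable {n m : ℕ} {P : Set (Fin m → ℝ)}

/-- The tropical part of a point. -/
def ord (q : ModelPoint n m P) : Fin m → ℝ := fun i => (q.pt.z i).order

theorem ord_mem (q : ModelPoint n m P) : q.ord ∈ P := q.pt.order_mem

theorem isInducing : IsInducing (fun q : ModelPoint n m P =>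
    ((q.x, fun e => smoothMonomial e q.pt) : (Fin n → ℝ) × (SmoothExponent P → ℂ))) := ⟨rfl⟩

theorem continuous_x : Continuous fun q : ModelPoint n m P => q.x :=
  continuous_fst.comp isInducing.continuous

theorem continuous_smoothMonomial (e : SmoothExponent P) :
    Continuous fun q : ModelPoint n m P => smoothMonomial e q.pt :=
  (continuous_apply e).comp (continuous_snd.comp isInducing.continuous)

theorem tendsto_iff {α : Type*} {l : Filter α} {t : α → ModelPoint n m P} {q : ModelPoint n m P} :
    Tendsto t l (𝓝 q) ↔ Tendsto (fun a => (t a).x) l (𝓝 q.x) ∧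
      ∀ e, Tendsto (fun a => smoothMonomial e (t a).pt) l (𝓝 (smoothMonomial e q.pt)) := by
  rw [isInducing.tendsto_nhds_iff, nhds_prod_eq, Filter.tendsto_prod_iff']
  exact and_congr Iff.rfl tendsto_pi_nhds

theorem inseparable_iff {q q' : ModelPoint n m P} :
    Inseparable q q' ↔ q.x = q'.x ∧ ∀ e, smoothMonomial e q.pt = smoothMonomial e q'.pt := by
  rw [← isInducing.inseparable_iff, inseparable_iff_eq, Prod.ext_iff]
  exact and_congr Iff.rfl funext_iff

theorem smoothMonomial_eq (e : SmoothExponent P) (q : ModelPoint n m P) :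
    smoothMonomial e q.pt =
      if affine e.a e.α q.ord = 0 then ∏ i, (q.pt.z i).coeff ^ e.α i else 0 := by
  simp only [smoothMonomial, Number.smoothPart, monomial_order, monomial_coeff, one_mul]
  rfl

theorem smoothMonomial_ne_zero_iff (e : SmoothExponent P) (q : ModelPoint n m P) :
    smoothMonomial e q.pt ≠ 0 ↔ affine e.a e.α q.ord = 0 := by
  rw [smoothMonomial_eq]
  split_ifs with h
  · exact iff_of_true (Finset.prod_ne_zero_iff.2 fun i _ => zpow_ne_zero _ (q.pt.coeff_ne_zero i)) h
  · exact iff_of_false (fun h => h rfl) h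

/-- The point with the same coordinates, up to its tropical part. -/
def setOrd (q : ModelPoint n m P) (y : Fin m → ℝ) (hy : y ∈ P) : ModelPoint n m P :=
  ⟨q.x, ⟨fun i => ⟨(q.pt.z i).coeff, y i⟩, q.pt.coeff_ne_zero, hy⟩⟩

/-- A smooth monomial sees the tropical part of a point only through the vanishing of its order,
which is constant on the relative interior of a face. So the topology does not notice a change of
the tropical part within it. -/
theorem inseparable_setOrd {s s' : Finset (ℝ × (Fin m → ℤ))}
    (q : ModelPoint n m (polyhedron s s')) (y : Fin m → ℝ) (hy : y ∈ polyhedron s s')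
    (h : ∀ c ∈ s, affine c.1 c.2 q.ord = 0 ↔ affine c.1 c.2 y = 0) :
    Inseparable q (q.setOrd y hy) := by
  refine inseparable_iff.2 ⟨rfl, fun e => ?_⟩
  have h1 : affine e.a e.α q.ord = 0 ↔ affine e.a e.α (q.setOrd y hy).ord = 0 :=
    ⟨affine_eq_zero_of_face q.ord_mem hy (fun c hc => (h c hc).1) e.nonneg,
      affine_eq_zero_of_face hy q.ord_mem (fun c hc => (h c hc).2) e.nonneg⟩
  rw [smoothMonomial_eq, smoothMonomial_eq]
  simp only [h1]
  rfl

end ModelPoint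

/-! ### Smooth germs on the models -/

/-- A bump function cuts the germ off. This is needed because the standard form of exploded
functions asks for a globally defined smooth `F`. -/
theorem exists_contDiff_eventuallyEq {E G : Type*} [NormedAddCommGroup E] [NormedSpace ℝ E]
    [FiniteDimensional ℝ E] [NormedAddCommGroup G] [NormedSpace ℝ G] {H : E → G} {x : E}
    (h : ∀ᶠ y in 𝓝 x, ContDiffAt ℝ ∞ H y) :
    ∃ H' : E → G, ContDiff ℝ ∞ H' ∧ H' =ᶠ[𝓝 x] H := by
  obtain ⟨r, hr, hball⟩ := Metric.eventually_nhds_iff_ball.1 h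
  let χ : ContDiffBump x := ⟨r / 3, r / 2, by positivity, by linarith⟩
  refine ⟨fun y => χ y • H y, contDiff_iff_contDiffAt.2 fun y => ?_, ?_⟩
  · by_cases hy : y ∈ Metric.ball x r
    · exact χ.contDiff.contDiffAt.smul (hball y hy)
    · have hy' : y ∉ tsupport χ := by
        rw [χ.tsupport_eq]
        intro hh
        exact hy (Metric.closedBall_subset_ball (by show r / 2 < r; linarith) hh)
      have h0 : (fun y => χ y • H y) =ᶠ[𝓝 y] fun _ => 0 := by
        filter_upwards [notMem_tsupport_iff_eventuallyEq.1 hy'] with z hz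
        simp [hz]
      exact contDiffAt_const.congr_of_eventuallyEq h0
  · filter_upwards [χ.eventuallyEq_one] with y hy
    simp [hy]

/-- A nonzero smooth germ extends to a smooth function without zeros. -/
theorem exists_contDiff_ne_zero_eventuallyEq {E : Type*} [NormedAddCommGroup E] [NormedSpace ℝ E]
    [FiniteDimensional ℝ E] {H : E → ℂ} {x : E} (h : ∀ᶠ y in 𝓝 x, ContDiffAt ℝ ∞ H y)
    (h0 : H x ≠ 0) :
    ∃ H' : E → ℂ, ContDiff ℝ ∞ H' ∧ (∀ y, H' y ≠ 0) ∧ H' =ᶠ[𝓝 x] H := by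
  -- After division by `H x` the values near `x` lie in the slit plane. The logarithm is extended
  -- globally and exponentiated again, which rules out zeros.
  have hc : ContinuousAt (fun y => H y / H x) x := (h.self_of_nhds.continuousAt).div_const _
  have hs : ∀ᶠ y in 𝓝 x, H y / H x ∈ Complex.slitPlane := by
    refine hc.eventually_mem (Complex.isOpen_slitPlane.mem_nhds ?_)
    rw [div_self h0]
    exact Complex.one_mem_slitPlane
  have hl : ∀ᶠ y in 𝓝 x, ContDiffAt ℝ ∞ (fun y => Complex.log (H y / H x)) y := by
    filter_upwards [h, hs] with y hy hy'
    exact ((Complex.contDiffAt_log hy').restrict_scalars ℝ).comp y (hy.div_const _)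
  obtain ⟨L, hL, e⟩ := exists_contDiff_eventuallyEq hl
  refine ⟨fun y => H x * Complex.exp (L y), contDiff_const.mul hL.cexp,
    fun y => mul_ne_zero h0 (Complex.exp_ne_zero _), ?_⟩
  filter_upwards [e, hs] with y hy hy'
  rw [hy, Complex.exp_log (Complex.slitPlane_ne_zero hy')]
  field_simp

/-- Germs at `q` of smooth functions of the real coordinates and finitely many smooth monomials. -/
def SmForm {n m : ℕ} {P : Set (Fin m → ℝ)} (q : ModelPoint n m P) (f : ModelPoint n m P → ℂ) :
    Prop :=
  ∃ (ι : Type) (_ : Fintype ι) (ζ : ι → SmoothExponent P) (F : (Fin n → ℝ) × (ι → ℂ) → ℂ),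
    ContDiff ℝ ∞ F ∧ f =ᶠ[𝓝 q] fun q' => F (q'.x, fun j => smoothMonomial (ζ j) q'.pt)

theorem continuous_coordinates {n m : ℕ} {P : Set (Fin m → ℝ)} {ι : Type*}
    (ζ : ι → SmoothExponent P) : Continuous fun q : ModelPoint n m P =>
      ((q.x, fun j => smoothMonomial (ζ j) q.pt) : (Fin n → ℝ) × (ι → ℂ)) :=
  ModelPoint.continuous_x.prodMk (continuous_pi fun j => ModelPoint.continuous_smoothMonomial (ζ j))

namespace SmForm

variable {n m : ℕ} {P : Set (Fin m → ℝ)} {q : ModelPoint n m P}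

theorem congr {f g : ModelPoint n m P → ℂ} (hf : SmForm q f) (e : f =ᶠ[𝓝 q] g) : SmForm q g := by
  obtain ⟨ι, _, ζ, F, hF, e'⟩ := hf
  exact ⟨ι, _, ζ, F, hF, e.symm.trans e'⟩

theorem continuousAt {f : ModelPoint n m P → ℂ} (hf : SmForm q f) : ContinuousAt f q := by
  obtain ⟨ι, _, ζ, F, hF, e⟩ := hf
  exact ((hF.continuous.comp (continuous_coordinates ζ)).continuousAt).congr e.symm

theorem smoothMonomial (q : ModelPoint n m P) (e : SmoothExponent P) :
    SmForm q fun q' => Exploded.smoothMonomial e q'.pt :=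
  ⟨Unit, inferInstance, fun _ => e, fun y => y.2 (), by fun_prop, Eventually.of_forall fun _ => rfl⟩

theorem coord (q : ModelPoint n m P) (i : Fin n) : SmForm q fun q' => (q'.x i : ℂ) :=
  ⟨Empty, inferInstance, Empty.elim, fun y => (y.1 i : ℂ),
    Complex.ofRealCLM.contDiff.comp (by fun_prop), Eventually.of_forall fun _ => rfl⟩

theorem comp {κ : Type} [Fintype κ] {f : κ → ModelPoint n m P → ℂ} (hf : ∀ k, SmForm q (f k))
    {H : (κ → ℂ) → ℂ} (hH : ∀ᶠ y in 𝓝 fun k => f k q, ContDiffAt ℝ ∞ H y) :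
    SmForm q fun q' => H fun k => f k q' := by
  wlog hκ : ∃ N, κ = Fin N generalizing κ
  · let e := Fintype.equivFin κ
    have hc : ContDiff ℝ ∞ fun y : Fin (Fintype.card κ) → ℂ => fun k => y (e k) := by fun_prop
    have := this (f := fun j => f (e.symm j)) (fun j => hf _)
      (H := fun y => H fun k => y (e k)) ?_ ⟨_, rfl⟩
    · simpa using this
    · have ht : Tendsto (fun y : Fin (Fintype.card κ) → ℂ => fun k => y (e k))
          (𝓝 fun j => f (e.symm j) q) (𝓝 fun k => f k q) := by
        have := hc.continuous.tendsto fun j => f (e.symm j) q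
        simpa using this
      filter_upwards [ht.eventually hH] with y hy
      exact ContDiffAt.comp y hy hc.contDiffAt
  obtain ⟨N, rfl⟩ := hκ
  choose ι hι ζ F hF e using hf
  obtain ⟨H', hH', eH⟩ := exists_contDiff_eventuallyEq hH
  refine ⟨Σ k, ι k, inferInstance, fun j => ζ j.1 j.2,
    fun y => H' fun k => F k (y.1, fun j => y.2 ⟨k, j⟩), ?_, ?_⟩
  · refine hH'.comp (contDiff_pi.2 fun k => (hF k).comp ?_)
    fun_prop
  · have hc : ContinuousAt (fun q' => fun k => f k q') q :=
      continuousAt_pi.2 fun k => continuousAt ⟨ι k, _, ζ k, F k, hF k, e k⟩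
    filter_upwards [hc.eventually eH, eventually_all.2 e] with q' h1 h2
    rw [← h1]
    exact congrArg H' (funext fun k => h2 k)

theorem comp₂ {f g : ModelPoint n m P → ℂ} (hf : SmForm q f) (hg : SmForm q g) {H : ℂ × ℂ → ℂ}
    (hH : ∀ᶠ y in 𝓝 (f q, g q), ContDiffAt ℝ ∞ H y) : SmForm q fun q' => H (f q', g q') := by
  have hc : ContDiff ℝ ∞ fun y : Fin 2 → ℂ => (y 0, y 1) := by fun_prop
  have ht : Tendsto (fun y : Fin 2 → ℂ => (y 0, y 1)) (𝓝 fun k => ![f, g] k q) (𝓝 (f q, g q)) := by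
    simpa using hc.continuous.tendsto fun k => ![f, g] k q
  have := comp (f := ![f, g]) (fun k => by fin_cases k; exacts [hf, hg])
    (H := fun y => H (y 0, y 1)) (by
      filter_upwards [ht.eventually hH] with y hy
      exact ContDiffAt.comp y hy hc.contDiffAt)
  simpa using this

end SmForm

/-! ### Monomials, their smooth parts, and germs of exploded functions on the models. -/

theorem monomial_mul {m : ℕ} {P : Set (Fin m → ℝ)} (z : TorusPoint m P) (c c' : ℂ) (a a' : ℝ)
    (α α' : Fin m → ℤ) :
    monomial c a α z.z * monomial c' a' α' z.z = monomial (c * c') (a + a') (α + α') z.z := by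
  ext1
  · simp only [Number.mul_coeff, monomial_coeff, Pi.add_apply]
    simp_rw [zpow_add₀ (z.coeff_ne_zero _), Finset.prod_mul_distrib]
    ring
  · simp only [Number.mul_order, monomial_order, affine_add_exponent]

theorem monomial_pow {m : ℕ} (z : Fin m → Number) (a : ℝ) (α : Fin m → ℤ) (N : ℕ) :
    monomial 1 a α z ^ N = monomial 1 (N * a) (N • α) z := by
  ext1
  · simp only [Number.pow_coeff, monomial_coeff, one_mul, ← Finset.prod_pow]
    refine Finset.prod_congr rfl fun i _ => ?_
    rw [← zpow_natCast, ← zpow_mul, mul_comm]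
    simp
  · simp only [Number.pow_order, monomial_order, affine_nsmul]

theorem monomial_eq_mul {m : ℕ} (c : ℂ) (a : ℝ) (α : Fin m → ℤ) (z : Fin m → Number) :
    monomial c a α z = Number.ofComplex c * monomial 1 a α z := by
  ext1 <;> simp [Number.ofComplex]

theorem Number.smoothPart_mul {a b : Number} (ha : 0 ≤ a.order) (hb : 0 ≤ b.order) :
    (a * b).smoothPart = a.smoothPart * b.smoothPart := by
  simp only [smoothPart, mul_order, mul_coeff]
  by_cases h : a.order = 0 <;> by_cases h' : b.order = 0
  · simp [h, h']
  · simp [h, h']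
  · simp [h, h']
  · rw [if_neg h, if_neg (by intro hh; exact h (by linarith))]; simp

theorem Number.smoothPart_pow {a : Number} (ha : 0 ≤ a.order) (N : ℕ) :
    (a ^ N).smoothPart = a.smoothPart ^ N := by
  induction N with
  | zero => simp [smoothPart]
  | succ N ih =>
    rw [pow_succ, smoothPart_mul (by rw [pow_order]; positivity) ha, ih, pow_succ]

section

variable {n m : ℕ} {s s' : Finset (ℝ × (Fin m → ℤ))}

/-- The smooth part of a monomial with nonnegative order near `q` is a smooth germ. -/
theorem SmForm.monomial_smoothPart {q : ModelPoint n m (polyhedron s s')} {a : ℝ} {α : Fin m → ℤ}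
    (h : ∀ᶠ q' in 𝓝 q, 0 ≤ affine a α q'.ord) :
    SmForm q fun q' => (monomial 1 a α q'.pt.z).smoothPart := by
  -- Nonnegativity near `q` spreads over the relative interior of its face, whose points give points
  -- with the same neighbourhoods. Multiplying by a power of the face monomial then gives a smooth
  -- monomial on the whole polytope, and the face monomial is invertible near `q`.
  obtain ⟨N, hN⟩ := exists_add_faceExponent_nonneg (x := q.ord) q.ord_mem (a := a) (α := α) (by
    intro y hy hqy
    have h1 := (ModelPoint.inseparable_setOrd q y hy hqy).nhds_eq
    rw [h1] at h
    exact h.self_of_nhds)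
  set g := faceExponent s s' q.ord with hg
  let e : SmoothExponent (polyhedron s s') := ⟨a + N * g.a, α + N • g.α, fun y hy => by
    rw [affine_add_exponent, affine_nsmul]; exact hN y hy⟩
  have hg0 : Exploded.smoothMonomial g q.pt ≠ 0 :=
    (ModelPoint.smoothMonomial_ne_zero_iff g q).2 (affine_faceExponent_self s s' q.ord)
  have hne : ∀ᶠ q' : ModelPoint n m (polyhedron s s') in 𝓝 q, Exploded.smoothMonomial g q'.pt ≠ 0 :=
    (ModelPoint.continuous_smoothMonomial g).continuousAt.eventually_ne hg0
  refine ((SmForm.smoothMonomial q e).comp₂ (SmForm.smoothMonomial q g)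
    (H := fun y => y.1 * (y.2⁻¹) ^ N) ?_).congr ?_
  · have : ∀ᶠ y : ℂ × ℂ in 𝓝 (Exploded.smoothMonomial e q.pt, Exploded.smoothMonomial g q.pt),
        y.2 ≠ 0 := continuous_snd.continuousAt.eventually_ne hg0
    filter_upwards [this] with y hy
    exact contDiffAt_fst.mul ((contDiffAt_snd.inv hy).pow N)
  · filter_upwards [hne, h] with q' h1 h2
    have h3 := (ModelPoint.smoothMonomial_ne_zero_iff g q').1 h1
    have h4 : Exploded.smoothMonomial e q'.pt =
        (monomial 1 a α q'.pt.z).smoothPart * Exploded.smoothMonomial g q'.pt ^ N := by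
      have h5 : monomial 1 (a + N * g.a) (α + N • g.α) q'.pt.z =
          monomial 1 a α q'.pt.z * monomial 1 g.a g.α q'.pt.z ^ N := by
        rw [monomial_pow, monomial_mul, one_mul]
      rw [Exploded.smoothMonomial, show monomial 1 e.a e.α q'.pt.z = _ from h5,
        Number.smoothPart_mul h2 (by
          rw [Number.pow_order]; exact mul_nonneg (Nat.cast_nonneg _) h3.ge),
        Number.smoothPart_pow h3.ge]
      rfl
    rw [h4, mul_assoc, ← mul_pow, mul_inv_cancel₀ h1, one_pow, mul_one]

/-- At the level of germs the factor `F` only has to be nonzero at the point, since it can be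
replaced by a smooth function without zeros that agrees with it nearby. -/
theorem explAt_model_iff {P : Set (Fin m → ℝ)} {q : ModelPoint n m P}
    {h : ModelPoint n m P → Number} : ExplAt (model n m P) q h ↔
      ∃ (f : ModelPoint n m P → ℂ) (a : ℝ) (α : Fin m → ℤ), SmForm q f ∧ f q ≠ 0 ∧
        h =ᶠ[𝓝 q] fun q' => monomial (f q') a α q'.pt.z := by
  constructor
  · rintro ⟨U, hU, H⟩
    obtain ⟨V, hV, -, N, ζ, F, a, α, hF, hF0, e⟩ := H q hU
    exact ⟨fun q' => F (q'.x, fun j => smoothMonomial (ζ j) q'.pt), a, α,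
      ⟨Fin N, inferInstance, ζ, F, hF, EventuallyEq.rfl⟩, hF0 _,
      mem_of_superset (V.isOpen.mem_nhds hV) e⟩
  · rintro ⟨f, a, α, ⟨ι, _, ζ, F, hF, ef⟩, h0, e⟩
    obtain ⟨F', hF', hF0, eF⟩ := exists_contDiff_ne_zero_eventuallyEq
      (x := (q.x, fun j => smoothMonomial (ζ j) q.pt)) (Eventually.of_forall fun _ => hF.contDiffAt)
      (by rw [← ef.eq_of_nhds]; exact h0)
    have ev : ∀ᶠ q' in 𝓝 q, h q' =
        monomial (F' (q'.x, fun j => smoothMonomial (ζ j) q'.pt)) a α q'.pt.z := by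
      filter_upwards [e, ef, (continuous_coordinates ζ).continuousAt.eventually eF] with q' h1 h2 h3
      rw [h1, h2]
      exact congrArg (fun c => monomial c a α q'.pt.z) h3.symm
    obtain ⟨W, hW, hWo, hqW⟩ := mem_nhds_iff.1 ev
    let E := Fintype.equivFin ι
    have sf : HasStandardForm W h := by
      refine ⟨Fintype.card ι, fun j => ζ (E.symm j), fun y => F' (y.1, fun j => y.2 (E j)), a, α,
        hF'.comp (by fun_prop), fun y => hF0 _, fun q' hq' => ?_⟩
      have := hW hq'
      simpa using this
    refine ⟨⟨W, hWo⟩, hqW, fun q' hq' => ⟨⟨W, hWo⟩, hq', le_rfl, sf⟩⟩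

/-- `f` is a smooth complex function near `p`. -/
def SmAt (X : Space.{u}) (p : X) (f : X → ℂ) : Prop :=
  ∃ c : ℂ, ExplAt X p fun x => ⟨f x + c, 0⟩

theorem SmAt.congr {X : Space.{u}} {p : X} {f g : X → ℂ} (hf : SmAt X p f) (e : f =ᶠ[𝓝 p] g) :
    SmAt X p g := by
  obtain ⟨c, hc⟩ := hf
  refine ⟨c, hc.congr ?_⟩
  filter_upwards [e] with x hx
  rw [hx]

theorem smAt_model_iff {q : ModelPoint n m (polyhedron s s')}
    {f : ModelPoint n m (polyhedron s s') → ℂ} :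
    SmAt (model n m (polyhedron s s')) q f ↔ SmForm q f := by
  constructor
  · rintro ⟨c, hc⟩
    obtain ⟨f', a, α, hf', -, e⟩ := explAt_model_iff.1 hc
    have h0 : ∀ᶠ q' : ModelPoint n m (polyhedron s s') in 𝓝 q, affine a α q'.ord = 0 := by
      filter_upwards [e] with q' hq'
      exact (congrArg Number.order hq').symm
    -- The standard form may involve a nontrivial monomial, but its order is locally `0`, so its
    -- coefficient is its smooth part and can be absorbed in the smooth factor.
    have h1 := SmForm.monomial_smoothPart (h0.mono fun _ h => h.ge)
    refine (hf'.comp₂ h1 (H := fun y => y.1 * y.2 - c)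
      (Eventually.of_forall fun y => by fun_prop)).congr ?_
    filter_upwards [e, h0] with q' h2 h3
    have h4 := congrArg Number.coeff h2
    rw [Number.smoothPart_of_order_eq_zero h3]
    simp only [monomial_coeff, one_mul] at h4 ⊢
    rw [← h4]; ring
  · intro hf
    refine ⟨1 - f q, explAt_model_iff.2 ⟨fun q' => f q' + (1 - f q), 0, 0, ?_, by simp, ?_⟩⟩
    · exact hf.comp₂ hf (H := fun y => y.1 + (1 - f q)) (Eventually.of_forall fun y => by fun_prop)
    · refine Eventually.of_forall fun q' => ?_
      ext1 <;> simp [affine]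

end

/-! ### Smooth germs on exploded manifolds -/

/-- `X` is locally isomorphic to a model near `p`. -/
def IsModeled (X : Space.{u}) (p : X) : Prop :=
  ∃ (n m : ℕ) (P : Set (Fin m → ℝ)), IsPolytope P ∧ Nonempty (Chart X p (model n m P))

theorem Manifold.isModeled (X : Manifold.{u}) (p : X) : IsModeled X.toSpace p := X.exists_chart p

theorem isModeled_model {n m : ℕ} {P : Set (Fin m → ℝ)} (hP : IsPolytope P)
    (q : ModelPoint n m P) : IsModeled (model n m P) q :=
  ⟨n, m, P, hP, ⟨Chart.ofIso (Hom.id _) (Hom.id _) (fun _ => rfl) fun _ => rfl⟩⟩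

theorem Chart.smAt_symm {X : Space.{u}} {Y : Space.{v}} {p : X} (κ : Chart X p Y) {f : X → ℂ} :
    SmAt Y (κ.map p) (fun y => f (κ.symm y)) ↔ SmAt X p f :=
  exists_congr fun c => κ.explAt_symm (h := fun x => ⟨f x + c, 0⟩)

theorem IsModeled.exists_chart {X : Space.{u}} {p : X} (hX : IsModeled X p) :
    ∃ (n m : ℕ) (s s' : Finset (ℝ × (Fin m → ℤ))),
      Nonempty (Chart X p (model n m (polyhedron s s'))) := by
  obtain ⟨n, m, P, ⟨-, s, s', rfl⟩, κ⟩ := hX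
  exact ⟨n, m, s, s', κ⟩

section

variable {X : Space.{u}} {p : X}

theorem SmAt.comp (hX : IsModeled X p) {κ : Type} [Fintype κ] {f : κ → X → ℂ}
    (hf : ∀ k, SmAt X p (f k)) {H : (κ → ℂ) → ℂ}
    (hH : ∀ᶠ y in 𝓝 fun k => f k p, ContDiffAt ℝ ∞ H y) : SmAt X p fun x => H fun k => f k x := by
  obtain ⟨n, m, s, s', ⟨μ⟩⟩ := hX.exists_chart
  refine μ.smAt_symm.1 (smAt_model_iff.2 (SmForm.comp
    (fun k => smAt_model_iff.1 (μ.smAt_symm.2 (hf k))) ?_))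
  simpa only [μ.left'] using hH

theorem SmAt.continuousAt (hX : IsModeled X p) {f : X → ℂ} (hf : SmAt X p f) :
    ContinuousAt f p := by
  obtain ⟨n, m, s, s', ⟨μ⟩⟩ := hX.exists_chart
  have h1 : ContinuousAt (fun y => f (μ.symm y)) (μ.map p) :=
    (smAt_model_iff.1 (μ.smAt_symm.2 hf)).continuousAt
  refine (h1.comp (f := μ.map) (μ.morph_map _ μ.mem).1).congr ?_
  filter_upwards [μ.eventually_left] with x hx
  simp only [Function.comp, hx]

theorem SmAt.explAt (hX : IsModeled X p) {f : X → ℂ} (hf : SmAt X p f) (h0 : f p ≠ 0) :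
    ExplAt X p fun x => ⟨f x, 0⟩ := by
  obtain ⟨n, m, s, s', ⟨μ⟩⟩ := hX.exists_chart
  refine μ.explAt_symm.1 (explAt_model_iff.2 ⟨fun y => f (μ.symm y), 0, 0,
    smAt_model_iff.1 (μ.smAt_symm.2 hf), by
      show f (μ.symm (μ.map p)) ≠ 0
      rwa [μ.left'], ?_⟩)
  refine Eventually.of_forall fun q' => ?_
  ext1 <;> simp [affine]

/-- In a chart `h` is a smooth factor times a monomial of nonnegative order, whose smooth part is
smooth. This is the source of smooth functions built from exploded ones: pulled back smooth
monomials, and coefficients of functions of order `0`. -/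
theorem ExplAt.smAt_smoothPart (hX : IsModeled X p) {h : X → Number} (hh : ExplAt X p h)
    (h0 : ∀ᶠ x in 𝓝 p, 0 ≤ (h x).order) : SmAt X p fun x => (h x).smoothPart := by
  obtain ⟨n, m, s, s', ⟨μ⟩⟩ := hX.exists_chart
  obtain ⟨f, a, α, hf, -, e⟩ := explAt_model_iff.1 (μ.explAt_symm.2 hh)
  have h1 : ∀ᶠ q' : ModelPoint n m (polyhedron s s') in 𝓝 (μ.map p), 0 ≤ affine a α q'.ord := by
    filter_upwards [e, μ.tendsto_symm.eventually h0] with q' h2 h3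
    have h3' : 0 ≤ (h (μ.symm q')).order := h3
    rw [show h (μ.symm q') = _ from h2] at h3'
    exact h3'
  refine μ.smAt_symm.1 (smAt_model_iff.2 ((hf.comp₂ (SmForm.monomial_smoothPart h1)
    (H := fun y => y.1 * y.2) (Eventually.of_forall fun y => by fun_prop)).congr ?_))
  filter_upwards [e, h1] with q' h2 h3
  rw [h2, monomial_eq_mul, Number.smoothPart_mul le_rfl h3]
  simp only [Number.ofComplex, Number.smoothPart, if_true, monomial_order, monomial_coeff, one_mul,
    mul_ite, mul_zero]
  rfl

theorem SmAt.comp₁ (hX : IsModeled X p) {f : X → ℂ} (hf : SmAt X p f) {H : ℂ → ℂ}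
    (hH : ∀ᶠ y in 𝓝 (f p), ContDiffAt ℝ ∞ H y) : SmAt X p fun x => H (f x) := by
  refine SmAt.comp hX (f := fun _ : Unit => f) (fun _ => hf) (H := fun y => H (y ())) ?_
  have hc : ContDiff ℝ ∞ fun y : Unit → ℂ => y () := by fun_prop
  filter_upwards [(hc.continuous.tendsto fun _ => f p).eventually hH] with y hy
  exact ContDiffAt.comp y hy hc.contDiffAt

theorem SmAt.comp₂ (hX : IsModeled X p) {f g : X → ℂ} (hf : SmAt X p f) (hg : SmAt X p g)
    {H : ℂ × ℂ → ℂ} (hH : ∀ᶠ y in 𝓝 (f p, g p), ContDiffAt ℝ ∞ H y) :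
    SmAt X p fun x => H (f x, g x) := by
  have hc : ContDiff ℝ ∞ fun y : Fin 2 → ℂ => (y 0, y 1) := by fun_prop
  have ht : Tendsto (fun y : Fin 2 → ℂ => (y 0, y 1)) (𝓝 fun k => ![f, g] k p) (𝓝 (f p, g p)) := by
    simpa using hc.continuous.tendsto fun k => ![f, g] k p
  have := SmAt.comp hX (f := ![f, g]) (fun k => by fin_cases k; exacts [hf, hg])
    (H := fun y => H (y 0, y 1)) (by
      filter_upwards [ht.eventually hH] with y hy
      exact ContDiffAt.comp y hy hc.contDiffAt)
  simpa using this

theorem SmAt.const (X : Space.{u}) (p : X) (c : ℂ) : SmAt X p fun _ => c :=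
  ⟨1 - c, ExplAt.const X p (by simp)⟩

theorem SmAt.add (hX : IsModeled X p) {f g : X → ℂ} (hf : SmAt X p f) (hg : SmAt X p g) :
    SmAt X p fun x => f x + g x :=
  hf.comp₂ hX hg (H := fun y => y.1 + y.2) (Eventually.of_forall fun y => by fun_prop)

theorem SmAt.mul (hX : IsModeled X p) {f g : X → ℂ} (hf : SmAt X p f) (hg : SmAt X p g) :
    SmAt X p fun x => f x * g x :=
  hf.comp₂ hX hg (H := fun y => y.1 * y.2) (Eventually.of_forall fun y => by fun_prop)

theorem SmAt.re (hX : IsModeled X p) {f : X → ℂ} (hf : SmAt X p f) :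
    SmAt X p fun x => ((f x).re : ℂ) :=
  hf.comp₁ hX (H := fun y => (y.re : ℂ)) (Eventually.of_forall fun _ =>
    (Complex.ofRealCLM.contDiff.comp Complex.reCLM.contDiff).contDiffAt)

theorem SmAt.im (hX : IsModeled X p) {f : X → ℂ} (hf : SmAt X p f) :
    SmAt X p fun x => ((f x).im : ℂ) :=
  hf.comp₁ hX (H := fun y => (y.im : ℂ)) (Eventually.of_forall fun _ =>
    (Complex.ofRealCLM.contDiff.comp Complex.imCLM.contDiff).contDiffAt)

theorem SmAt.eventually {f : X → ℂ} (hf : SmAt X p f) : ∀ᶠ q in 𝓝 p, SmAt X q f := by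
  obtain ⟨c, hc⟩ := hf
  filter_upwards [hc.eventually] with q hq using ⟨c, hq⟩

theorem MorphAt.smAt {Y : Space.{v}} {φ : X → Y} (hφ : MorphAt φ p) {f : Y → ℂ}
    (hf : SmAt Y (φ p) f) : SmAt X p fun x => f (φ x) := by
  obtain ⟨c, hc⟩ := hf
  exact ⟨c, hφ.2 _ hc⟩

/-- A function to a model is a morphism if its coordinates are smooth and exploded functions. -/
theorem morphAt_model (hX : IsModeled X p) {n m : ℕ} {P : Set (Fin m → ℝ)}
    {φ : X → ModelPoint n m P} (hx : ∀ i, SmAt X p fun y => ((φ y).x i : ℂ))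
    (hz : ∀ i, ExplAt X p fun y => (φ y).pt.z i) : MorphAt (Y := model n m P) φ p := by
  -- A smooth monomial pulls back to the smooth part of an exploded function of nonnegative order.
  -- Continuity and the pullback of every standard form follow from this.
  have hm : ∀ e : SmoothExponent P, SmAt X p fun y => smoothMonomial e (φ y).pt := fun e =>
    ExplAt.smAt_smoothPart hX (ExplAt.monomial one_ne_zero e.a e.α hz)
      (Eventually.of_forall fun y => e.nonneg _ (φ y).ord_mem)
  have hc : ContinuousAt φ p := by
    refine ModelPoint.tendsto_iff.2 ⟨tendsto_pi_nhds.2 fun i => ?_, fun e => (hm e).continuousAt hX⟩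
    have := Complex.continuous_re.continuousAt.comp ((hx i).continuousAt hX)
    simpa [ContinuousAt, Function.comp_def] using this
  refine ⟨hc, fun h hh => ?_⟩
  obtain ⟨f, a, α, ⟨ι, _, ζ, F, hF, ef⟩, h0, e⟩ := explAt_model_iff.1 hh
  have hs : SmAt X p fun y => F ((φ y).x, fun j => smoothMonomial (ζ j) (φ y).pt) := by
    have := SmAt.comp hX (κ := Fin n ⊕ ι)
      (f := fun k y => Sum.elim (fun i => ((φ y).x i : ℂ)) (fun j => smoothMonomial (ζ j) (φ y).pt) k)
      (fun k => by cases k; exacts [hx _, hm _])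
      (H := fun w => F (fun i => (w (Sum.inl i)).re, fun j => w (Sum.inr j)))
      (Eventually.of_forall fun w => by
        refine (hF.comp ?_).contDiffAt
        refine (contDiff_pi.2 fun i => Complex.reCLM.contDiff.comp (by fun_prop)).prodMk
          (by fun_prop))
    simpa using this
  have h1 : ExplAt X p fun y => ⟨F ((φ y).x, fun j => smoothMonomial (ζ j) (φ y).pt), 0⟩ :=
    hs.explAt hX (by rw [← ef.eq_of_nhds]; exact h0)
  refine (h1.mul (ExplAt.monomial one_ne_zero a α hz)).congr ?_
  filter_upwards [hc.eventually e, hc.eventually ef] with y h2 h3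
  rw [h2, h3]
  exact (monomial_eq_mul _ _ _ _).symm

theorem ModelPoint.smAt_x {n m : ℕ} {P : Set (Fin m → ℝ)} (q : ModelPoint n m P) (i : Fin n) :
    SmAt (model n m P) q fun y => (ModelPoint.x y i : ℂ) := by
  refine ⟨Complex.I, explAt_model_iff.2 ⟨fun q' => q'.x i + Complex.I, 0, 0, ?_, ?_, ?_⟩⟩
  · exact (SmForm.coord q i).comp₂ (SmForm.coord q i) (H := fun y => y.1 + Complex.I)
      (Eventually.of_forall fun y => by fun_prop)
  · intro h
    simpa using congrArg Complex.im h
  · refine Eventually.of_forall fun q' => ?_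
    ext1 <;> simp [affine]

theorem ModelPoint.explAt_z {n m : ℕ} {P : Set (Fin m → ℝ)} (q : ModelPoint n m P) (i : Fin m) :
    ExplAt (model n m P) q fun y => (ModelPoint.pt y).z i := by
  refine explAt_model_iff.2 ⟨fun _ => 1, 0, Pi.single i 1, ?_, one_ne_zero, ?_⟩
  · exact ⟨Empty, inferInstance, Empty.elim, fun _ => 1, contDiff_const, EventuallyEq.rfl⟩
  · refine Eventually.of_forall fun q' => ?_
    ext1
    · rw [monomial_coeff, one_mul, Finset.prod_eq_single i]
      · simp
      · intro j _ hj; simp [hj]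
      · simp
    · simp [affine, Pi.single_apply]

end

/-! ### Integral affine maps -/

/-- The integral affine map `y ↦ a + A y`. -/
def affMap {m k : ℕ} (a : Fin m → ℝ) (A : Matrix (Fin m) (Fin k) ℤ) (y : Fin k → ℝ) : Fin m → ℝ :=
  fun i => affine (a i) (A i) y

theorem continuous_affMap {m k : ℕ} (a : Fin m → ℝ) (A : Matrix (Fin m) (Fin k) ℤ) :
    Continuous (affMap a A) :=
  continuous_pi fun i => continuous_affine (a i) (A i)

theorem affine_affMap {m k : ℕ} (c : ℝ) (γ : Fin m → ℤ) (a : Fin m → ℝ)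
    (A : Matrix (Fin m) (Fin k) ℤ) (y : Fin k → ℝ) :
    affine c γ (affMap a A y) = affine (affine c γ a) (Matrix.vecMul γ A) y := by
  simp only [affine, affMap, Matrix.vecMul, dotProduct, mul_add, Finset.sum_add_distrib,
    Int.cast_sum, Int.cast_mul, Finset.sum_mul, Finset.mul_sum, add_assoc]
  rw [Finset.sum_comm]
  simp only [mul_assoc]

theorem affMap_affMap {m k l : ℕ} (a : Fin m → ℝ) (A : Matrix (Fin m) (Fin k) ℤ) (b : Fin k → ℝ)
    (B : Matrix (Fin k) (Fin l) ℤ) (y : Fin l → ℝ) :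
    affMap a A (affMap b B y) = affMap (affMap a A b) (A * B) y := by
  funext i
  exact affine_affMap _ _ _ _ _

theorem affMap_zero_one {m : ℕ} (y : Fin m → ℝ) : affMap 0 (1 : Matrix (Fin m) (Fin m) ℤ) y = y := by
  funext i
  simp [affMap, affine, Matrix.one_apply]

/-- The inequality `c` pulled back by `affMap a A`. -/
def pullIneq {m k : ℕ} (a : Fin m → ℝ) (A : Matrix (Fin m) (Fin k) ℤ) (c : ℝ × (Fin m → ℤ)) :
    ℝ × (Fin k → ℤ) :=
  (affine c.1 c.2 a, Matrix.vecMul c.2 A)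

theorem preimage_polyhedron {m k : ℕ} (a : Fin m → ℝ) (A : Matrix (Fin m) (Fin k) ℤ)
    (s s' : Finset (ℝ × (Fin m → ℤ))) : affMap a A ⁻¹' polyhedron s s' =
      polyhedron (s.image (pullIneq a A)) (s'.image (pullIneq a A)) := by
  ext y
  simp only [polyhedron, Set.mem_preimage, Set.mem_ofPred_eq, affine_affMap, pullIneq,
    Finset.forall_mem_image]

theorem prod_zpow_vecMul {m k : ℕ} {c : Fin m → ℂ} (hc : ∀ i, c i ≠ 0)
    (A : Matrix (Fin k) (Fin m) ℤ) (γ : Fin k → ℤ) :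
    ∏ l, (∏ j, c j ^ A l j) ^ γ l = ∏ j, c j ^ Matrix.vecMul γ A j := by
  have h : ∀ j, c j ^ Matrix.vecMul γ A j = ∏ l, c j ^ (A l j * γ l) := fun j => by
    rw [Matrix.vecMul, dotProduct]
    generalize (Finset.univ : Finset (Fin k)) = s
    induction s using Finset.induction_on with
    | empty => simp
    | insert a s ha ih => rw [Finset.sum_insert ha, Finset.prod_insert ha, zpow_add₀ (hc j), ih,
        mul_comm (γ a)]
  simp only [h]
  rw [Finset.prod_comm]
  simp only [← Finset.prod_zpow, zpow_mul]

theorem monomial_monomial {m k : ℕ} {z : Fin m → Number} (hz : ∀ i, (z i).coeff ≠ 0) (d : ℂ) (c : ℝ)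
    (γ : Fin k → ℤ) (u : Fin k → ℂ) (a : Fin k → ℝ) (A : Matrix (Fin k) (Fin m) ℤ) :
    monomial d c γ (fun l => monomial (u l) (a l) (A l) z) =
      monomial (d * ∏ l, u l ^ γ l) (affine c γ a) (Matrix.vecMul γ A) z := by
  ext1
  · simp only [monomial_coeff, mul_zpow, Finset.prod_mul_distrib, prod_zpow_vecMul hz, mul_assoc]
  · exact affine_affMap _ _ _ _ _

theorem monomial_single {m : ℕ} (z : Fin m → Number) (i : Fin m) :
    monomial 1 0 ((1 : Matrix (Fin m) (Fin m) ℤ) i) z = z i := by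
  ext1
  · simp only [monomial_coeff, one_mul, Matrix.one_apply]
    rw [Finset.prod_eq_single i]
    · simp
    · intro j _ hj; simp [hj.symm]
    · simp
  · simpa [affMap] using congrFun (affMap_zero_one fun j => (z j).order) i

/-- The tuple of the monomials `uᵢ t^(aᵢ) z^(Aᵢ)`. -/
def monMap {m k : ℕ} (u : Fin k → ℂ) (a : Fin k → ℝ) (A : Matrix (Fin k) (Fin m) ℤ)
    (z : Fin m → Number) : Fin k → Number :=
  fun i => monomial (u i) (a i) (A i) z

theorem monMap_coeff_ne_zero {m k : ℕ} {u : Fin k → ℂ} (hu : ∀ i, u i ≠ 0) (a : Fin k → ℝ)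
    (A : Matrix (Fin k) (Fin m) ℤ) {z : Fin m → Number} (hz : ∀ i, (z i).coeff ≠ 0) (i : Fin k) :
    (monMap u a A z i).coeff ≠ 0 :=
  mul_ne_zero (hu i) (Finset.prod_ne_zero_iff.2 fun j _ => zpow_ne_zero _ (hz j))

theorem monMap_order {m k : ℕ} (u : Fin k → ℂ) (a : Fin k → ℝ) (A : Matrix (Fin k) (Fin m) ℤ)
    (z : Fin m → Number) : (fun i => (monMap u a A z i).order) = affMap a A fun i => (z i).order :=
  rfl

theorem monMap_monMap {m k l : ℕ} {z : Fin m → Number} (hz : ∀ i, (z i).coeff ≠ 0) (v : Fin l → ℂ)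
    (c : Fin l → ℝ) (C : Matrix (Fin l) (Fin k) ℤ) (u : Fin k → ℂ) (a : Fin k → ℝ)
    (A : Matrix (Fin k) (Fin m) ℤ) : monMap v c C (monMap u a A z) =
      monMap (fun i => v i * ∏ j, u j ^ C i j) (affMap c C a) (C * A) z :=
  funext fun _ => monomial_monomial hz _ _ _ _ _ _

theorem monMap_one {m : ℕ} (z : Fin m → Number) : monMap (fun _ => 1) 0 1 z = z :=
  funext fun i => monomial_single z i

/-- The point with given coordinates, or `d` if there is none. -/
def mkPoint {n m : ℕ} {P : Set (Fin m → ℝ)} (d : ModelPoint n m P) (x : Fin n → ℝ)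
    (z : Fin m → Number) : ModelPoint n m P :=
  haveI := Classical.propDecidable
  if h : (∀ i, (z i).coeff ≠ 0) ∧ (fun i => (z i).order) ∈ P then ⟨x, ⟨z, h.1, h.2⟩⟩ else d

section

variable {n m : ℕ} {P : Set (Fin m → ℝ)} (d : ModelPoint n m P) {x : Fin n → ℝ} {z : Fin m → Number}

theorem mkPoint_eq (h1 : ∀ i, (z i).coeff ≠ 0) (h2 : (fun i => (z i).order) ∈ P) :
    mkPoint d x z = ⟨x, ⟨z, h1, h2⟩⟩ := dif_pos ⟨h1, h2⟩

theorem mkPoint_self (q : ModelPoint n m P) : mkPoint d q.x q.pt.z = q :=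
  mkPoint_eq d q.pt.coeff_ne_zero q.pt.order_mem

theorem morphAt_mkPoint {X : Space.{u}} {p : X} (hX : IsModeled X p) {x : X → Fin n → ℝ}
    {z : X → Fin m → Number} (hx : ∀ i, SmAt X p fun y => (x y i : ℂ))
    (hz : ∀ i, ExplAt X p fun y => z y i)
    (hP : ∀ᶠ y in 𝓝 p, (fun i => (z y i).order) ∈ P) :
    MorphAt (Y := model n m P) (fun y => mkPoint d (x y) (z y)) p := by
  have h1 : ∀ᶠ y in 𝓝 p, ∀ i, (z y i).coeff ≠ 0 :=
    eventually_all.2 fun i => (hz i).eventually.mono fun y h => h.coeff_ne_zero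
  refine morphAt_model hX (fun i => (hx i).congr ?_) fun i => (hz i).congr ?_
  · filter_upwards [h1, hP] with y h2 h3
    rw [mkPoint_eq d h2 h3]
  · filter_upwards [h1, hP] with y h2 h3
    rw [mkPoint_eq d h2 h3]

end

/-! ### Charts centered in the interior of a polytope -/

/-- Smith normal form provides a basis of `ℤ^m` such that nonzero multiples of some basis vectors
form a basis of `N`. The rows of `B` are these vectors, a basis of the saturation of `N`, and the
rows of `D` are the others; `B'` and `D'` are the blocks of the inverse base change. -/
theorem exists_lattice_splitting {m : ℕ} (N : Submodule ℤ (Fin m → ℤ)) :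
    ∃ (r k : ℕ) (B : Matrix (Fin r) (Fin m) ℤ) (D : Matrix (Fin k) (Fin m) ℤ)
      (B' : Matrix (Fin m) (Fin r) ℤ) (D' : Matrix (Fin m) (Fin k) ℤ),
      B' * B + D' * D = 1 ∧ B * B' = 1 ∧ D * D' = 1 ∧ B * D' = 0 ∧ D * B' = 0 ∧
      (∀ α ∈ N, Matrix.vecMul α D' = 0) ∧ ∀ i, ∃ a : ℤ, a ≠ 0 ∧ a • B i ∈ N := by
  classical
  obtain ⟨r, snf⟩ := N.smithNormalForm (Pi.basisFun ℤ (Fin m))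
  let e : Fin (Fintype.card {l // l ∉ Set.range snf.f}) ≃ {l // l ∉ Set.range snf.f} :=
    (Fintype.equivFin _).symm
  let σ : Fin r ⊕ Fin (Fintype.card {l // l ∉ Set.range snf.f}) ≃ Fin m :=
    ((Equiv.ofInjective snf.f snf.f.injective).sumCongr e).trans
      (Equiv.Set.sumCompl (Set.range snf.f))
  have hσl : ∀ i, σ (Sum.inl i) = snf.f i := fun i => rfl
  have hσr : ∀ j, σ (Sum.inr j) = (e j).1 := fun j => rfl
  let M : Matrix (Fin m) (Fin m) ℤ := Matrix.of fun l i => snf.bM l i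
  let M' : Matrix (Fin m) (Fin m) ℤ := Matrix.of fun i l => snf.bM.repr (Pi.single i 1) l
  have hrepr : ∀ α : Fin m → ℤ, ∀ l, Matrix.vecMul α M' l = snf.bM.repr α l := fun α l => by
    conv_rhs => rw [pi_eq_sum_univ' α]
    simp only [map_sum, map_smul, Finsupp.coe_finsetSum, Finset.sum_apply, Finsupp.smul_apply,
      Matrix.vecMul, dotProduct, M', Matrix.of_apply, smul_eq_mul]
  have hMM' : M * M' = 1 := by
    ext l l'
    have : (M * M') l l' = Matrix.vecMul (snf.bM l) M' l' := rfl
    rw [this, hrepr, Module.Basis.repr_self, Finsupp.single_apply, Matrix.one_apply]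
  have hM'M : M' * M = 1 := mul_eq_one_comm.1 hMM'
  have entry : ∀ l l', ∑ i, M l i * M' i l' = if l = l' then 1 else 0 := fun l l' => by
    have := congrFun (congrFun hMM' l) l'
    rwa [Matrix.mul_apply, Matrix.one_apply] at this
  refine ⟨r, _, fun i => M (σ (Sum.inl i)), fun j => M (σ (Sum.inr j)),
    fun i l => M' i (σ (Sum.inl l)), fun i l => M' i (σ (Sum.inr l)), ?_, ?_, ?_, ?_, ?_, ?_, ?_⟩
  · ext i j
    have := congrFun (congrFun hM'M i) j
    rw [Matrix.mul_apply, ← σ.sum_comp, Fintype.sum_sum_type] at this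
    exact this
  · ext i j
    exact (entry _ _).trans (by simp [Matrix.one_apply])
  · ext i j
    exact (entry _ _).trans (by simp [Matrix.one_apply])
  · ext i j
    exact (entry _ _).trans (by simp)
  · ext i j
    exact (entry _ _).trans (by simp)
  · intro α hα
    funext j
    refine (hrepr α (σ (Sum.inr j))).trans ?_
    exact snf.repr_eq_zero_of_notMem_range ⟨α, hα⟩ (e j).2
  · intro i
    refine ⟨snf.a i, fun h => ?_, ?_⟩
    · have h1 := snf.snf i
      rw [h, zero_smul] at h1
      exact snf.bN.ne_zero i (Subtype.ext h1)
    · have h1 := snf.snf i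
      have h2 : snf.a i • M (σ (Sum.inl i)) = (snf.bN i : Fin m → ℤ) := h1.symm
      rw [h2]
      exact (snf.bN i).2

theorem linForm_eq_of_mem_span {m : ℕ} {S : Set (Fin m → ℤ)} {x y : Fin m → ℝ}
    (h : ∀ α ∈ S, linForm α x = linForm α y) {α : Fin m → ℤ} (hα : α ∈ Submodule.span ℤ S) :
    linForm α x = linForm α y := by
  induction hα using Submodule.span_induction with
  | mem α hα => exact h α hα
  | zero => simp [linForm_apply]
  | add α β _ _ hα hβ => rw [linForm_add_left, LinearMap.add_apply, LinearMap.add_apply, hα, hβ]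
  | smul a α _ hα =>
    have key : ∀ z, linForm (a • α) z = a * linForm α z := fun z => by
      simp [linForm_apply, Finset.mul_sum, mul_assoc]
    rw [key, key, hα]

theorem mem_interior_polyhedron {m : ℕ} {s s' : Finset (ℝ × (Fin m → ℤ))} {x : Fin m → ℝ}
    (hx : x ∈ polyhedron s s')
    (h : ∀ c ∈ s, affine c.1 c.2 x = 0 → ∀ y, 0 ≤ affine c.1 c.2 y) :
    x ∈ interior (polyhedron s s') := by
  rw [mem_interior_iff_mem_nhds]
  have key : ∀ c : ℝ × (Fin m → ℤ), 0 < affine c.1 c.2 x → ∀ᶠ y in 𝓝 x, 0 < affine c.1 c.2 y :=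
    fun c hc => (continuous_affine c.1 c.2).continuousAt.eventually (lt_mem_nhds hc)
  have h1 : ∀ᶠ y in 𝓝 x, ∀ c ∈ s, 0 ≤ affine c.1 c.2 y :=
    (Filter.eventually_all_finset s).2 fun c hc => by
      rcases (hx.1 c hc).eq_or_lt with h0 | h0
      · exact Eventually.of_forall (h c hc h0.symm)
      · exact (key c h0).mono fun y hy => hy.le
  have h2 : ∀ᶠ y in 𝓝 x, ∀ c ∈ s', 0 < affine c.1 c.2 y :=
    (Filter.eventually_all_finset s').2 fun c hc => key c (hx.2 c hc)
  filter_upwards [h1, h2] with y a b using ⟨a, b⟩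

theorem SmAt.explAt_prod {X : Space.{u}} {p : X} (hX : IsModeled X p) {ι : Type*} [Fintype ι]
    {f : ι → X → ℂ} (hf : ∀ i, SmAt X p (f i)) (h0 : ∀ i, f i p ≠ 0) (γ : ι → ℤ) :
    ExplAt X p fun x => ⟨∏ i, f i x ^ γ i, 0⟩ := by
  have := ExplAt.prod Finset.univ (f := fun i x => (⟨f i x, 0⟩ : Number) ^ γ i)
    fun i _ => ((hf i).explAt hX (h0 i)).zpow _
  refine this.congr (Eventually.of_forall fun x => ?_)
  ext1 <;> simp

/-- With `B' * B + D' * D = 1` this recovers `y` from its two blocks of coordinates. Where the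
`B`-block is constant, the `D`-block alone determines `y`. -/
theorem affMap_split {m r k : ℕ} (B' : Matrix (Fin m) (Fin r) ℤ) (B : Matrix (Fin r) (Fin m) ℤ)
    (D' : Matrix (Fin m) (Fin k) ℤ) (D : Matrix (Fin k) (Fin m) ℤ) (y : Fin m → ℝ) :
    affMap (affMap 0 B' (affMap 0 B y)) D' (affMap 0 D y) = affMap 0 (B' * B + D' * D) y := by
  funext i
  have h1 : ∀ (c : ℝ) (γ : Fin k → ℤ) z, affine c γ z = c + affine 0 γ z := fun c γ z => by
    simp [affine]
  have h2 : (B' * B + D' * D) i = (B' * B) i + (D' * D) i := rfl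
  have h3 := affine_add_exponent 0 0 ((B' * B) i) ((D' * D) i) y
  rw [add_zero] at h3
  show affine _ (D' i) _ = affine 0 _ y
  rw [h2, h3, h1, affMap_affMap]
  congr 1
  · simp [affMap, affine]
  · rw [affine_affMap]
    simp [affine, Matrix.mul_apply, Matrix.vecMul, dotProduct]

/-- The real coordinates `x` together with the real and imaginary parts of `u`. -/
def joinCoeff {n r : ℕ} (x : Fin n → ℝ) (u : Fin r → ℂ) : Fin (n + (r + r)) → ℝ :=
  Fin.append x (Fin.append (fun i => (u i).re) fun i => (u i).im)

/-- The complex numbers among the coordinates `joinCoeff x u`. -/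
def coeffPart {n r : ℕ} (v : Fin (n + (r + r)) → ℝ) (i : Fin r) : ℂ :=
  ⟨v (Fin.natAdd n (Fin.castAdd r i)), v (Fin.natAdd n (Fin.natAdd r i))⟩

/-- The real numbers among the coordinates `joinCoeff x u`. -/
def realPart {n r : ℕ} (v : Fin (n + (r + r)) → ℝ) (i : Fin n) : ℝ := v (Fin.castAdd _ i)

theorem coeffPart_joinCoeff {n r : ℕ} (x : Fin n → ℝ) (u : Fin r → ℂ) :
    coeffPart (joinCoeff x u) = u := by
  funext i
  apply Complex.ext <;> simp [coeffPart, joinCoeff, -Fin.natAdd_eq_addNat]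

theorem realPart_joinCoeff {n r : ℕ} (x : Fin n → ℝ) (u : Fin r → ℂ) :
    realPart (joinCoeff x u) = x := by
  funext i
  simp [realPart, joinCoeff]

theorem joinCoeff_parts {n r : ℕ} (v : Fin (n + (r + r)) → ℝ) :
    joinCoeff (realPart v) (coeffPart v) = v := by
  funext i
  refine Fin.addCases (fun i => ?_) (fun i => ?_) i
  · simp [realPart, joinCoeff]
  · refine Fin.addCases (fun i => ?_) (fun i => ?_) i <;>
      simp [coeffPart, joinCoeff, -Fin.natAdd_eq_addNat]

theorem smAt_joinCoeff {X : Space.{u}} {p : X} (hX : IsModeled X p) {n r : ℕ} {x : X → Fin n → ℝ}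
    {u : X → Fin r → ℂ} (hx : ∀ i, SmAt X p fun y => (x y i : ℂ))
    (hu : ∀ i, SmAt X p fun y => u y i) (i : Fin (n + (r + r))) :
    SmAt X p fun y => (joinCoeff (x y) (u y) i : ℂ) := by
  refine Fin.addCases (fun i => ?_) (fun i => ?_) i
  · simpa [joinCoeff] using hx i
  · refine Fin.addCases (fun i => ?_) (fun i => ?_) i
    · simpa [joinCoeff] using (hu i).re hX
    · simpa [joinCoeff, -Fin.natAdd_eq_addNat] using (hu i).im hX

theorem smAt_coeffPart {X : Space.{u}} {p : X} (hX : IsModeled X p) {n r : ℕ}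
    {v : X → Fin (n + (r + r)) → ℝ} (hv : ∀ i, SmAt X p fun y => (v y i : ℂ)) (i : Fin r) :
    SmAt X p fun y => coeffPart (v y) i := by
  refine ((hv (Fin.natAdd n (Fin.castAdd r i))).comp₂ hX (hv (Fin.natAdd n (Fin.natAdd r i)))
    (H := fun y => y.1 + y.2 * Complex.I)
    (Eventually.of_forall fun y => by fun_prop)).congr (Eventually.of_forall fun y => ?_)
  exact (Complex.mk_eq_add_mul_I _ _).symm

theorem isOpen_coeffPart_ne_zero {n r k : ℕ} {P : Set (Fin k → ℝ)} :
    IsOpen {v : ModelPoint (n + (r + r)) k P | ∀ i, coeffPart v.x i ≠ 0} := by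
  have h1 : Continuous fun v : ModelPoint (n + (r + r)) k P => coeffPart v.x := by
    refine continuous_pi fun i => ?_
    have h2 : ∀ j, Continuous fun v : ModelPoint (n + (r + r)) k P => v.x j :=
      fun j => (continuous_apply j).comp ModelPoint.continuous_x
    exact Complex.equivRealProdCLM.symm.continuous.comp ((h2 _).prodMk (h2 _))
  have h2 := (isOpen_set_pi (Set.finite_univ (α := Fin r))
    fun _ _ => isOpen_compl_singleton (x := (0 : ℂ))).preimage h1
  convert h2 using 1
  ext v
  simp

section

variable {n m r k : ℕ} {P : Set (Fin m → ℝ)} (q : ModelPoint n m P) (g : SmoothExponent P)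
  (B : Matrix (Fin r) (Fin m) ℤ) (D : Matrix (Fin k) (Fin m) ℤ)
  (B' : Matrix (Fin m) (Fin r) ℤ) (D' : Matrix (Fin m) (Fin k) ℤ) (b : Fin r → ℝ)

/-- The points of `T_P` with given coordinates in the decomposition given by `B'` and `D'`. -/
def splitInv (v : ModelPoint (n + (r + r)) k (affMap (affMap 0 B' b) D' ⁻¹' P)) :
    ModelPoint n m P :=
  mkPoint q (realPart v.x)
    (monMap (fun i => ∏ l, coeffPart v.x l ^ B' i l) (affMap 0 B' b) D' v.pt.z)

variable {b} in
/-- The coordinates of a point in the decomposition given by `B` and `D`. -/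
def splitMap (d : ModelPoint (n + (r + r)) k (affMap (affMap 0 B' b) D' ⁻¹' P))
    (p : ModelPoint n m P) : ModelPoint (n + (r + r)) k (affMap (affMap 0 B' b) D' ⁻¹' P) :=
  mkPoint d (joinCoeff p.x fun i => (monMap (fun _ => 1) 0 B p.pt.z i).coeff)
    (monMap (fun _ => 1) 0 D p.pt.z)

variable {b} (d : ModelPoint (n + (r + r)) k (affMap (affMap 0 B' b) D' ⁻¹' P))

theorem splitMap_eq (h1 : B' * B + D' * D = 1) {p : ModelPoint n m P}
    (hp : affMap 0 B p.ord = b) :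
    splitMap B D B' D' d p = ⟨joinCoeff p.x fun i => (monMap (fun _ => 1) 0 B p.pt.z i).coeff,
      ⟨monMap (fun _ => 1) 0 D p.pt.z,
        monMap_coeff_ne_zero (fun _ => one_ne_zero) _ _ p.pt.coeff_ne_zero, by
          have := affMap_split B' B D' D p.ord
          rw [hp, h1, affMap_zero_one] at this
          show affMap (affMap 0 B' b) D' (affMap 0 D p.ord) ∈ P
          rw [this]
          exact p.ord_mem⟩⟩ := mkPoint_eq d _ _

theorem splitInv_eq {v : ModelPoint (n + (r + r)) k (affMap (affMap 0 B' b) D' ⁻¹' P)}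
    (hv : ∀ i, coeffPart v.x i ≠ 0) : splitInv q B' D' b v = ⟨realPart v.x,
      ⟨monMap (fun i => ∏ l, coeffPart v.x l ^ B' i l) (affMap 0 B' b) D' v.pt.z,
        monMap_coeff_ne_zero (fun _ => Finset.prod_ne_zero_iff.2 fun l _ => zpow_ne_zero _ (hv l))
          _ _ v.pt.coeff_ne_zero, v.ord_mem⟩⟩ := mkPoint_eq q _ _

theorem splitInv_splitMap (h1 : B' * B + D' * D = 1) {p : ModelPoint n m P}
    (hp : affMap 0 B p.ord = b) : splitInv q B' D' b (splitMap B D B' D' d p) = p := by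
  have hz := p.pt.coeff_ne_zero
  have hv : ∀ i, coeffPart (joinCoeff p.x fun i => (monMap (fun _ => 1) 0 B p.pt.z i).coeff) i ≠ 0 := by
    rw [coeffPart_joinCoeff]
    exact fun i => monMap_coeff_ne_zero (fun _ => one_ne_zero) _ _ hz i
  rw [splitMap_eq B D B' D' d h1 hp, splitInv_eq q B' D' hv]
  refine ModelPoint.ext (realPart_joinCoeff _ _) (TorusPoint.ext ?_)
  simp only [coeffPart_joinCoeff]
  rw [monMap_monMap hz]
  funext i
  have h2 : (B' * B) i + (D' * D) i = (1 : Matrix (Fin m) (Fin m) ℤ) i := by rw [← h1]; rfl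
  ext1
  · have h3 := congrArg Number.coeff (monomial_single p.pt.z i)
    simp only [monMap, monomial_coeff, one_mul, one_zpow, Finset.prod_const_one, mul_one] at h3 ⊢
    rw [prod_zpow_vecMul hz, ← h3, ← h2, ← Finset.prod_mul_distrib]
    exact Finset.prod_congr rfl fun j _ => (zpow_add₀ (hz j) _ _).symm
  · have h3 := congrFun (affMap_split B' B D' D p.ord) i
    rw [hp, h1, affMap_zero_one, affMap_affMap] at h3
    exact h3

theorem splitMap_splitInv (h1 : B' * B + D' * D = 1) (hBB : B * B' = 1) (hDD : D * D' = 1)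
    (hBD : B * D' = 0) (hDB : D * B' = 0)
    {v : ModelPoint (n + (r + r)) k (affMap (affMap 0 B' b) D' ⁻¹' P)}
    (hv : ∀ i, coeffPart v.x i ≠ 0) (hb : affMap 0 B (splitInv q B' D' b v).ord = b) :
    splitMap B D B' D' d (splitInv q B' D' b v) = v := by
  have hz := v.pt.coeff_ne_zero
  rw [splitMap_eq B D B' D' d h1 hb]
  simp only [splitInv_eq q B' D' hv]
  have e0 : affMap 0 D (affMap 0 B' b) = 0 := by
    rw [affMap_affMap, hDB]
    funext i; simp [affMap, affine]
  refine ModelPoint.ext ?_ (TorusPoint.ext ?_)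
  · have : (fun i => (monMap (fun _ => 1) 0 B (monMap (fun i => ∏ l, coeffPart v.x l ^ B' i l)
        (affMap 0 B' b) D' v.pt.z) i).coeff) = coeffPart v.x := by
      rw [monMap_monMap hz, hBD]
      funext i
      have h3 : Matrix.vecMul (B i) B' = (1 : Matrix (Fin r) (Fin r) ℤ) i := by rw [← hBB]; rfl
      simp only [monMap, monomial_coeff, one_mul, prod_zpow_vecMul hv, h3, Matrix.zero_apply,
        zpow_zero, Finset.prod_const_one, mul_one, Matrix.one_apply]
      rw [Finset.prod_eq_single i]
      · simp
      · intro j _ hj; simp [hj.symm]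
      · simp
    simp only [this, joinCoeff_parts]
  · simp only
    rw [monMap_monMap hz, hDD, e0]
    have : (fun i => (1 : ℂ) * ∏ j, (∏ l, coeffPart v.x l ^ B' j l) ^ D i j) = fun _ => 1 := by
      funext i
      have h3 : Matrix.vecMul (D i) B' = (0 : Matrix (Fin k) (Fin r) ℤ) i := by rw [← hDB]; rfl
      simp only [prod_zpow_vecMul hv, h3, Matrix.zero_apply, zpow_zero, Finset.prod_const_one,
        mul_one]
    rw [this, monMap_one]

theorem morphAt_splitMap (hX : IsModeled (model n m P) q) (h1 : B' * B + D' * D = 1)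
    (hq : ∀ᶠ p : ModelPoint n m P in 𝓝 q, affMap 0 B p.ord = b) :
    MorphAt (X := model n m P) (Y := model (n + (r + r)) k (affMap (affMap 0 B' b) D' ⁻¹' P))
      (splitMap B D B' D' d) q := by
  refine morphAt_mkPoint (X := model n m P) (p := q) d hX
    (smAt_joinCoeff hX (q.smAt_x) fun i => ?_)
    (fun i => ExplAt.monomial one_ne_zero _ _ q.explAt_z) ?_
  -- Near `q` the monomial with exponent `B i` has constant order `b i`. Shifting by `-b i` makes
  -- the order `0`, so that the coefficient is a smooth part and hence smooth.
  · have hz : ExplAt (model n m P) q fun p => monomial 1 (-b i) (B i) (ModelPoint.pt p).z :=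
      ExplAt.monomial one_ne_zero _ _ q.explAt_z
    have h0 : ∀ᶠ p : ModelPoint n m P in 𝓝 q, affine (-b i) (B i) p.ord = 0 := by
      filter_upwards [hq] with p hp
      have := congrFun hp i
      simp only [affMap, affine_eq, Pi.zero_apply] at this ⊢
      linarith
    refine (hz.smAt_smoothPart hX (h0.mono fun p hp => hp.ge)).congr ?_
    filter_upwards [h0] with p hp
    exact Number.smoothPart_of_order_eq_zero hp
  · filter_upwards [hq] with p hp
    have := affMap_split B' B D' D p.ord
    rw [hp, h1, affMap_zero_one] at this
    show affMap (affMap 0 B' b) D' (affMap 0 D p.ord) ∈ P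
    rw [this]
    exact p.ord_mem

theorem morphAt_splitInv {v : ModelPoint (n + (r + r)) k (affMap (affMap 0 B' b) D' ⁻¹' P)}
    (hX : IsModeled (model (n + (r + r)) k (affMap (affMap 0 B' b) D' ⁻¹' P)) v)
    (hv : ∀ i, coeffPart v.x i ≠ 0) :
    MorphAt (X := model (n + (r + r)) k (affMap (affMap 0 B' b) D' ⁻¹' P)) (Y := model n m P)
      (splitInv q B' D' b) v := by
  refine morphAt_mkPoint (X := model (n + (r + r)) k (affMap (affMap 0 B' b) D' ⁻¹' P)) (p := v)
    q hX (fun i => v.smAt_x _) (fun i => ?_) (Eventually.of_forall fun p => p.ord_mem)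
  have h2 := (SmAt.explAt_prod hX (smAt_coeffPart hX v.smAt_x) hv (B' i)).mul
    (ExplAt.monomial one_ne_zero (affMap 0 B' b i) (D' i) v.explAt_z)
  refine h2.congr (Eventually.of_forall fun p => ?_)
  exact (monomial_eq_mul _ _ _ _).symm

/-- The chart given by a decomposition of the lattice of exponents. -/
def splitChart (hP : IsPolytope P) (hP' : IsPolytope (affMap (affMap 0 B' b) D' ⁻¹' P))
    (h1 : B' * B + D' * D = 1) (hBB : B * B' = 1) (hDD : D * D' = 1)
    (hBD : B * D' = 0) (hDB : D * B' = 0) (hq : smoothMonomial g q.pt ≠ 0)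
    (hface : ∀ p : ModelPoint n m P, smoothMonomial g p.pt ≠ 0 → affMap 0 B p.ord = b)
    (hg : ∀ y, affine g.a g.α (affMap (affMap 0 B' b) D' y) = 0) :
    Chart (model n m P) q (model (n + (r + r)) k (affMap (affMap 0 B' b) D' ⁻¹' P)) where
  U := ⟨{p | smoothMonomial g (ModelPoint.pt p) ≠ 0},
    isOpen_ne_fun (ModelPoint.continuous_smoothMonomial g) continuous_const⟩
  V := ⟨{v | ∀ i, coeffPart (ModelPoint.x v) i ≠ 0}, isOpen_coeffPart_ne_zero⟩
  map := splitMap B D B' D' d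
  symm := splitInv q B' D' b
  mem := hq
  map_mem p hp i := by
    rw [splitMap_eq B D B' D' d h1 (hface p hp), coeffPart_joinCoeff]
    exact monMap_coeff_ne_zero (fun _ => one_ne_zero) _ _ (ModelPoint.pt p).coeff_ne_zero i
  symm_mem v hv := by
    show smoothMonomial g (ModelPoint.pt (splitInv q B' D' b v)) ≠ 0
    rw [splitInv_eq q B' D' hv]
    exact (ModelPoint.smoothMonomial_ne_zero_iff g _).2 (hg _)
  left p hp := splitInv_splitMap q B D B' D' d h1 (hface p hp)
  right v hv := splitMap_splitInv q B D B' D' d h1 hBB hDD hBD hDB hv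
    (hface (splitInv q B' D' b v) (by
      rw [splitInv_eq q B' D' hv]
      exact (ModelPoint.smoothMonomial_ne_zero_iff g _).2 (hg _)))
  morph_map p hp := morphAt_splitMap p B D B' D' d (isModeled_model hP p) h1 <|
    mem_of_superset ((isOpen_ne_fun (ModelPoint.continuous_smoothMonomial g)
      continuous_const).mem_nhds hp) hface
  morph_symm v hv := morphAt_splitInv q B' D' (isModeled_model hP' v) hv

end

/-- Split the exponents along the lattice spanned by the inequalities active at `q`. Where the face
monomial is nonzero, the monomials in the saturation of this lattice have fixed order, and their
nonzero coefficients become `2r` real coordinates. In the remaining exploded coordinates the active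
inequalities are identically zero, so `q` is no longer on the boundary. -/
theorem exists_centered_chart_model {n m : ℕ} {s s' : Finset (ℝ × (Fin m → ℤ))}
    (hP : IsPolytope (polyhedron s s')) (q : ModelPoint n m (polyhedron s s')) :
    ∃ (n' k : ℕ) (P' : Set (Fin k → ℝ)) (κ : Chart (model n m (polyhedron s s')) q (model n' k P')),
      IsPolytope P' ∧ (ModelPoint.ord (κ.map q)) ∈ interior P' := by
  classical
  obtain ⟨r, k, B, D, B', D', h1, hBB, hDD, hBD, hDB, hD', hB⟩ := exists_lattice_splitting
    (Submodule.span ℤ {α | ∃ c ∈ s, affine c.1 c.2 q.ord = 0 ∧ c.2 = α})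
  let b : Fin r → ℝ := affMap 0 B q.ord
  let a : Fin m → ℝ := affMap 0 B' b
  let g := faceExponent s s' q.ord
  have hface : ∀ q' : ModelPoint n m (polyhedron s s'), smoothMonomial g q'.pt ≠ 0 →
      affMap 0 B q'.ord = b := by
    intro q' hq'
    have h2 := eq_zero_of_affine_faceExponent q'.ord_mem.1
      ((ModelPoint.smoothMonomial_ne_zero_iff g q').1 hq').le
    funext i
    obtain ⟨c, hc0, hc⟩ := hB i
    have h3 := linForm_eq_of_mem_span (x := q'.ord) (y := q.ord) (by
      rintro _ ⟨c, hc, hc0, rfl⟩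
      have h4 := h2 c hc hc0
      rw [affine_eq] at h4 hc0
      linarith) hc
    have key : ∀ z, linForm (c • B i) z = c * linForm (B i) z := fun z => by
      simp [linForm_apply, Finset.mul_sum, mul_assoc]
    rw [key, key] at h3
    have h5 := mul_left_cancel₀ (Int.cast_ne_zero.2 hc0) h3
    simp only [b, affMap, affine_eq, h5]
  have hsplit : affMap a D' (affMap 0 D q.ord) = q.ord := by
    have := affMap_split B' B D' D q.ord
    rw [h1, affMap_zero_one] at this
    exact this
  have hact : ∀ c ∈ s, affine c.1 c.2 q.ord = 0 → ∀ y, affine c.1 c.2 (affMap a D' y) = 0 := by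
    intro c hc hc0 y
    have h2 : ∀ y, affine c.1 c.2 (affMap a D' y) = affine c.1 c.2 a := fun y => by
      rw [affine_affMap, hD' c.2 (Submodule.subset_span ⟨c, hc, hc0, rfl⟩)]
      simp [affine]
    rw [h2, ← h2 (affMap 0 D q.ord), hsplit, hc0]
  have hgv : ∀ y, affine g.a g.α (affMap a D' y) = 0 := fun y => by
    rw [affine_faceExponent]
    exact Finset.sum_eq_zero fun c hc =>
      hact c (Finset.mem_filter.1 hc).1 (Finset.mem_filter.1 hc).2 y
  have hint : affMap 0 D q.ord ∈ interior (affMap a D' ⁻¹' polyhedron s s') := by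
    have h2 : affMap 0 D q.ord ∈ affMap a D' ⁻¹' polyhedron s s' := by
      rw [Set.mem_preimage, hsplit]
      exact q.ord_mem
    rw [preimage_polyhedron a D' s s'] at h2 ⊢
    refine mem_interior_polyhedron h2 fun c hc hc0 y => ?_
    obtain ⟨c, hcs, rfl⟩ := Finset.mem_image.1 hc
    simp only [pullIneq, ← affine_affMap] at hc0 ⊢
    rw [hsplit] at hc0
    exact (hact c hcs hc0 y).ge
  have hP' : IsPolytope (affMap a D' ⁻¹' polyhedron s s') :=
    ⟨⟨_, hint⟩, _, _, preimage_polyhedron a D' s s'⟩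
  let d : ModelPoint (n + (r + r)) k (affMap a D' ⁻¹' polyhedron s s') :=
    ⟨0, ⟨monMap (fun _ => 1) 0 D q.pt.z,
      monMap_coeff_ne_zero (fun _ => one_ne_zero) _ _ q.pt.coeff_ne_zero, interior_subset hint⟩⟩
  have hq : smoothMonomial g q.pt ≠ 0 :=
    (ModelPoint.smoothMonomial_ne_zero_iff g q).2 (affine_faceExponent_self s s' q.ord)
  refine ⟨_, k, _, splitChart q g B D B' D' d hP hP' h1 hBB hDD hBD hDB hq hface hgv, hP', ?_⟩
  have : ModelPoint.ord (splitMap B D B' D' d q) = affMap 0 D q.ord := by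
    rw [splitMap_eq B D B' D' d h1 (hface q hq)]
    rfl
  rw [← this] at hint
  exact hint

theorem IsModeled.exists_centered_chart {X : Space.{u}} {p : X} (hX : IsModeled X p) :
    ∃ (n m : ℕ) (P : Set (Fin m → ℝ)) (κ : Chart X p (model n m P)),
      IsPolytope P ∧ ModelPoint.ord (κ.map p) ∈ interior P := by
  obtain ⟨n, m, P, hP, ⟨κ⟩⟩ := hX
  obtain ⟨-, s, s', rfl⟩ := id hP
  obtain ⟨n', k, P', μ, hP', hμ⟩ := exists_centered_chart_model hP (κ.map p)
  exact ⟨n', k, P', κ.trans μ, hP', hμ⟩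

/-! ### Hadamard's lemma -/

theorem exists_hadamard {E : Type} [NormedAddCommGroup E] [NormedSpace ℝ E]
    [FiniteDimensional ℝ E] {F : E → ℝ} (hF : ContDiff ℝ ∞ F) (y₀ : E) :
    ∃ G : E → E →L[ℝ] ℝ, ContDiff ℝ ∞ G ∧ G y₀ = fderiv ℝ F y₀ ∧
      ∀ y, F y = F y₀ + G y (y - y₀) := by
  -- `G` is the average of the derivative of `F` over the segment from `y₀` to `y`. To get
  -- smoothness in `y`, the integral is written as the value at `0` of a convolution of the
  -- indicator of `(0,1]` with a family of functions; the cutoff, equal to `1` on `[-2,2]`, gives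
  -- them compact support.
  let χ : ContDiffBump (0 : ℝ) := ⟨2, 3, by norm_num, by norm_num⟩
  let D : E → E →L[ℝ] ℝ := fderiv ℝ F
  have hD : ContDiff ℝ ∞ D := hF.fderiv_right le_rfl
  let f : ℝ → ℝ := (Set.Ioc (0 : ℝ) 1).indicator fun _ => 1
  let g : E → ℝ → E →L[ℝ] ℝ := fun y u => χ u • D (y₀ + (-u) • (y - y₀))
  have hg : ContDiff ℝ ∞ (fun p : E × ℝ => g p.1 p.2) := by
    refine (χ.contDiff.comp contDiff_snd).smul (hD.comp ?_)
    fun_prop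
  have hf : MeasureTheory.LocallyIntegrable f MeasureTheory.volume :=
    (MeasureTheory.locallyIntegrable_const (1 : ℝ)).indicator measurableSet_Ioc
  have key := MeasureTheory.contDiffOn_convolution_right_with_param (𝕜 := ℝ) (n := (⊤ : ℕ∞)) (f := f)
    (μ := MeasureTheory.volume) (ContinuousLinearMap.lsmul ℝ ℝ) (g := g) (s := Set.univ)
    (k := Metric.closedBall 0 3) isOpen_univ (isCompact_closedBall _ _) (by
      intro y u _ hu
      have : χ u = 0 := by
        apply χ.zero_of_le_dist
        simpa using (not_le.1 fun h => hu (by simpa using h)).le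
      simp [g, this]) hf hg.contDiffOn
  have hG : ContDiff ℝ ∞ fun y : E => ∫ t in (0 : ℝ)..1, D (y₀ + t • (y - y₀)) := by
    rw [Set.univ_prod_univ, contDiffOn_univ] at key
    have h1 := key.comp (contDiff_id.prodMk (contDiff_const (c := (0 : ℝ))) : ContDiff ℝ ∞ fun y : E => (y, (0 : ℝ)))
    convert h1 using 1
    funext y
    simp only [Function.comp_apply, MeasureTheory.convolution]
    rw [intervalIntegral.integral_of_le zero_le_one, ← MeasureTheory.integral_indicator measurableSet_Ioc]
    refine MeasureTheory.integral_congr_ae (Eventually.of_forall fun t => ?_)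
    by_cases ht : t ∈ Set.Ioc (0 : ℝ) 1
    · have h2 : χ (0 - t) = 1 := by
        apply χ.one_of_mem_closedBall
        have : |t| ≤ 2 := by rw [abs_of_pos ht.1]; linarith [ht.2]
        simpa [χ] using this
      have h2' : χ (-t) = 1 := by simpa using h2
      simp [f, g, ht, h2']
    · simp [f, ht]
  refine ⟨_, hG, ?_, fun y => ?_⟩
  · simp [D]
  · have hline : ∀ t : ℝ, HasDerivAt (fun t : ℝ => F (y₀ + t • (y - y₀)))
        (D (y₀ + t • (y - y₀)) (y - y₀)) t := fun t => by
      have h1 : HasDerivAt (fun t : ℝ => y₀ + t • (y - y₀)) (y - y₀) t := by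
        simpa using ((hasDerivAt_id t).smul_const (y - y₀)).const_add y₀
      exact ((hF.differentiable (by simp)) _).hasFDerivAt.comp_hasDerivAt t h1
    have hcont : Continuous fun t : ℝ => D (y₀ + t • (y - y₀)) :=
      hD.continuous.comp (by fun_prop)
    have h2 := intervalIntegral.integral_eq_sub_of_hasDerivAt (a := 0) (b := 1)
      (fun t _ => hline t) ((hcont.clm_apply continuous_const).intervalIntegrable _ _)
    rw [ContinuousLinearMap.intervalIntegral_apply (hcont.intervalIntegrable _ _), h2]
    simp

/-! ### Points over the interior of a polytope -/

/-- An interior zero is a minimum, so no coordinate direction can have a slope. -/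
theorem eq_zero_of_interior {m : ℕ} {P : Set (Fin m → ℝ)} {a : ℝ} {α : Fin m → ℤ}
    (h : ∀ y ∈ P, 0 ≤ affine a α y) {y : Fin m → ℝ} (hy : y ∈ interior P)
    (h0 : affine a α y = 0) : a = 0 ∧ α = 0 := by
  classical
  have h1 : ∀ i, α i = 0 := by
    intro i
    have hc : Continuous fun t : ℝ => y + t • (Pi.single i 1 : Fin m → ℝ) := by fun_prop
    have h2 : ∀ᶠ t : ℝ in 𝓝 0, y + t • (Pi.single i 1 : Fin m → ℝ) ∈ P := by
      have := hc.tendsto 0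
      rw [zero_smul, add_zero] at this
      exact this.eventually (mem_interior_iff_mem_nhds.1 hy)
    obtain ⟨ε, hε, hball⟩ := Metric.eventually_nhds_iff.1 h2
    have val : ∀ t : ℝ, affine a α (y + t • (Pi.single i 1 : Fin m → ℝ)) = t * α i := fun t => by
      rw [affine_eq, map_add, map_smul, ← add_assoc, ← affine_eq, h0, zero_add, linForm_apply]
      simp [Pi.single_apply]
    have hp := h _ (hball (y := ε / 2) (by simp [abs_of_pos hε]; linarith))
    have hm := h _ (hball (y := -(ε / 2)) (by simp [abs_of_pos hε]; linarith))
    rw [val] at hp hm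
    have : (α i : ℝ) = 0 := by nlinarith
    exact_mod_cast this
  have h2 : α = 0 := funext h1
  exact ⟨by simpa [h2, affine] using h0, h2⟩

namespace ModelPoint

variable {n m : ℕ} {P : Set (Fin m → ℝ)}

theorem smoothMonomial_of_interior (e : SmoothExponent P) {q : ModelPoint n m P}
    (hq : q.ord ∈ interior P) :
    smoothMonomial e q.pt = open Classical in if e.a = 0 ∧ e.α = 0 then 1 else 0 := by
  rw [smoothMonomial_eq]
  by_cases h : affine e.a e.α q.ord = 0
  · have := eq_zero_of_interior e.nonneg hq h
    rw [if_pos h, if_pos this, this.2]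
    simp
  · rw [if_neg h, if_neg]
    rintro ⟨h1, h2⟩
    exact h (by rw [h1, h2]; simp [affine])

/-- Over the interior the smooth monomials take only the values `0` and `1`, independently of the
point, so the topology sees nothing but the real coordinates. -/
theorem inseparable_of_interior {q q' : ModelPoint n m P} (hq : q.ord ∈ interior P)
    (hq' : q'.ord ∈ interior P) (hx : q.x = q'.x) : Inseparable q q' :=
  inseparable_iff.2 ⟨hx, fun e => by
    rw [smoothMonomial_of_interior e hq, smoothMonomial_of_interior e hq']⟩

end ModelPoint

/-! ### Germs of smooth and of exploded tropical functions -/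

theorem Number.mk_add_mk (c c' : ℂ) (o : ℝ) : (⟨c, o⟩ : Number) + ⟨c', o⟩ = ⟨c + c', o⟩ :=
  Number.add_of_eq rfl

theorem explAt_realLine_iff {x : ℝ} {h : ℝ → Number} : ExplAt realLine x h ↔
    (h x).coeff ≠ 0 ∧ (∀ᶠ y in 𝓝 x, ContDiffAt ℝ ∞ (fun y => (h y).coeff) y) ∧
      ∀ᶠ y in 𝓝 x, (h y).order = (h x).order := by
  constructor
  · rintro ⟨U, hU, H⟩
    exact ⟨(H x hU).1, mem_of_superset (U.isOpen.mem_nhds hU) fun y hy => (H y hy).2.1,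
      (H x hU).2.2⟩
  · rintro ⟨h0, h1, h2⟩
    have h3 : ∀ᶠ y in 𝓝 x, (h y).coeff ≠ 0 :=
      h1.self_of_nhds.continuousAt.eventually_ne h0
    obtain ⟨U, hU, hUo, hxU⟩ := mem_nhds_iff.1 (h1.and (h2.and h3))
    refine ⟨⟨U, hUo⟩, hxU, fun y hy => ⟨(hU hy).2.2, (hU hy).1, ?_⟩⟩
    filter_upwards [hUo.mem_nhds hy] with y' hy'
    rw [(hU hy').2.1, (hU hy).2.1]

theorem morphAt_realLine {X : Space.{u}} {p : X} (hX : IsModeled X p) {f : X → ℝ}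
    (hf : SmAt X p fun x => (f x : ℂ)) : MorphAt (Y := realLine) f p := by
  have hc : ContinuousAt f p :=
    (Complex.continuous_re.continuousAt (x := (f p : ℂ))).comp (f := fun x => (f x : ℂ))
      (hf.continuousAt hX)
  refine ⟨hc, fun h hh => ?_⟩
  obtain ⟨h0, h1, h2⟩ := explAt_realLine_iff.1 hh
  have h3 : SmAt X p fun x => (h (f x)).coeff := by
    refine hf.comp₁ hX (H := fun y => (h y.re).coeff) ?_
    have h4 : Tendsto Complex.re (𝓝 (f p : ℂ)) (𝓝 (f p)) := by
      simpa using Complex.continuous_re.tendsto (f p : ℂ)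
    filter_upwards [h4.eventually h1] with y hy
    exact ContDiffAt.comp (g := fun x : ℝ => (h x).coeff) y hy Complex.reCLM.contDiff.contDiffAt
  refine ((ExplAt.const X p (c := ⟨1, (h (f p)).order⟩) one_ne_zero).mul
    (h3.explAt hX h0)).congr ?_
  filter_upwards [hc.eventually h2] with x hx
  ext1 <;> simp [hx]

theorem ofReal_add_I_ne_zero (y : ℝ) : (y : ℂ) + Complex.I ≠ 0 := fun h => by
  simpa using congrArg Complex.im h

/-- Adding `i` to the coordinate of the real line gives a function without zeros, hence an exploded
function that can be pulled back. -/
theorem smAt_of_isSmooth {X : Space.{u}} {U : Opens X} {f : X → ℝ} (h : X.IsSmooth U f) {q : X}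
    (hq : q ∈ U) : SmAt X q fun x => (f x : ℂ) := by
  obtain ⟨φ, hφ⟩ := h
  have h1 : ExplAt realLine (φ ⟨q, hq⟩) fun y : ℝ => ⟨(y : ℂ) + Complex.I, 0⟩ := by
    refine explAt_realLine_iff.2 ⟨fun h => ?_, Eventually.of_forall fun y => ?_, by simp⟩
    · exact ofReal_add_I_ne_zero _ h
    · exact (Complex.ofRealCLM.contDiff.add contDiff_const).contDiffAt
  exact ⟨Complex.I, (explAt_onOpen hq fun x hx => by rw [hφ]).1 ((φ.morphAt ⟨q, hq⟩).2 _ h1)⟩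

theorem isSmooth_iff {X : Space.{u}} (hX : ∀ q, IsModeled X q) {U : Opens X} {f : X → ℝ} :
    X.IsSmooth U f ↔ ∀ q ∈ U, SmAt X q fun x => (f x : ℂ) := by
  refine ⟨fun h q hq => smAt_of_isSmooth h hq, fun h => ?_⟩
  refine ⟨Hom.ofMorphAt (X := X.onOpen U) (Y := realLine) (fun x : U => f x) ?_, fun x => rfl⟩
  rintro ⟨q, hq⟩
  have h1 := morphAt_realLine (hX q) (h q hq)
  exact ⟨h1.1.comp (f := Subtype.val) continuous_subtype_val.continuousAt,
    fun g hg => (explAt_onOpen hq fun x hx => rfl).2 (h1.2 g hg)⟩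

theorem exists_isSmooth {X : Space.{u}} (hX : ∀ q, IsModeled X q) {p : X} {f : X → ℝ}
    (hf : SmAt X p fun x => (f x : ℂ)) : ∃ U : Opens X, p ∈ U ∧ X.IsSmooth U f := by
  obtain ⟨U, hU, hUo, hpU⟩ := mem_nhds_iff.1 hf.eventually
  exact ⟨⟨U, hUo⟩, hpU, (isSmooth_iff hX).2 fun q hq => hU hq⟩

/-- `f` is an exploded tropical function near `p`. -/
def TropAt (X : Space.{u}) (p : X) (f : X → Number) : Prop := ∃ U : Opens X, p ∈ U ∧ X.IsTropical U f

theorem tropAt_of_mem_closure {X : Space.{u}} {p : X} {f g : X → Number} {V : Opens X} (hp : p ∈ V)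
    (hg : g ∈ AddSubsemigroup.closure {g : X → Number | X.IsExploded V g})
    (e : ∀ y ∈ V, f y = g y) : TropAt X p f :=
  ⟨V, hp, fun _ hx => ⟨V, hx, le_rfl, g, hg, e⟩⟩

theorem ExplAt.tropAt {X : Space.{u}} {p : X} {h : X → Number} (hh : ExplAt X p h) :
    TropAt X p h := by
  obtain ⟨U, hU, H⟩ := hh
  exact tropAt_of_mem_closure hU (AddSubsemigroup.subset_closure H) fun _ _ => rfl

theorem ExplAt.tropAt_add {X : Space.{u}} {p : X} {f g : X → Number} (hf : ExplAt X p f)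
    (hg : ExplAt X p g) : TropAt X p fun x => f x + g x := by
  obtain ⟨U, hU, H⟩ := hf
  obtain ⟨V, hV, H'⟩ := hg
  exact tropAt_of_mem_closure (V := U ⊓ V) ⟨hU, hV⟩
    (AddSubsemigroup.add_mem _ (AddSubsemigroup.subset_closure (X.restrict inf_le_left H))
      (AddSubsemigroup.subset_closure (X.restrict inf_le_right H'))) fun _ _ => rfl

/-- A smooth function with zeros is not exploded, but it is the sum of the exploded functions `f +
c` and `-c`. -/
theorem SmAt.tropAt {X : Space.{u}} {p : X} {f : X → ℂ} (hf : SmAt X p f) :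
    TropAt X p fun x => ⟨f x, 0⟩ := by
  obtain ⟨c, hc⟩ := hf
  by_cases h0 : c = 0
  · subst h0
    simpa using hc.tropAt
  · have := hc.tropAt_add (ExplAt.const X p (c := ⟨-c, 0⟩) (neg_ne_zero.2 h0))
    convert this using 2 with x
    rw [Number.mk_add_mk]
    simp

/-! ### Derivations of exploded functions and their logarithmic derivatives. -/

namespace TangentVector

variable {X : Space.{u}} {p : X} (v : TangentVector X p)

open Classical in
/-- The derivative of a smooth function. -/
def dS (f : X → ℝ) : ℝ := if h : ∃ U : Opens X, p ∈ U ∧ X.IsSmooth U f then v.onSmooth ⟨f, h⟩ else 0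

open Classical in
/-- The derivative of an exploded tropical function. -/
def dT (f : X → Number) : Number := if h : TropAt X p f then v.onTropical ⟨f, h⟩ else ⟨0, 0⟩

/-- The logarithmic derivative of an exploded function. -/
def dlog (f : X → Number) : ℂ := (v.dT f).coeff / (f p).coeff

theorem dT_eq (f : TropicalAt X p) : v.dT f.fn = v.onTropical f := dif_pos f.tropical

theorem dS_eq (f : SmoothAt X p) : v.dS f.fn = v.onSmooth f := dif_pos f.smooth

variable {v}

theorem dT_congr {f g : X → Number} (hf : TropAt X p f) (hg : TropAt X p g) (e : f =ᶠ[𝓝 p] g) :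
    v.dT f = v.dT g := by
  rw [dT, dT, dif_pos hf, dif_pos hg]
  exact v.tropical_germ _ _ e

theorem dT_mul {f g : X → Number} (hf : TropAt X p f) (hg : TropAt X p g)
    (hfg : TropAt X p fun x => f x * g x) :
    v.dT (fun x => f x * g x) = v.dT f * g p + f p * v.dT g := by
  rw [dT, dT, dT, dif_pos hf, dif_pos hg, dif_pos hfg]
  exact v.tropical_mul ⟨f, hf⟩ ⟨g, hg⟩ _ fun _ => rfl

theorem dT_add {f g : X → Number} (hf : TropAt X p f) (hg : TropAt X p g)
    (hfg : TropAt X p fun x => f x + g x) :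
    v.dT (fun x => f x + g x) = v.dT f + v.dT g := by
  rw [dT, dT, dT, dif_pos hf, dif_pos hg, dif_pos hfg]
  exact v.tropical_add ⟨f, hf⟩ ⟨g, hg⟩ _ fun _ => rfl

theorem dT_const_mul (c : Number) {f : X → Number} (hf : TropAt X p f)
    (hcf : TropAt X p fun x => c * f x) : v.dT (fun x => c * f x) = c * v.dT f := by
  rw [dT, dT, dif_pos hf, dif_pos hcf]
  exact v.tropical_const_mul c ⟨f, hf⟩ _ fun _ => rfl

/-- The Leibniz rule only yields that the coefficient is `0`; the exponent comes from compatibility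
with the smooth function `1`. -/
theorem dT_one : v.dT (fun _ => 1) = ⟨0, 0⟩ := by
  have h1 : TropAt X p fun _ => (1 : Number) := (ExplAt.const X p one_ne_zero).tropAt
  have h2 : v.dT (fun _ => 1) = v.dT (fun _ => 1) + v.dT (fun _ => 1) := by
    have := dT_mul (v := v) h1 h1 (by simpa using h1)
    simpa using this
  have h3 : (v.dT fun _ => 1).coeff = 0 := by
    rw [Number.add_of_eq rfl] at h2
    simpa using congrArg Number.coeff h2
  have h4 : ∃ U : Opens X, p ∈ U ∧ X.IsSmooth U fun _ => (1 : ℝ) :=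
    ⟨⊤, trivial, Hom.ofMorphAt (X := X.onOpen ⊤) (Y := realLine) (fun _ => (1 : ℝ))
      (fun q => MorphAt.const (Y := realLine) (1 : ℝ) q), fun _ => rfl⟩
  have h5 := v.compatible ⟨_, h4⟩ ⟨_, h1⟩ fun x => by simp [Number.ofComplex]; rfl
  rw [← dT_eq] at h5
  ext1
  · exact h3
  · simpa [Number.ofComplex] using congrArg Number.order h5

theorem dT_const {c : Number} (hc : c.coeff ≠ 0) : v.dT (fun _ => c) = ⟨0, c.order⟩ := by
  have h1 : TropAt X p fun _ => (1 : Number) := (ExplAt.const X p one_ne_zero).tropAt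
  have h2 := dT_const_mul (v := v) c h1 (by simpa using (ExplAt.const X p hc).tropAt)
  rw [dT_one] at h2
  simp only [mul_one] at h2
  rw [h2]
  ext1 <;> simp

/-- The zero function `0 t^0` is tropical, being `1 + (-1)`. Differentiating `0 t^0 * g` both as a
constant multiple and as a product compares the order of `v g` with a minimum that involves `g p`,
which bounds it above. The lower bound comes from the Leibniz rule for `h * h⁻¹`. -/
theorem dT_order {h : X → Number} (hh : ExplAt X p h) : (v.dT h).order = (h p).order := by
  have hm1 : ((⟨-1, 0⟩ : Number).coeff) ≠ 0 := by simp
  have key : ∀ {g : X → Number}, ExplAt X p g → (v.dT g).order ≤ (g p).order := fun {g} hg => by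
    have e1 : (fun x : X => (⟨0, 0⟩ : Number)) = fun _ => (1 : Number) + ⟨-1, 0⟩ := by
      funext x
      exact (by rw [Number.mk_add_mk]; simp : (⟨0, 0⟩ : Number) = ⟨1, 0⟩ + ⟨-1, 0⟩)
    have e2 : (fun x => (⟨0, 0⟩ : Number) * g x) = fun x => g x + ⟨-1, 0⟩ * g x := by
      funext x
      rw [Number.add_of_eq (by simp)]
      ext1 <;> simp
    have t1 : TropAt X p fun _ => (⟨0, 0⟩ : Number) := by
      rw [e1]
      exact (ExplAt.const X p one_ne_zero).tropAt_add (ExplAt.const X p hm1)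
    have t2 : TropAt X p fun x => (⟨0, 0⟩ : Number) * g x := by
      rw [e2]
      exact hg.tropAt_add ((ExplAt.const X p hm1).mul hg)
    have h1 := dT_const_mul (v := v) _ hg.tropAt t2
    rw [dT_mul t1 hg.tropAt t2] at h1
    have h2 := congrArg Number.order h1
    have h3 := dT_const_mul (v := v) (⟨0, 0⟩ : Number)
      (ExplAt.const X p (c := 1) one_ne_zero).tropAt (by simpa using t1)
    simp only [mul_one, dT_one] at h3
    rw [h3, Number.add_order] at h2
    simp only [Number.mul_order, zero_add] at h2
    linarith [min_le_left (0 + (g p).order) (v.dT g).order, min_eq_right_iff.1 h2]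
  refine le_antisymm (key hh) ?_
  have h1 := dT_mul (v := v) hh.tropAt hh.inv.tropAt (hh.mul hh.inv).tropAt
  have h2 : v.dT (fun x => h x * (h x)⁻¹) = ⟨0, 0⟩ := by
    rw [← dT_one (v := v)]
    refine dT_congr (hh.mul hh.inv).tropAt (ExplAt.const X p one_ne_zero).tropAt ?_
    filter_upwards [hh.eventually] with x hx
    ext1
    · simp [hx.coeff_ne_zero]
    · simp
  rw [h2] at h1
  have h3 := congrArg Number.order h1
  rw [Number.add_order] at h3
  simp only [Number.mul_order, Number.inv_order] at h3
  have := min_le_left ((v.dT h).order + -(h p).order) ((h p).order + (v.dT fun x => (h x)⁻¹).order)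
  linarith

theorem dT_explAt {h : X → Number} (hh : ExplAt X p h) :
    v.dT h = ⟨v.dlog h * (h p).coeff, (h p).order⟩ := by
  ext1
  · simp [dlog, hh.coeff_ne_zero]
  · exact dT_order hh

theorem dlog_congr {f g : X → Number} (hf : ExplAt X p f) (e : f =ᶠ[𝓝 p] g) :
    v.dlog f = v.dlog g := by
  rw [dlog, dlog, dT_congr hf.tropAt (hf.congr e).tropAt e, e.eq_of_nhds]

theorem dlog_mul {f g : X → Number} (hf : ExplAt X p f) (hg : ExplAt X p g) :
    v.dlog (fun x => f x * g x) = v.dlog f + v.dlog g := by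
  rw [dlog, dT_mul hf.tropAt hg.tropAt (hf.mul hg).tropAt, dT_explAt hf, dT_explAt hg,
    Number.add_of_eq (by simp)]
  have := hf.coeff_ne_zero
  have := hg.coeff_ne_zero
  simp only [Number.mul_coeff]
  field_simp

theorem dlog_const {c : Number} (hc : c.coeff ≠ 0) : v.dlog (fun _ => c) = 0 := by
  simp [dlog, dT_const hc]

theorem dlog_inv {f : X → Number} (hf : ExplAt X p f) :
    v.dlog (fun x => (f x)⁻¹) = -v.dlog f := by
  have h1 := dlog_mul (v := v) hf hf.inv
  rw [dlog_congr (g := fun _ => 1) (hf.mul hf.inv), dlog_const one_ne_zero] at h1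
  · linear_combination -h1
  · filter_upwards [hf.eventually] with x hx
    ext1
    · simp [hx.coeff_ne_zero]
    · simp

theorem dlog_pow {f : X → Number} (hf : ExplAt X p f) (n : ℕ) :
    v.dlog (fun x => f x ^ n) = n * v.dlog f := by
  induction n with
  | zero => simpa using dlog_const (v := v) (c := 1) one_ne_zero
  | succ n ih =>
    simp only [pow_succ, dlog_mul (hf.pow n) hf, ih]
    push_cast
    ring

theorem dlog_zpow {f : X → Number} (hf : ExplAt X p f) (n : ℤ) :
    v.dlog (fun x => f x ^ n) = n * v.dlog f := by
  cases n with
  | ofNat n => simpa using dlog_pow hf n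
  | negSucc n =>
    simp only [zpow_negSucc, dlog_inv (hf.pow (n + 1)), dlog_pow hf, Int.cast_negSucc]
    ring

theorem dlog_prod {ι : Type*} (s : Finset ι) {f : ι → X → Number}
    (hf : ∀ i ∈ s, ExplAt X p (f i)) :
    v.dlog (fun x => ∏ i ∈ s, f i x) = ∑ i ∈ s, v.dlog (f i) := by
  classical
  induction s using Finset.induction_on with
  | empty => simpa using dlog_const (v := v) (c := 1) one_ne_zero
  | insert a s h ih =>
    simp only [Finset.prod_insert h, Finset.sum_insert h]
    rw [dlog_mul (hf a (by simp)) (ExplAt.prod _ fun i hi => hf i (by simp [hi])),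
      ih fun i hi => hf i (by simp [hi])]

theorem dlog_monomial {m : ℕ} (a : ℝ) (α : Fin m → ℤ) {f : X → Number} (hf : ExplAt X p f)
    {z : Fin m → X → Number} (hz : ∀ i, ExplAt X p (z i)) :
    v.dlog (fun x => f x * monomial 1 a α fun i => z i x) =
      v.dlog f + ∑ i, (α i : ℂ) * v.dlog (z i) := by
  have h1 : ∀ i ∈ Finset.univ, ExplAt X p fun x => z i x ^ α i := fun i _ => (hz i).zpow _
  rw [dlog_mul hf (ExplAt.monomial one_ne_zero a α hz)]
  simp only [monomial_eq]
  rw [dlog_mul (ExplAt.const X p (c := ⟨1, a⟩) one_ne_zero) (ExplAt.prod _ h1),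
    dlog_const (c := ⟨1, a⟩) one_ne_zero, dlog_prod _ h1]
  simp only [dlog_zpow (hz _), zero_add]

end TangentVector

/-! ### Derivatives of smooth functions on a manifold. -/

namespace TangentVector

variable {X : Manifold.{u}} {p : X} {v : TangentVector X.toSpace p}

theorem dS_congr {f g : X → ℝ} (hf : SmAt X.toSpace p fun x => (f x : ℂ)) (e : f =ᶠ[𝓝 p] g) :
    v.dS f = v.dS g := by
  have h1 := exists_isSmooth X.isModeled hf
  have h2 := exists_isSmooth X.isModeled (hf.congr (g := fun x => (g x : ℂ)) (by
    filter_upwards [e] with x hx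
    rw [hx]))
  rw [dS, dS, dif_pos h1, dif_pos h2]
  exact v.smooth_germ _ _ e

theorem dS_add {f g : X → ℝ} (hf : SmAt X.toSpace p fun x => (f x : ℂ))
    (hg : SmAt X.toSpace p fun x => (g x : ℂ)) : v.dS (fun x => f x + g x) = v.dS f + v.dS g := by
  have h1 := exists_isSmooth X.isModeled hf
  have h2 := exists_isSmooth X.isModeled hg
  have h3 : ∃ U : Opens X.toSpace, p ∈ U ∧ X.IsSmooth U fun x => f x + g x :=
    exists_isSmooth X.isModeled (by simpa using hf.add (X.isModeled p) hg)
  rw [dS, dS, dS, dif_pos h1, dif_pos h2, dif_pos h3]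
  exact v.smooth_add ⟨f, h1⟩ ⟨g, h2⟩ _ fun _ => rfl

theorem dS_mul {f g : X → ℝ} (hf : SmAt X.toSpace p fun x => (f x : ℂ))
    (hg : SmAt X.toSpace p fun x => (g x : ℂ)) :
    v.dS (fun x => f x * g x) = v.dS f * g p + f p * v.dS g := by
  have h1 := exists_isSmooth X.isModeled hf
  have h2 := exists_isSmooth X.isModeled hg
  have h3 : ∃ U : Opens X.toSpace, p ∈ U ∧ X.IsSmooth U fun x => f x * g x :=
    exists_isSmooth X.isModeled (by simpa using hf.mul (X.isModeled p) hg)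
  rw [dS, dS, dS, dif_pos h1, dif_pos h2, dif_pos h3]
  exact v.smooth_mul ⟨f, h1⟩ ⟨g, h2⟩ _ fun _ => rfl

theorem dT_ofReal {f : X → ℝ} (hf : SmAt X.toSpace p fun x => (f x : ℂ)) :
    v.dT (fun x => ⟨(f x : ℂ), 0⟩) = ⟨v.dS f, 0⟩ := by
  have h1 := exists_isSmooth X.isModeled hf
  rw [dS, dif_pos h1, dT, dif_pos hf.tropAt]
  exact v.compatible ⟨f, h1⟩ _ fun _ => rfl

theorem dS_const (c : ℝ) : v.dS (fun _ => c) = 0 := by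
  have h1 := dT_ofReal (v := v) (f := fun _ => c) (SmAt.const _ _ _)
  by_cases hc : (c : ℂ) = 0
  · have h2 : v.dS (fun _ => c) = v.dS (fun _ => c) + v.dS (fun _ => c) := by
      rw [← dS_add (SmAt.const _ _ _) (SmAt.const _ _ _)]
      simp [Complex.ofReal_eq_zero.1 hc]
    linarith
  · rw [dT_const (c := ⟨c, 0⟩) hc] at h1
    simpa using (congrArg Number.coeff h1).symm

theorem dS_sum {ι : Type*} (s : Finset ι) {f : ι → X → ℝ}
    (hf : ∀ i ∈ s, SmAt X.toSpace p fun x => (f i x : ℂ)) :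
    v.dS (fun x => ∑ i ∈ s, f i x) = ∑ i ∈ s, v.dS (f i) ∧
      SmAt X.toSpace p fun x => ((∑ i ∈ s, f i x : ℝ) : ℂ) := by
  classical
  induction s using Finset.induction_on with
  | empty => simpa using ⟨dS_const (v := v) 0, SmAt.const _ _ _⟩
  | insert a s h ih =>
    obtain ⟨h1, h2⟩ := ih fun i hi => hf i (by simp [hi])
    simp only [Finset.sum_insert h]
    exact ⟨by rw [dS_add (hf a (by simp)) h2, h1],
      by simpa using (hf a (by simp)).add (X.isModeled p) h2⟩

theorem dT_smooth {f : X → ℂ} (hf : SmAt X.toSpace p f) :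
    v.dT (fun x => ⟨f x, 0⟩) =
      ⟨v.dS (fun x => (f x).re) + Complex.I * v.dS (fun x => (f x).im), 0⟩ := by
  have hX := X.isModeled p
  have hI : SmAt X.toSpace p fun x => Complex.I * ((f x).im : ℂ) :=
    (SmAt.const X.toSpace p Complex.I).mul hX (hf.im hX)
  have e : (fun x => (⟨f x, 0⟩ : Number)) =
      fun x => ⟨((f x).re : ℂ), 0⟩ + ⟨Complex.I * ((f x).im : ℂ), 0⟩ := by
    funext x
    rw [Number.mk_add_mk, mul_comm, Complex.re_add_im]
  have e' : (fun x => (⟨Complex.I * ((f x).im : ℂ), 0⟩ : Number)) =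
      fun x => ⟨Complex.I, 0⟩ * ⟨((f x).im : ℂ), 0⟩ := by
    funext x
    ext1 <;> simp
  have h1 := dT_add (v := v) (hf.re hX).tropAt hI.tropAt (e ▸ hf.tropAt)
  have h2 := dT_const_mul (v := v) ⟨Complex.I, 0⟩ (hf.im hX).tropAt (e' ▸ hI.tropAt)
  rw [← e, e', h2, dT_ofReal (hf.re hX), dT_ofReal (hf.im hX), Number.add_of_eq (by simp)] at h1
  rw [h1]
  rfl

theorem dlog_smooth {f : X → ℂ} (hf : SmAt X.toSpace p f) :
    v.dlog (fun x => ⟨f x, 0⟩) =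
      (v.dS (fun x => (f x).re) + Complex.I * v.dS (fun x => (f x).im)) / f p := by
  rw [dlog, dT_smooth hf]

end TangentVector

/-! ### Tangent vectors in charts -/

theorem smAt_model_iff_of_isPolytope {n m : ℕ} {P : Set (Fin m → ℝ)} (hP : IsPolytope P)
    {q : ModelPoint n m P} {f : ModelPoint n m P → ℂ} : SmAt (model n m P) q f ↔ SmForm q f := by
  obtain ⟨-, s, s', rfl⟩ := hP
  exact smAt_model_iff

namespace Chart

variable {X : Space.{u}} {p : X} {n m : ℕ} {P : Set (Fin m → ℝ)} (κ : Chart X p (model n m P))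

/-- The real coordinates of a chart. -/
def xc (y : X) : Fin n → ℝ := ModelPoint.x (κ.map y)

/-- The exploded coordinates of a chart. -/
def zc (y : X) : Fin m → Number := (ModelPoint.pt (κ.map y)).z

/-- The tropical part of the coordinates of a chart. -/
def ordc (y : X) : Fin m → ℝ := ModelPoint.ord (κ.map y)

/-- The smooth monomials in the coordinates of a chart. -/
def mon (e : SmoothExponent P) (y : X) : ℂ := smoothMonomial e (ModelPoint.pt (κ.map y))

theorem smAt_xc {y : X} (hy : y ∈ κ.U) (l : Fin n) : SmAt X y fun y => (κ.xc y l : ℂ) :=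
  (κ.morph_map y hy).smAt (ModelPoint.smAt_x _ l)

theorem explAt_zc {y : X} (hy : y ∈ κ.U) (i : Fin m) : ExplAt X y fun y => κ.zc y i :=
  (κ.morph_map y hy).2 _ (ModelPoint.explAt_z _ i)

theorem ordc_mem (y : X) : κ.ordc y ∈ P := ModelPoint.ord_mem _

theorem zc_coeff_ne_zero (y : X) (i : Fin m) : (κ.zc y i).coeff ≠ 0 :=
  (ModelPoint.pt (κ.map y)).coeff_ne_zero i

theorem mon_eq (e : SmoothExponent P) (y : X) : κ.mon e y =
    if affine e.a e.α (κ.ordc y) = 0 then ∏ i, (κ.zc y i).coeff ^ e.α i else 0 :=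
  ModelPoint.smoothMonomial_eq e (κ.map y)

variable {κ}

theorem exists_smooth_form (hP : IsPolytope P) {f : X → ℂ} (hf : SmAt X p f) :
    ∃ (ι : Type) (_ : Fintype ι) (ζ : ι → SmoothExponent P) (F : (Fin n → ℝ) × (ι → ℂ) → ℂ),
      ContDiff ℝ ∞ F ∧ f =ᶠ[𝓝 p] fun y => F (κ.xc y, fun j => κ.mon (ζ j) y) := by
  obtain ⟨ι, hι, ζ, F, hF, e⟩ := (smAt_model_iff_of_isPolytope hP).1 (κ.smAt_symm.2 hf)
  refine ⟨ι, hι, ζ, F, hF, ?_⟩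
  filter_upwards [κ.tendsto_map.eventually e, κ.eventually_left] with y hy hy'
  rw [hy'] at hy
  exact hy

theorem smAt_of_form (hP : IsPolytope P) {ι : Type} [Fintype ι] (ζ : ι → SmoothExponent P)
    {F : (Fin n → ℝ) × (ι → ℂ) → ℂ} (hF : ContDiff ℝ ∞ F) :
    SmAt X p fun y => F (κ.xc y, fun j => κ.mon (ζ j) y) :=
  (κ.morph_map p κ.mem).smAt ((smAt_model_iff_of_isPolytope hP).2 ⟨ι, _, ζ, F, hF, .rfl⟩)

theorem smAt_mon (hP : IsPolytope P) (e : SmoothExponent P) : SmAt X p (κ.mon e) :=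
  (κ.morph_map p κ.mem).smAt ((smAt_model_iff_of_isPolytope hP).2 (SmForm.smoothMonomial _ e))

theorem exists_exploded_form (hP : IsPolytope P) {h : X → Number} (hh : ExplAt X p h) :
    ∃ (f : X → ℂ) (a : ℝ) (α : Fin m → ℤ), SmAt X p f ∧ f p ≠ 0 ∧
      h =ᶠ[𝓝 p] fun y => ⟨f y, 0⟩ * monomial 1 a α (κ.zc y) := by
  obtain ⟨f, a, α, hf, h0, e⟩ := explAt_model_iff.1 (κ.explAt_symm.2 hh)
  refine ⟨fun y => f (κ.map y), a, α,
    (κ.morph_map p κ.mem).smAt ((smAt_model_iff_of_isPolytope hP).2 hf), h0, ?_⟩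
  filter_upwards [κ.tendsto_map.eventually e, κ.eventually_left] with y hy hy'
  rw [hy'] at hy
  rw [hy, monomial_eq_mul]
  rfl

end Chart

namespace TangentVector

variable {X : Manifold.{u}} {p : X} {v w : TangentVector X.toSpace p} {n m : ℕ}
  {P : Set (Fin m → ℝ)} {κ : Chart X.toSpace p (model n m P)}

/-- Adding `1` to an exploded monomial of nonnegative order gives the same function as adding `1` to
its smooth part: where the order is positive, `1` wins in both cases. For a nonconstant monomial the
order at the centered point `p` is positive, so its derivative is absorbed by `v(1) = 0`, and the
derivative of the smooth part vanishes. -/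
theorem dS_mon (hP : IsPolytope P) (hκ : κ.ordc p ∈ interior P) (e : SmoothExponent P) :
    v.dS (fun y => (κ.mon e y).re) = 0 ∧ v.dS (fun y => (κ.mon e y).im) = 0 := by
  have hs := Chart.smAt_mon (κ := κ) hP e
  by_cases h0 : affine e.a e.α (κ.ordc p) = 0
  · obtain ⟨h1, h2⟩ := eq_zero_of_interior e.nonneg hκ h0
    have h3 : ∀ y, κ.mon e y = 1 := fun y => by
      rw [Chart.mon_eq, if_pos (by rw [h1, h2]; simp [affine]), h2]
      simp
    simp only [h3]
    exact ⟨dS_const _, dS_const _⟩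
  · have hpos : 0 < affine e.a e.α (κ.ordc p) := lt_of_le_of_ne (e.nonneg _ (κ.ordc_mem p)) (Ne.symm h0)
    have hX := X.isModeled p
    have hμ : ExplAt X.toSpace p fun y => monomial 1 e.a e.α (κ.zc y) :=
      ExplAt.monomial one_ne_zero _ _ (κ.explAt_zc κ.mem)
    have h1 : (fun y => monomial 1 e.a e.α (κ.zc y) + 1) = fun y => ⟨κ.mon e y + 1, 0⟩ := by
      funext y
      rw [Chart.mon_eq]
      rcases (e.nonneg _ (κ.ordc_mem y)).eq_or_lt with h | h
      · rw [if_pos h.symm, Number.add_of_eq h.symm]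
        ext1
        · simp
        · exact h.symm
      · rw [if_neg h.ne', Number.add_of_gt h]
        ext1 <;> simp
    have h2 : v.dT (fun y => ⟨κ.mon e y + 1, 0⟩) = ⟨0, 0⟩ := by
      rw [← h1, dT_add hμ.tropAt (ExplAt.const _ _ one_ne_zero).tropAt
        (hμ.tropAt_add (ExplAt.const _ _ one_ne_zero)), dT_one, Number.add_of_gt]
      rw [dT_order hμ]
      exact hpos
    rw [dT_smooth (hs.add hX (SmAt.const _ _ 1))] at h2
    have h3 := congrArg Number.coeff h2
    simp only [Complex.add_re, Complex.add_im, Complex.one_re, Complex.one_im, add_zero] at h3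
    have hc : SmAt X.toSpace p fun _ => ((1 : ℝ) : ℂ) := SmAt.const _ _ _
    rw [dS_add (hs.re hX) hc, dS_const, add_zero] at h3
    exact ⟨by simpa using congrArg Complex.re h3, by simpa using congrArg Complex.im h3⟩

/-- Hadamard's lemma writes `F` as a constant plus a sum of smooth functions times coordinate
differences that vanish at `p`. The Leibniz rule leaves only the derivatives of the coordinates, and
those of the smooth monomials are zero. -/
theorem dS_form (hP : IsPolytope P) (hκ : κ.ordc p ∈ interior P) {ι : Type} [Fintype ι]
    (ζ : ι → SmoothExponent P) {F : (Fin n → ℝ) × (ι → ℂ) → ℝ} (hF : ContDiff ℝ ∞ F) :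
    v.dS (fun y => F (κ.xc y, fun j => κ.mon (ζ j) y)) =
      ∑ l, fderiv ℝ F (κ.xc p, fun j => κ.mon (ζ j) p) (Pi.single l 1, 0) *
        v.dS fun y => κ.xc y l := by
  classical
  have hX := X.isModeled p
  let c : X → (Fin n → ℝ) × (ι → ℂ) := fun y => (κ.xc y, fun j => κ.mon (ζ j) y)
  obtain ⟨G, hG, hG0, hFG⟩ := exists_hadamard hF (c p)
  have hg : ∀ u, SmAt X.toSpace p fun y => ((G (c y) u : ℝ) : ℂ) := fun u =>
    Chart.smAt_of_form hP ζ (F := fun y => ((G y u : ℝ) : ℂ))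
      (Complex.ofRealCLM.contDiff.comp (hG.clm_apply contDiff_const))
  have key : ∀ (u : (Fin n → ℝ) × (ι → ℂ)) {t : X → ℝ}, SmAt X.toSpace p (fun y => (t y : ℂ)) →
      SmAt X.toSpace p (fun y => ((G (c y) u * (t y - t p) : ℝ) : ℂ)) ∧
      v.dS (fun y => G (c y) u * (t y - t p)) = fderiv ℝ F (c p) u * v.dS t := fun u t ht => by
    have h1 : SmAt X.toSpace p fun y => ((t y + -t p : ℝ) : ℂ) := by
      simpa using ht.add hX (SmAt.const _ _ (-(t p : ℂ)))
    have hm : SmAt X.toSpace p fun _ => ((-t p : ℝ) : ℂ) := SmAt.const _ _ _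
    constructor
    · simpa [sub_eq_add_neg] using (hg u).mul hX h1
    · simp only [sub_eq_add_neg]
      rw [dS_mul (hg u) h1, dS_add ht hm, dS_const, hG0]
      simp
  have hdec : ∀ y, F (c y) = F (c p) +
      (∑ l, G (c y) (Pi.single l 1, 0) * (κ.xc y l - κ.xc p l) +
        (∑ j, G (c y) (0, Pi.single j 1) * ((κ.mon (ζ j) y).re - (κ.mon (ζ j) p).re) +
          ∑ j, G (c y) (0, Pi.single j Complex.I) *
            ((κ.mon (ζ j) y).im - (κ.mon (ζ j) p).im))) := fun y => by
    rw [hFG (c y)]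
    congr 1
    have e : c y - c p = ∑ l, (κ.xc y l - κ.xc p l) • ((Pi.single l 1, 0) : (Fin n → ℝ) × (ι → ℂ)) +
        (∑ j, ((κ.mon (ζ j) y).re - (κ.mon (ζ j) p).re) •
            ((0, Pi.single j 1) : (Fin n → ℝ) × (ι → ℂ)) +
          ∑ j, ((κ.mon (ζ j) y).im - (κ.mon (ζ j) p).im) •
            ((0, Pi.single j Complex.I) : (Fin n → ℝ) × (ι → ℂ))) := by
      ext k
      · simp [c, Prod.fst_sum, Finset.sum_apply, Pi.single_apply]
      · simp [c, Prod.snd_sum, Finset.sum_apply, Pi.single_apply]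
        linear_combination (Complex.re_add_im (κ.mon (ζ _) p)) - Complex.re_add_im (κ.mon (ζ _) y)
    rw [e]
    simp only [map_add, map_sum, map_smul, smul_eq_mul]
    simp only [mul_comm]
  have h1 := fun l => key (Pi.single l 1, 0) (κ.smAt_xc κ.mem l)
  have h2 := fun j => key (0, Pi.single j 1) ((Chart.smAt_mon (κ := κ) hP (ζ j)).re hX)
  have h3 := fun j => key (0, Pi.single j Complex.I) ((Chart.smAt_mon (κ := κ) hP (ζ j)).im hX)
  have s1 := dS_sum (v := v) Finset.univ fun l _ => (h1 l).1
  have s2 := dS_sum (v := v) Finset.univ fun j _ => (h2 j).1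
  have s3 := dS_sum (v := v) Finset.univ fun j _ => (h3 j).1
  have s23 := s2.2.add hX s3.2
  have s123 := s1.2.add hX s23
  simp only [← Complex.ofReal_add] at s23 s123
  show v.dS (fun y => F (c y)) = _
  rw [funext hdec, dS_add (SmAt.const _ _ _) s123, dS_const, dS_add s1.2 s23, dS_add s2.2 s3.2,
    s1.1, s2.1, s3.1]
  simp only [(h1 _).2, (h2 _).2, (h3 _).2, (dS_mon hP hκ _).1, (dS_mon hP hκ _).2, mul_zero,
    Finset.sum_const_zero, zero_add, add_zero]
  rfl

theorem dS_congr_coords (hP : IsPolytope P) (hκ : κ.ordc p ∈ interior P)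
    (h : ∀ l, v.dS (fun y => κ.xc y l) = w.dS fun y => κ.xc y l) {f : X → ℝ}
    (hf : SmAt X.toSpace p fun y => (f y : ℂ)) : v.dS f = w.dS f := by
  obtain ⟨ι, hι, ζ, F, hF, e⟩ := Chart.exists_smooth_form (κ := κ) hP hf
  have e' : f =ᶠ[𝓝 p] fun y => (F (κ.xc y, fun j => κ.mon (ζ j) y)).re := by
    filter_upwards [e] with y hy
    rw [← hy, Complex.ofReal_re]
  have hF' : ContDiff ℝ ∞ fun y => (F y).re := Complex.reCLM.contDiff.comp hF
  rw [dS_congr hf e', dS_congr hf e', dS_form hP hκ ζ hF', dS_form hP hκ ζ hF']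
  simp only [h]

theorem dlog_form {h : X → Number} {f : X → ℂ} {a : ℝ} {α : Fin m → ℤ} (hf : SmAt X.toSpace p f)
    (h0 : f p ≠ 0) (e : h =ᶠ[𝓝 p] fun y => ⟨f y, 0⟩ * monomial 1 a α (κ.zc y)) :
    v.dlog h = (v.dS (fun x => (f x).re) + Complex.I * v.dS (fun x => (f x).im)) / f p +
      ∑ i, (α i : ℂ) * v.dlog fun y => κ.zc y i := by
  have h1 := hf.explAt (X.isModeled p) h0
  rw [dlog_congr ((h1.mul (ExplAt.monomial one_ne_zero a α (κ.explAt_zc κ.mem))).congr e.symm) e,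
    dlog_monomial a α h1 (κ.explAt_zc κ.mem), dlog_smooth hf]

/-- Every exploded germ is a smooth factor times a monomial, so its logarithmic derivative is fixed
by the coordinates; tropical functions follow by induction on sums. -/
theorem ext_coords (hP : IsPolytope P) (hκ : κ.ordc p ∈ interior P)
    (hx : ∀ l, v.dS (fun y => κ.xc y l) = w.dS fun y => κ.xc y l)
    (hz : ∀ i, v.dlog (fun y => κ.zc y i) = w.dlog fun y => κ.zc y i) : v = w := by
  have hX := X.isModeled p
  have key : ∀ h, ExplAt X.toSpace p h → v.dT h = w.dT h := fun h hh => by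
    obtain ⟨f, a, α, hf, h0, e⟩ := Chart.exists_exploded_form (κ := κ) hP hh
    rw [dT_explAt hh, dT_explAt hh, dlog_form hf h0 e, dlog_form hf h0 e,
      dS_congr_coords hP hκ hx (hf.re hX), dS_congr_coords hP hκ hx (hf.im hX)]
    simp only [hz]
  ext1
  · funext f
    obtain ⟨U, hU, hf⟩ := f.smooth
    rw [← dS_eq, ← dS_eq]
    exact dS_congr_coords hP hκ hx (smAt_of_isSmooth hf hU)
  · funext f
    obtain ⟨U, hU, hf⟩ := f.tropical
    obtain ⟨V, hV, -, g, hg, e⟩ := hf p hU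
    have hgt : TropAt X.toSpace p g := tropAt_of_mem_closure hV hg fun _ _ => rfl
    have e' : f.fn =ᶠ[𝓝 p] g := mem_of_superset (V.isOpen.mem_nhds hV) e
    rw [← dT_eq, ← dT_eq, dT_congr f.tropical hgt e', dT_congr f.tropical hgt e']
    clear e e' hgt
    induction hg using AddSubsemigroup.closure_induction with
    | mem g hg => exact key g ⟨V, hV, hg⟩
    | add a b ha hb iha ihb =>
      have h1 := tropAt_of_mem_closure hV ha fun _ _ => rfl
      have h2 := tropAt_of_mem_closure hV hb fun _ _ => rfl
      have h3 := tropAt_of_mem_closure hV (AddSubsemigroup.add_mem _ ha hb) fun _ _ => rfl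
      have h4 := dT_add (v := v) h1 h2 h3
      have h5 := dT_add (v := w) h1 h2 h3
      rw [iha, ihb] at h4
      exact h4.trans h5.symm

/-! ### Integral vectors -/

theorem IsIntegral.exists_dlog (hv : v.IsIntegral) {h : X → Number} (hh : ExplAt X.toSpace p h) :
    ∃ k : ℤ, v.dlog h = k := by
  obtain ⟨k, hk⟩ := hv ⟨h, hh.tropAt⟩ hh
  rw [← dT_eq] at hk
  exact ⟨k, congrArg Number.coeff hk⟩

/-- Near `p` the function has an exploded `N`-th root for every `N > 0`, because its coefficient is
smooth and nonzero. Hence the integer `v.dlog h` is divisible by every `N`. -/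
theorem IsIntegral.dlog_eq_zero (hv : v.IsIntegral) {h : X → Number} (hh : ExplAt X.toSpace p h)
    (h0 : ∀ᶠ y in 𝓝 p, (h y).order = 0) : v.dlog h = 0 := by
  have hX := X.isModeled p
  have hf : SmAt X.toSpace p fun y => (h y).smoothPart :=
    hh.smAt_smoothPart hX (h0.mono fun y hy => hy.ge)
  have hp : (h p).smoothPart ≠ 0 := by
    rw [Number.smoothPart_of_order_eq_zero h0.self_of_nhds]
    exact hh.coeff_ne_zero
  have root : ∀ N : ℕ, N ≠ 0 → ∃ k : ℤ, v.dlog h = N * k := fun N hN => by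
    have hc : Continuous fun y : ℂ => y / (h p).smoothPart := continuous_id.div_const _
    have hev : ∀ᶠ y in 𝓝 (h p).smoothPart, y / (h p).smoothPart ∈ Complex.slitPlane :=
      hc.continuousAt.eventually
        (Complex.isOpen_slitPlane.mem_nhds (by simp only [div_self hp]; exact Complex.one_mem_slitPlane))
    have hr : SmAt X.toSpace p fun y =>
        Complex.exp (Complex.log ((h y).smoothPart / (h p).smoothPart) / N) :=
      hf.comp₁ hX (H := fun y => Complex.exp (Complex.log (y / (h p).smoothPart) / N)) (by
        filter_upwards [hev] with y hy
        have h1 : ContDiffAt ℂ ∞ (fun y => Complex.log (y / (h p).smoothPart) / N) y :=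
          ((Complex.contDiffAt_log hy).comp y
            (contDiffAt_id.div_const (h p).smoothPart)).div_const (N : ℂ)
        exact (h1.cexp).restrict_scalars ℝ)
    have hre := hr.explAt hX (Complex.exp_ne_zero _)
    obtain ⟨k, hk⟩ := hv.exists_dlog hre
    refine ⟨k, ?_⟩
    have hcst := ExplAt.const X.toSpace p (c := ⟨(h p).smoothPart, 0⟩) hp
    rw [← hk, ← dlog_pow hre N, ← zero_add (v.dlog fun x => _ ^ N), ← dlog_const (v := v)
      (c := ⟨(h p).smoothPart, 0⟩) hp, ← dlog_mul hcst (hre.pow N)]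
    refine dlog_congr hh ?_
    filter_upwards [h0, hf.continuousAt hX |>.eventually hev] with y hy hy'
    have hN' : (N : ℂ) ≠ 0 := Nat.cast_ne_zero.2 hN
    ext1
    · simp only [Number.mul_coeff, Number.pow_coeff]
      rw [← Complex.exp_nat_mul, mul_div_cancel₀ _ hN', Complex.exp_log (Complex.slitPlane_ne_zero hy'),
        mul_div_cancel₀ _ hp, Number.smoothPart_of_order_eq_zero hy]
    · simp [hy]
  obtain ⟨k, hk⟩ := hv.exists_dlog hh
  -- A number larger than `|k|` divides `k` only if `k = 0`.
  obtain ⟨k', hk'⟩ := root (k.natAbs + 1) (by simp)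
  rw [hk] at hk' ⊢
  have h1 : k = ((k.natAbs + 1 : ℕ) : ℤ) * k' := by
    rw [← Int.cast_natCast, ← Int.cast_mul] at hk'
    exact Int.cast_injective hk'
  have h2 : k = 0 := by
    by_contra hne
    have h3 := Int.natAbs_dvd_natAbs.2 (Dvd.intro _ h1.symm)
    have h4 := Nat.le_of_dvd (Int.natAbs_pos.2 hne) h3
    rw [Int.natAbs_natCast] at h4
    omega
  rw [h2]
  simp

/-- Shifted to take the value `1` at `p`, the function is exploded of order `0`, and its derivative
is then its logarithmic derivative. -/
theorem IsIntegral.dS_eq_zero (hv : v.IsIntegral) {f : X → ℝ}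
    (hf : SmAt X.toSpace p fun y => (f y : ℂ)) : v.dS f = 0 := by
  have hX := X.isModeled p
  have hc : SmAt X.toSpace p fun _ => ((1 - f p : ℝ) : ℂ) := SmAt.const _ _ _
  have hg := hf.add hX hc
  have h1 := hv.dlog_eq_zero (hg.explAt hX (by simp)) (Eventually.of_forall fun _ => rfl)
  rw [dlog_smooth hg] at h1
  have h2 : ((f p : ℂ) + ((1 - f p : ℝ) : ℂ)) = 1 := by simp
  have h3 : (fun x => ((f x : ℂ) + ((1 - f p : ℝ) : ℂ)).re) = fun x => f x + (1 - f p) := by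
    funext x
    simp
  rw [h2, h3, dS_add hf hc, dS_const, div_one] at h1
  simpa using congrArg Complex.re h1

theorem isIntegral_of_coords (hP : IsPolytope P) (hκ : κ.ordc p ∈ interior P)
    (hx : ∀ l, v.dS (fun y => κ.xc y l) = 0)
    (hz : ∀ i, ∃ k : ℤ, v.dlog (fun y => κ.zc y i) = k) : v.IsIntegral := by
  intro h hh
  have hX := X.isModeled p
  obtain ⟨f, a, α, hf, h0, e⟩ := Chart.exists_exploded_form (κ := κ) hP hh
  choose k hk using hz
  have hzero : ∀ {g : X → ℝ}, SmAt X.toSpace p (fun y => (g y : ℂ)) → v.dS g = 0 := fun {g} hg => by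
    obtain ⟨ι, hι, ζ, F, hF, e⟩ := Chart.exists_smooth_form (κ := κ) hP hg
    have e' : g =ᶠ[𝓝 p] fun y => (F (κ.xc y, fun j => κ.mon (ζ j) y)).re := by
      filter_upwards [e] with y hy
      rw [← hy, Complex.ofReal_re]
    rw [dS_congr hg e',
      dS_form hP hκ ζ (F := fun y => (F y).re) (Complex.reCLM.contDiff.comp hF)]
    simp [hx]
  refine ⟨∑ i, α i * k i, ?_⟩
  rw [← dT_eq, dT_explAt hh, dlog_form hf h0 e, hzero (hf.re hX), hzero (hf.im hX)]
  ext1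
  · have := ExplAt.coeff_ne_zero hh
    simp only [Number.ofComplex, Number.mul_coeff, Number.inv_coeff, hk]
    rw [mul_inv_cancel_right₀ this]
    simp
  · simp [Number.ofComplex]

end TangentVector

/-! ### Velocity vectors -/

/-- A point of the model `ℝ`. -/
def linePt (s : ℝ) : ModelPoint 1 0 Set.univ := ⟨fun _ => s, ⟨Fin.elim0, fun i => i.elim0, trivial⟩⟩

theorem isModeled_line (q : ModelPoint 1 0 Set.univ) : IsModeled (model 1 0 Set.univ) q :=
  isModeled_model ⟨by simp, ∅, ∅, by simp⟩ q

theorem smoothMonomial_line (e : SmoothExponent (Set.univ : Set (Fin 0 → ℝ)))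
    (q : ModelPoint 1 0 Set.univ) : smoothMonomial e q.pt = if e.a = 0 then 1 else 0 := by
  rw [ModelPoint.smoothMonomial_eq]
  simp [affine]

theorem tendsto_linePt : Tendsto linePt (𝓝 0) (𝓝 (linePt 0)) := by
  refine ModelPoint.tendsto_iff.2 ⟨?_, fun e => ?_⟩
  · exact tendsto_pi_nhds.2 fun _ => tendsto_id
  · simp only [smoothMonomial_line]
    exact tendsto_const_nhds

/-- A curve in the exploded semiring whose order is constant near `0` and whose coefficient is
differentiable at `0`. -/
def Tame (g : ℝ → Number) : Prop :=
  (∀ᶠ s in 𝓝 0, (g s).order = (g 0).order) ∧ DifferentiableAt ℝ (fun s => (g s).coeff) 0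

/-- The derivative at `0` of a curve in the exploded semiring. -/
def der (g : ℝ → Number) : Number := ⟨deriv (fun s => (g s).coeff) 0, (g 0).order⟩

theorem Tame.congr {g h : ℝ → Number} (hg : Tame g) (e : g =ᶠ[𝓝 0] h) : Tame h := by
  refine ⟨?_, hg.2.congr_of_eventuallyEq ?_⟩
  · filter_upwards [hg.1, e] with s hs hs'
    rw [← hs', hs, e.eq_of_nhds]
  · filter_upwards [e] with s hs
    rw [hs]

theorem der_congr {g h : ℝ → Number} (e : g =ᶠ[𝓝 0] h) : der g = der h := by
  rw [der, der, e.eq_of_nhds, EventuallyEq.deriv_eq (f₁ := fun s => (g s).coeff)]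
  filter_upwards [e] with s hs
  rw [hs]

theorem Tame.add {g h : ℝ → Number} (hg : Tame g) (hh : Tame h) :
    Tame (fun s => g s + h s) ∧ der (fun s => g s + h s) = der g + der h := by
  rcases lt_trichotomy (g 0).order (h 0).order with hlt | heq | hgt
  · have e : g =ᶠ[𝓝 0] fun s => g s + h s := by
      filter_upwards [hg.1, hh.1] with s hs hs'
      rw [Number.add_of_lt (by rwa [hs, hs'])]
    exact ⟨hg.congr e, by rw [← der_congr e, Number.add_of_lt (a := der g) (b := der h) hlt]⟩
  · have e : (fun s => (⟨(g s).coeff + (h s).coeff, (g 0).order⟩ : Number)) =ᶠ[𝓝 0]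
        fun s => g s + h s := by
      filter_upwards [hg.1, hh.1] with s hs hs'
      rw [Number.add_of_eq (by rw [hs, hs', heq]), hs]
    refine ⟨Tame.congr ⟨Eventually.of_forall fun _ => rfl, hg.2.add hh.2⟩ e, ?_⟩
    rw [← der_congr e, Number.add_of_eq (a := der g) (b := der h) heq]
    ext1
    · exact deriv_add hg.2 hh.2
    · rfl
  · have e : h =ᶠ[𝓝 0] fun s => g s + h s := by
      filter_upwards [hg.1, hh.1] with s hs hs'
      rw [Number.add_of_gt (by rwa [hs, hs'])]
    exact ⟨hh.congr e, by rw [← der_congr e, Number.add_of_gt (a := der g) (b := der h) hgt]⟩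

theorem Tame.der_mul {g h : ℝ → Number} (hg : Tame g) (hh : Tame h) :
    der (fun s => g s * h s) = der g * h 0 + g 0 * der h := by
  rw [Number.add_of_eq (a := der g * h 0) (b := g 0 * der h) rfl]
  ext1
  · exact deriv_mul hg.2 hh.2
  · rfl

theorem ExplAt.tame {h : ModelPoint 1 0 Set.univ → Number}
    (hh : ExplAt (model 1 0 Set.univ) (linePt 0) h) : Tame fun s => h (linePt s) := by
  obtain ⟨f, a, α, ⟨ι, hι, ζ, F, hF, e⟩, -, e'⟩ := explAt_model_iff.1 hh
  let d : ι → ℂ := fun j => if (ζ j).a = 0 then 1 else 0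
  have h1 : Tame fun s => ⟨F (fun _ => s, d), a⟩ := by
    refine ⟨Eventually.of_forall fun _ => rfl, ?_⟩
    exact ((hF.differentiable (by simp)).comp (by fun_prop : Differentiable ℝ fun s : ℝ =>
      ((fun _ => s, d) : (Fin 1 → ℝ) × (ι → ℂ)))).differentiableAt
  refine h1.congr ?_
  filter_upwards [tendsto_linePt.eventually e, tendsto_linePt.eventually e'] with s hs hs'
  rw [hs', hs]
  simp only [smoothMonomial_line]
  ext1 <;> simp [d, linePt, affine]

section

variable {X : Space.{u}} {p : X} {c : ModelPoint 1 0 Set.univ → X}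

/-- Exploded functions on the model `ℝ` have locally constant order. Sums preserve this, because
near the base point either one summand dominates throughout or the coefficients add. -/
theorem TropAt.tame (hc : MorphAt (X := model 1 0 Set.univ) c (linePt 0)) (hp : c (linePt 0) = p)
    {f : X → Number} (hf : TropAt X p f) : Tame fun s => f (c (linePt s)) := by
  subst hp
  obtain ⟨U, hU, hf⟩ := hf
  obtain ⟨V, hV, -, g, hg, e⟩ := hf _ hU
  have ht : Tendsto (fun s => c (linePt s)) (𝓝 0) (𝓝 (c (linePt 0))) := hc.1.tendsto.comp tendsto_linePt
  have h1 : Tame fun s => g (c (linePt s)) := by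
    clear e
    induction hg using AddSubsemigroup.closure_induction with
    | mem g hg => exact (hc.2 g ⟨V, hV, hg⟩).tame
    | add a b _ _ ha hb => exact (ha.add hb).1
  refine h1.congr ?_
  filter_upwards [ht.eventually (V.isOpen.mem_nhds hV)] with s hs
  rw [e _ hs]

theorem SmAt.differentiableAt (hc : MorphAt (X := model 1 0 Set.univ) c (linePt 0))
    (hp : c (linePt 0) = p) {f : X → ℂ} (hf : SmAt X p f) :
    DifferentiableAt ℝ (fun s => f (c (linePt s))) 0 := by
  obtain ⟨k, hk⟩ := hf
  have := (hk.tropAt.tame hc hp).2.sub_const k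
  simpa using this

theorem SmoothAt.differentiableAt (hc : MorphAt (X := model 1 0 Set.univ) c (linePt 0))
    (hp : c (linePt 0) = p) (f : SmoothAt X p) :
    DifferentiableAt ℝ (fun s => f.fn (c (linePt s))) 0 := by
  obtain ⟨U, hU, hf⟩ := f.smooth
  have h1 := (smAt_of_isSmooth hf hU).differentiableAt hc hp
  exact Complex.reCLM.differentiableAt.comp (0 : ℝ) h1

/-- The velocity of a curve. -/
def velocity (hc : MorphAt (X := model 1 0 Set.univ) c (linePt 0)) (hp : c (linePt 0) = p) :
    TangentVector X p where
  onSmooth f := deriv (fun s => f.fn (c (linePt s))) 0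
  onTropical f := der fun s => f.fn (c (linePt s))
  smooth_germ f g e := by
    subst hp
    exact EventuallyEq.deriv_eq ((hc.1.tendsto.comp tendsto_linePt).eventually e)
  tropical_germ f g e := by
    subst hp
    exact der_congr ((hc.1.tendsto.comp tendsto_linePt).eventually e)
  smooth_add f g h e := by
    simp only [e]
    exact deriv_add (f.differentiableAt hc hp) (g.differentiableAt hc hp)
  tropical_add f g h e := by
    simp only [e]
    exact ((TropAt.tame hc hp f.tropical).add (TropAt.tame hc hp g.tropical)).2
  smooth_mul f g h e := by
    subst hp
    simp only [e]
    exact deriv_mul (f.differentiableAt hc rfl) (g.differentiableAt hc rfl)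
  tropical_mul f g h e := by
    subst hp
    simp only [e]
    exact (TropAt.tame hc rfl f.tropical).der_mul (TropAt.tame hc rfl g.tropical)
  tropical_const_mul k f h e := by
    simp only [e]
    ext1
    · exact deriv_const_mul _ (TropAt.tame hc hp f.tropical).2
    · rfl
  compatible f h e := by
    simp only [e]
    ext1
    · exact (f.differentiableAt hc hp).hasDerivAt.ofReal_comp.deriv
    · rfl

end

namespace TangentVector

variable {X : Manifold.{u}} {p : X}

/-- The vector is the velocity of the curve that moves the real coordinates linearly with slope `u`
and multiplies the exploded ones by `exp (w i * s)`, leaving their orders fixed. -/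
theorem exists_of_coords {n m : ℕ} {P : Set (Fin m → ℝ)} (κ : Chart X.toSpace p (model n m P))
    (u : Fin n → ℝ) (w : Fin m → ℂ) : ∃ v : TangentVector X.toSpace p,
      (∀ l, v.dS (fun y => κ.xc y l) = u l) ∧ ∀ i, v.dlog (fun y => κ.zc y i) = w i := by
  let μ : ModelPoint 1 0 Set.univ → ModelPoint n m P := fun q =>
    mkPoint (κ.map p) (fun l => κ.xc p l + u l * q.x 0)
      fun i => ⟨(κ.zc p i).coeff * Complex.exp (w i * q.x 0), (κ.zc p i).order⟩
  have hμ : ∀ q, μ q = ⟨fun l => κ.xc p l + u l * q.x 0,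
      ⟨fun i => ⟨(κ.zc p i).coeff * Complex.exp (w i * q.x 0), (κ.zc p i).order⟩,
        fun i => mul_ne_zero (κ.zc_coeff_ne_zero p i) (Complex.exp_ne_zero _), κ.ordc_mem p⟩⟩ :=
    fun q => mkPoint_eq _ _ _
  have hμ0 : μ (linePt 0) = κ.map p := by
    rw [hμ]
    refine ModelPoint.ext ?_ (TorusPoint.ext ?_)
    · funext l
      simp [linePt, Chart.xc]
    · funext i
      simp [linePt, Chart.zc]
  have hL := isModeled_line (linePt 0)
  have hx := (ModelPoint.smAt_x (linePt 0) 0)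
  have h1 : MorphAt (X := model 1 0 Set.univ) (Y := model n m P) μ (linePt 0) := by
    refine morphAt_mkPoint (X := model 1 0 Set.univ) (κ.map p) hL (fun l => ?_) (fun i => ?_)
      (Eventually.of_forall fun q => κ.ordc_mem p)
    · simpa using (SmAt.const _ _ (κ.xc p l : ℂ)).add hL ((SmAt.const _ _ (u l : ℂ)).mul hL hx)
    · refine ((SmAt.const _ _ (κ.zc p i).coeff).mul hL (hx.comp₁ hL
        (H := fun y => Complex.exp (w i * y)) (Eventually.of_forall fun y => ?_))).explAt hL
        (mul_ne_zero (κ.zc_coeff_ne_zero p i) (Complex.exp_ne_zero _)) |>.mul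
        (ExplAt.const _ _ (c := ⟨1, (κ.zc p i).order⟩) one_ne_zero) |>.congr
        (Eventually.of_forall fun q => ?_)
      · exact ((contDiff_const.mul contDiff_id).cexp).contDiffAt
      · ext1 <;> simp
  have hc : MorphAt (X := model 1 0 Set.univ) (fun q => κ.symm (μ q)) (linePt 0) := by
    refine MorphAt.comp (X := model 1 0 Set.univ) (Y := model n m P) (φ := μ) ?_ h1
    rw [hμ0]
    exact κ.morph_symm _ κ.map_mem'
  have hp : κ.symm (μ (linePt 0)) = p := by rw [hμ0, κ.left']
  have hev : ∀ᶠ s in 𝓝 (0 : ℝ), κ.map (κ.symm (μ (linePt s))) = μ (linePt s) := by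
    have h2 : Tendsto (fun s => μ (linePt s)) (𝓝 0) (𝓝 (κ.map p)) := by
      rw [← hμ0]
      exact h1.1.tendsto.comp tendsto_linePt
    exact h2.eventually κ.eventually_right
  refine ⟨velocity hc hp, fun l => ?_, fun i => ?_⟩
  · have h2 := exists_isSmooth X.isModeled (κ.smAt_xc κ.mem l)
    rw [dS, dif_pos h2]
    show deriv (fun s => κ.xc (κ.symm (μ (linePt s))) l) 0 = u l
    have h3 : (fun s => κ.xc (κ.symm (μ (linePt s))) l) =ᶠ[𝓝 0] fun s => κ.xc p l + u l * s := by
      filter_upwards [hev] with s hs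
      rw [Chart.xc, hs, hμ]
      rfl
    rw [h3.deriv_eq]
    simp
  · have h2 := (κ.explAt_zc κ.mem i).tropAt
    rw [dlog, dT, dif_pos h2]
    show deriv (fun s => (κ.zc (κ.symm (μ (linePt s))) i).coeff) 0 / _ = w i
    have h3 : (fun s => (κ.zc (κ.symm (μ (linePt s))) i).coeff) =ᶠ[𝓝 0]
        fun s => (κ.zc p i).coeff * Complex.exp (w i * s) := by
      filter_upwards [hev] with s hs
      rw [Chart.zc, hs, hμ]
      rfl
    have h4 : HasDerivAt (fun s : ℝ => (κ.zc p i).coeff * Complex.exp (w i * s))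
        ((κ.zc p i).coeff * w i) 0 := by
      have h5 : HasDerivAt (fun s : ℝ => w i * (s : ℂ)) (w i * 1) 0 :=
        (hasDerivAt_id (0 : ℝ)).ofReal_comp.const_mul (w i)
      simpa using (h5.cexp).const_mul (κ.zc p i).coeff
    rw [h3.deriv_eq, h4.deriv, mul_div_cancel_left₀ _ (κ.zc_coeff_ne_zero p i)]

theorem differential_dS {Y : Manifold.{u}} (φ : Hom X.toSpace Y.toSpace)
    (v : TangentVector X.toSpace p) {f : Y → ℝ} (hf : SmAt Y.toSpace (φ p) fun y => (f y : ℂ)) :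
    (φ.differential p v).dS f = v.dS fun x => f (φ x) := by
  have h1 := exists_isSmooth Y.isModeled hf
  have h2 := exists_isSmooth X.isModeled ((φ.morphAt p).smAt hf)
  rw [dS, dS, dif_pos h1, dif_pos h2]
  rfl

theorem differential_dlog {Y : Manifold.{u}} (φ : Hom X.toSpace Y.toSpace)
    (v : TangentVector X.toSpace p) {h : Y → Number} (hh : ExplAt Y.toSpace (φ p) h) :
    (φ.differential p v).dlog h = v.dlog fun x => h (φ x) := by
  have h1 := hh.tropAt
  have h2 := ((φ.morphAt p).2 _ hh).tropAt
  rw [dlog, dlog, dT, dT, dif_pos h1, dif_pos h2]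
  rfl

end TangentVector

/-! ### Changes of coordinates -/

theorem Chart.exists_of_eventually {X : Space.{u}} {Y : Space.{v}} {p : X} {φ : X → Y} {ψ : Y → X}
    (hφ : ∀ᶠ x in 𝓝 p, MorphAt φ x) (hψ : ∀ᶠ y in 𝓝 (φ p), MorphAt ψ y)
    (hl : ∀ᶠ x in 𝓝 p, ψ (φ x) = x) (hr : ∀ᶠ y in 𝓝 (φ p), φ (ψ y) = y) :
    ∃ κ : Chart X p Y, κ.map = φ := by
  obtain ⟨U, hU, hUo, hpU⟩ := mem_nhds_iff.1 (hφ.and hl)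
  obtain ⟨V, hV, hVo, hpV⟩ := mem_nhds_iff.1 (hψ.and hr)
  exact ⟨{
    U := ⟨{x | x ∈ U ∧ φ x ∈ V},
      isOpen_preimage_of_morphAt (U := ⟨U, hUo⟩) (fun x hx => (hU hx).1) ⟨V, hVo⟩⟩
    V := ⟨{y | y ∈ V ∧ ψ y ∈ U},
      isOpen_preimage_of_morphAt (U := ⟨V, hVo⟩) (fun x hx => (hV hx).1) ⟨U, hUo⟩⟩
    map := φ
    symm := ψ
    mem := ⟨hpU, hpV⟩
    map_mem := fun x hx => ⟨hx.2, by rw [(hU hx.1).2]; exact hx.1⟩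
    symm_mem := fun y hy => ⟨hy.2, by rw [(hV hy.1).2]; exact hy.1⟩
    left := fun x hx => (hU hx.1).2
    right := fun y hy => (hV hy.1).2
    morph_map := fun x hx => (hU hx.1).1
    morph_symm := fun y hy => (hV hy.1).1 }, rfl⟩

theorem exists_contDiff_local_inverse {E E' : Type} [NormedAddCommGroup E] [NormedSpace ℝ E]
    [FiniteDimensional ℝ E] [NormedAddCommGroup E'] [NormedSpace ℝ E'] [FiniteDimensional ℝ E']
    {Φ : E → E'} (hΦ : ContDiff ℝ ∞ Φ) {y₀ : E} (h : Function.Bijective (fderiv ℝ Φ y₀)) :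
    ∃ S : E' → E, ContDiff ℝ ∞ S ∧ (∀ᶠ y in 𝓝 y₀, S (Φ y) = y) ∧
      ∀ᶠ w in 𝓝 (Φ y₀), Φ (S w) = w := by
  have : CompleteSpace E := FiniteDimensional.complete ℝ E
  have : CompleteSpace E' := FiniteDimensional.complete ℝ E'
  let L : E ≃L[ℝ] E' := ContinuousLinearEquiv.ofBijective (fderiv ℝ Φ y₀)
    (LinearMap.ker_eq_bot.2 h.1) (LinearMap.range_eq_top.2 h.2)
  have hL : (L : E →L[ℝ] E') = fderiv ℝ Φ y₀ := ContinuousLinearEquiv.coe_ofBijective _ _ _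
  have hd : Differentiable ℝ Φ := hΦ.differentiable (by simp)
  have hL' : HasFDerivAt Φ (L : E →L[ℝ] E') y₀ := hL ▸ (hd y₀).hasFDerivAt
  let e := hΦ.contDiffAt.toOpenPartialHomeomorph Φ hL' (by simp)
  have hs : y₀ ∈ e.source := hΦ.contDiffAt.mem_toOpenPartialHomeomorph_source hL' (by simp)
  have ht : Φ y₀ ∈ e.target := hΦ.contDiffAt.image_mem_toOpenPartialHomeomorph_target hL' (by simp)
  have hinv : e.symm (Φ y₀) = y₀ := e.left_inv hs
  have hcont : ContinuousAt e.symm (Φ y₀) := e.continuousAt_symm ht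
  have hev : ∀ᶠ w in 𝓝 (Φ y₀), ContDiffAt ℝ ∞ e.symm w := by
    -- Invertibility of the derivative is an open condition, so the inverse is smooth on a whole
    -- neighbourhood and can be extended globally by a cutoff.
    have h1 : ∀ᶠ y in 𝓝 y₀, fderiv ℝ Φ y ∈ Set.range ((↑) : (E ≃L[ℝ] E') → E →L[ℝ] E') :=
      (hΦ.continuous_fderiv (by simp)).continuousAt.eventually
        (ContinuousLinearEquiv.isOpen.mem_nhds ⟨L, hL⟩)
    rw [← hinv] at h1
    filter_upwards [hcont.eventually h1, e.open_target.mem_nhds ht] with w ⟨M, hM⟩ hw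
    exact e.contDiffAt_symm hw (f₀' := M) (hM ▸ (hd _).hasFDerivAt) hΦ.contDiffAt
  obtain ⟨S, hS, heq⟩ := exists_contDiff_eventuallyEq hev
  refine ⟨S, hS, ?_, ?_⟩
  · filter_upwards [hΦ.continuous.continuousAt.eventually heq, e.open_source.mem_nhds hs]
      with y hy hy'
    rw [hy]
    exact e.left_inv hy'
  · filter_upwards [heq, e.open_target.mem_nhds ht] with w hw hw'
    rw [hw]
    exact e.right_inv hw'

theorem contDiff_zpow {E : Type*} [NormedAddCommGroup E] [NormedSpace ℝ E] {f : E → ℂ}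
    (hf : ContDiff ℝ ∞ f) (h0 : ∀ y, f y ≠ 0) (k : ℤ) : ContDiff ℝ ∞ fun y => f y ^ k := by
  cases k with
  | ofNat k => simpa using hf.pow k
  | negSucc k =>
    simp only [zpow_negSucc]
    exact ContDiff.inv (hf.pow (k + 1)) fun y => pow_ne_zero _ (h0 y)

theorem smoothPart_monomial {m : ℕ} (c : ℂ) (a : ℝ) (α : Fin m → ℤ) (z : Fin m → Number) :
    (monomial c a α z).smoothPart = c * (monomial 1 a α z).smoothPart := by
  by_cases h : (affine a α fun i => (z i).order) = 0
  · rw [Number.smoothPart_of_order_eq_zero h, Number.smoothPart_of_order_eq_zero h]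
    simp
  · rw [Number.smoothPart_of_order_ne_zero h, Number.smoothPart_of_order_ne_zero h, mul_zero]

/-- The smooth exponent pulled back by an integral affine map. -/
def SmoothExponent.pull {m k : ℕ} {P : Set (Fin m → ℝ)} (b : Fin m → ℝ)
    (B : Matrix (Fin m) (Fin k) ℤ) (e : SmoothExponent P) : SmoothExponent (affMap b B ⁻¹' P) where
  a := affine e.a e.α b
  α := Matrix.vecMul e.α B
  nonneg y hy := by
    rw [← affine_affMap]
    exact e.nonneg _ hy

section

variable {n m n' m' : ℕ} {P : Set (Fin m → ℝ)} {ι : Type} [Fintype ι]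

/-- The real coordinates and some smooth monomials. -/
def coords (ζ : ι → SmoothExponent P) (q : ModelPoint n m P) : (Fin n → ℝ) × (ι → ℂ) :=
  (q.x, fun j => smoothMonomial (ζ j) q.pt)

/-- At `y₀` the product rule for `y.2 j * W j y` leaves only multiplication by `W j y₀`: either `y.2
j` vanishes there or `W j` is constant. The derivative is block triangular, with the real Jacobian
of `F` as the other diagonal block. -/
theorem fderiv_bijective_of_triangular {F : (Fin n → ℝ) × (ι → ℂ) → (Fin n' → ℝ)}
    (hF : ContDiff ℝ ∞ F) {W : ι → (Fin n → ℝ) × (ι → ℂ) → ℂ} (hW : ∀ j, ContDiff ℝ ∞ (W j))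
    (hW0 : ∀ j y, W j y ≠ 0) {y₀ : (Fin n → ℝ) × (ι → ℂ)}
    (hJ : Function.Bijective fun u => fderiv ℝ F y₀ (u, 0))
    (h0 : ∀ j, y₀.2 j = 0 ∨ ∀ y, W j y = 1) :
    ContDiff ℝ ∞ (fun y => (F y, fun j => y.2 j * W j y)) ∧
      Function.Bijective (fderiv ℝ (fun y => (F y, fun j => y.2 j * W j y)) y₀) := by
  have hp : ∀ j, ContDiff ℝ ∞ fun y : (Fin n → ℝ) × (ι → ℂ) => y.2 j := fun j => by fun_prop
  have hd : ∀ u, fderiv ℝ (fun y => (F y, fun j => y.2 j * W j y)) y₀ u =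
      (fderiv ℝ F y₀ u, fun j => u.2 j * W j y₀) := fun u => by
    have h1 : HasFDerivAt F (fderiv ℝ F y₀) y₀ := (hF.differentiable (by simp) _).hasFDerivAt
    have h2 : ∀ j, HasFDerivAt (fun y : (Fin n → ℝ) × (ι → ℂ) => y.2 j * W j y)
        (W j y₀ • ((ContinuousLinearMap.proj j).comp (ContinuousLinearMap.snd ℝ _ (ι → ℂ)))) y₀ :=
      fun j => by
        have h3 : HasFDerivAt (fun y : (Fin n → ℝ) × (ι → ℂ) => y.2 j)
            ((ContinuousLinearMap.proj j).comp (ContinuousLinearMap.snd ℝ _ (ι → ℂ))) y₀ :=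
          ContinuousLinearMap.hasFDerivAt
            ((ContinuousLinearMap.proj j).comp (ContinuousLinearMap.snd ℝ (Fin n → ℝ) (ι → ℂ)))
        rcases h0 j with h | h
        · have h4 := h3.mul ((hW j).differentiable (by simp) y₀).hasFDerivAt
          refine h4.congr_fderiv (ContinuousLinearMap.ext fun u => ?_)
          simp [h]
        · simp only [h, mul_one, one_smul]
          exact h3
    rw [(h1.prodMk (hasFDerivAt_pi.2 h2)).fderiv]
    ext1
    · rfl
    · funext j
      simp [mul_comm]
  refine ⟨hF.prodMk (contDiff_pi.2 fun j => (hp j).mul (hW j)), ?_, ?_⟩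
  · refine (injective_iff_map_eq_zero _).2 fun u hu => ?_
    rw [hd] at hu
    have h2 : u.2 = 0 := by
      funext j
      have := congrFun (congrArg Prod.snd hu) j
      simpa [hW0] using this
    have h1 : u.1 = 0 := hJ.1 (by
      have := congrArg Prod.fst hu
      simp only [Prod.fst_zero] at this
      show fderiv ℝ F y₀ (u.1, 0) = fderiv ℝ F y₀ (0, 0)
      rw [← h2, Prod.mk.eta, this, h2]
      exact (map_zero _).symm)
    exact Prod.ext h1 h2
  · rintro ⟨t, r⟩
    let s : ι → ℂ := fun j => r j / W j y₀
    obtain ⟨u, hu⟩ := hJ.2 (t - fderiv ℝ F y₀ (0, s))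
    refine ⟨(u, s), ?_⟩
    rw [hd]
    have : ((u, s) : (Fin n → ℝ) × (ι → ℂ)) = (u, 0) + (0, s) := by simp
    simp only at hu
    ext1
    · show fderiv ℝ F y₀ (u, s) = t
      rw [this, map_add, hu, sub_add_cancel]
    · funext j
      simp [s, hW0]

/-- The integer matrix inverts the tropical part of the substitution. The smooth part is a map of
real coordinates and smooth monomials in which each monomial is multiplied by a nonvanishing factor.
At a centered point its derivative is triangular, so the inverse function theorem applies, and its
local inverse supplies the arguments of the coefficient functions in the inverse substitution. -/
theorem exists_coord_change (hP : IsPolytope P) (q : ModelPoint n m P) (hq : q.ord ∈ interior P)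
    (ζ : ι → SmoothExponent P) {F : (Fin n → ℝ) × (ι → ℂ) → (Fin n' → ℝ)} (hF : ContDiff ℝ ∞ F)
    (hJ : Function.Bijective fun u => fderiv ℝ F (coords ζ q) (u, 0))
    {f : Fin m' → (Fin n → ℝ) × (ι → ℂ) → ℂ} (hf : ∀ i, ContDiff ℝ ∞ (f i))
    (hf0 : ∀ i y, f i y ≠ 0) (a : Fin m' → ℝ) {A : Matrix (Fin m') (Fin m) ℤ}
    {B : Matrix (Fin m) (Fin m') ℤ} (hAB : A * B = 1) (hBA : B * A = 1) :
    ∃ (P' : Set (Fin m' → ℝ)) (μ : Chart (model n m P) q (model n' m' P')), IsPolytope P' ∧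
      μ.ordc q ∈ interior P' ∧ ∀ q' : ModelPoint n m P, μ.xc q' = F (coords ζ q') ∧
        μ.zc q' = fun i => monomial (f i (coords ζ q')) (a i) (A i) q'.pt.z := by
  let b := affMap 0 B (-a)
  let P' := affMap b B ⁻¹' P
  have hba : affMap b B a = 0 := by
    funext l
    simp only [b, affMap, affine_eq, Pi.zero_apply, map_neg]
    ring
  have hab : affMap a A b = 0 := by
    rw [affMap_affMap, hAB]
    funext i
    simp [affMap, affine, Matrix.one_apply]
  have inv1 : ∀ y, affMap b B (affMap a A y) = y := fun y => by
    rw [affMap_affMap, hba, hBA, affMap_zero_one]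
  let u : Fin m → (Fin n → ℝ) × (ι → ℂ) → ℂ := fun l y => ∏ i, f i y ^ (-B) l i
  have hu0 : ∀ l y, u l y ≠ 0 := fun l y =>
    Finset.prod_ne_zero_iff.2 fun i _ => zpow_ne_zero _ (hf0 i y)
  have hu : ∀ l, ContDiff ℝ ∞ (u l) := fun l =>
    contDiff_prod fun i _ => contDiff_zpow (hf i) (hf0 i) _
  have back1 : ∀ (y : (Fin n → ℝ) × (ι → ℂ)) {z : Fin m → Number}, (∀ i, (z i).coeff ≠ 0) →
      monMap (fun l => u l y) b B (monMap (fun i => f i y) a A z) = z := fun y z hz => by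
    rw [monMap_monMap hz, hba, hBA]
    convert monMap_one z using 2
    funext l
    simp only [u, ← Finset.prod_mul_distrib]
    refine Finset.prod_eq_one fun i _ => ?_
    rw [← zpow_add₀ (hf0 i y)]
    simp
  have back2 : ∀ (y : (Fin n → ℝ) × (ι → ℂ)) {z : Fin m' → Number}, (∀ i, (z i).coeff ≠ 0) →
      monMap (fun i => f i y) a A (monMap (fun l => u l y) b B z) = z := fun y z hz => by
    rw [monMap_monMap hz, hab, hAB]
    convert monMap_one z using 2
    funext i
    have h1 : Matrix.vecMul (A i) (-B) = -(1 : Matrix (Fin m') (Fin m') ℤ) i := by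
      rw [Matrix.vecMul_neg, ← hAB]
      rfl
    simp only [u, prod_zpow_vecMul (fun i => hf0 i y), h1, Pi.neg_apply]
    rw [Finset.prod_eq_single i (by intro k _ hk; simp [hk.symm]) (by simp)]
    simp [hf0]
  -- Substituting `z = u t^b z'^B` in the old monomial `ζ j` yields the product of the `u l ^ α l`
  -- times the new monomial; `W j` is the inverse of this product.
  let W : ι → (Fin n → ℝ) × (ι → ℂ) → ℂ := fun j y => (∏ l, u l y ^ (ζ j).α l)⁻¹
  have hW0 : ∀ j y, W j y ≠ 0 := fun j y =>
    inv_ne_zero (Finset.prod_ne_zero_iff.2 fun l _ => zpow_ne_zero _ (hu0 l y))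
  have hW : ∀ j, ContDiff ℝ ∞ (W j) := fun j =>
    ContDiff.inv (contDiff_prod fun l _ => contDiff_zpow (hu l) (hu0 l) _)
      fun y => Finset.prod_ne_zero_iff.2 fun l _ => zpow_ne_zero _ (hu0 l y)
  let ζ' : ι → SmoothExponent P' := fun j => (ζ j).pull b B
  have hζ : ∀ (y : (Fin n → ℝ) × (ι → ℂ)) (z : TorusPoint m P) (z' : TorusPoint m' P'),
      z.z = monMap (fun l => u l y) b B z'.z →
      ∀ j, smoothMonomial (ζ' j) z' = smoothMonomial (ζ j) z * W j y := fun y z z' hz j => by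
    have h1 := monomial_monomial z'.coeff_ne_zero 1 (ζ j).a (ζ j).α (fun l => u l y) b B
    rw [smoothMonomial, smoothMonomial, hz]
    show (monomial 1 (affine (ζ j).a (ζ j).α b) (Matrix.vecMul (ζ j).α B) z'.z).smoothPart =
      (monomial 1 (ζ j).a (ζ j).α fun l => monomial (u l y) (b l) (B l) z'.z).smoothPart *
        (∏ l, u l y ^ (ζ j).α l)⁻¹
    rw [h1, smoothPart_monomial (1 * ∏ l, u l y ^ (ζ j).α l), one_mul, mul_right_comm,
      mul_inv_cancel₀ (Finset.prod_ne_zero_iff.2 fun l _ => zpow_ne_zero _ (hu0 l y)), one_mul]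
  let Φ : (Fin n → ℝ) × (ι → ℂ) → (Fin n' → ℝ) × (ι → ℂ) := fun y => (F y, fun j => y.2 j * W j y)
  obtain ⟨hΦ, hΦ'⟩ := fderiv_bijective_of_triangular hF hW hW0 hJ (fun j => by
    by_cases h : affine (ζ j).a (ζ j).α q.ord = 0
    · right
      obtain ⟨-, h2⟩ := eq_zero_of_interior (ζ j).nonneg hq h
      simp [W, h2]
    · left
      show smoothMonomial (ζ j) q.pt = 0
      rw [ModelPoint.smoothMonomial_eq, if_neg h])
  obtain ⟨S, hS, hSl, hSr⟩ := exists_contDiff_local_inverse hΦ hΦ'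
  let θ : ModelPoint n m P → ModelPoint n' m' P' := fun q' => ⟨F (coords ζ q'),
    ⟨monMap (fun i => f i (coords ζ q')) a A q'.pt.z,
      monMap_coeff_ne_zero (fun i => hf0 i _) _ _ q'.pt.coeff_ne_zero, by
        show affMap b B (affMap a A q'.ord) ∈ P
        rw [inv1]
        exact q'.ord_mem⟩⟩
  let θ' : ModelPoint n' m' P' → ModelPoint n m P := fun r => ⟨(S (coords ζ' r)).1,
    ⟨monMap (fun l => u l (S (coords ζ' r))) b B r.pt.z,
      monMap_coeff_ne_zero (fun i => hu0 i _) _ _ r.pt.coeff_ne_zero, r.ord_mem⟩⟩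
  have hc : ∀ q', coords ζ' (θ q') = Φ (coords ζ q') := fun q' => by
    refine Prod.ext rfl (funext fun j => ?_)
    exact hζ (coords ζ q') q'.pt (θ q').pt (back1 _ q'.pt.coeff_ne_zero).symm j
  have hint : (θ q).ord ∈ interior P' := by
    refine interior_maximal (Set.preimage_mono interior_subset)
      (isOpen_interior.preimage (continuous_affMap b B)) ?_
    show affMap b B (affMap a A q.ord) ∈ interior P
    rwa [inv1]
  have hP' : IsPolytope P' := by
    refine ⟨⟨_, hint⟩, ?_⟩
    obtain ⟨-, s, s', rfl⟩ := hP
    exact ⟨_, _, preimage_polyhedron b B s s'⟩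
  have hθ : ∀ q', MorphAt (X := model n m P) (Y := model n' m' P') θ q' := fun q' => by
    refine morphAt_model (X := model n m P) (isModeled_model hP q') (fun i => ?_) (fun i => ?_)
    · exact (smAt_model_iff_of_isPolytope hP).2 ⟨ι, _, ζ, fun y => (F y i : ℂ),
        Complex.ofRealCLM.contDiff.comp ((contDiff_pi.1 hF) i), .rfl⟩
    · exact explAt_model_iff.2 ⟨fun q' => f i (coords ζ q'), a i, A i, ⟨ι, _, ζ, f i, hf i, .rfl⟩,
        hf0 _ _, .rfl⟩
  have hθ' : ∀ r, MorphAt (X := model n' m' P') (Y := model n m P) θ' r := fun r => by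
    refine morphAt_model (X := model n' m' P') (isModeled_model hP' r) (fun i => ?_) (fun i => ?_)
    · exact (smAt_model_iff_of_isPolytope hP').2 ⟨ι, _, ζ', fun y => ((S y).1 i : ℂ),
        Complex.ofRealCLM.contDiff.comp ((contDiff_pi.1 hS.fst) i), .rfl⟩
    · exact explAt_model_iff.2 ⟨fun r => u i (S (coords ζ' r)), b i, B i,
        ⟨ι, _, ζ', fun y => u i (S y), (hu i).comp hS, .rfl⟩, hu0 _ _, .rfl⟩
  have hl : ∀ᶠ q' in 𝓝 q, θ' (θ q') = q' := by
    filter_upwards [(continuous_coordinates ζ).continuousAt.eventually hSl] with q' hq'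
    replace hq' : S (coords ζ' (θ q')) = coords ζ q' := by
      rw [hc]
      exact hq'
    refine ModelPoint.ext ?_ (TorusPoint.ext ?_)
    · exact congrArg Prod.fst hq'
    · show monMap (fun l => u l (S (coords ζ' (θ q')))) b B _ = _
      rw [hq']
      exact back1 _ q'.pt.coeff_ne_zero
  have hr : ∀ᶠ r in 𝓝 (θ q), θ (θ' r) = r := by
    have h1 : Tendsto (coords ζ') (𝓝 (θ q)) (𝓝 (Φ (coords ζ q))) := by
      rw [← hc]
      exact (continuous_coordinates ζ').continuousAt
    filter_upwards [h1.eventually hSr] with r hr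
    -- Both sides give the new monomials after multiplication by the nonvanishing factors `W j`,
    -- which can be cancelled.
    have h2 : coords ζ (θ' r) = S (coords ζ' r) := by
      refine Prod.ext rfl (funext fun j => ?_)
      have h3 := hζ (S (coords ζ' r)) (θ' r).pt r.pt rfl j
      have h4 := congrFun (congrArg Prod.snd hr) j
      exact mul_right_cancel₀ (hW0 j _) (h3.symm.trans h4.symm)
    refine ModelPoint.ext ?_ (TorusPoint.ext ?_)
    · show F (coords ζ (θ' r)) = _
      rw [h2]
      exact congrArg Prod.fst hr
    · show monMap (fun i => f i (coords ζ (θ' r))) a A _ = _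
      rw [h2]
      exact back2 _ r.pt.coeff_ne_zero
  obtain ⟨μ, hμ⟩ := Chart.exists_of_eventually (X := model n m P) (Y := model n' m' P') (p := q)
    (φ := θ) (ψ := θ') (Eventually.of_forall hθ) (Eventually.of_forall hθ') hl hr
  have e : ∀ q' : ModelPoint n m P, μ.map q' = θ q' := congrFun hμ
  refine ⟨P', μ, hP', ?_, fun q' => ⟨congrArg ModelPoint.x (e q'),
    congrArg (fun r : ModelPoint n' m' P' => r.pt.z) (e q')⟩⟩
  have h1 : μ.ordc q = (θ q).ord := congrArg ModelPoint.ord (e q)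
  rw [h1]
  exact hint

end

/-! ### Normal form of a submersion -/

/-- A surjection onto a free module splits, and over a principal ideal domain its kernel is free.
`Λ` takes the coordinates of the kernel component; the lemma serves for real Jacobians as well as
for integer exponent matrices. -/
theorem exists_complement {R : Type} [CommRing R] [IsDomain R] [IsPrincipalIdealRing R] {n k : ℕ}
    (A : (Fin n → R) →ₗ[R] (Fin k → R)) (hA : Function.Surjective A) :
    ∃ (d : ℕ) (Λ : (Fin n → R) →ₗ[R] (Fin d → R)),
      Function.Bijective fun u => Fin.append (A u) (Λ u) := by
  obtain ⟨K, hK⟩ := Module.projective_lifting_property A LinearMap.id hA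
  have hAK : ∀ s, A (K s) = s := fun s => LinearMap.congr_fun hK s
  obtain ⟨d, b⟩ := Submodule.basisOfPid (Pi.basisFun R (Fin n)) (LinearMap.ker A)
  let r : (Fin n → R) →ₗ[R] LinearMap.ker A :=
    (LinearMap.id - K.comp A).codRestrict _ fun u => by simp [hAK]
  have hr : ∀ u, ((r u : LinearMap.ker A) : Fin n → R) = u - K (A u) := fun u => rfl
  refine ⟨d, b.equivFun.toLinearMap.comp r, ?_, fun w => ?_⟩
  · intro u u' h
    have h1 : A u = A u' := by
      funext i
      simpa using congrFun h (Fin.castAdd d i)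
    have h2 : r u = r u' := b.equivFun.injective (by
      funext i
      simpa using congrFun h (Fin.natAdd k i))
    have h3 := congrArg Subtype.val h2
    rw [hr, hr, h1] at h3
    exact sub_left_injective h3
  · let t : LinearMap.ker A := b.equivFun.symm fun i => w (Fin.natAdd k i)
    have ht : A (t : Fin n → R) = 0 := LinearMap.mem_ker.1 t.2
    have h1 : A (K (fun i => w (Fin.castAdd d i)) + t) = fun i => w (Fin.castAdd d i) := by
      rw [map_add, hAK, ht, add_zero]
    have h2 : r (K (fun i => w (Fin.castAdd d i)) + t) = t := by
      ext1
      rw [hr, h1, add_sub_cancel_left]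
    refine ⟨K (fun i => w (Fin.castAdd d i)) + t, ?_⟩
    funext i
    refine Fin.addCases (fun i => ?_) (fun i => ?_) i
    · simp only [Fin.append_left, h1]
    · simp only [Fin.append_right, LinearMap.comp_apply, h2]
      show b.equivFun (b.equivFun.symm _) i = _
      rw [LinearEquiv.apply_symm_apply]

theorem exists_matrix_complement {m j : ℕ} (A : Matrix (Fin j) (Fin m) ℤ)
    (hA : Function.Surjective A.mulVec) :
    ∃ (d : ℕ) (D : Matrix (Fin d) (Fin m) ℤ) (B : Matrix (Fin m) (Fin (j + d)) ℤ),
      Matrix.of (Fin.append A D) * B = 1 ∧ B * Matrix.of (Fin.append A D) = 1 := by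
  obtain ⟨d, Λ, hΛ⟩ := exists_complement (Matrix.toLin' A) hA
  have h1 : ∀ u, (Matrix.of (Fin.append A (LinearMap.toMatrix' Λ))).mulVec u =
      Fin.append (Matrix.toLin' A u) (Λ u) := fun u => by
    funext i
    refine Fin.addCases (fun i => ?_) (fun i => ?_) i
    · rw [Fin.append_left]
      exact congrArg (fun r => dotProduct r u) (Fin.append_left _ _ _)
    · rw [Fin.append_right]
      exact (congrArg (fun r => dotProduct r u) (Fin.append_right _ _ _)).trans
        (congrFun (LinearMap.toMatrix'_mulVec Λ u) i)
  let T := Matrix.toLin' (Matrix.of (Fin.append A (LinearMap.toMatrix' Λ)))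
  have hT : Function.Bijective T := by
    convert hΛ using 1
    funext u
    exact h1 u
  let e := LinearEquiv.ofBijective T hT
  have h2 : Matrix.of (Fin.append A (LinearMap.toMatrix' Λ)) = LinearMap.toMatrix' T :=
    (LinearMap.toMatrix'_toLin' _).symm
  refine ⟨d, LinearMap.toMatrix' Λ, LinearMap.toMatrix' e.symm.toLinearMap, ?_, ?_⟩
  · rw [h2, ← LinearMap.toMatrix'_comp]
    convert LinearMap.toMatrix'_id using 2
    exact LinearMap.ext fun u => e.apply_symm_apply u
  · rw [h2, ← LinearMap.toMatrix'_comp]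
    convert LinearMap.toMatrix'_id using 2
    exact LinearMap.ext fun u => e.symm_apply_apply u

namespace Chart

variable {X : Space.{u}} {p : X} {n m : ℕ} {P : Set (Fin m → ℝ)} {κ : Chart X p (model n m P)}

/-- Real coordinates and some smooth monomials of a chart. -/
def coords (κ : Chart X p (model n m P)) {ι : Type} (ζ : ι → SmoothExponent P) (y : X) :
    (Fin n → ℝ) × (ι → ℂ) := (κ.xc y, fun j => κ.mon (ζ j) y)

/-- Pooling the smooth monomials lets finitely many functions be treated as functions of one common
set of coordinates, and functions nonzero at `p` are given representatives without zeros. -/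
theorem exists_smooth_forms (hP : IsPolytope P) {K : Type} [Fintype K] {f : K → X → ℂ}
    (hf : ∀ k, SmAt X p (f k)) :
    ∃ (ι : Type) (_ : Fintype ι) (ζ : ι → SmoothExponent P)
      (F : K → (Fin n → ℝ) × (ι → ℂ) → ℂ), ∀ k, ContDiff ℝ ∞ (F k) ∧
        f k =ᶠ[𝓝 p] (fun y => F k (κ.coords ζ y)) ∧ (f k p ≠ 0 → ∀ y, F k y ≠ 0) := by
  choose ι hι ζ F hF e using fun k => exists_smooth_form (κ := κ) hP (hf k)
  let ζ' : (Σ k, ι k) → SmoothExponent P := fun j => ζ j.1 j.2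
  let F' : K → (Fin n → ℝ) × ((Σ k, ι k) → ℂ) → ℂ := fun k y => F k (y.1, fun j => y.2 ⟨k, j⟩)
  have hF' : ∀ k, ContDiff ℝ ∞ (F' k) := fun k => (hF k).comp (by fun_prop)
  have e' : ∀ k, f k =ᶠ[𝓝 p] fun y => F' k (κ.coords ζ' y) := e
  have hc : Tendsto (κ.coords ζ') (𝓝 p) (𝓝 (κ.coords ζ' p)) :=
    ((continuous_coordinates ζ').continuousAt (x := κ.map p)).tendsto.comp κ.tendsto_map
  have key : ∀ k, ∃ G : (Fin n → ℝ) × ((Σ k, ι k) → ℂ) → ℂ, ContDiff ℝ ∞ G ∧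
      f k =ᶠ[𝓝 p] (fun y => G (κ.coords ζ' y)) ∧ (f k p ≠ 0 → ∀ y, G y ≠ 0) := fun k => by
    by_cases h0 : f k p = 0
    · exact ⟨F' k, hF' k, e' k, fun h => absurd h0 h⟩
    · have h1 : F' k (κ.coords ζ' p) ≠ 0 := by rwa [← (e' k).eq_of_nhds]
      obtain ⟨G, hG, hG0, hGe⟩ := exists_contDiff_ne_zero_eventuallyEq
        (Eventually.of_forall fun y => (hF' k).contDiffAt) h1
      refine ⟨G, hG, ?_, fun _ => hG0⟩
      filter_upwards [e' k, hc.eventually hGe] with y hy hy'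
      rw [hy, hy']
  choose G hG using key
  exact ⟨_, inferInstance, ζ', G, hG⟩

end Chart

/-- In centered charts only the real directions contribute to the derivatives of the real
coordinates of `π`, so surjectivity on tangent vectors makes the real Jacobian `J` surjective.
Integral vectors kill smooth factors, so on them `π` acts by the exponent matrix `A`, which is thus
surjective over `ℤ`. Complementing `J` and `A` gives new coordinates on `C` that begin with the
pulled back coordinates of `F`. -/
theorem exists_normal_form {C F : Manifold.{u}} (π : Hom C.toSpace F.toSpace) (p : C)
    (h1 : Function.Surjective (π.differential p))
    (h2 : Set.SurjOn (π.differential p) {v | v.IsIntegral} {v | v.IsIntegral}) :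
    ∃ (k j : ℕ) (Q : Set (Fin j → ℝ)) (μ : Chart F.toSpace (π p) (model k j Q)) (d' d : ℕ)
      (P : Set (Fin (j + d) → ℝ)) (κ : Chart C.toSpace p (model (k + d') (j + d) P)),
      IsPolytope Q ∧ IsPolytope P ∧ μ.ordc (π p) ∈ interior Q ∧ κ.ordc p ∈ interior P ∧
      ∀ y ∈ κ.U, π y ∈ μ.U ∧ (∀ i, κ.xc y (Fin.castAdd d' i) = μ.xc (π y) i) ∧
        ∀ i, κ.zc y (Fin.castAdd d i) = μ.zc (π y) i := by
  obtain ⟨k, j, Q, μ, hQ, hμ⟩ := (F.isModeled (π p)).exists_centered_chart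
  obtain ⟨n, m, P, κ, hP, hκ⟩ := (C.isModeled p).exists_centered_chart
  have hπ := π.morphAt p
  have hξ : ∀ i, SmAt C.toSpace p fun y => (μ.xc (π y) i : ℂ) := fun i =>
    hπ.smAt (μ.smAt_xc μ.mem i)
  have hη : ∀ i, ExplAt C.toSpace p fun y => μ.zc (π y) i := fun i =>
    hπ.2 _ (μ.explAt_zc μ.mem i)
  choose f a A hf hf0 hA using fun i => Chart.exists_exploded_form (κ := κ) hP (hη i)
  obtain ⟨ι, hι, ζ, G, hG⟩ := Chart.exists_smooth_forms (κ := κ) hP (K := Fin k ⊕ Fin j)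
    (f := Sum.elim (fun i y => (μ.xc (π y) i : ℂ)) f) (by
      rintro (i | i)
      · exact hξ i
      · exact hf i)
  have hG1 : ∀ i, ContDiff ℝ ∞ fun y => (G (Sum.inl i) y).re := fun i =>
    Complex.reCLM.contDiff.comp (hG _).1
  have e1 : ∀ i, (fun y => μ.xc (π y) i) =ᶠ[𝓝 p] fun y => (G (Sum.inl i) (κ.coords ζ y)).re :=
    fun i => by
      filter_upwards [(hG (Sum.inl i)).2.1] with y hy
      rw [← hy]
      simp
  let J : (Fin n → ℝ) →ₗ[ℝ] (Fin k → ℝ) := LinearMap.pi fun i =>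
    (fderiv ℝ (fun y => (G (Sum.inl i) y).re) (κ.coords ζ p)).toLinearMap.comp
      (LinearMap.inl ℝ (Fin n → ℝ) (ι → ℂ))
  have hJ : Function.Surjective J := fun t => by
    obtain ⟨v, hv, -⟩ := TangentVector.exists_of_coords μ t 0
    obtain ⟨w, rfl⟩ := h1 v
    refine ⟨fun l => w.dS fun y => κ.xc y l, ?_⟩
    funext i
    rw [← hv i, TangentVector.differential_dS _ _ (μ.smAt_xc μ.mem i),
      TangentVector.dS_congr (hξ i) (e1 i)]
    refine Eq.trans ?_ (TangentVector.dS_form hP hκ ζ (hG1 i)).symm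
    show fderiv ℝ (fun y => (G (Sum.inl i) y).re) (κ.coords ζ p)
      (fun l => w.dS fun y => κ.xc y l, 0) = _
    have h3 : ((fun l => w.dS fun y => κ.xc y l, 0) : (Fin n → ℝ) × (ι → ℂ)) =
        ∑ l, (w.dS fun y => κ.xc y l) • ((Pi.single l 1, 0) : (Fin n → ℝ) × (ι → ℂ)) := by
      ext l
      · simp [Prod.fst_sum, Finset.sum_apply, Pi.single_apply]
      · simp [Prod.snd_sum]
    rw [h3, map_sum]
    refine Finset.sum_congr rfl fun l _ => ?_
    rw [map_smul, smul_eq_mul, mul_comm]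
    rfl
  have hAs : Function.Surjective (Matrix.mulVec A) := fun t => by
    obtain ⟨v, hv, hv'⟩ := TangentVector.exists_of_coords μ 0 fun i => (t i : ℂ)
    have hvi : v.IsIntegral := TangentVector.isIntegral_of_coords hQ hμ hv fun i => ⟨t i, hv' i⟩
    obtain ⟨w, hw, rfl⟩ := h2 hvi
    choose s hs using fun l => TangentVector.IsIntegral.exists_dlog hw (κ.explAt_zc κ.mem l)
    refine ⟨s, ?_⟩
    funext i
    have h3 := hv' i
    rw [TangentVector.differential_dlog _ _ (μ.explAt_zc μ.mem i),
      TangentVector.dlog_form (hf i) (hf0 i) (hA i),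
      TangentVector.IsIntegral.dS_eq_zero hw ((hf i).re (C.isModeled p)),
      TangentVector.IsIntegral.dS_eq_zero hw ((hf i).im (C.isModeled p))] at h3
    simp only [hs, Complex.ofReal_zero, mul_zero, add_zero, zero_div, zero_add] at h3
    exact_mod_cast h3
  obtain ⟨d', Λ, hΛ⟩ := exists_complement J hJ
  obtain ⟨d, D, B, hAB, hBA⟩ := exists_matrix_complement A hAs
  let Λ' : (Fin n → ℝ) →L[ℝ] (Fin d' → ℝ) := LinearMap.toContinuousLinearMap Λ
  let H : (Fin n → ℝ) × (ι → ℂ) → Fin (k + d') → ℝ := fun y =>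
    Fin.append (fun i => (G (Sum.inl i) y).re) (Λ' y.1)
  have hH : ContDiff ℝ ∞ H := by
    refine contDiff_pi.2 fun i => Fin.addCases (fun i => ?_) (fun i => ?_) i
    · simpa only [H, Fin.append_left] using hG1 i
    · simp only [H, Fin.append_right]
      exact (contDiff_pi.1 (Λ'.contDiff.comp contDiff_fst)) i
  have hH' : ∀ u, fderiv ℝ H (κ.coords ζ p) (u, 0) = Fin.append (J u) (Λ u) := fun u => by
    have hd := hH.differentiable (by simp) (κ.coords ζ p)
    funext i
    refine Eq.trans (congrArg (fun L => L (u, 0))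
      (hasFDerivAt_pi'.1 hd.hasFDerivAt i).fderiv).symm ?_
    refine Fin.addCases (fun i => ?_) (fun i => ?_) i
    · simp only [H, Fin.append_left]
      rfl
    · simp only [H, Fin.append_right]
      have h3 : HasFDerivAt (fun y : (Fin n → ℝ) × (ι → ℂ) => Λ' y.1 i)
          ((ContinuousLinearMap.proj i).comp (Λ'.comp (ContinuousLinearMap.fst ℝ _ (ι → ℂ))))
          (κ.coords ζ p) := ContinuousLinearMap.hasFDerivAt
            ((ContinuousLinearMap.proj i).comp (Λ'.comp (ContinuousLinearMap.fst ℝ _ (ι → ℂ))))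
      rw [h3.fderiv]
      rfl
  obtain ⟨P', ν, hP', hν, hν'⟩ := exists_coord_change (n' := k + d') (m' := j + d) hP (κ.map p) hκ ζ hH
    (by
      convert hΛ using 1
      funext u
      exact hH' u)
    (f := Fin.append (fun i => G (Sum.inr i)) fun _ _ => 1)
    (fun i => Fin.addCases (fun i => by simpa using (hG (Sum.inr i)).1)
      (fun i => by simpa using contDiff_const) i)
    (fun i => Fin.addCases (fun i => by simpa using (hG (Sum.inr i)).2.2 (hf0 i))
      (fun i => by simp) i)
    (Fin.append a 0) hAB hBA
  have hev : ∀ᶠ y in 𝓝 p, π y ∈ μ.U ∧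
      (∀ i, (κ.trans ν).xc y (Fin.castAdd d' i) = μ.xc (π y) i) ∧
        ∀ i, (κ.trans ν).zc y (Fin.castAdd d i) = μ.zc (π y) i := by
    have h3 := hπ.1.eventually (μ.U.isOpen.mem_nhds μ.mem)
    have h4 := eventually_all.2 e1
    have h5 := eventually_all.2 hA
    have h6 := eventually_all.2 fun i => (hG (Sum.inr i)).2.1
    -- The normal form holds only where all the local expressions for `π` are valid; the chart is
    -- restricted to such a neighbourhood.
    filter_upwards [h3, h4, h5, h6] with y h3 h4 h5 h6
    refine ⟨h3, fun i => ?_, fun i => ?_⟩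
    · rw [h4]
      refine (congrFun (hν' (κ.map y)).1 _).trans ?_
      simp only [H, Fin.append_left]
      rfl
    · rw [h5]
      refine (congrFun (hν' (κ.map y)).2 _).trans ?_
      have h8 : Matrix.of (Fin.append A D) (Fin.castAdd d i) = A i := Fin.append_left _ _ _
      simp only [Fin.append_left]
      rw [monomial_eq_mul, h8]
      have h7 : f i y = G (Sum.inr i) (κ.coords ζ y) := h6 i
      rw [h7]
      rfl
  obtain ⟨W, hW, hWo, hpW⟩ := mem_nhds_iff.1 hev
  exact ⟨k, j, Q, μ, d', d, P', (κ.trans ν).restrict ⟨W, hWo⟩ hpW, hQ, hP', hμ, hν,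
    fun y hy => hW hy.2⟩

/-! ### The fiber product as an abstract exploded space -/

section

variable {C F G : Space.{u}} (π : Hom C F) (f : Hom G F)

/-- The set-theoretic fiber product. -/
def Fib : Type u := {x : C × G // π x.1 = f x.2}

variable {π f}

/-- Both components of a map to the fiber product are morphisms at a point. -/
def FibMorphAt {Y : Space.{v}} (t : Y → Fib π f) (q : Y) : Prop :=
  MorphAt (fun y => (t y).1.1) q ∧ MorphAt (fun y => (t y).1.2) q

variable (π f)

/-- The fiber product has the finest topology for which maps from open subsets of models are
continuous if their components are morphisms. -/
instance fibTopology : TopologicalSpace (Fib π f) where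
  IsOpen W := ∀ (n m : ℕ) (P : Set (Fin m → ℝ)) (Ω : Opens (model n m P))
    (t : model n m P → Fib π f), IsPolytope P → (∀ q ∈ Ω, FibMorphAt t q) →
      IsOpen {q | q ∈ Ω ∧ t q ∈ W}
  isOpen_univ n m P Ω t _ _ := by simpa using Ω.isOpen
  isOpen_inter W W' h h' n m P Ω t hP ht := by
    convert (h n m P Ω t hP ht).inter (h' n m P Ω t hP ht) using 1
    ext q
    simp only [Set.mem_ofPred_eq, Set.mem_inter_iff]
    tauto
  isOpen_sUnion s h n m P Ω t hP ht := by
    convert isOpen_biUnion fun W (hW : W ∈ s) => h W hW n m P Ω t hP ht using 1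
    ext q
    simp only [Set.mem_ofPred_eq, Set.mem_sUnion, Set.mem_iUnion, exists_prop]
    tauto

/-- The fiber product as an abstract exploded space. -/
def fibSpace : Space.{u} where
  carrier := Fib π f
  IsExploded W h := (∀ x ∈ W, (h x).coeff ≠ 0) ∧ ∀ (n m : ℕ) (P : Set (Fin m → ℝ))
    (Ω : Opens (model n m P)) (t : model n m P → Fib π f), IsPolytope P →
      (∀ q ∈ Ω, FibMorphAt t q) → ∀ q ∈ Ω, t q ∈ W → ExplAt (model n m P) q fun q => h (t q)
  coeff_ne_zero h := h.1
  congr := by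
    intro W g h e H
    refine ⟨fun x hx => e x hx ▸ H.1 x hx, fun n m P Ω t hP ht q hq hqW =>
      (H.2 n m P Ω t hP ht q hq hqW).congr ?_⟩
    have hW : IsOpen (W : Set (Fib π f)) := W.2
    filter_upwards [(hW n m P Ω t hP ht).mem_nhds ⟨hq, hqW⟩] with q' hq'
    exact e _ hq'.2
  restrict h H := ⟨fun x hx => H.1 x (h hx), fun n m P Ω t hP ht q hq hqW =>
    H.2 n m P Ω t hP ht q hq (h hqW)⟩
  glue := by
    intro W g H
    refine ⟨fun x hx => ?_, fun n m P Ω t hP ht q hq hqW => ?_⟩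
    · obtain ⟨V, hxV, -, h⟩ := H x hx
      exact h.1 x hxV
    · obtain ⟨V, hxV, -, h⟩ := H _ hqW
      exact h.2 n m P Ω t hP ht q hq hxV
  const _ c hc := ⟨fun _ _ => hc, fun _ _ _ _ _ _ _ _ _ _ => ExplAt.const _ _ hc⟩
  mul h h' := ⟨fun x hx => mul_ne_zero (h.1 x hx) (h'.1 x hx), fun n m P Ω t hP ht q hq hqW =>
    (h.2 n m P Ω t hP ht q hq hqW).mul (h'.2 n m P Ω t hP ht q hq hqW)⟩
  inv h := ⟨fun x hx => inv_ne_zero (h.1 x hx), fun n m P Ω t hP ht q hq hqW =>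
    (h.2 n m P Ω t hP ht q hq hqW).inv⟩

variable {π f}

theorem morphAt_fibSpace_of_model {n m : ℕ} {P : Set (Fin m → ℝ)} (hP : IsPolytope P)
    {t : model n m P → fibSpace π f} {q : model n m P}
    (ht : ∀ᶠ q' in 𝓝 q, FibMorphAt (π := π) (f := f) t q') : MorphAt t q := by
  obtain ⟨Ω, hΩ, hΩo, hqΩ⟩ := mem_nhds_iff.1 ht
  constructor
  · refine continuousAt_def.2 fun A hA => ?_
    obtain ⟨W, hWA, hWo, hqW⟩ := mem_nhds_iff.1 hA
    have hW : IsOpen (X := Fib π f) W := hWo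
    exact mem_of_superset ((hW n m P ⟨Ω, hΩo⟩ t hP fun q hq => hΩ hq).mem_nhds ⟨hqΩ, hqW⟩)
      fun q' hq' => hWA hq'.2
  · rintro h ⟨W, hqW, H⟩
    exact H.2 n m P ⟨Ω, hΩo⟩ t hP (fun q hq => hΩ hq) q hqΩ hqW

/-- A chart of `Y` turns the map into one of the tests that define the structure of the fiber
product. This is the existence part of the universal property. -/
theorem morphAt_fibSpace {Y : Space.{v}} {y : Y} (hY : IsModeled Y y) {t : Y → fibSpace π f}
    (ht : ∀ᶠ y' in 𝓝 y, FibMorphAt (π := π) (f := f) t y') : MorphAt t y := by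
  obtain ⟨n, m, P, hP, ⟨κ⟩⟩ := hY
  have h1 : MorphAt (fun r => t (κ.symm r)) (κ.map y) := by
    refine morphAt_fibSpace_of_model hP ?_
    filter_upwards [κ.tendsto_symm.eventually ht, κ.V.isOpen.mem_nhds κ.map_mem'] with r hr hr'
    exact ⟨MorphAt.comp (φ := κ.symm) hr.1 (κ.morph_symm r hr'),
      MorphAt.comp (φ := κ.symm) hr.2 (κ.morph_symm r hr')⟩
  refine (MorphAt.comp (ψ := fun r => t (κ.symm r)) h1 (κ.morph_map y κ.mem)).congr ?_
  filter_upwards [κ.eventually_left] with y' hy'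
  rw [hy']

theorem isOpen_fibSpace {W : Set (fibSpace π f)} : IsOpen W ↔
    ∀ (n m : ℕ) (P : Set (Fin m → ℝ)) (Ω : Opens (model n m P)) (t : model n m P → Fib π f),
      IsPolytope P → (∀ q ∈ Ω, FibMorphAt t q) → IsOpen {q | q ∈ Ω ∧ t q ∈ W} := Iff.rfl

/-- The fiber product carries the final structure for the test maps, so a map out of it only has to
be checked after composition with them. -/
theorem morphAt_of_tests {Y : Space.{v}} {W : Opens (fibSpace π f)} {φ : fibSpace π f → Y}
    (H : ∀ (n m : ℕ) (P : Set (Fin m → ℝ)) (Ω : Opens (model n m P)) (t : model n m P → Fib π f),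
      IsPolytope P → (∀ q ∈ Ω, FibMorphAt t q) → ∀ q ∈ Ω, t q ∈ W →
        MorphAt (fun q => φ (t q)) q) {x : fibSpace π f} (hx : x ∈ W) : MorphAt φ x := by
  have hopen : ∀ V : Opens Y, IsOpen {x | x ∈ W ∧ φ x ∈ V} := fun V =>
    isOpen_fibSpace.2 fun n m P Ω t hP ht => by
      have h1 := isOpen_fibSpace.1 W.isOpen n m P Ω t hP ht
      convert isOpen_preimage_of_morphAt (U := ⟨_, h1⟩) (φ := fun q => φ (t q))
        (fun q hq => H n m P Ω t hP ht q hq.1 hq.2) V using 1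
      ext q
      simp only [Set.mem_ofPred_eq]
      exact and_assoc.symm
  constructor
  · refine continuousAt_def.2 fun A hA => ?_
    obtain ⟨V, hVA, hVo, hxV⟩ := mem_nhds_iff.1 hA
    exact mem_of_superset ((hopen ⟨V, hVo⟩).mem_nhds ⟨hx, hxV⟩) fun y hy => hVA hy.2
  · rintro h ⟨V, hxV, hh⟩
    refine ⟨⟨_, hopen V⟩, ⟨hx, hxV⟩, fun y hy => Y.coeff_ne_zero hh _ hy.2,
      fun n m P Ω t hP ht q hq hqW => ?_⟩
    exact (H n m P Ω t hP ht q hq hqW.1).2 h ⟨V, hqW.2, hh⟩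

variable (π f)

/-- The first projection. -/
def fibFst : Hom (fibSpace π f) C := Hom.ofMorphAt (fun x => x.1.1) fun _ =>
  morphAt_of_tests (W := ⊤) (fun _ _ _ _ _ _ ht q hq _ => (ht q hq).1) trivial

/-- The second projection. -/
def fibSnd : Hom (fibSpace π f) G := Hom.ofMorphAt (fun x => x.1.2) fun _ =>
  morphAt_of_tests (W := ⊤) (fun _ _ _ _ _ _ ht q hq _ => (ht q hq).2) trivial

end

/-! ### Charts of the fiber product -/

/-- Compatible charts around points `c` and `g` with the same image: `π` is a projection in the
charts `κ` and `μ`, and the exploded coordinates of `f` are given by `ψ`, `a` and `A`. -/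
structure LocalData {C F G : Manifold.{u}} (π : Hom C.toSpace F.toSpace) (f : Hom G.toSpace F.toSpace)
    (c : C) (g : G) where
  (k j d' d n m : ℕ)
  Q : Set (Fin j → ℝ)
  P : Set (Fin (j + d) → ℝ)
  R : Set (Fin m → ℝ)
  μ : Chart F.toSpace (π c) (model k j Q)
  κ : Chart C.toSpace c (model (k + d') (j + d) P)
  ν : Chart G.toSpace g (model n m R)
  hP : IsPolytope P
  hR : IsPolytope R
  hκ : κ.ordc c ∈ interior P
  hν : ν.ordc g ∈ interior R
  κ_mem : ∀ y ∈ κ.U, π y ∈ μ.U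
  κ_xc : ∀ y ∈ κ.U, ∀ i, κ.xc y (Fin.castAdd d' i) = μ.xc (π y) i
  κ_zc : ∀ y ∈ κ.U, ∀ i, κ.zc y (Fin.castAdd d i) = μ.zc (π y) i
  ψ : Fin j → G → ℂ
  a : Fin j → ℝ
  A : Matrix (Fin j) (Fin m) ℤ
  smAt_ψ : ∀ i, SmAt G.toSpace g (ψ i)
  ψ_ne_zero : ∀ i, ψ i g ≠ 0
  ν_mem : ∀ y ∈ ν.U, f y ∈ μ.U
  ν_zc : ∀ y ∈ ν.U, ∀ i, μ.zc (f y) i = ⟨ψ i y, 0⟩ * monomial 1 (a i) (A i) (ν.zc y)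

section

variable {C F G : Manifold.{u}} {π : Hom C.toSpace F.toSpace} {f : Hom G.toSpace F.toSpace}

theorem nonempty_localData {c : C} {g : G} (h : π c = f g)
    (h1 : Function.Surjective (π.differential c))
    (h2 : Set.SurjOn (π.differential c) {v | v.IsIntegral} {v | v.IsIntegral}) :
    Nonempty (LocalData π f c g) := by
  obtain ⟨k, j, Q, μ, d', d, P, κ, -, hP, -, hκ, H⟩ := exists_normal_form π c h1 h2
  obtain ⟨n, m, R, ν, hR, hν⟩ := (G.isModeled g).exists_centered_chart
  have hg : f g ∈ μ.U := h ▸ μ.mem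
  have hη : ∀ i, ExplAt G.toSpace g fun y => μ.zc (f y) i := fun i =>
    (f.morphAt g).2 _ (μ.explAt_zc hg i)
  choose ψ a A hψ hψ0 hA using fun i => Chart.exists_exploded_form (κ := ν) hR (hη i)
  obtain ⟨W, hW, hWo, hgW⟩ := mem_nhds_iff.1
    (((f.continuous.continuousAt.eventually (μ.U.isOpen.mem_nhds hg))).and (eventually_all.2 hA))
  exact ⟨{
    k := k, j := j, d' := d', d := d, n := n, m := m, Q := Q, P := P, R := R, μ := μ, κ := κ
    ν := ν.restrict ⟨W, hWo⟩ hgW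
    hP := hP, hR := hR, hκ := hκ, hν := hν
    κ_mem := fun y hy => (H y hy).1
    κ_xc := fun y hy => (H y hy).2.1
    κ_zc := fun y hy => (H y hy).2.2
    ψ := ψ, a := a, A := A, smAt_ψ := hψ, ψ_ne_zero := hψ0
    ν_mem := fun y hy => (hW hy.2).1
    ν_zc := fun y hy => (hW hy.2).2 }⟩

namespace LocalData

variable {c : C} {g : G} (D : LocalData π f c g)

theorem ν_ord {y : G} (hy : y ∈ D.ν.U) :
    (fun i => (D.μ.zc (f y) i).order) = affMap D.a D.A (D.ν.ordc y) := by
  funext i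
  rw [D.ν_zc y hy]
  simp only [Number.mul_order, zero_add]
  rfl

/-- The projection to the tropical coordinates of `G`. -/
def baseMatrix : Matrix (Fin D.m) (Fin (D.d + D.m)) ℤ := Matrix.of fun i => Fin.append 0 (Pi.single i 1)

/-- The linear part of the map to the tropical coordinates of `C`. -/
def totalMatrix : Matrix (Fin (D.j + D.d)) (Fin (D.d + D.m)) ℤ :=
  Matrix.of (Fin.append (fun i => Fin.append 0 (D.A i)) fun i => Fin.append (Pi.single i 1) 0)

theorem affMap_baseMatrix (y : Fin (D.d + D.m) → ℝ) :
    affMap 0 D.baseMatrix y = fun i => y (Fin.natAdd D.d i) := by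
  funext i
  simp [affMap, affine, baseMatrix, Fin.sum_univ_add, Pi.single_apply, -Fin.natAdd_eq_addNat]

theorem affMap_totalMatrix (y : Fin (D.d + D.m) → ℝ) :
    affMap (Fin.append D.a 0) D.totalMatrix y =
      Fin.append (affMap D.a D.A fun i => y (Fin.natAdd D.d i)) fun i => y (Fin.castAdd D.m i) := by
  funext i
  refine Fin.addCases (fun i => ?_) (fun i => ?_) i
  · have h : D.totalMatrix (Fin.castAdd D.d i) = Fin.append 0 (D.A i) :=
      Fin.append_left (fun i => Fin.append (0 : Fin D.d → ℤ) (D.A i)) (fun i => Fin.append (Pi.single i 1) 0) i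
    simp only [affMap, Fin.append_left, h]
    simp [affine, Fin.sum_univ_add, -Fin.natAdd_eq_addNat]
  · have h : D.totalMatrix (Fin.natAdd D.j i) = Fin.append (Pi.single i 1) 0 :=
      Fin.append_right (fun i => Fin.append (0 : Fin D.d → ℤ) (D.A i)) (fun i => Fin.append (Pi.single i 1) 0) i
    simp only [affMap, Fin.append_right, h]
    simp [affine, Fin.sum_univ_add, Pi.single_apply, -Fin.natAdd_eq_addNat]

/-- The polytope of the fiber product. -/
def S : Set (Fin (D.d + D.m) → ℝ) :=
  affMap 0 D.baseMatrix ⁻¹' D.R ∩ affMap (Fin.append D.a 0) D.totalMatrix ⁻¹' D.P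

/-- In normal form the first coordinates of `c'` are those of `π c' = f g'`, hence functions of
`g'`; only the fiber coordinates are free. -/
theorem ordc_eq {c' : C} {g' : G} (h : π c' = f g') (hc : c' ∈ D.κ.U) (hg : g' ∈ D.ν.U) :
    D.κ.ordc c' = Fin.append (affMap D.a D.A (D.ν.ordc g'))
      fun i => D.κ.ordc c' (Fin.natAdd D.j i) := by
  funext i
  refine Fin.addCases (fun i => ?_) (fun i => ?_) i
  · rw [Fin.append_left, ← D.ν_ord hg, ← h]
    exact congrArg Number.order (D.κ_zc c' hc i)
  · rw [Fin.append_right]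

/-- The real coordinates on the fiber product. -/
def xcoord (c' : C) (g' : G) : Fin (D.d' + D.n) → ℝ :=
  Fin.append (fun i => D.κ.xc c' (Fin.natAdd D.k i)) (D.ν.xc g')

/-- The exploded coordinates on the fiber product. -/
def zcoord (c' : C) (g' : G) : Fin (D.d + D.m) → Number :=
  Fin.append (fun i => D.κ.zc c' (Fin.natAdd D.j i)) (D.ν.zc g')

theorem zcoord_coeff_ne_zero (c' : C) (g' : G) (i : Fin (D.d + D.m)) :
    (D.zcoord c' g' i).coeff ≠ 0 := by
  refine Fin.addCases (fun i => ?_) (fun i => ?_) i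
  · rw [zcoord, Fin.append_left]
    exact D.κ.zc_coeff_ne_zero _ _
  · rw [zcoord, Fin.append_right]
    exact D.ν.zc_coeff_ne_zero _ _

theorem base_zcoord (c' : C) (g' : G) :
    affMap 0 D.baseMatrix (fun i => (D.zcoord c' g' i).order) = D.ν.ordc g' := by
  rw [affMap_baseMatrix]
  funext i
  rw [zcoord, Fin.append_right]
  rfl

theorem total_zcoord {c' : C} {g' : G} (h : π c' = f g') (hc : c' ∈ D.κ.U) (hg : g' ∈ D.ν.U) :
    affMap (Fin.append D.a 0) D.totalMatrix (fun i => (D.zcoord c' g' i).order) = D.κ.ordc c' := by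
  rw [affMap_totalMatrix, D.ordc_eq h hc hg]
  simp only [zcoord, Fin.append_left, Fin.append_right]
  rfl

theorem order_mem_S {c' : C} {g' : G} (h : π c' = f g') (hc : c' ∈ D.κ.U) (hg : g' ∈ D.ν.U) :
    (fun i => (D.zcoord c' g' i).order) ∈ D.S := by
  constructor
  · rw [Set.mem_preimage, base_zcoord]
    exact D.ν.ordc_mem g'
  · rw [Set.mem_preimage, D.total_zcoord h hc hg]
    exact D.κ.ordc_mem c'

/-- Both charts are centered, so the point lies in the preimages of both interiors, which are open.
This is what keeps the fiber product of the polytopes full-dimensional. -/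
theorem order_mem_interior_S (h : π c = f g) :
    (fun i => (D.zcoord c g i).order) ∈ interior D.S := by
  refine interior_maximal (Set.inter_subset_inter (Set.preimage_mono interior_subset)
    (Set.preimage_mono interior_subset)) ((isOpen_interior.preimage (continuous_affMap _ _)).inter
      (isOpen_interior.preimage (continuous_affMap _ _))) ⟨?_, ?_⟩
  · rw [Set.mem_preimage, base_zcoord]
    exact D.hν
  · rw [Set.mem_preimage, D.total_zcoord h D.κ.mem D.ν.mem]
    exact D.hκ

theorem S_eq : ∀ {s s' : Finset (ℝ × (Fin (D.j + D.d) → ℤ))} {r r' : Finset (ℝ × (Fin D.m → ℤ))},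
    D.P = polyhedron s s' → D.R = polyhedron r r' → D.S =
      polyhedron (r.image (pullIneq 0 D.baseMatrix) ∪
          s.image (pullIneq (Fin.append D.a 0) D.totalMatrix))
        (r'.image (pullIneq 0 D.baseMatrix) ∪
          s'.image (pullIneq (Fin.append D.a 0) D.totalMatrix)) := by
  intro s s' r r' h h'
  rw [S, h, h', preimage_polyhedron, preimage_polyhedron]
  ext y
  simp only [polyhedron, Set.mem_inter_iff, Set.mem_ofPred_eq, Finset.mem_union, or_imp,
    forall_and]
  tauto

theorem isPolytope_S (h : π c = f g) : IsPolytope D.S := by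
  obtain ⟨-, s, s', hP⟩ := D.hP
  obtain ⟨-, r, r', hR⟩ := D.hR
  exact ⟨⟨_, D.order_mem_interior_S h⟩, _, _, D.S_eq hP hR⟩

/-- A point of the model of the fiber product. -/
def toModel (h : π c = f g) (c' : C) (g' : G) : ModelPoint (D.d' + D.n) (D.d + D.m) D.S :=
  mkPoint ⟨D.xcoord c g, ⟨D.zcoord c g, D.zcoord_coeff_ne_zero c g,
    D.order_mem_S h D.κ.mem D.ν.mem⟩⟩ (D.xcoord c' g') (D.zcoord c' g')

theorem toModel_eq (h : π c = f g) {c' : C} {g' : G} (h' : π c' = f g') (hc : c' ∈ D.κ.U)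
    (hg : g' ∈ D.ν.U) : D.toModel h c' g' = ⟨D.xcoord c' g', ⟨D.zcoord c' g',
      D.zcoord_coeff_ne_zero c' g', D.order_mem_S h' hc hg⟩⟩ := mkPoint_eq _ _ _

/-- The component in the model of `G`. -/
def gModel (r : ModelPoint (D.d' + D.n) (D.d + D.m) D.S) : ModelPoint D.n D.m D.R :=
  ⟨fun i => r.x (Fin.natAdd D.d' i), ⟨fun i => r.pt.z (Fin.natAdd D.d i),
    fun i => r.pt.coeff_ne_zero _, by
      have := r.ord_mem.1
      rw [Set.mem_preimage, affMap_baseMatrix] at this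
      exact this⟩⟩

/-- The component in `G`. -/
def gPoint (r : ModelPoint (D.d' + D.n) (D.d + D.m) D.S) : G := D.ν.symm (D.gModel r)

/-- The component in the model of `C`. -/
def cModel (r : ModelPoint (D.d' + D.n) (D.d + D.m) D.S) :
    ModelPoint (D.k + D.d') (D.j + D.d) D.P :=
  mkPoint (D.κ.map c) (Fin.append (D.μ.xc (f (D.gPoint r))) fun i => r.x (Fin.castAdd D.n i))
    (Fin.append (D.μ.zc (f (D.gPoint r))) fun i => r.pt.z (Fin.castAdd D.m i))

/-- The component in `C`. -/
def cPoint (r : ModelPoint (D.d' + D.n) (D.d + D.m) D.S) : C := D.κ.symm (D.cModel r)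

theorem morphAt_gPoint (h : π c = f g) {r : ModelPoint (D.d' + D.n) (D.d + D.m) D.S}
    (hr : D.gModel r ∈ D.ν.V) :
    MorphAt (X := model (D.d' + D.n) (D.d + D.m) D.S) D.gPoint r :=
  MorphAt.comp (X := model (D.d' + D.n) (D.d + D.m) D.S) (Y := model D.n D.m D.R)
    (φ := D.gModel) (D.ν.morph_symm _ hr)
    (morphAt_model (X := model (D.d' + D.n) (D.d + D.m) D.S) (isModeled_model (D.isPolytope_S h) r)
      (fun _ => r.smAt_x _) fun _ => r.explAt_z _)

theorem gPoint_mem {r : ModelPoint (D.d' + D.n) (D.d + D.m) D.S} (hr : D.gModel r ∈ D.ν.V) :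
    D.gPoint r ∈ D.ν.U := D.ν.symm_mem _ hr

theorem ν_map_gPoint {r : ModelPoint (D.d' + D.n) (D.d + D.m) D.S} (hr : D.gModel r ∈ D.ν.V) :
    D.ν.map (D.gPoint r) = D.gModel r := D.ν.right _ hr

theorem cModel_mem {r : ModelPoint (D.d' + D.n) (D.d + D.m) D.S} (hr : D.gModel r ∈ D.ν.V) :
    (fun i => (Fin.append (D.μ.zc (f (D.gPoint r))) (fun i => r.pt.z (Fin.castAdd D.m i)) i).order) ∈
      D.P := by
  have h1 := r.ord_mem.2
  rw [Set.mem_preimage, affMap_totalMatrix] at h1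
  convert h1 using 1
  funext i
  refine Fin.addCases (fun i => ?_) (fun i => ?_) i
  · rw [Fin.append_left, Fin.append_left]
    refine (congrFun (D.ν_ord (D.gPoint_mem hr)) i).trans ?_
    rw [Chart.ordc, D.ν_map_gPoint hr]
    rfl
  · rw [Fin.append_right, Fin.append_right]
    rfl

theorem cModel_eq {r : ModelPoint (D.d' + D.n) (D.d + D.m) D.S} (hr : D.gModel r ∈ D.ν.V) :
    D.cModel r = ⟨Fin.append (D.μ.xc (f (D.gPoint r))) fun i => r.x (Fin.castAdd D.n i),
      ⟨Fin.append (D.μ.zc (f (D.gPoint r))) fun i => r.pt.z (Fin.castAdd D.m i), by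
        refine Fin.addCases (fun i => ?_) (fun i => ?_)
        · rw [Fin.append_left]
          exact D.μ.zc_coeff_ne_zero _ _
        · rw [Fin.append_right]
          exact r.pt.coeff_ne_zero _, D.cModel_mem hr⟩⟩ := mkPoint_eq _ _ _

theorem eventually_gModel (h : π c = f g) {r : ModelPoint (D.d' + D.n) (D.d + D.m) D.S}
    (hr : D.gModel r ∈ D.ν.V) : ∀ᶠ r' in 𝓝 r, D.gModel r' ∈ D.ν.V :=
  (morphAt_model (X := model (D.d' + D.n) (D.d + D.m) D.S) (isModeled_model (D.isPolytope_S h) r)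
      (φ := D.gModel) (fun _ => r.smAt_x _) fun _ => r.explAt_z _).1.eventually
    (D.ν.V.isOpen.mem_nhds hr)

theorem morphAt_cModel (h : π c = f g) {r : ModelPoint (D.d' + D.n) (D.d + D.m) D.S}
    (hr : D.gModel r ∈ D.ν.V) :
    MorphAt (X := model (D.d' + D.n) (D.d + D.m) D.S) (Y := model (D.k + D.d') (D.j + D.d) D.P)
      D.cModel r := by
  have hg := D.morphAt_gPoint h hr
  have hfg := MorphAt.comp (X := model (D.d' + D.n) (D.d + D.m) D.S) (f.morphAt _) hg
  have hU := D.ν_mem _ (D.gPoint_mem hr)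
  refine morphAt_mkPoint (X := model (D.d' + D.n) (D.d + D.m) D.S) _
    (isModeled_model (D.isPolytope_S h) r) (fun i => ?_) (fun i => ?_) ?_
  · refine Fin.addCases (fun i => ?_) (fun i => ?_) i
    · simp only [Fin.append_left]
      exact hfg.smAt (D.μ.smAt_xc hU i)
    · simp only [Fin.append_right]
      exact r.smAt_x _
  · refine Fin.addCases (fun i => ?_) (fun i => ?_) i
    · simp only [Fin.append_left]
      exact hfg.2 _ (D.μ.explAt_zc hU i)
    · simp only [Fin.append_right]
      exact r.explAt_z _
  · filter_upwards [D.eventually_gModel h hr] with r' hr'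
    exact D.cModel_mem hr'

/-- Equality can be tested in the chart `μ`, whose coordinates are the first ones of `κ`; the
component in `C` was built with these equal to the coordinates of `f (D.gPoint r)`. -/
theorem π_cPoint {r : ModelPoint (D.d' + D.n) (D.d + D.m) D.S} (hr : D.gModel r ∈ D.ν.V)
    (hr' : D.cModel r ∈ D.κ.V) : π (D.cPoint r) = f (D.gPoint r) := by
  have hc : D.cPoint r ∈ D.κ.U := D.κ.symm_mem _ hr'
  have hm : D.κ.map (D.cPoint r) = D.cModel r := D.κ.right _ hr'
  rw [D.cModel_eq hr] at hm
  rw [← D.μ.left _ (D.κ_mem _ hc), ← D.μ.left _ (D.ν_mem _ (D.gPoint_mem hr))]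
  congr 1
  refine ModelPoint.ext ?_ (TorusPoint.ext ?_)
  · funext i
    refine (D.κ_xc _ hc i).symm.trans ?_
    rw [Chart.xc, hm]
    exact Fin.append_left (D.μ.xc (f (D.gPoint r))) (fun i => r.x (Fin.castAdd D.n i)) i
  · funext i
    refine (D.κ_zc _ hc i).symm.trans ?_
    rw [Chart.zc, hm]
    exact Fin.append_left (D.μ.zc (f (D.gPoint r))) (fun i => r.pt.z (Fin.castAdd D.m i)) i

open Classical in
/-- The inverse of the chart. -/
def ofModel (h : π c = f g) (r : ModelPoint (D.d' + D.n) (D.d + D.m) D.S) : fibSpace π f :=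
  if h' : π (D.cPoint r) = f (D.gPoint r) then ⟨(D.cPoint r, D.gPoint r), h'⟩ else ⟨(c, g), h⟩

theorem ofModel_eq (h : π c = f g) {r : ModelPoint (D.d' + D.n) (D.d + D.m) D.S}
    (hr : D.gModel r ∈ D.ν.V) (hr' : D.cModel r ∈ D.κ.V) :
    D.ofModel h r = ⟨(D.cPoint r, D.gPoint r), D.π_cPoint hr hr'⟩ := dif_pos _

theorem gModel_toModel (h : π c = f g) {c' : C} {g' : G} (h' : π c' = f g') (hc : c' ∈ D.κ.U)
    (hg : g' ∈ D.ν.U) : D.gModel (D.toModel h c' g') = D.ν.map g' := by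
  rw [D.toModel_eq h h' hc hg]
  refine ModelPoint.ext ?_ (TorusPoint.ext ?_)
  · funext i
    exact Fin.append_right (fun i => D.κ.xc c' (Fin.natAdd D.k i)) (D.ν.xc g') i
  · funext i
    exact Fin.append_right (fun i => D.κ.zc c' (Fin.natAdd D.j i)) (D.ν.zc g') i

theorem gPoint_toModel (h : π c = f g) {c' : C} {g' : G} (h' : π c' = f g') (hc : c' ∈ D.κ.U)
    (hg : g' ∈ D.ν.U) : D.gPoint (D.toModel h c' g') = g' := by
  rw [gPoint, D.gModel_toModel h h' hc hg]
  exact D.ν.left _ hg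

theorem cModel_toModel (h : π c = f g) {c' : C} {g' : G} (h' : π c' = f g') (hc : c' ∈ D.κ.U)
    (hg : g' ∈ D.ν.U) : D.cModel (D.toModel h c' g') = D.κ.map c' := by
  have hr : D.gModel (D.toModel h c' g') ∈ D.ν.V := by
    rw [D.gModel_toModel h h' hc hg]
    exact D.ν.map_mem _ hg
  rw [D.cModel_eq hr]
  refine ModelPoint.ext ?_ (TorusPoint.ext ?_)
  · funext i
    refine Fin.addCases (fun i => ?_) (fun i => ?_) i
    · simp only [Fin.append_left]
      rw [D.gPoint_toModel h h' hc hg, ← h']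
      exact (D.κ_xc _ hc i).symm
    · simp only [Fin.append_right]
      rw [D.toModel_eq h h' hc hg]
      exact Fin.append_left (fun i => D.κ.xc c' (Fin.natAdd D.k i)) (D.ν.xc g') i
  · funext i
    refine Fin.addCases (fun i => ?_) (fun i => ?_) i
    · simp only [Fin.append_left]
      rw [D.gPoint_toModel h h' hc hg, ← h']
      exact (D.κ_zc _ hc i).symm
    · simp only [Fin.append_right]
      rw [D.toModel_eq h h' hc hg]
      exact Fin.append_left (fun i => D.κ.zc c' (Fin.natAdd D.j i)) (D.ν.zc g') i

/-- The chart of the fiber product at `(c, g)`. -/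
def chart (h : π c = f g) :
    Chart (fibSpace π f) ⟨(c, g), h⟩ (model (D.d' + D.n) (D.d + D.m) D.S) where
  U := D.κ.U.comap ⟨_, (fibFst π f).continuous⟩ ⊓ D.ν.U.comap ⟨_, (fibSnd π f).continuous⟩
  V := ⟨{r | (r ∈ (⟨{r | D.gModel r ∈ D.ν.V}, isOpen_iff_eventually.2 fun r hr =>
    D.eventually_gModel h hr⟩ : Opens (model (D.d' + D.n) (D.d + D.m) D.S))) ∧ D.cModel r ∈ D.κ.V},
      isOpen_preimage_of_morphAt (Y := model (D.k + D.d') (D.j + D.d) D.P)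
        (fun r hr => D.morphAt_cModel h hr) D.κ.V⟩
  map x := D.toModel h x.1.1 x.1.2
  symm := D.ofModel h
  mem := ⟨D.κ.mem, D.ν.mem⟩
  map_mem := by
    rintro ⟨⟨c', g'⟩, h'⟩ ⟨hc, hg⟩
    constructor
    · show D.gModel (D.toModel h c' g') ∈ D.ν.V
      rw [D.gModel_toModel h h' hc hg]
      exact D.ν.map_mem _ hg
    · show D.cModel (D.toModel h c' g') ∈ D.κ.V
      rw [D.cModel_toModel h h' hc hg]
      exact D.κ.map_mem _ hc
  symm_mem := by
    rintro r ⟨hr, hr'⟩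
    rw [D.ofModel_eq h hr hr']
    exact ⟨D.κ.symm_mem _ hr', D.gPoint_mem hr⟩
  left := by
    rintro ⟨⟨c', g'⟩, h'⟩ ⟨hc, hg⟩
    have h1 : D.gModel (D.toModel h c' g') ∈ D.ν.V := by
      rw [D.gModel_toModel h h' hc hg]
      exact D.ν.map_mem _ hg
    have h2 : D.cModel (D.toModel h c' g') ∈ D.κ.V := by
      rw [D.cModel_toModel h h' hc hg]
      exact D.κ.map_mem _ hc
    rw [D.ofModel_eq h h1 h2]
    refine Subtype.ext (Prod.ext ?_ (D.gPoint_toModel h h' hc hg))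
    show D.κ.symm (D.cModel (D.toModel h c' g')) = c'
    rw [D.cModel_toModel h h' hc hg]
    exact D.κ.left _ hc
  right := by
    rintro r ⟨hr, hr'⟩
    rw [D.ofModel_eq h hr hr']
    show D.toModel h (D.cPoint r) (D.gPoint r) = r
    have hm : D.κ.map (D.cPoint r) = D.cModel r := D.κ.right _ hr'
    have hm' := D.ν_map_gPoint hr
    rw [D.cModel_eq hr] at hm
    rw [D.toModel_eq h (D.π_cPoint hr hr') (D.κ.symm_mem _ hr') (D.gPoint_mem hr)]
    refine ModelPoint.ext ?_ (TorusPoint.ext ?_)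
    · funext i
      refine Fin.addCases (fun i => ?_) (fun i => ?_) i
      · simp only [xcoord, Fin.append_left]
        rw [Chart.xc, hm]
        exact Fin.append_right (D.μ.xc (f (D.gPoint r))) (fun i => r.x (Fin.castAdd D.n i)) i
      · simp only [xcoord, Fin.append_right]
        rw [Chart.xc, hm']
        rfl
    · funext i
      refine Fin.addCases (fun i => ?_) (fun i => ?_) i
      · simp only [zcoord, Fin.append_left]
        rw [Chart.zc, hm]
        exact Fin.append_right (D.μ.zc (f (D.gPoint r))) (fun i => r.pt.z (Fin.castAdd D.m i)) i
      · simp only [zcoord, Fin.append_right]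
        rw [Chart.zc, hm']
        rfl
  morph_map x hx := by
    -- Along a test map the coordinates are pulled back from `C` and `G` by morphisms, and the
    -- orders stay in the polytope because test maps take values in the fiber product.
    refine morphAt_of_tests (Y := model (D.d' + D.n) (D.d + D.m) D.S)
      (φ := fun x => D.toModel h x.1.1 x.1.2) (fun n m P Ω t hP ht q hq hqW => ?_) hx
    refine morphAt_mkPoint _ (isModeled_model hP q) (fun i => ?_) (fun i => ?_) ?_
    · refine Fin.addCases (fun i => ?_) (fun i => ?_) i
      · simp only [xcoord, Fin.append_left]
        exact (ht q hq).1.smAt (D.κ.smAt_xc hqW.1 _)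
      · simp only [xcoord, Fin.append_right]
        exact (ht q hq).2.smAt (D.ν.smAt_xc hqW.2 _)
    · refine Fin.addCases (fun i => ?_) (fun i => ?_) i
      · simp only [zcoord, Fin.append_left]
        exact (ht q hq).1.2 _ (D.κ.explAt_zc hqW.1 _)
      · simp only [zcoord, Fin.append_right]
        exact (ht q hq).2.2 _ (D.ν.explAt_zc hqW.2 _)
    · filter_upwards [(ht q hq).1.1.eventually (D.κ.U.isOpen.mem_nhds hqW.1),
        (ht q hq).2.1.eventually (D.ν.U.isOpen.mem_nhds hqW.2)] with q' h1 h2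
      exact D.order_mem_S (t q').2 h1 h2
  morph_symm := by
    have hc : ∀ r : ModelPoint (D.d' + D.n) (D.d + D.m) D.S, D.gModel r ∈ D.ν.V →
        D.cModel r ∈ D.κ.V → MorphAt (X := model (D.d' + D.n) (D.d + D.m) D.S) D.cPoint r :=
      fun r hr hr' => MorphAt.comp (X := model (D.d' + D.n) (D.d + D.m) D.S)
        (Y := model (D.k + D.d') (D.j + D.d) D.P) (φ := D.cModel) (D.κ.morph_symm _ hr')
          (D.morphAt_cModel h hr)
    rintro r ⟨hr, hr'⟩
    have key : ∀ᶠ r' : ModelPoint (D.d' + D.n) (D.d + D.m) D.S in 𝓝 r,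
        D.gModel r' ∈ D.ν.V ∧ D.cModel r' ∈ D.κ.V :=
      (D.eventually_gModel h hr).and ((D.morphAt_cModel h hr).1.eventually
        (D.κ.V.isOpen.mem_nhds hr'))
    refine morphAt_fibSpace (isModeled_model (D.isPolytope_S h) r) ?_
    -- The components have to be morphisms at all nearby points, so the formula for the inverse is
    -- needed in a neighbourhood of each of them.
    filter_upwards [key.eventually_nhds] with r' hr'
    have hn := hr'.self_of_nhds
    refine ⟨(hc r' hn.1 hn.2).congr ?_, (D.morphAt_gPoint h hn.1).congr ?_⟩
    · filter_upwards [hr'] with r'' h''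
      rw [D.ofModel_eq h h''.1 h''.2]
    · filter_upwards [hr'] with r'' h''
      rw [D.ofModel_eq h h''.1 h''.2]

end LocalData

end

/-! ### Existence of fiber products -/

section

variable {C F G : Manifold.{u}} {π : Hom C.toSpace F.toSpace} {f : Hom G.toSpace F.toSpace}

/-- The fiber product as an exploded manifold. -/
def fibManifold (hπ : ∀ p : C, Function.Surjective (π.differential p) ∧
    Set.SurjOn (π.differential p) {v | v.IsIntegral} {v | v.IsIntegral})
    (f : Hom G.toSpace F.toSpace) : Manifold.{u} where
  toSpace := fibSpace π f
  locally_model := by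
    rintro ⟨⟨c, g⟩, h⟩
    obtain ⟨D⟩ := nonempty_localData (f := f) h (hπ c).1 (hπ c).2
    exact ⟨(D.chart h).U, (D.chart h).mem, _, _, _, (D.chart h).V, D.isPolytope_S h,
      (D.chart h).isomorphic⟩

/-- `X` has the points and the charts of the fiber product. -/
structure IsFib {X : Manifold.{u}} (π : Hom C.toSpace F.toSpace) (f : Hom G.toSpace F.toSpace)
    (fst : Hom X.toSpace C.toSpace) (snd : Hom X.toSpace G.toSpace) : Prop where
  comm : ∀ x, π (fst x) = f (snd x)
  exists_point : ∀ c g, π c = f g → ∃ x, fst x = c ∧ snd x = g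
  exists_chart : ∀ (x : X) (D : LocalData π f (fst x) (snd x)),
    ∃ κ : Chart X.toSpace x (model (D.d' + D.n) (D.d + D.m) D.S),
      (∀ x', x' ∈ κ.U ↔ fst x' ∈ D.κ.U ∧ snd x' ∈ D.ν.U) ∧
      ∀ x' ∈ κ.U, κ.xc x' = D.xcoord (fst x') (snd x') ∧ κ.zc x' = D.zcoord (fst x') (snd x')

end

variable {C F G : Manifold.{u}}

theorem isPullback_fibManifold (π : C ⟶ F) (hπ : ∀ p : C, Function.Surjective (Hom.differential π p) ∧
    Set.SurjOn (Hom.differential π p) {v | v.IsIntegral} {v | v.IsIntegral}) (f : G ⟶ F) :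
    IsPullback (C := Manifold.{u}) (P := fibManifold hπ f) (fibFst π f) (fibSnd π f) π f := by
  have comm : ∀ s : Limits.PullbackCone π f, ∀ y : s.pt.carrier,
      Hom.toFun π (Hom.toFun s.fst y) = Hom.toFun f (Hom.toFun s.snd y) := fun s y =>
    congrFun (congrArg Hom.toFun s.condition) y
  let lift : ∀ s : Limits.PullbackCone π f, s.pt ⟶ fibManifold hπ f := fun s =>
    Hom.ofMorphAt (Y := fibSpace π f) (fun y => ⟨(Hom.toFun s.fst y, Hom.toFun s.snd y), comm s y⟩)
      fun y => morphAt_fibSpace (s.pt.isModeled y) (Eventually.of_forall fun y' =>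
        ⟨Hom.morphAt s.fst y', Hom.morphAt s.snd y'⟩)
  refine ⟨⟨Hom.ext (funext fun x => x.2)⟩, ⟨Limits.PullbackCone.IsLimit.mk _ lift ?_ ?_ ?_⟩⟩
  · intro s
    rfl
  · intro s
    rfl
  · intro s m h1 h2
    refine Hom.ext (funext fun y => Subtype.ext (Prod.ext ?_ ?_))
    · exact congrFun (congrArg Hom.toFun h1) y
    · exact congrFun (congrArg Hom.toFun h2) y

/-- Any pullback is isomorphic to the constructed one over `C` and `G`, so points and charts can be
transported to it. -/
theorem IsFib.of_isPullback {π : C ⟶ F} (hπ : ∀ p : C, Function.Surjective (Hom.differential π p) ∧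
    Set.SurjOn (Hom.differential π p) {v | v.IsIntegral} {v | v.IsIntegral}) {f : G ⟶ F}
    {X : Manifold.{u}} {fst : X ⟶ C} {snd : X ⟶ G} (H : IsPullback fst snd π f) :
    IsFib (X := X) π f fst snd := by
  let e := H.isoIsPullback _ _ (isPullback_fibManifold π hπ f)
  have e1 : e.hom ≫ (fibFst π f : fibManifold hπ f ⟶ C) = fst := H.isoIsPullback_hom_fst _ _ _
  have e2 : e.hom ≫ (fibSnd π f : fibManifold hπ f ⟶ G) = snd := H.isoIsPullback_hom_snd _ _ _
  have he : ∀ x, Hom.toFun e.inv (Hom.toFun e.hom x) = x := fun x =>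
    congrFun (congrArg Hom.toFun e.hom_inv_id) x
  have he' : ∀ y, Hom.toFun e.hom (Hom.toFun e.inv y) = y := fun y =>
    congrFun (congrArg Hom.toFun e.inv_hom_id) y
  have h1 : ∀ x, (Hom.toFun e.hom x).1.1 = Hom.toFun fst x := fun x =>
    congrFun (congrArg Hom.toFun e1) x
  have h2 : ∀ x, (Hom.toFun e.hom x).1.2 = Hom.toFun snd x := fun x =>
    congrFun (congrArg Hom.toFun e2) x
  have comm : ∀ x, Hom.toFun π (Hom.toFun fst x) = Hom.toFun f (Hom.toFun snd x) := fun x =>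
    congrFun (congrArg Hom.toFun H.w) x
  refine ⟨comm, fun c g h => ?_, fun x D => ?_⟩
  · refine ⟨Hom.toFun e.inv (⟨(c, g), h⟩ : fibSpace π f), ?_, ?_⟩
    · exact (h1 _).symm.trans (congrArg (fun y : Fib π f => y.1.1) (he' _))
    · exact (h2 _).symm.trans (congrArg (fun y : Fib π f => y.1.2) (he' _))
  · let ι : Chart X.toSpace x (fibSpace π f) := Chart.ofIso (X := X.toSpace) (Y := fibSpace π f) e.hom e.inv he he'
    have hx : ι.map x = (⟨(Hom.toFun fst x, Hom.toFun snd x), comm x⟩ : Fib π f) :=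
      Subtype.ext (Prod.ext (h1 x) (h2 x))
    have hmem : ι.map x ∈ (D.chart (comm x)).U := by
      rw [hx]
      exact (D.chart (comm x)).mem
    have hU : ∀ x', x' ∈ (ι.trans ((D.chart (comm x)).at' (ι.map x) hmem)).U ↔
        Hom.toFun fst x' ∈ D.κ.U ∧ Hom.toFun snd x' ∈ D.ν.U := fun x' =>
      ⟨fun h => ⟨h1 x' ▸ h.2.1, h2 x' ▸ h.2.2⟩,
        fun h => ⟨trivial, (congrArg (· ∈ D.κ.U) (h1 x')).mpr h.1,
          (congrArg (· ∈ D.ν.U) (h2 x')).mpr h.2⟩⟩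
    refine ⟨ι.trans ((D.chart (comm x)).at' (ι.map x) hmem), hU, fun x' hx' => ?_⟩
    obtain ⟨hc, hg⟩ := (hU x').1 hx'
    have key : (ι.trans ((D.chart (comm x)).at' (ι.map x) hmem)).map x' =
        D.toModel (comm x) (Hom.toFun fst x') (Hom.toFun snd x') :=
      congrArg₂ (D.toModel (comm x)) (h1 x') (h2 x')
    rw [D.toModel_eq _ (comm x') hc hg] at key
    exact ⟨congrArg ModelPoint.x key, congrArg (fun r : ModelPoint _ _ D.S => r.pt.z) key⟩

/-! ### Tangent vectors of the fiber product -/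

namespace IsFib

variable {C F G X : Manifold.{u}} {π : Hom C.toSpace F.toSpace} {f : Hom G.toSpace F.toSpace}
  {fst : Hom X.toSpace C.toSpace} {snd : Hom X.toSpace G.toSpace}

/-- The coordinates of `G` are part of the product chart, so a vector lifts by prescribing zero
derivatives along the fiber coordinates. Zero being an integer, integrality is preserved. -/
theorem exists_tangentVector (H : IsFib π f fst snd)
    (hπ : ∀ p : C, Function.Surjective (π.differential p) ∧
      Set.SurjOn (π.differential p) {v | v.IsIntegral} {v | v.IsIntegral}) (x : X)
    (v : TangentVector G.toSpace (snd x)) : ∃ V : TangentVector X.toSpace x,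
      snd.differential x V = v ∧ (v.IsIntegral → V.IsIntegral) := by
  obtain ⟨D⟩ := nonempty_localData (H.comm x) (hπ _).1 (hπ _).2
  obtain ⟨κ, hU, hκ⟩ := H.exists_chart x D
  have hx : ∀ᶠ x' in 𝓝 x, x' ∈ κ.U := κ.U.isOpen.mem_nhds κ.mem
  have hsnd := hU _ |>.1 κ.mem |>.2
  obtain ⟨V, hV, hV'⟩ := TangentVector.exists_of_coords κ
    (Fin.append 0 fun l => v.dS fun y => D.ν.xc y l)
    (Fin.append 0 fun i => v.dlog fun y => D.ν.zc y i)
  have ex : ∀ l, V.dS (fun y => D.ν.xc (snd y) l) = v.dS fun y => D.ν.xc y l := by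
    intro l
    have h := hV (Fin.natAdd D.d' l)
    rw [Fin.append_right] at h
    rw [← h]
    refine TangentVector.dS_congr ((snd.morphAt x).smAt (D.ν.smAt_xc hsnd l)) ?_
    filter_upwards [hx] with y hy
    rw [(hκ y hy).1]
    exact (Fin.append_right (fun i => D.κ.xc (fst y) (Fin.natAdd D.k i)) (D.ν.xc (snd y)) l).symm
  have ez : ∀ i, V.dlog (fun y => D.ν.zc (snd y) i) = v.dlog fun y => D.ν.zc y i := by
    intro i
    have h := hV' (Fin.natAdd D.d i)
    rw [Fin.append_right] at h
    rw [← h]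
    refine TangentVector.dlog_congr ((snd.morphAt x).2 _ (D.ν.explAt_zc hsnd i)) ?_
    filter_upwards [hx] with y hy
    rw [(hκ y hy).2]
    exact (Fin.append_right (fun i => D.κ.zc (fst y) (Fin.natAdd D.j i)) (D.ν.zc (snd y)) i).symm
  have hS : κ.ordc x ∈ interior D.S := by
    have h : κ.ordc x = fun i => (D.zcoord (fst x) (snd x) i).order :=
      congrArg (fun z i => Number.order (z i)) (hκ x κ.mem).2
    rw [h]
    exact D.order_mem_interior_S (H.comm x)
  refine ⟨V, TangentVector.ext_coords (κ := D.ν) D.hR D.hν (fun l => ?_) fun i => ?_, fun hv => ?_⟩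
  · rw [TangentVector.differential_dS snd V (D.ν.smAt_xc hsnd l), ex]
  · rw [TangentVector.differential_dlog snd V (D.ν.explAt_zc hsnd i), ez]
  · refine TangentVector.isIntegral_of_coords (D.isPolytope_S (H.comm x)) hS (fun l => ?_) fun i => ?_
    · rw [hV]
      refine Fin.addCases (fun l => ?_) (fun l => ?_) l
      · rw [Fin.append_left]
        rfl
      · rw [Fin.append_right]
        exact hv.dS_eq_zero (D.ν.smAt_xc hsnd l)
    · rw [hV']
      refine Fin.addCases (fun i => ?_) (fun i => ?_) i
      · rw [Fin.append_left]
        exact ⟨0, by simp⟩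
      · rw [Fin.append_right]
        exact hv.exists_dlog (D.ν.explAt_zc hsnd i)

end IsFib

/-! ### Extending curves -/

/-- Every neighbourhood of a point over the interior meets all tropical positions of the polytope,
including those on its boundary. -/
theorem ModelPoint.exists_tendsto {n m : ℕ} {P : Set (Fin m → ℝ)} {q : ModelPoint n m P}
    (hq : q.ord ∈ interior P) {y : Fin m → ℝ} (hy : y ∈ P) : ∃ t : ℕ → ModelPoint n m P,
      (∀ N, (t N).x = q.x) ∧ (∀ N, (t N).ord = y) ∧ Tendsto t atTop (𝓝 q) := by
  -- With these coefficients a monomial whose order vanishes at `y` takes the value `exp (-N * o)`,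
  -- where `o` is its order at `q`. For nonconstant smooth monomials `o > 0`.
  let t : ℕ → ModelPoint n m P := fun N => ⟨q.x,
    ⟨fun i => ⟨(Real.exp (-(N * (q.ord i - y i))) : ℝ), y i⟩,
      fun i => Complex.ofReal_ne_zero.2 (Real.exp_pos _).ne', hy⟩⟩
  refine ⟨t, fun _ => rfl, fun _ => rfl, tendsto_iff.2 ⟨tendsto_const_nhds, fun e => ?_⟩⟩
  have ht : ∀ N, smoothMonomial e (t N).pt = if affine e.a e.α y = 0 then
      ∏ i, ((Real.exp (-(N * (q.ord i - y i))) : ℝ) : ℂ) ^ e.α i else 0 := fun N =>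
    smoothMonomial_eq e (t N)
  simp only [smoothMonomial_of_interior e hq, ht]
  by_cases he : e.a = 0 ∧ e.α = 0
  · have h : ∀ y : Fin m → ℝ, affine 0 0 y = 0 := fun y => by simp [affine]
    simp [he.1, he.2, h]
  rw [if_neg he]
  have hpos : 0 < affine e.a e.α q.ord := (e.nonneg _ q.ord_mem).lt_of_ne fun h =>
    he (eq_zero_of_interior e.nonneg hq h.symm)
  by_cases h0 : affine e.a e.α y = 0
  · have key : ∀ N : ℕ, ∏ i, ((Real.exp (-(N * (q.ord i - y i))) : ℝ) : ℂ) ^ e.α i =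
        (Real.exp (-(N * affine e.a e.α q.ord)) : ℝ) := by
      intro N
      have h : affine e.a e.α q.ord = ∑ i, (e.α i : ℝ) * (q.ord i - y i) := by
        rw [← sub_zero (affine e.a e.α q.ord), ← h0]
        simp only [affine, mul_sub, Finset.sum_sub_distrib]
        ring
      rw [h, Finset.mul_sum, ← Finset.sum_neg_distrib, Real.exp_sum]
      push_cast
      refine Finset.prod_congr rfl fun i _ => ?_
      rw [← Complex.exp_int_mul]
      congr 1
      ring
    have hlim : Tendsto (fun N : ℕ => ((Real.exp (-(N * affine e.a e.α q.ord)) : ℝ) : ℂ)) atTop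
        (𝓝 0) := by
      rw [← Complex.ofReal_zero]
      refine (Complex.continuous_ofReal.tendsto 0).comp (Real.tendsto_exp_atBot.comp ?_)
      exact tendsto_neg_atTop_atBot.comp
        (tendsto_natCast_atTop_atTop.atTop_mul_const hpos)
    refine hlim.congr fun N => ?_
    rw [← key N, if_pos h0]
  · simp only [if_neg h0]
    exact tendsto_const_nhds

theorem affine_one {a : ℝ} {α : Fin 1 → ℤ} (y : Fin 1 → ℝ) : affine a α y = a + α 0 * y 0 := by
  simp [affine]

section

variable {l : ℝ}

theorem isOpen_Ioo_set : IsOpen {x : Fin 1 → ℝ | x 0 ∈ Set.Ioo 0 l} :=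
  isOpen_Ioo.preimage (continuous_apply 0)

theorem isPolytope_Ioo (hl : 0 < l) : IsPolytope {x : Fin 1 → ℝ | x 0 ∈ Set.Ioo 0 l} := by
  refine ⟨?_, ∅, {(0, 1), (l, -1)}, ?_⟩
  · rw [isOpen_Ioo_set.interior_eq]
    exact ⟨fun _ => l / 2, by constructor <;> simp <;> linarith⟩
  · ext x
    simp [affine, ← sub_eq_add_neg]

theorem isPolytope_Icc (hl : 0 < l) : IsPolytope {x : Fin 1 → ℝ | x 0 ∈ Set.Icc 0 l} := by
  refine ⟨?_, {(0, 1), (l, -1)}, ∅, ?_⟩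
  · exact (isPolytope_Ioo hl).1.mono (interior_mono fun x hx => Set.Ioo_subset_Icc_self hx)
  · ext x
    simp [affine, ← sub_eq_add_neg]

theorem Ioo_subset_interior_Icc :
    {x : Fin 1 → ℝ | x 0 ∈ Set.Ioo 0 l} ⊆ interior {x : Fin 1 → ℝ | x 0 ∈ Set.Icc 0 l} :=
  interior_maximal (fun _ hx => Set.Ioo_subset_Icc_self (Set.mem_ofPred_eq ▸ hx)) isOpen_Ioo_set

/-- The interval is open and there are no real coordinates. Hence `T_(0,l)` behaves like a single
point: germs are global, and a curve from it lies in any open set that it meets. -/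
theorem interval_inseparable (q q' : ModelPoint 0 1 {x | x 0 ∈ Set.Ioo 0 l}) : Inseparable q q' := by
  refine ModelPoint.inseparable_of_interior ?_ ?_ (Subsingleton.elim _ _)
  · rw [isOpen_Ioo_set.interior_eq]
    exact q.ord_mem
  · rw [isOpen_Ioo_set.interior_eq]
    exact q'.ord_mem

theorem interval_eventually {q : ModelPoint 0 1 {x | x 0 ∈ Set.Ioo 0 l}}
    {p : ModelPoint 0 1 {x | x 0 ∈ Set.Ioo 0 l} → Prop} (h : ∀ᶠ q' in 𝓝 q, p q')
    (q' : ModelPoint 0 1 {x | x 0 ∈ Set.Ioo 0 l}) : p q' := by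
  rw [(interval_inseparable q q').nhds_eq] at h
  exact h.self_of_nhds

theorem interval_eq_of_continuousAt {Z : Type*} [TopologicalSpace Z] [T1Space Z]
    {q : ModelPoint 0 1 {x | x 0 ∈ Set.Ioo 0 l}}
    {f : ModelPoint 0 1 {x | x 0 ∈ Set.Ioo 0 l} → Z} (hf : ContinuousAt f q)
    (q' : ModelPoint 0 1 {x | x 0 ∈ Set.Ioo 0 l}) : f q' = f q := by
  by_contra hne
  exact interval_eventually (hf.eventually (isOpen_ne.mem_nhds (Ne.symm hne))) q' rfl

theorem interval_explAt {q : ModelPoint 0 1 {x | x 0 ∈ Set.Ioo 0 l}}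
    {h : ModelPoint 0 1 {x | x 0 ∈ Set.Ioo 0 l} → Number}
    (hh : ExplAt (model 0 1 {x | x 0 ∈ Set.Ioo 0 l}) q h) :
    ∃ (u : ℂ) (a : ℝ) (α : Fin 1 → ℤ), u ≠ 0 ∧ ∀ q', h q' = monomial u a α q'.pt.z := by
  obtain ⟨f, a, α, hf, h0, e⟩ := explAt_model_iff.1 hh
  refine ⟨f q, a, α, h0, fun q' => ?_⟩
  refine (interval_eventually e q').trans ?_
  show monomial (f q') a α q'.pt.z = _
  rw [interval_eq_of_continuousAt hf.continuousAt q']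

variable {X : Space.{u}} {p : X} {n m : ℕ} {P : Set (Fin m → ℝ)} {κ : Chart X p (model n m P)}
  {γ : Hom (interval (Set.Ioo 0 l)) X}

theorem curve_mem {W : Set X} (hW : IsOpen W) {q : interval (Set.Ioo 0 l)} (hq : γ q ∈ W)
    (q' : interval (Set.Ioo 0 l)) : γ q' ∈ W :=
  interval_eventually (γ.continuous.continuousAt.eventually (hW.mem_nhds hq)) q'

theorem exists_curve_form (hγ : ∀ q, γ q ∈ κ.U) (q : interval (Set.Ioo 0 l)) :
    ∃ (u : Fin m → ℂ) (a : Fin m → ℝ) (K : Matrix (Fin m) (Fin 1) ℤ), (∀ i, u i ≠ 0) ∧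
      ∀ q', κ.zc (γ q') = monMap u a K (ModelPoint.pt q').z := by
  have h : ∀ i, ExplAt (interval (Set.Ioo 0 l)) q fun q' => κ.zc (γ q') i := fun i =>
    (γ.morphAt q).2 _ (κ.explAt_zc (hγ q) i)
  choose u a K hu hK using fun i => interval_explAt (h i)
  exact ⟨u, a, K, hu, fun q' => funext fun i => hK i q'⟩

theorem curve_xc (hγ : ∀ q, γ q ∈ κ.U) (q q' : interval (Set.Ioo 0 l)) :
    κ.xc (γ q') = κ.xc (γ q) := by
  refine interval_eq_of_continuousAt (f := fun q => κ.xc (γ q)) ?_ q'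
  exact (ModelPoint.continuous_x.continuousAt.comp (κ.morph_map _ (hγ q)).1).comp
    γ.continuous.continuousAt

theorem eqOn_Icc_of_eqOn_Ioo (hl : 0 < l) {Z : Type*} [TopologicalSpace Z] [T2Space Z]
    {f g : (Fin 1 → ℝ) → Z} (hf : Continuous f) (hg : Continuous g)
    (h : ∀ s ∈ Set.Ioo 0 l, f (fun _ => s) = g fun _ => s) {s : ℝ} (hs : s ∈ Set.Icc 0 l) :
    f (fun _ => s) = g fun _ => s := by
  have h' : Set.EqOn (fun s => f fun _ => s) (fun s => g fun _ => s) (Set.Ioo 0 l) := h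
  have := h'.closure (hf.comp (continuous_pi fun _ => continuous_id))
    (hg.comp (continuous_pi fun _ => continuous_id))
  rw [closure_Ioo hl.ne] at this
  exact this hs

/-- A point of order `s`. -/
def intervalPt {S : Set ℝ} {s : ℝ} (hs : s ∈ S) : ModelPoint 0 1 {x | x 0 ∈ S} :=
  ⟨Fin.elim0, ⟨fun _ => ⟨1, s⟩, fun _ => one_ne_zero, hs⟩⟩

theorem curve_order {u : Fin m → ℂ} {a : Fin m → ℝ} {K : Matrix (Fin m) (Fin 1) ℤ}
    (hK : ∀ q, κ.zc (γ q) = monMap u a K (ModelPoint.pt q).z) {s : ℝ} (hs : s ∈ Set.Ioo 0 l) :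
    κ.ordc (γ (intervalPt hs : ModelPoint 0 1 {x | x 0 ∈ Set.Ioo 0 l})) = affMap a K fun _ => s := by
  have h : κ.ordc (γ (intervalPt hs : ModelPoint 0 1 {x | x 0 ∈ Set.Ioo 0 l})) = _ :=
    congrArg (fun z i => Number.order (z i)) (hK (intervalPt hs))
  rw [h]
  exact monMap_order _ _ _ _

/-- Near an interior point the extension has orders given by one affine map, and such a
neighbourhood contains points of every order in `[0,l]`. This affine map agrees with the one of `γ`
on `(0,l)`, hence also at the ends, and its values are orders of points of the chart. -/
theorem Extends.affMap_mem (hl : 0 < l) (h : Extends γ) (hγ : ∀ q, γ q ∈ κ.U) {u : Fin m → ℂ}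
    {a : Fin m → ℝ} {K : Matrix (Fin m) (Fin 1) ℤ}
    (hK : ∀ q, κ.zc (γ q) = monMap u a K (ModelPoint.pt q).z) {s : ℝ} (hs : s ∈ Set.Icc 0 l) :
    affMap a K (fun _ => s) ∈ P := by
  obtain ⟨γ', hγ'⟩ := h
  have h2 : l / 2 ∈ Set.Ioo 0 l := ⟨by linarith, by linarith⟩
  let q₀ : ModelPoint 0 1 {x | x 0 ∈ Set.Ioo 0 l} := intervalPt h2
  let q₁ : ModelPoint 0 1 {x | x 0 ∈ Set.Icc 0 l} := interval.incl Set.Ioo_subset_Icc_self q₀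
  have hq₁ : γ' q₁ ∈ κ.U := by
    rw [hγ' q₀]
    exact hγ q₀
  obtain ⟨t, -, ht, htq⟩ := ModelPoint.exists_tendsto (q := q₁) (Ioo_subset_interior_Icc h2) (y := fun _ => s) hs
  have hf : ∀ i, ExplAt (model 0 1 {x | x 0 ∈ Set.Icc 0 l}) q₁ fun q => κ.zc (γ' q) i := fun i =>
    (γ'.morphAt q₁).2 _ (κ.explAt_zc hq₁ i)
  choose f a' K' _ _ e using fun i => explAt_model_iff.1 (hf i)
  have e' : ∀ᶠ q : ModelPoint 0 1 {x | x 0 ∈ Set.Icc 0 l} in 𝓝 q₁,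
      κ.ordc (γ' q) = affMap a' K' q.ord := by
    filter_upwards [eventually_all.2 e] with q hq
    exact funext fun i => congrArg Number.order (hq i)
  obtain ⟨N, hN⟩ := (htq.eventually e').exists
  have key : ∀ s ∈ Set.Ioo 0 l, affMap a K (fun _ => s) = affMap a' K' fun _ => s := by
    intro s hs
    let q₂ : ModelPoint 0 1 {x | x 0 ∈ Set.Icc 0 l} :=
      interval.incl Set.Ioo_subset_Icc_self (intervalPt hs : ModelPoint 0 1 {x | x 0 ∈ Set.Ioo 0 l})
    have h12 : Inseparable q₁ q₂ :=
      ModelPoint.inseparable_of_interior (Ioo_subset_interior_Icc h2)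
        (Ioo_subset_interior_Icc hs) (Subsingleton.elim _ _)
    rw [h12.nhds_eq] at e'
    have := e'.self_of_nhds
    exact (curve_order hK hs).symm.trans ((congrArg κ.ordc (hγ' (intervalPt hs))).symm.trans this)
  rw [eqOn_Icc_of_eqOn_Ioo hl (continuous_affMap a K) (continuous_affMap a' K') key hs]
  rw [ht] at hN
  rw [← hN]
  exact κ.ordc_mem _

/-- The coordinate of `T_[0,l]` as a smooth monomial. -/
def lowerExponent (l : ℝ) : SmoothExponent {x : Fin 1 → ℝ | x 0 ∈ Set.Icc 0 l} :=
  ⟨0, 1, fun x hx => by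
    rw [affine_one]
    simpa using hx.1⟩

/-- The smooth monomial `t^l z⁻¹` on `T_[0,l]`. -/
def upperExponent (l : ℝ) : SmoothExponent {x : Fin 1 → ℝ | x 0 ∈ Set.Icc 0 l} :=
  ⟨l, -1, fun x hx => by
    rw [affine_one]
    have : x 0 ≤ l := hx.2
    simpa using this⟩

theorem smoothMonomial_lower (q : ModelPoint 0 1 {x | x 0 ∈ Set.Icc 0 l}) :
    smoothMonomial (lowerExponent l) q.pt = if q.ord 0 = 0 then (q.pt.z 0).coeff else 0 := by
  rw [ModelPoint.smoothMonomial_eq, affine_one]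
  simp [lowerExponent]

theorem smoothMonomial_upper (q : ModelPoint 0 1 {x | x 0 ∈ Set.Icc 0 l}) :
    smoothMonomial (upperExponent l) q.pt = if q.ord 0 = l then (q.pt.z 0).coeff⁻¹ else 0 := by
  rw [ModelPoint.smoothMonomial_eq, affine_one]
  simp only [upperExponent, Pi.neg_apply, Pi.one_apply, Int.cast_neg, Int.cast_one, neg_one_mul,
    add_neg_eq_zero, Fin.prod_univ_one, zpow_neg_one, eq_comm (a := l)]

/-- A nonconstant smooth monomial vanishes over the open interval. Where it is nonzero, at order `0`
or `l`, it is a positive power of the lower or the upper monomial. -/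
theorem norm_smoothMonomial_le (e : SmoothExponent {x : Fin 1 → ℝ | x 0 ∈ Set.Icc 0 l}) (hl : 0 < l)
    (he : ¬ (e.a = 0 ∧ e.α = 0)) {q : ModelPoint 0 1 {x | x 0 ∈ Set.Icc 0 l}}
    (h1 : ‖smoothMonomial (lowerExponent l) q.pt‖ ≤ 1)
    (h2 : ‖smoothMonomial (upperExponent l) q.pt‖ ≤ 1) :
    ‖smoothMonomial e q.pt‖ ≤ ‖smoothMonomial (lowerExponent l) q.pt‖ +
      ‖smoothMonomial (upperExponent l) q.pt‖ := by
  have hα : e.a = 0 → e.α 0 ≠ 0 := fun h h' => he ⟨h, funext fun i => by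
    rw [Subsingleton.elim i 0]
    exact h'⟩
  have n0 := e.nonneg (fun _ => 0) ⟨le_rfl, hl.le⟩
  have nl := e.nonneg (fun _ => l) ⟨hl.le, le_rfl⟩
  rw [affine_one] at n0 nl
  have key : ∀ (c : ℂ) (k : ℤ), ‖c‖ ≤ 1 → 0 < k → ‖c ^ k‖ ≤ ‖c‖ := by
    intro c k hc hk
    lift k to ℕ using hk.le
    rw [zpow_natCast, norm_pow]
    exact pow_le_of_le_one (norm_nonneg _) hc (by omega)
  rw [ModelPoint.smoothMonomial_eq]
  by_cases h0 : affine e.a e.α q.ord = 0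
  swap
  · rw [if_neg h0, norm_zero]
    positivity
  rw [if_pos h0, Fin.prod_univ_one]
  rw [smoothMonomial_lower] at *
  rw [smoothMonomial_upper] at *
  by_cases hs : q.ord 0 = 0
  · rw [affine_one, hs] at h0
    simp only [mul_zero, add_zero] at h0 n0
    rw [if_pos hs] at *
    have hpos : 0 < e.α 0 := by
      have : (0 : ℝ) ≤ e.α 0 := by
        by_contra hneg
        nlinarith
      exact lt_of_le_of_ne (by exact_mod_cast this) (hα h0).symm
    exact (key _ _ h1 hpos).trans (le_add_of_nonneg_right (norm_nonneg _))
  · rw [if_neg hs, norm_zero, zero_add]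
    by_cases hs' : q.ord 0 = l
    · rw [affine_one, hs'] at h0
      rw [if_pos hs'] at *
      have hne : e.α 0 ≠ 0 := fun h => hα (by simpa [h] using h0) h
      have hneg : e.α 0 < 0 := by
        have : (e.α 0 : ℝ) ≤ 0 := by
          by_contra hpos
          nlinarith
        exact lt_of_le_of_ne (by exact_mod_cast this) hne
      have := key _ (-e.α 0) h2 (by omega)
      rwa [inv_zpow, zpow_neg, inv_inv] at this
    · have hq : q.ord ∈ {x : Fin 1 → ℝ | x 0 ∈ Set.Ioo 0 l} :=
        ⟨lt_of_le_of_ne q.ord_mem.1 (Ne.symm hs), lt_of_le_of_ne q.ord_mem.2 hs'⟩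
      exact absurd (eq_zero_of_interior e.nonneg (Ioo_subset_interior_Icc hq) h0) he

/-- All nonconstant smooth monomials vanish at `q` and are controlled by the two end monomials,
which thus define a neighbourhood basis. -/
theorem interval_nhds (hl : 0 < l) {q : ModelPoint 0 1 {x | x 0 ∈ Set.Icc 0 l}}
    (hq : q.ord 0 ∈ Set.Ioo 0 l) {W : Set (ModelPoint 0 1 {x | x 0 ∈ Set.Icc 0 l})} (hW : W ∈ 𝓝 q) :
    ∃ ε > 0, ∀ w, ‖smoothMonomial (lowerExponent l) w.pt‖ < ε →
      ‖smoothMonomial (upperExponent l) w.pt‖ < ε → w ∈ W := by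
  let N : ModelPoint 0 1 {x | x 0 ∈ Set.Icc 0 l} → ℝ := fun w =>
    ‖smoothMonomial (lowerExponent l) w.pt‖ + ‖smoothMonomial (upperExponent l) w.pt‖
  have hN : Tendsto N (comap N (𝓝 0)) (𝓝 0) := tendsto_comap
  have hlim : Tendsto (fun w => w) (comap N (𝓝 0)) (𝓝 q) := by
    refine ModelPoint.tendsto_iff.2 ⟨tendsto_const_nhds.congr fun _ => Subsingleton.elim _ _, fun e => ?_⟩
    rw [ModelPoint.smoothMonomial_of_interior e (Ioo_subset_interior_Icc hq)]
    by_cases he : e.a = 0 ∧ e.α = 0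
    · rw [if_pos he]
      refine tendsto_const_nhds.congr fun w => ?_
      rw [ModelPoint.smoothMonomial_eq, he.1, he.2]
      simp [affine]
    · rw [if_neg he]
      refine squeeze_zero_norm' ?_ hN
      filter_upwards [hN.eventually (Iio_mem_nhds one_pos)] with w hw
      refine norm_smoothMonomial_le e hl he ?_ ?_
      · exact (le_add_of_nonneg_right (norm_nonneg _)).trans hw.le
      · exact (le_add_of_nonneg_left (norm_nonneg _)).trans hw.le
  obtain ⟨t, ht, htW⟩ := mem_comap.1 (hlim hW)
  obtain ⟨ε, hε, hball⟩ := Metric.mem_nhds_iff.1 ht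
  refine ⟨ε / 2, by positivity, fun w h1 h2 => htW (hball ?_)⟩
  rw [Metric.mem_ball, dist_zero_right, Real.norm_of_nonneg (by positivity)]
  show _ + _ < _
  linarith

/-- A map of `T_[0,l]` that is the identity over the interior and moves the ends towards it. -/
def squeeze (ε : ℝ) (w : ModelPoint 0 1 {x | x 0 ∈ Set.Icc 0 l}) : ℝ :=
  (1 + ‖smoothMonomial (upperExponent l) w.pt‖ ^ 2 / ε ^ 2) /
    (1 + ‖smoothMonomial (lowerExponent l) w.pt‖ ^ 2 / ε ^ 2)

theorem squeeze_pos (ε : ℝ) (w : ModelPoint 0 1 {x | x 0 ∈ Set.Icc 0 l}) : 0 < squeeze ε w := by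
  unfold squeeze
  positivity

theorem squeeze_of_interior (ε : ℝ) {w : ModelPoint 0 1 {x | x 0 ∈ Set.Icc 0 l}}
    (hw : w.ord 0 ∈ Set.Ioo 0 l) : squeeze ε w = 1 := by
  rw [squeeze, smoothMonomial_lower, smoothMonomial_upper, if_neg hw.1.ne', if_neg hw.2.ne]
  simp

theorem smAt_squeeze (hl : 0 < l) (ε : ℝ) (w : ModelPoint 0 1 {x | x 0 ∈ Set.Icc 0 l}) :
    SmAt (model 0 1 {x | x 0 ∈ Set.Icc 0 l}) w fun w => (squeeze ε w : ℂ) := by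
  have hX := isModeled_model (n := 0) (isPolytope_Icc hl) w
  have h : ∀ e : SmoothExponent {x : Fin 1 → ℝ | x 0 ∈ Set.Icc 0 l},
      SmAt (model 0 1 {x | x 0 ∈ Set.Icc 0 l}) w fun w => smoothMonomial e (ModelPoint.pt w) :=
    fun e => (smAt_model_iff_of_isPolytope (isPolytope_Icc hl)).2 (SmForm.smoothMonomial w e)
  refine SmAt.comp₂ hX (h (lowerExponent l)) (h (upperExponent l)) (H := fun y =>
    (((1 + ‖y.2‖ ^ 2 / ε ^ 2) / (1 + ‖y.1‖ ^ 2 / ε ^ 2) : ℝ) : ℂ)) (Eventually.of_forall fun y => ?_)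
  refine Complex.ofRealCLM.contDiff.contDiffAt.comp y (ContDiffAt.div ?_ ?_ (by positivity))
  · exact contDiffAt_const.add ((contDiff_snd.norm_sq ℝ).contDiffAt.div_const _)
  · exact contDiffAt_const.add ((contDiff_fst.norm_sq ℝ).contDiffAt.div_const _)

/-- The point with coordinate multiplied by `squeeze`. -/
def squeezePt (ε : ℝ) (w : ModelPoint 0 1 {x | x 0 ∈ Set.Icc 0 l}) :
    ModelPoint 0 1 {x | x 0 ∈ Set.Icc 0 l} :=
  ⟨w.x, ⟨fun i => ⟨squeeze ε w, 0⟩ * w.pt.z i,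
    fun i => mul_ne_zero (Complex.ofReal_ne_zero.2 (squeeze_pos ε w).ne') (w.pt.coeff_ne_zero i), by
      have := w.pt.order_mem
      simpa using this⟩⟩

theorem squeezePt_of_interior (ε : ℝ) {w : ModelPoint 0 1 {x | x 0 ∈ Set.Icc 0 l}}
    (hw : w.ord 0 ∈ Set.Ioo 0 l) : squeezePt ε w = w := by
  refine ModelPoint.ext rfl (TorusPoint.ext (funext fun i => Number.ext ?_ ?_))
  · simp [squeezePt, squeeze_of_interior ε hw]
  · simp [squeezePt]

theorem morphAt_squeezePt (hl : 0 < l) (ε : ℝ) (w : ModelPoint 0 1 {x | x 0 ∈ Set.Icc 0 l}) :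
    MorphAt (X := model 0 1 {x | x 0 ∈ Set.Icc 0 l}) (Y := model 0 1 {x | x 0 ∈ Set.Icc 0 l})
      (squeezePt ε) w := by
  have hX := isModeled_model (n := 0) (isPolytope_Icc hl) w
  refine morphAt_model (X := model 0 1 {x | x 0 ∈ Set.Icc 0 l}) hX (fun i => i.elim0) fun i => ?_
  exact ((smAt_squeeze hl ε w).explAt hX (Complex.ofReal_ne_zero.2 (squeeze_pos ε w).ne')).mul
    (w.explAt_z i)

/-- At each end one of the two monomials in `squeeze` is zero and the other has its norm replaced by
this expression, whatever its size. -/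
theorem div_one_add_sq_lt {ε : ℝ} (hε : 0 < ε) (r : ℝ) : r / (1 + r ^ 2 / ε ^ 2) < ε := by
  rw [div_lt_iff₀ (by positivity)]
  have : ε * (1 + r ^ 2 / ε ^ 2) = ε + r ^ 2 / ε := by
    field_simp
  rw [this, ← sub_pos]
  have : ε + r ^ 2 / ε - r = ((r - ε / 2) ^ 2 + 3 / 4 * ε ^ 2) / ε := by
    field_simp
    ring
  rw [this]
  positivity

theorem norm_lower_squeezePt {ε : ℝ} (hl : 0 < l) (hε : 0 < ε)
    (w : ModelPoint 0 1 {x | x 0 ∈ Set.Icc 0 l}) :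
    ‖smoothMonomial (lowerExponent l) (squeezePt ε w).pt‖ < ε := by
  have ho : (squeezePt ε w).ord 0 = w.ord 0 := by simp [squeezePt, ModelPoint.ord]
  rw [smoothMonomial_lower, ho]
  by_cases h : w.ord 0 = 0
  · rw [if_pos h]
    show ‖((squeeze ε w : ℝ) : ℂ) * _‖ < ε
    rw [squeeze, smoothMonomial_lower, smoothMonomial_upper, if_pos h, if_neg (by rw [h]; exact hl.ne), norm_mul,
      Complex.norm_real, Real.norm_of_nonneg (by positivity), norm_zero]
    have := div_one_add_sq_lt hε ‖(w.pt.z 0).coeff‖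
    convert this using 1
    field_simp
    ring
  · rw [if_neg h, norm_zero]
    exact hε

theorem norm_upper_squeezePt {ε : ℝ} (hl : 0 < l) (hε : 0 < ε)
    (w : ModelPoint 0 1 {x | x 0 ∈ Set.Icc 0 l}) :
    ‖smoothMonomial (upperExponent l) (squeezePt ε w).pt‖ < ε := by
  have ho : (squeezePt ε w).ord 0 = w.ord 0 := by simp [squeezePt, ModelPoint.ord]
  rw [smoothMonomial_upper, ho]
  by_cases h : w.ord 0 = l
  · rw [if_pos h]
    show ‖(((squeeze ε w : ℝ) : ℂ) * _)⁻¹‖ < ε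
    rw [squeeze, smoothMonomial_lower, smoothMonomial_upper, if_pos h, if_neg (by rw [h]; exact hl.ne'), norm_inv,
      norm_mul, Complex.norm_real, Real.norm_of_nonneg (by positivity), norm_zero]
    have := div_one_add_sq_lt hε ‖(w.pt.z 0).coeff⁻¹‖
    convert this using 1
    rw [norm_inv]
    field_simp
    ring
  · rw [if_neg h, norm_zero]
    exact hε

/-- The monomials that describe `γ` define a map of all of `T_[0,l]` to the model, but near the ends
it may leave the target of the chart. Precomposing with `squeezePt` keeps the map over the open
interval and brings both ends into a neighbourhood that is mapped to the target. -/
theorem Extends.of_affMap_mem (hl : 0 < l) (hγ : ∀ q, γ q ∈ κ.U) {u : Fin m → ℂ}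
    (hu : ∀ i, u i ≠ 0) {a : Fin m → ℝ} {K : Matrix (Fin m) (Fin 1) ℤ}
    (hK : ∀ q, κ.zc (γ q) = monMap u a K (ModelPoint.pt q).z)
    (h : ∀ s ∈ Set.Icc 0 l, affMap a K (fun _ => s) ∈ P) : Extends γ := by
  have h2 : l / 2 ∈ Set.Ioo 0 l := ⟨by linarith, by linarith⟩
  let q₀ : ModelPoint 0 1 {x | x 0 ∈ Set.Ioo 0 l} := intervalPt h2
  let q₁ : ModelPoint 0 1 {x | x 0 ∈ Set.Icc 0 l} := interval.incl Set.Ioo_subset_Icc_self q₀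
  let φ : ModelPoint 0 1 {x | x 0 ∈ Set.Icc 0 l} → ModelPoint n m P := fun w =>
    mkPoint (κ.map p) (κ.xc (γ q₀)) (monMap u a K w.pt.z)
  have hφ : ∀ w, MorphAt (X := model 0 1 {x | x 0 ∈ Set.Icc 0 l}) (Y := model n m P) φ w := by
    intro w
    refine morphAt_mkPoint (X := model 0 1 {x | x 0 ∈ Set.Icc 0 l}) _
      (isModeled_model (isPolytope_Icc hl) w) (fun i => SmAt.const _ _ _)
      (fun i => ExplAt.monomial (hu i) _ _ fun j => w.explAt_z j) (Eventually.of_forall fun w' => ?_)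
    rw [monMap_order]
    convert h _ w'.ord_mem using 2
    exact funext fun i => by rw [Subsingleton.elim i 0]; rfl
  have hφγ : ∀ q : interval (Set.Ioo 0 l), φ (interval.incl Set.Ioo_subset_Icc_self q) = κ.map (γ q) := by
    intro q
    show mkPoint _ _ (monMap u a K (ModelPoint.pt q).z) = _
    rw [← hK q, ← curve_xc hγ q₀ q]
    exact mkPoint_self _ _
  have hm : φ q₁ ∈ κ.V := (congrArg (· ∈ κ.V) (hφγ q₀)).mpr (κ.map_mem _ (hγ q₀))
  have hV : {w | φ w ∈ κ.V} ∈ 𝓝 q₁ := (hφ q₁).1.eventually (κ.V.isOpen.mem_nhds hm)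
  obtain ⟨ε, hε, hεV⟩ := interval_nhds (q := q₁) hl h2 hV
  have hin : ∀ w, φ (squeezePt ε w) ∈ κ.V := fun w =>
    hεV _ (norm_lower_squeezePt hl hε w) (norm_upper_squeezePt hl hε w)
  refine ⟨Hom.ofMorphAt (X := model 0 1 {x | x 0 ∈ Set.Icc 0 l}) (fun w => κ.symm (φ (squeezePt ε w)))
    fun w => ?_, fun q => ?_⟩
  · exact MorphAt.comp (X := model 0 1 {x | x 0 ∈ Set.Icc 0 l}) (Y := model n m P)
      (φ := fun w => φ (squeezePt ε w)) (κ.morph_symm _ (hin w))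
      (MorphAt.comp (X := model 0 1 {x | x 0 ∈ Set.Icc 0 l}) (Y := model 0 1 {x | x 0 ∈ Set.Icc 0 l})
        (φ := squeezePt ε) (hφ _) (morphAt_squeezePt hl ε w))
  · show κ.symm (φ (squeezePt ε (interval.incl Set.Ioo_subset_Icc_self q))) = γ q
    have hq : (ModelPoint.ord (interval.incl Set.Ioo_subset_Icc_self q :
        ModelPoint 0 1 {x | x 0 ∈ Set.Icc 0 l})) 0 ∈ Set.Ioo 0 l := (ModelPoint.pt q).order_mem
    rw [squeezePt_of_interior ε hq, hφγ]
    exact κ.left _ (hγ q)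

end

theorem Extends.mem_of_order {l : ℝ} {X : Space.{u}} {p : X} {n m : ℕ} {P : Set (Fin m → ℝ)}
    {κ : Chart X p (model n m P)} {γ : Hom (interval (Set.Ioo 0 l)) X} (hl : 0 < l)
    (h : Extends γ) (hγ : ∀ q, γ q ∈ κ.U) {g : (Fin 1 → ℝ) → Fin m → ℝ} (hg : Continuous g)
    (e : ∀ (s : ℝ) (hs : s ∈ Set.Ioo 0 l),
      κ.ordc (γ (intervalPt hs : ModelPoint 0 1 {x | x 0 ∈ Set.Ioo 0 l})) = g fun _ => s)
    {s : ℝ} (hs : s ∈ Set.Icc 0 l) : g (fun _ => s) ∈ P := by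
  have h2 : l / 2 ∈ Set.Ioo 0 l := ⟨by linarith, by linarith⟩
  obtain ⟨u, a, K, -, hK⟩ := exists_curve_form hγ (intervalPt h2)
  rw [← eqOn_Icc_of_eqOn_Ioo hl (continuous_affMap a K) hg
    (fun s hs => (curve_order hK hs).symm.trans (e s hs)) hs]
  exact h.affMap_mem hl hγ hK hs

namespace IsFib

variable {C F G X : Manifold.{u}} {π : Hom C.toSpace F.toSpace} {f : Hom G.toSpace F.toSpace}
  {fst : Hom X.toSpace C.toSpace} {snd : Hom X.toSpace G.toSpace}

/-- If the curve extends in `G`, its image in `F` extends, and completeness of `π` extends the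
component in `C`. The two extensions put the closed segment into the two polytopes, hence into their
fiber product. -/
theorem extends_iff (H : IsFib π f fst snd)
    (hπ : ∀ p : C, Function.Surjective (π.differential p) ∧
      Set.SurjOn (π.differential p) {v | v.IsIntegral} {v | v.IsIntegral}) {l : ℝ} (hl : 0 < l)
    (hc : ∀ γ : Hom (interval (Set.Ioo 0 l)) C.toSpace, Extends γ ↔ Extends (γ.comp π))
    (γ : Hom (interval (Set.Ioo 0 l)) X.toSpace) : Extends γ ↔ Extends (γ.comp snd) := by
  refine ⟨fun ⟨γ', h⟩ => ⟨γ'.comp snd, fun q => congrArg snd (h q)⟩, fun h => ?_⟩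
  have hfst : Extends (γ.comp fst) := by
    rw [hc]
    obtain ⟨γ', h⟩ := h
    exact ⟨γ'.comp f, fun q => (congrArg f (h q)).trans (H.comm (γ q)).symm⟩
  have h2 : l / 2 ∈ Set.Ioo 0 l := ⟨by linarith, by linarith⟩
  let q₀ : interval (Set.Ioo 0 l) := (intervalPt h2 : ModelPoint 0 1 {x | x 0 ∈ Set.Ioo 0 l})
  obtain ⟨D⟩ := nonempty_localData (H.comm (γ q₀)) (hπ _).1 (hπ _).2
  obtain ⟨κ, hU, hκ⟩ := H.exists_chart (γ q₀) D
  have hγ : ∀ q, γ q ∈ κ.U := curve_mem κ.U.isOpen κ.mem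
  have hγ1 : ∀ q, fst (γ q) ∈ D.κ.U := fun q => ((hU _).1 (hγ q)).1
  have hγ2 : ∀ q, snd (γ q) ∈ D.ν.U := fun q => ((hU _).1 (hγ q)).2
  obtain ⟨u, a, K, hu, hK⟩ := exists_curve_form hγ q₀
  have ho : ∀ (s : ℝ) (hs : s ∈ Set.Ioo 0 l), (fun i => (D.zcoord
      (fst (γ (intervalPt hs : ModelPoint 0 1 {x | x 0 ∈ Set.Ioo 0 l})))
      (snd (γ (intervalPt hs : ModelPoint 0 1 {x | x 0 ∈ Set.Ioo 0 l}))) i).order) =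
        affMap a K fun _ => s := fun s hs => by
    rw [← curve_order hK hs]
    exact (congrArg (fun z i => Number.order (z i)) (hκ _ (hγ _)).2).symm
  refine Extends.of_affMap_mem hl hγ hu hK fun s hs => ⟨?_, ?_⟩
  · refine h.mem_of_order (κ := D.ν) (g := fun y => affMap 0 D.baseMatrix (affMap a K y)) hl hγ2
      ((continuous_affMap _ _).comp (continuous_affMap _ _)) (fun s hs => ?_) hs
    rw [← ho s hs]
    exact (D.base_zcoord _ _).symm
  · refine hfst.mem_of_order (κ := D.κ)
      (g := fun y => affMap (Fin.append D.a 0) D.totalMatrix (affMap a K y)) hl hγ1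
      ((continuous_affMap _ _).comp (continuous_affMap _ _)) (fun s hs => ?_) hs
    rw [← ho s hs]
    exact (D.total_zcoord (H.comm _) (hγ1 _) (hγ2 _)).symm

end IsFib

/-! ### Lifting points of the base -/

theorem inseparable_map_of_continuousAt {Y Z : Type*} [TopologicalSpace Y] [TopologicalSpace Z]
    {f : Y → Z} {x y : Y} (h : Inseparable x y) (hx : ContinuousAt f x) (hy : ContinuousAt f y) :
    Inseparable (f x) (f y) := by
  rw [inseparable_iff_specializes_and]
  constructor
  · rw [specializes_iff_pure, ← map_pure]
    exact hy.mono_left ((pure_le_nhds x).trans h.nhds_eq.le)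
  · rw [specializes_iff_pure, ← map_pure]
    exact hx.mono_left ((pure_le_nhds y).trans h.nhds_eq.ge)

/-! ### Interiors, convexity and projections of polyhedra. -/

theorem mem_interior_of_inseparable {n m : ℕ} {P : Set (Fin m → ℝ)} (hP : IsPolytope P)
    {q q' : ModelPoint n m P} (hq : q.ord ∈ interior P) (h : Inseparable q q') :
    q'.ord ∈ interior P := by
  obtain ⟨-, s, s', hP⟩ := hP
  obtain rfl : P = polyhedron s s' := hP
  refine mem_interior_polyhedron (s := s) (s' := s') q'.ord_mem fun c hc h0 => ?_
  let e : SmoothExponent (polyhedron s s') := ⟨c.1, c.2, fun y hy => hy.1 c hc⟩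
  have h1 := (ModelPoint.smoothMonomial_ne_zero_iff e q').2 h0
  rw [← (ModelPoint.inseparable_iff.1 h).2 e, ModelPoint.smoothMonomial_ne_zero_iff] at h1
  obtain ⟨ha, hα⟩ := eq_zero_of_interior e.nonneg hq h1
  intro y
  rw [show c.1 = 0 from ha, show c.2 = 0 from hα]
  simp [affine]

theorem segment_mem_interior {m : ℕ} {s s' : Finset (ℝ × (Fin m → ℤ))} {x y : Fin m → ℝ}
    (hx : x ∈ interior (polyhedron s s')) (hy : ∀ c ∈ s ∪ s', 0 ≤ affine c.1 c.2 y) {t : ℝ}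
    (h0 : 0 ≤ t) (h1 : t < 1) : x + t • (y - x) ∈ interior (polyhedron s s') := by
  have hxm := interior_subset hx
  have key : ∀ c : ℝ × (Fin m → ℤ), affine c.1 c.2 (x + t • (y - x)) =
      (1 - t) * affine c.1 c.2 x + t * affine c.1 c.2 y := fun c => by
    rw [affine_add_smul_sub]
    ring
  refine mem_interior_polyhedron ⟨fun c hc => ?_, fun c hc => ?_⟩ fun c hc h z => ?_
  · rw [key]
    exact add_nonneg (mul_nonneg (by linarith) (hxm.1 c hc))
      (mul_nonneg h0 (hy c (Finset.mem_union_left _ hc)))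
  · rw [key]
    exact add_pos_of_pos_of_nonneg (mul_pos (by linarith) (hxm.2 c hc))
      (mul_nonneg h0 (hy c (Finset.mem_union_right _ hc)))
  · rw [key] at h
    have ha := mul_nonneg (sub_nonneg.2 h1.le) (hxm.1 c hc)
    have hb := mul_nonneg h0 (hy c (Finset.mem_union_left _ hc))
    -- An inequality active at the convex combination is active at the interior point `x`, which has
    -- positive weight; it is therefore identically zero.
    have h2 : affine c.1 c.2 x = 0 := by
      refine (mul_eq_zero.1 (by linarith : (1 - t) * affine c.1 c.2 x = 0)).resolve_left ?_
      linarith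
    obtain ⟨ha, hα⟩ := eq_zero_of_interior (fun y (hy : y ∈ polyhedron s s') => hy.1 c hc) hx h2
    rw [ha, hα]
    simp [affine]

theorem convex_polyhedron {m : ℕ} (s s' : Finset (ℝ × (Fin m → ℤ))) : Convex ℝ (polyhedron s s') := by
  intro x hx y hy a b ha hb hab
  obtain rfl : a = 1 - b := by linarith
  have key : ∀ c : ℝ × (Fin m → ℤ), affine c.1 c.2 ((1 - b) • x + b • y) =
      (1 - b) * affine c.1 c.2 x + b * affine c.1 c.2 y := fun c => by
    rw [show (1 - b) • x + b • y = x + b • (y - x) by module, affine_add_smul_sub]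
    ring
  refine ⟨fun c hc => ?_, fun c hc => ?_⟩
  · rw [key]
    exact add_nonneg (mul_nonneg ha (hx.1 c hc)) (mul_nonneg hb (hy.1 c hc))
  · rw [key]
    rcases ha.eq_or_lt with h | h
    · rw [← h, zero_mul, zero_add, show b = 1 by linarith, one_mul]
      exact hy.2 c hc
    · exact add_pos_of_pos_of_nonneg (mul_pos h (hx.2 c hc)) (mul_nonneg hb (hy.2 c hc).le)

/-- The first coordinates. -/
def baseCoords {j d : ℕ} (y : Fin (j + d) → ℝ) : Fin j → ℝ := fun i => y (Fin.castAdd d i)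

theorem continuous_append {j d : ℕ} (w : Fin d → ℝ) :
    Continuous fun y : Fin j → ℝ => Fin.append y w := by
  refine continuous_pi fun i => ?_
  refine Fin.addCases (fun i => ?_) (fun i => ?_) i
  · simp only [Fin.append_left]
    exact continuous_apply i
  · simp only [Fin.append_right]
    exact continuous_const

theorem isOpen_image_baseCoords {j d : ℕ} {U : Set (Fin (j + d) → ℝ)} (hU : IsOpen U) :
    IsOpen (baseCoords '' U) := by
  rw [isOpen_iff_mem_nhds]
  rintro _ ⟨y, hy, rfl⟩
  have hg := (continuous_append (j := j) fun i => y (Fin.natAdd j i)).continuousAt (x := baseCoords y)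
  have hy' : Fin.append (baseCoords y) (fun i => y (Fin.natAdd j i)) = y := Fin.append_castAdd_natAdd
  filter_upwards [hg.preimage_mem_nhds (hU.mem_nhds (by rw [hy']; exact hy))] with z hz
  exact ⟨_, hz, funext fun i => Fin.append_left _ _ _⟩

theorem affine_append {j d : ℕ} (a : ℝ) (α : Fin (j + d) → ℤ) (y : Fin j → ℝ) (w : Fin d → ℝ) :
    affine a α (Fin.append y w) = affine a (fun i => α (Fin.castAdd d i)) y +
      linForm (fun i => α (Fin.natAdd j i)) w := by
  simp only [affine, linForm_apply, Fin.sum_univ_add, Fin.append_left, Fin.append_right]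
  ring

/-- The image of a closed polyhedron under a projection is closed. -/
theorem exists_lift_of_mem_closure {j d : ℕ} (s : Finset (ℝ × (Fin (j + d) → ℤ)))
    {U : Set (Fin (j + d) → ℝ)} (hU : ∀ y ∈ U, ∀ c ∈ s, 0 ≤ affine c.1 c.2 y) {y : Fin j → ℝ}
    (hy : y ∈ closure (baseCoords '' U)) :
    ∃ z : Fin (j + d) → ℝ, baseCoords z = y ∧ ∀ c ∈ s, 0 ≤ affine c.1 c.2 z := by
  by_contra hne
  have hempty : ¬ ∃ w : Fin d → ℝ, ∀ c ∈ s, 0 ≤ affine c.1 (fun i => c.2 (Fin.castAdd d i)) y +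
      linForm (fun i => c.2 (Fin.natAdd j i)) w := by
    rintro ⟨w, hw⟩
    refine hne ⟨Fin.append y w, funext fun i => Fin.append_left _ _ _, fun c hc => ?_⟩
    rw [affine_append]
    exact hw c hc
  -- An empty fiber over `y` has a Farkas certificate: a nonnegative combination of the inequalities
  -- in which the fiber variables cancel and whose value at `y` is `-1`. It is nonnegative on the
  -- image, hence on its closure.
  obtain ⟨r, hr, h1, h2⟩ := affine_farkas_empty s _ _ hempty
  have hclosed : IsClosed {y : Fin j → ℝ |
      0 ≤ ∑ c ∈ s, r c * affine c.1 (fun i => c.2 (Fin.castAdd d i)) y} :=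
    isClosed_le continuous_const
      (continuous_finsetSum _ fun c _ => continuous_const.mul (continuous_affine _ _))
  have hsub : baseCoords '' U ⊆ {y : Fin j → ℝ |
      0 ≤ ∑ c ∈ s, r c * affine c.1 (fun i => c.2 (Fin.castAdd d i)) y} := by
    rintro _ ⟨z, hz, rfl⟩
    have hz' : z = Fin.append (baseCoords z) fun i => z (Fin.natAdd j i) :=
      Fin.append_castAdd_natAdd.symm
    have h0 := congrArg (fun g => g fun i => z (Fin.natAdd j i)) h2
    simp only [LinearMap.sum_apply, LinearMap.smul_apply, smul_eq_mul, LinearMap.zero_apply] at h0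
    have h3 : 0 ≤ ∑ c ∈ s, r c * affine c.1 c.2 z :=
      Finset.sum_nonneg fun c hc => mul_nonneg (hr c) (hU z hz c hc)
    have h4 : ∑ c ∈ s, r c * affine c.1 c.2 z =
        ∑ c ∈ s, r c * affine c.1 (fun i => c.2 (Fin.castAdd d i)) (baseCoords z) := by
      rw [← add_zero (∑ c ∈ s, r c * affine c.1 (fun i => c.2 (Fin.castAdd d i)) (baseCoords z)),
        ← h0, ← Finset.sum_add_distrib]
      refine Finset.sum_congr rfl fun c _ => ?_
      rw [← mul_add, ← affine_append, ← hz']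
    rwa [h4] at h3
  have : (0 : ℝ) ≤ ∑ c ∈ s, r c * affine c.1 (fun i => c.2 (Fin.castAdd d i)) y :=
    closure_minimal hsub hclosed hy
  linarith

/-- Rational translations are dense. -/
theorem exists_rational_sub_mem {m : ℕ} {U : Set (Fin m → ℝ)} (hU : IsOpen U) (hne : U.Nonempty)
    (y : Fin m → ℝ) : ∃ (N : ℕ) (k : Fin m → ℤ), 0 < N ∧ (fun i => y i - k i * (1 / N : ℝ)) ∈ U := by
  obtain ⟨x, hx⟩ := hne
  -- The translation is `y - x` with its entries rounded down to multiples of `1 / N`.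
  have hlim : Tendsto (fun N : ℕ => fun i => y i - (⌊(y i - x i) * N⌋ : ℤ) * (1 / N : ℝ)) atTop
      (𝓝 x) := by
    refine tendsto_pi_nhds.2 fun i => ?_
    have h : Tendsto (fun N : ℕ => (⌊(y i - x i) * N⌋ : ℝ) / N) atTop (𝓝 (y i - x i)) := by
      have hlow := (tendsto_const_nhds (x := y i - x i)).sub (tendsto_one_div_atTop_nhds_zero_nat (𝕜 := ℝ))
      rw [sub_zero] at hlow
      refine tendsto_of_tendsto_of_tendsto_of_le_of_le' hlow tendsto_const_nhds ?_ ?_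
      · filter_upwards [eventually_gt_atTop 0] with N hN
        have hN' : (0 : ℝ) < N := Nat.cast_pos.2 hN
        rw [le_div_iff₀ hN', sub_mul, one_div_mul_cancel hN'.ne']
        exact (Int.sub_one_lt_floor _).le
      · filter_upwards [eventually_gt_atTop 0] with N hN
        rw [div_le_iff₀ (Nat.cast_pos.2 hN)]
        exact Int.floor_le _
    have h' := (tendsto_const_nhds (x := y i)).sub h
    rw [sub_sub_cancel] at h'
    exact h'.congr fun N => by simp [div_eq_mul_inv]
  obtain ⟨N, hN, h0⟩ := ((hlim.eventually (hU.mem_nhds hx)).and (eventually_gt_atTop 0)).exists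
  exact ⟨N, _, h0, hN⟩

namespace Chart

variable {X : Space.{u}} {p : X} {n m : ℕ} {P : Set (Fin m → ℝ)} {κ : Chart X p (model n m P)}

theorem mem_V_of_interior (hκ : κ.ordc p ∈ interior P) {q : ModelPoint n m P} (hx : q.x = κ.xc p)
    (hq : q.ord ∈ interior P) : q ∈ κ.V :=
  ((ModelPoint.inseparable_of_interior hκ hq hx.symm).mem_open_iff κ.V.isOpen).1 κ.map_mem'

theorem inseparable_symm (hκ : κ.ordc p ∈ interior P) {q : ModelPoint n m P} (hx : q.x = κ.xc p)
    (hq : q.ord ∈ interior P) : Inseparable p (κ.symm q) := by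
  have h := inseparable_map_of_continuousAt (f := κ.symm)
    (ModelPoint.inseparable_of_interior (q := κ.map p) hκ hq hx.symm) (κ.morph_symm _ κ.map_mem').1
    (κ.morph_symm _ (mem_V_of_interior hκ hx hq)).1
  rwa [κ.left'] at h

end Chart

/-! ### Surjectivity onto the interior of the base polytope. -/

section

variable {C F : Manifold.{u}} {π : Hom C.toSpace F.toSpace} {p : C} {k j d' d : ℕ}
  {Q : Set (Fin j → ℝ)} {s s' : Finset (ℝ × (Fin (j + d) → ℤ))}
  {μ : Chart F.toSpace (π p) (model k j Q)}
  {κ : Chart C.toSpace p (model (k + d') (j + d) (polyhedron s s'))}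

theorem baseCoords_mem (hκ : κ.ordc p ∈ interior (polyhedron s s'))
    (H : ∀ y ∈ κ.U, ∀ i, κ.zc y (Fin.castAdd d i) = μ.zc (π y) i) {y : Fin (j + d) → ℝ}
    (hy : y ∈ interior (polyhedron s s')) : baseCoords y ∈ Q := by
  let q : ModelPoint (k + d') (j + d) (polyhedron s s') :=
    ⟨κ.xc p, ⟨fun i => ⟨1, y i⟩, fun _ => one_ne_zero, interior_subset hy⟩⟩
  have hq : q ∈ κ.V := Chart.mem_V_of_interior hκ rfl hy
  have h := H _ (κ.symm_mem q hq)
  have e : baseCoords y = μ.ordc (π (κ.symm q)) := by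
    funext i
    refine Eq.trans ?_ (congrArg Number.order (h i))
    rw [Chart.zc, κ.right q hq]
    rfl
  rw [e]
  exact μ.ordc_mem _

/-- Completeness forces the fibers of the polytope to be closed. -/
theorem mem_of_baseCoords_mem
    (hc : ∀ l : ℝ, 0 < l → ∀ γ : Hom (interval (Set.Ioo 0 l)) C.toSpace,
      Extends γ ↔ Extends (γ.comp π))
    (hκ : κ.ordc p ∈ interior (polyhedron s s')) (H : ∀ y ∈ κ.U, π y ∈ μ.U ∧
      ∀ i, κ.zc y (Fin.castAdd d i) = μ.zc (π y) i) {y : Fin (j + d) → ℝ}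
    (hy : ∀ c ∈ s ∪ s', 0 ≤ affine c.1 c.2 y) (hyQ : baseCoords y ∈ Q) : y ∈ polyhedron s s' := by
  -- A monomial curve must have integral direction, so the interior starting point is chosen to
  -- differ from `y` by `r / N`; the curve of length `1 / N` in direction `r` then ends exactly at
  -- `y`.
  obtain ⟨N, r, hN, hr⟩ := exists_rational_sub_mem isOpen_interior ⟨_, hκ⟩ y
  have hN' : (0 : ℝ) < N := Nat.cast_pos.2 hN
  set y₀ : Fin (j + d) → ℝ := fun i => y i - r i * (1 / N : ℝ) with hy₀
  let l : ℝ := 1 / N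
  have hl : 0 < l := by positivity
  let K : Matrix (Fin (j + d)) (Fin 1) ℤ := Matrix.of fun i _ => r i
  have hseg : ∀ t : ℝ, affMap y₀ K (fun _ => t) = y₀ + (t * N) • (y - y₀) := by
    intro t
    funext i
    simp only [affMap, affine_one, K, Matrix.of_apply, Pi.add_apply, Pi.smul_apply, Pi.sub_apply,
      smul_eq_mul, hy₀]
    field_simp
    ring
  have hend : affMap y₀ K (fun _ => l) = y := by
    rw [hseg, one_div_mul_cancel hN'.ne', one_smul, add_sub_cancel]
  have hint : ∀ t : ℝ, 0 ≤ t → t < l → affMap y₀ K (fun _ => t) ∈ interior (polyhedron s s') := by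
    intro t h0 h1
    rw [hseg]
    exact segment_mem_interior hr hy (by positivity) ((lt_div_iff₀ hN').1 h1)
  let ψ : ModelPoint 0 1 {x | x 0 ∈ Set.Ioo 0 l} →
      ModelPoint (k + d') (j + d) (polyhedron s s') := fun q =>
    mkPoint (κ.map p) (κ.xc p) (monMap (fun _ => 1) y₀ K q.pt.z)
  have hord : ∀ q : ModelPoint 0 1 {x | x 0 ∈ Set.Ioo 0 l},
      (fun i => (monMap (fun _ => 1) y₀ K q.pt.z i).order) ∈ interior (polyhedron s s') := by
    intro q
    rw [monMap_order]
    convert hint _ q.ord_mem.1.le q.ord_mem.2 using 2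
    exact funext fun i => by rw [Subsingleton.elim i 0]; rfl
  have hψ : ∀ q, ψ q = ⟨κ.xc p, ⟨monMap (fun _ => 1) y₀ K q.pt.z,
      monMap_coeff_ne_zero (fun _ => one_ne_zero) _ _ q.pt.coeff_ne_zero,
      interior_subset (hord q)⟩⟩ := fun q => mkPoint_eq _ _ _
  have hV : ∀ q, ψ q ∈ κ.V := fun q => by
    rw [hψ]
    exact Chart.mem_V_of_interior hκ rfl (hord q)
  have hmorph : ∀ q, MorphAt (X := model 0 1 {x | x 0 ∈ Set.Ioo 0 l})
      (Y := model (k + d') (j + d) (polyhedron s s')) ψ q := fun q =>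
    morphAt_mkPoint (X := model 0 1 {x | x 0 ∈ Set.Ioo 0 l}) _
      (isModeled_model (isPolytope_Ioo hl) q) (fun i => SmAt.const _ _ _)
      (fun i => ExplAt.monomial one_ne_zero _ _ fun j => ModelPoint.explAt_z q j)
      (Eventually.of_forall fun q' => interior_subset (hord q'))
  let γ : Hom (interval (Set.Ioo 0 l)) C.toSpace :=
    Hom.ofMorphAt (X := model 0 1 {x | x 0 ∈ Set.Ioo 0 l}) (fun q => κ.symm (ψ q)) fun q =>
      MorphAt.comp (X := model 0 1 {x | x 0 ∈ Set.Ioo 0 l})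
        (Y := model (k + d') (j + d) (polyhedron s s')) (φ := ψ) (κ.morph_symm _ (hV q)) (hmorph q)
  have hγ : ∀ q, γ q ∈ κ.U := fun q => κ.symm_mem _ (hV q)
  have hK : ∀ q, κ.zc (γ q) = monMap (fun _ => 1) y₀ K (ModelPoint.pt q).z := by
    intro q
    have e : κ.map (γ q) = ψ q := κ.right _ (hV q)
    exact congrArg (fun r : ModelPoint _ _ _ => r.pt.z) (e.trans (hψ q))
  -- The projected segment stays in `Q`: before the end because interior points project to `Q`, at
  -- the end by hypothesis. Completeness lifts the extension, which forces the endpoint `y` into the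
  -- polytope.
  have hext : Extends γ := by
    rw [hc l hl]
    refine Extends.of_affMap_mem (κ := μ) (u := fun _ => 1) (a := baseCoords y₀)
      (K := Matrix.of fun i _ => r (Fin.castAdd d i)) hl (fun q => (H _ (hγ q)).1)
      (fun _ => one_ne_zero) (fun q => ?_) fun t ht => ?_
    · funext i
      refine ((H _ (hγ q)).2 i).symm.trans ?_
      rw [hK]
      rfl
    · show baseCoords (affMap y₀ K fun _ => t) ∈ Q
      rcases ht.2.eq_or_lt with h | h
      · rw [h, hend]
        exact hyQ
      · exact baseCoords_mem hκ (fun y hy => (H y hy).2) (hint t ht.1 h)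
  rw [← hend]
  exact hext.affMap_mem hl hγ hK ⟨hl.le, le_rfl⟩

/-- Integral vectors lift, so the image of the polytope contains a neighbourhood of each of its
points in the interior of the base polytope. -/
theorem exists_interior_baseCoords_eq (hQ : IsPolytope Q)
    (hκ : κ.ordc p ∈ interior (polyhedron s s'))
    (h2 : ∀ c, Set.SurjOn (π.differential c) {v | v.IsIntegral} {v | v.IsIntegral})
    (H : ∀ y ∈ κ.U, π y ∈ μ.U ∧ ∀ i, κ.zc y (Fin.castAdd d i) = μ.zc (π y) i)
    {y : Fin (j + d) → ℝ} (hy : y ∈ polyhedron s s') (hyQ : baseCoords y ∈ interior Q) :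
    ∃ z ∈ interior (polyhedron s s'), baseCoords z = baseCoords y := by
  -- The neighbourhood of `p` covered by the chart contains a point `c` of order `y`, even if `y` is
  -- on the boundary. Integral vectors can be lifted there.
  obtain ⟨t, -, ht, htq⟩ := ModelPoint.exists_tendsto (q := κ.map p) hκ hy
  obtain ⟨N, hN⟩ := (htq.eventually (κ.V.isOpen.mem_nhds κ.map_mem')).exists
  set c := κ.symm (t N) with hcdef
  have hc : c ∈ κ.U := κ.symm_mem _ hN
  have hcy : κ.ordc c = y := (congrArg ModelPoint.ord (κ.right _ hN)).trans (ht N)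
  have hcF : π c ∈ μ.U := (H c hc).1
  have hcQ : (μ.at' (π c) hcF).ordc (π c) ∈ interior Q := by
    convert hyQ using 1
    funext i
    rw [← hcy]
    exact (congrArg Number.order ((H c hc).2 i)).symm
  choose v hv hv' using fun i : Fin j =>
    TangentVector.exists_of_coords (μ.at' (π c) hcF) 0 (Pi.single i 1)
  have hvi : ∀ i, (v i).IsIntegral := fun i => by
    refine TangentVector.isIntegral_of_coords hQ hcQ (hv i) fun i' => ?_
    rw [hv' i]
    rcases eq_or_ne i' i with rfl | hne
    · exact ⟨1, by simp⟩
    · exact ⟨0, by simp [hne]⟩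
  choose w hw hw' using fun i => h2 c (hvi i)
  choose W hW using fun i i' => (hw i).exists_dlog (κ.explAt_zc hc i')
  have hWbase : ∀ i i', W i (Fin.castAdd d i') = (Pi.single i 1 : Fin j → ℤ) i' := by
    intro i i'
    have h : (w i).dlog (fun x => κ.zc x (Fin.castAdd d i')) = (Pi.single i 1 : Fin j → ℂ) i' := by
      rw [← hv' i i', ← hw' i]
      refine Eq.trans ?_ (TangentVector.differential_dlog π (w i) (μ.explAt_zc hcF i')).symm
      refine TangentVector.dlog_congr (κ.explAt_zc hc _) ?_
      filter_upwards [κ.U.isOpen.mem_nhds hc] with x hx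
      exact (H x hx).2 i'
    rw [hW] at h
    have h' : ((Pi.single i 1 : Fin j → ℂ) i') = (((Pi.single i 1 : Fin j → ℤ) i' : ℤ) : ℂ) := by
      simp [Pi.single_apply]
    exact_mod_cast h.trans h'
  -- A monomial active at `y` has order `0` near `c`, so integral vectors have zero logarithmic
  -- derivative on it. The lifted directions are thus tangent to the face of `y`.
  have hface : ∀ a ∈ s, affine a.1 a.2 y = 0 → ∀ i, ∑ i', (a.2 i' : ℝ) * W i i' = 0 := by
    intro a ha h0 i
    let e : SmoothExponent (polyhedron s s') := ⟨a.1, a.2, fun y hy => hy.1 a ha⟩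
    have hcont := (Chart.smAt_mon (κ := κ.at' c hc) ⟨⟨_, hκ⟩, s, s', rfl⟩ e).continuousAt
      (C.isModeled c)
    have hne : κ.mon e c ≠ 0 := by
      refine (ModelPoint.smoothMonomial_ne_zero_iff e (κ.map c)).2 ?_
      rw [show ModelPoint.ord (κ.map c) = y from hcy]
      exact h0
    have hzero : ∀ᶠ x in 𝓝 c, affine a.1 a.2 (κ.ordc x) = 0 := by
      filter_upwards [hcont.eventually (isOpen_ne.mem_nhds hne)] with x hx
      exact (ModelPoint.smoothMonomial_ne_zero_iff e (κ.map x)).1 hx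
    have h1 : ExplAt C.toSpace c fun _ => (1 : Number) := ExplAt.const _ _ one_ne_zero
    have h3 := TangentVector.dlog_monomial (v := w i) a.1 a.2 h1 fun i' => κ.explAt_zc hc i'
    rw [TangentVector.dlog_const (one_ne_zero : (1 : Number).coeff ≠ 0), zero_add,
      (hw i).dlog_eq_zero (h1.mul (ExplAt.monomial one_ne_zero _ _ fun i' => κ.explAt_zc hc i'))
        (hzero.mono fun x hx => by
          rw [Number.mul_order]
          exact (zero_add _).trans hx)] at h3
    simp only [hW] at h3
    exact_mod_cast h3.symm
  let y₁ := κ.ordc p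
  -- `δ` is the displacement in the base from the interior point `y₁` to `y`. Continuing it along
  -- the lifted integral directions keeps the active inequalities, so one can go beyond `y` by a
  -- small multiple `ε`.
  let δ : Fin j → ℝ := fun i => y (Fin.castAdd d i) - y₁ (Fin.castAdd d i)
  let y' : Fin (j + d) → ℝ := fun i' => y i' + ∑ i, δ i * W i i'
  have hy' : ∀ a ∈ s, affine a.1 a.2 y = 0 → 0 ≤ affine a.1 a.2 y' := by
    intro a ha h0
    have : affine a.1 a.2 y' = affine a.1 a.2 y + ∑ i, δ i * ∑ i', (a.2 i' : ℝ) * W i i' := by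
      simp only [affine, y', mul_add, Finset.sum_add_distrib, Finset.mul_sum, add_assoc]
      congr 2
      rw [Finset.sum_comm]
      exact Finset.sum_congr rfl fun i _ => Finset.sum_congr rfl fun i' _ => by ring
    rw [this, h0, zero_add]
    exact (Finset.sum_eq_zero fun i _ => by rw [hface a ha h0, mul_zero]).ge
  obtain ⟨ε, hε, hε0⟩ := ((eventually_mem_polyhedron hy hy').and self_mem_nhdsWithin).exists
  have hε0 : 0 < ε := hε0
  -- The overshoot lies at distance `1 + ε` times `δ` from `y₁` in the base, so the segment from
  -- `y₁` to it passes over the base point of `y` at time `1 / (1 + ε)`, before the end and hence in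
  -- the interior.
  refine ⟨y₁ + (1 / (1 + ε)) • (y + ε • (y' - y) - y₁), segment_mem_interior hκ (fun a ha => ?_)
    (by positivity) ?_, ?_⟩
  · rcases Finset.mem_union.1 ha with ha | ha
    · exact hε.1 a ha
    · exact (hε.2 a ha).le
  · rw [div_lt_one (by positivity)]
    linarith
  · funext i'
    have hsum : ∑ i, δ i * W i (Fin.castAdd d i') = δ i' := by
      simp [hWbase, Pi.single_apply]
    simp only [baseCoords, Pi.add_apply, Pi.smul_apply, Pi.sub_apply, smul_eq_mul, y', hsum, δ]
    field_simp
    ring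

end

/-- Every point of the base that is topologically indistinguishable from `π p` lifts to a point that
is topologically indistinguishable from `p`. -/
theorem exists_inseparable_lift {C F : Manifold.{u}} (π : Hom C.toSpace F.toSpace)
    (hπ : ∀ p : C, Function.Surjective (π.differential p) ∧
      Set.SurjOn (π.differential p) {v | v.IsIntegral} {v | v.IsIntegral})
    (hc : ∀ l : ℝ, 0 < l → ∀ γ : Hom (interval (Set.Ioo 0 l)) C.toSpace,
      Extends γ ↔ Extends (γ.comp π)) (p : C) (b : F) (hb : Inseparable (π p) b) :
    ∃ p' : C, Inseparable p p' ∧ π p' = b := by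
  obtain ⟨k, j, Q, μ, d', d, P, κ, hQ, hP, hμ, hκ, H⟩ :=
    exists_normal_form π p (hπ p).1 (hπ p).2
  have hbU : b ∈ μ.U := (hb.mem_open_iff μ.U.isOpen).1 μ.mem
  have hmb : Inseparable (μ.map (π p)) (μ.map b) :=
    inseparable_map_of_continuousAt hb (μ.morph_map _ μ.mem).1 (μ.morph_map _ hbU).1
  have hbQ : μ.ordc b ∈ interior Q := mem_interior_of_inseparable hQ hμ hmb
  obtain ⟨-, s, s', hPs⟩ := hP
  obtain rfl : P = polyhedron s s' := hPs
  have H' : ∀ y ∈ κ.U, π y ∈ μ.U ∧ ∀ i, κ.zc y (Fin.castAdd d i) = μ.zc (π y) i := fun y hy =>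
    ⟨(H y hy).1, (H y hy).2.2⟩
  have hQconv : Convex ℝ (interior Q) := by
    obtain ⟨-, r, r', hQs⟩ := hQ
    rw [hQs]
    exact (convex_polyhedron r r').interior
  -- The image is open and meets the connected set `interior Q`; it remains to see that it is closed
  -- relative to it.
  have hsub : interior Q ⊆ baseCoords '' interior (polyhedron s s') := by
    refine hQconv.isPreconnected.subset_of_closure_inter_subset (isOpen_image_baseCoords isOpen_interior)
      ⟨μ.ordc (π p), hμ, κ.ordc p, hκ, ?_⟩ ?_
    · exact funext fun i => congrArg Number.order ((H p κ.mem).2.2 i)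
    · rintro y ⟨hy, hyQ⟩
      obtain ⟨z, rfl, hz⟩ := exists_lift_of_mem_closure (s ∪ s') (fun y hy c hc => by
        rcases Finset.mem_union.1 hc with hc | hc
        · exact (interior_subset hy).1 c hc
        · exact ((interior_subset hy).2 c hc).le) hy
      have hzP := mem_of_baseCoords_mem hc hκ H' hz (interior_subset hyQ)
      exact exists_interior_baseCoords_eq hQ hκ (fun c => (hπ c).2) H' hzP hyQ
  obtain ⟨z, hz, hzb⟩ := hsub hbQ
  have hord : (fun i => (Fin.append (μ.zc b) (fun i => (⟨1, z (Fin.natAdd j i)⟩ : Number)) i).order) = z := by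
    funext i
    refine Fin.addCases (fun i => ?_) (fun i => ?_) i
    · rw [Fin.append_left]
      exact (congrFun hzb i).symm
    · rw [Fin.append_right]
  -- Real coordinates agree with those of `p`, the first exploded coordinates are those of `b`, and
  -- the others have coefficient `1` and the orders of the lift `z`. Lying over the interior, this
  -- point is indistinguishable from `p` in the chart.
  let q : ModelPoint (k + d') (j + d) (polyhedron s s') := ⟨κ.xc p,
    ⟨Fin.append (μ.zc b) fun i => ⟨1, z (Fin.natAdd j i)⟩, fun i => by
      refine Fin.addCases (fun i => ?_) (fun i => ?_) i
      · rw [Fin.append_left]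
        exact μ.zc_coeff_ne_zero _ _
      · rw [Fin.append_right]
        exact one_ne_zero, by
      rw [hord]
      exact interior_subset hz⟩⟩
  have hq : q.ord ∈ interior (polyhedron s s') := by
    rw [show q.ord = z from hord]
    exact hz
  have hqV : q ∈ κ.V := Chart.mem_V_of_interior hκ rfl hq
  have hU := κ.symm_mem _ hqV
  have hr := κ.right _ hqV
  refine ⟨κ.symm q, Chart.inseparable_symm hκ rfl hq, ?_⟩
  rw [← μ.left b hbU, ← μ.left _ (H _ hU).1]
  refine congrArg μ.symm (ModelPoint.ext ?_ (TorusPoint.ext ?_))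
  · funext i
    refine ((H _ hU).2.1 i).symm.trans ?_
    rw [Chart.xc, hr]
    exact ((H p κ.mem).2.1 i).trans (congrFun (ModelPoint.inseparable_iff.1 hmb).1 i)
  · funext i
    refine ((H _ hU).2.2 i).symm.trans ?_
    rw [Chart.zc, hr]
    exact Fin.append_left (μ.zc b) (fun i => (⟨1, z (Fin.natAdd j i)⟩ : Number)) i

/-! ### Properness -/

/-- The quotient map to the smooth part is inducing and surjective, so the ultrafilter criterion for
properness can be pulled back; equality of limits becomes indistinguishability. -/
theorem Hom.isProper_iff {X : Space.{u}} {Y : Space.{v}} (f : Hom X Y) : f.IsProper ↔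
    ∀ (𝒱 : Ultrafilter X) (y : Y), Tendsto f 𝒱 (𝓝 y) →
      ∃ x, Inseparable (f x) y ∧ (𝒱 : Filter X) ≤ 𝓝 x := by
  rw [Hom.IsProper, isProperMap_iff_ultrafilter]
  have hcont : Continuous f.smoothPart :=
    SeparationQuotient.continuous_lift (SeparationQuotient.continuous_mk.comp f.continuous)
  constructor
  · rintro ⟨-, h⟩ 𝒱 y hy
    obtain ⟨x, hx, hx'⟩ := @h (𝒱.map SeparationQuotient.mk) (SeparationQuotient.mk y)
      ((SeparationQuotient.continuous_mk.tendsto y).comp hy)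
    obtain ⟨x, rfl⟩ := SeparationQuotient.surjective_mk x
    refine ⟨x, SeparationQuotient.mk_eq_mk.1 hx, ?_⟩
    rw [SeparationQuotient.isInducing_mk.nhds_eq_comap]
    exact map_le_iff_le_comap.1 hx'
  · refine fun h => ⟨hcont, fun 𝒰 y hy => ?_⟩
    obtain ⟨y, rfl⟩ := SeparationQuotient.surjective_mk y
    obtain ⟨s, hs⟩ := (SeparationQuotient.surjective_mk (X := X)).hasRightInverse
    obtain ⟨x, hx, hx'⟩ := h (𝒰.map s) y (by
      rw [SeparationQuotient.isInducing_mk.nhds_eq_comap, tendsto_comap_iff]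
      refine tendsto_map'_iff.2 (hy.congr fun z => ?_)
      conv_lhs => rw [← hs z]
      rfl)
    refine ⟨SeparationQuotient.mk x, SeparationQuotient.mk_eq_mk.2 hx, ?_⟩
    have h1 := (SeparationQuotient.continuous_mk.tendsto x).mono_left hx'
    have h2 : Tendsto (fun z => z) (𝒰 : Filter _) (𝓝 (SeparationQuotient.mk x)) :=
      (tendsto_map'_iff.1 h1).congr hs
    exact h2

/-! ### Convergence towards points over the interior of a polytope. -/

theorem nonneg_of_closed_polyhedron {m : ℕ} {s s' : Finset (ℝ × (Fin m → ℤ))}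
    (e : SmoothExponent (polyhedron s s')) {x₀ : Fin m → ℝ} (hx₀ : x₀ ∈ polyhedron s s')
    {y : Fin m → ℝ} (hy : ∀ c ∈ s ∪ s', 0 ≤ affine c.1 c.2 y) : 0 ≤ affine e.a e.α y := by
  by_contra! hneg
  have key : ∀ t : ℝ, 0 ≤ t → t < 1 → 0 ≤ (1 - t) * affine e.a e.α x₀ + t * affine e.a e.α y := by
    intro t h0 h1
    have h := e.nonneg (x₀ + t • (y - x₀)) ⟨fun c hc => ?_, fun c hc => ?_⟩
    · rw [affine_add_smul_sub] at h
      linarith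
    · rw [affine_add_smul_sub]
      have := hx₀.1 c hc
      have := hy c (Finset.mem_union_left _ hc)
      nlinarith
    · rw [affine_add_smul_sub]
      have := hx₀.2 c hc
      have := hy c (Finset.mem_union_right _ hc)
      nlinarith
  have h0 := e.nonneg _ hx₀
  have hlt : 0 < affine e.a e.α x₀ - affine e.a e.α y := by linarith
  -- At this time along the segment from `x₀` to `y` the function takes half of its negative value
  -- at `y`.
  have h := key ((affine e.a e.α x₀ - affine e.a e.α y / 2) /
    (affine e.a e.α x₀ - affine e.a e.α y)) (by
      apply div_nonneg <;> linarith) (by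
      rw [div_lt_one hlt]
      linarith)
  have h' : (1 - (affine e.a e.α x₀ - affine e.a e.α y / 2) /
      (affine e.a e.α x₀ - affine e.a e.α y)) * affine e.a e.α x₀ +
      (affine e.a e.α x₀ - affine e.a e.α y / 2) / (affine e.a e.α x₀ - affine e.a e.α y) *
        affine e.a e.α y = affine e.a e.α y / 2 := by
    field_simp
    ring
  rw [h'] at h
  linarith

/-- The smooth monomials are bounded by powers of those given by the defining inequalities. -/
theorem exists_norm_smoothMonomial_le {n m : ℕ} {s s' : Finset (ℝ × (Fin m → ℤ))}
    (hne : (polyhedron s s').Nonempty) (e : SmoothExponent (polyhedron s s')) (he : e.α ≠ 0) :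
    ∃ c ∈ s ∪ s', c.2 ≠ 0 ∧ ∃ r : ℝ, 0 < r ∧ ∀ q : ModelPoint n m (polyhedron s s'),
      (∀ c' ∈ s ∪ s', c'.2 ≠ 0 → ‖(monomial 1 c'.1 c'.2 q.pt.z).smoothPart‖ ≤ 1) →
        ‖smoothMonomial e q.pt‖ ≤ ‖(monomial 1 c.1 c.2 q.pt.z).smoothPart‖ ^ r := by
  obtain ⟨x₀, hx₀⟩ := hne
  have hweak : ∀ {x}, x ∈ polyhedron s s' → ∀ c ∈ s ∪ s', 0 ≤ affine c.1 c.2 x := fun hx c hc => by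
    rcases Finset.mem_union.1 hc with hc | hc
    · exact hx.1 c hc
    · exact (hx.2 c hc).le
  obtain ⟨c₀, r, hc₀, hr, ha, hα⟩ := affine_farkas (s ∪ s') (fun c => c.1) (fun c => linForm c.2) e.a
    (linForm e.α) x₀ (fun c hc => by
      rw [← affine_eq]
      exact hweak hx₀ c hc) fun x hx => by
      rw [← affine_eq]
      exact nonneg_of_closed_polyhedron e hx₀ fun c hc => by
        rw [affine_eq]
        exact hx c hc
  have hex : ∃ c ∈ s ∪ s', c.2 ≠ 0 ∧ r c ≠ 0 := by
    by_contra! hno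
    refine he (funext fun i => ?_)
    have h := congrArg (fun g => g (Pi.single i 1)) hα
    simp only [LinearMap.sum_apply, LinearMap.smul_apply, smul_eq_mul, linForm_apply] at h
    rw [Finset.sum_eq_zero (s := s ∪ s') fun c hc => ?_] at h
    · simpa [Pi.single_apply] using h
    · by_cases h0 : c.2 = 0
      · simp [h0]
      · rw [hno c hc h0, zero_mul]
  obtain ⟨c, hc, hc2, hrc⟩ := hex
  have hrc' : 0 < r c := lt_of_le_of_ne (hr c) hrc.symm
  refine ⟨c, hc, hc2, r c, hrc', fun q hq => ?_⟩
  rw [ModelPoint.smoothMonomial_eq]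
  split_ifs with h0
  swap
  · rw [norm_zero]
    positivity
  have hsum : affine e.a e.α q.ord = c₀ + ∑ c ∈ s ∪ s', r c * affine c.1 c.2 q.ord := by
    rw [affine_eq, ha, hα]
    simp only [affine_eq, LinearMap.sum_apply, LinearMap.smul_apply, smul_eq_mul, mul_add,
      Finset.sum_add_distrib]
    ring
  have hpos : ∀ c ∈ s ∪ s', 0 ≤ r c * affine c.1 c.2 q.ord := fun c hc =>
    mul_nonneg (hr c) (hweak q.ord_mem c hc)
  -- Where the monomial has order `0`, every inequality with a nonzero Farkas coefficient is active,
  -- so its smooth part is its full coefficient. Logarithms of norms turn the Farkas identity into a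
  -- sum of nonpositive terms, of which only one is kept.
  have hzero : ∀ c ∈ s ∪ s', r c * affine c.1 c.2 q.ord = 0 := by
    rw [hsum] at h0
    exact (Finset.sum_eq_zero_iff_of_nonneg hpos).1
      (le_antisymm (by linarith) (Finset.sum_nonneg hpos))
  let L : Fin m → ℝ := fun i => Real.log ‖(q.pt.z i).coeff‖
  have hL : ∀ α : Fin m → ℤ, ‖∏ i, (q.pt.z i).coeff ^ α i‖ = Real.exp (linForm α L) := by
    intro α
    rw [linForm_apply, Real.exp_sum, norm_prod]
    refine Finset.prod_congr rfl fun i _ => ?_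
    rw [norm_zpow, ← Real.rpow_intCast, Real.rpow_def_of_pos (norm_pos_iff.2 (q.pt.coeff_ne_zero i)),
      mul_comm]
  have hfac : ∀ c ∈ s ∪ s', r c ≠ 0 →
      (monomial 1 c.1 c.2 q.pt.z).smoothPart = ∏ i, (q.pt.z i).coeff ^ c.2 i := by
    intro c hc h
    have h1 := (mul_eq_zero.1 (hzero c hc)).resolve_left h
    rw [Number.smoothPart_of_order_eq_zero (show (monomial 1 c.1 c.2 q.pt.z).order = 0 from h1)]
    exact one_mul _
  have hle : ∀ c ∈ s ∪ s', r c * linForm c.2 L ≤ 0 := by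
    intro c hc
    by_cases h : r c = 0
    · rw [h, zero_mul]
    by_cases h2 : c.2 = 0
    · rw [h2]
      simp [linForm_apply]
    have h1 := hq c hc h2
    rw [hfac c hc h, hL, Real.exp_le_one_iff] at h1
    exact mul_nonpos_of_nonneg_of_nonpos (hr c) h1
  rw [hL, hα, hfac c hc hrc, hL, ← Real.exp_mul, Real.exp_le_exp, mul_comm]
  simp only [LinearMap.sum_apply, LinearMap.smul_apply, smul_eq_mul]
  have := Finset.sum_le_sum_of_subset_of_nonneg (f := fun c => -(r c * linForm c.2 L))
    (Finset.singleton_subset_iff.2 hc) fun c' hc' _ => neg_nonneg.2 (hle c' hc')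
  simpa using this

/-- Convergence to a point over the interior only has to be checked for the real coordinates and
the defining inequalities. -/
theorem ModelPoint.tendsto_of_interior {n m : ℕ} {P : Set (Fin m → ℝ)}
    {s s' : Finset (ℝ × (Fin m → ℤ))} (hP : P = polyhedron s s') {ι : Type*} {l : Filter ι}
    {t : ι → ModelPoint n m P} {q : ModelPoint n m P} (hq : q.ord ∈ interior P)
    (hx : Tendsto (fun a => (t a).x) l (𝓝 q.x)) (hz : ∀ c ∈ s ∪ s', c.2 ≠ 0 →
      Tendsto (fun a => (monomial 1 c.1 c.2 (t a).pt.z).smoothPart) l (𝓝 0)) :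
    Tendsto t l (𝓝 q) := by
  subst hP
  refine tendsto_iff.2 ⟨hx, fun e => ?_⟩
  rw [smoothMonomial_of_interior e hq]
  by_cases he : e.α = 0
  · refine tendsto_const_nhds.congr fun a => ?_
    rw [smoothMonomial_eq]
    simp [he, affine]
  rw [if_neg fun h => he h.2]
  obtain ⟨c, hc, hc2, r, hr, hle⟩ := exists_norm_smoothMonomial_le (n := n) ⟨_, q.ord_mem⟩ e he
  refine squeeze_zero_norm' (a := fun a => ‖(monomial 1 c.1 c.2 (t a).pt.z).smoothPart‖ ^ r) ?_ ?_
  · have : ∀ᶠ a in l, ∀ c' ∈ s ∪ s', c'.2 ≠ 0 →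
        ‖(monomial 1 c'.1 c'.2 (t a).pt.z).smoothPart‖ ≤ 1 := by
      refine (eventually_all_finset _).2 fun c' hc' => ?_
      by_cases h : c'.2 = 0
      · exact Eventually.of_forall fun _ h' => absurd h h'
      · have h1 := (hz c' hc' h).norm
        rw [norm_zero] at h1
        filter_upwards [h1.eventually (Iio_mem_nhds one_pos)] with a ha _
        exact ha.le
    filter_upwards [this] with a ha
    exact hle _ ha
  · have h1 := (hz c hc hc2).norm.rpow_const (p := r) (Or.inr hr.le)
    rwa [norm_zero, Real.zero_rpow hr.ne'] at h1

theorem monomial_append {j d : ℕ} (c : ℂ) (a : ℝ) (α : Fin j → ℤ) (β : Fin d → ℤ)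
    (z : Fin j → Number) (w : Fin d → Number) :
    monomial c a (Fin.append α β) (Fin.append z w) = monomial c a α z * monomial 1 0 β w := by
  ext1
  · simp only [monomial, Fin.prod_univ_add, Fin.append_left, Fin.append_right, Number.mul_coeff]
    ring
  · simp only [monomial, affine, Fin.sum_univ_add, Fin.append_left, Fin.append_right,
      Number.mul_order]
    ring

theorem monomial_zero {m : ℕ} (c : ℂ) (a : ℝ) (z : Fin m → Number) : monomial c a 0 z = ⟨c, a⟩ := by
  ext1 <;> simp [monomial, affine]

theorem monomial_pi_single {m : ℕ} (z : Fin m → Number) (i : Fin m) :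
    monomial 1 0 (Pi.single i 1) z = z i := by
  rw [← monomial_single z i]
  congr 1
  funext i'
  simp [Matrix.one_apply, Pi.single_apply, eq_comm]

theorem smoothPart_monomial_monMap {m k : ℕ} {z : Fin m → Number} (hz : ∀ i, (z i).coeff ≠ 0)
    (c : ℝ × (Fin k → ℤ)) (u : Fin k → ℂ) (a : Fin k → ℝ) (A : Matrix (Fin k) (Fin m) ℤ) :
    (monomial 1 c.1 c.2 (monMap u a A z)).smoothPart = (∏ l, u l ^ c.2 l) *
      (monomial 1 (pullIneq a A c).1 (pullIneq a A c).2 z).smoothPart := by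
  change (monomial 1 c.1 c.2 fun l => monomial (u l) (a l) (A l) z).smoothPart = _
  rw [monomial_monomial hz, one_mul, smoothPart_monomial]
  rfl

/-- At a centered point a nonconstant smooth monomial has the value `0`, and it is continuous. -/
theorem Chart.tendsto_smoothPart_monomial {X : Manifold.{u}} {p : X} {n m : ℕ}
    {P : Set (Fin m → ℝ)} {s s' : Finset (ℝ × (Fin m → ℤ))} (hP : P = polyhedron s s')
    {κ : Chart X.toSpace p (model n m P)} (hκ : κ.ordc p ∈ interior P) {c : ℝ × (Fin m → ℤ)} (hc : c ∈ s ∪ s')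
    (h0 : c.2 ≠ 0) : Tendsto (fun x => (monomial 1 c.1 c.2 (κ.zc x)).smoothPart) (𝓝 p) (𝓝 0) := by
  subst hP
  let e : SmoothExponent (polyhedron s s') := ⟨c.1, c.2, fun y hy => by
    rcases Finset.mem_union.1 hc with hc | hc
    · exact hy.1 c hc
    · exact (hy.2 c hc).le⟩
  have h := (Chart.smAt_mon (κ := κ) ⟨⟨_, hκ⟩, s, s', rfl⟩ e).continuousAt (X.isModeled p)
  have h1 : κ.mon e p = 0 := by
    refine (ModelPoint.smoothMonomial_of_interior e hκ).trans (if_neg ?_)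
    exact fun h => h0 h.2
  rw [ContinuousAt, h1] at h
  exact h

namespace LocalData

variable {C F G : Manifold.{u}} {π : Hom C.toSpace F.toSpace} {f : Hom G.toSpace F.toSpace} {c : C}
  {g : G} (D : LocalData π f c g)

theorem monMap_baseMatrix (c' : C) (g' : G) :
    monMap (fun _ => 1) 0 D.baseMatrix (D.zcoord c' g') = D.ν.zc g' := by
  funext i
  refine (monomial_append 1 0 0 (Pi.single i 1) (fun i => D.κ.zc c' (Fin.natAdd D.j i))
    (D.ν.zc g')).trans ?_
  rw [monomial_zero, monomial_pi_single]
  exact one_mul _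

theorem monMap_totalMatrix {c' : C} {g' : G} (h : π c' = f g') (hc : c' ∈ D.κ.U) (hg : g' ∈ D.ν.U) :
    monMap (Fin.append (fun i => D.ψ i g') fun _ => 1) (Fin.append D.a 0) D.totalMatrix
      (D.zcoord c' g') = D.κ.zc c' := by
  funext i
  refine Fin.addCases (fun i => ?_) (fun i => ?_) i
  · have h1 : D.totalMatrix (Fin.castAdd D.d i) = Fin.append 0 (D.A i) :=
      Fin.append_left (fun i => Fin.append (0 : Fin D.d → ℤ) (D.A i)) (fun i => Fin.append (Pi.single i 1) 0) i
    rw [monMap, h1, Fin.append_left, Fin.append_left, D.κ_zc c' hc, h, D.ν_zc g' hg, zcoord,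
      monomial_append, monomial_zero]
    ext1 <;> simp [monomial, affine]
  · have h1 : D.totalMatrix (Fin.natAdd D.j i) = Fin.append (Pi.single i 1) 0 :=
      Fin.append_right (fun i => Fin.append (0 : Fin D.d → ℤ) (D.A i)) (fun i => Fin.append (Pi.single i 1) 0) i
    rw [monMap, h1, Fin.append_right, Fin.append_right, zcoord, monomial_append, monomial_zero]
    refine Eq.trans ?_ (mul_one _)
    exact congrArg (· * 1) (monomial_pi_single _ i)

end LocalData

namespace IsFib

variable {C F G X : Manifold.{u}} {π : Hom C.toSpace F.toSpace} {f : Hom G.toSpace F.toSpace}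
  {fst : Hom X.toSpace C.toSpace} {snd : Hom X.toSpace G.toSpace}

/-- At a centered point only real coordinates and defining inequalities need to be checked. The real
coordinates are shared with `C` and `G`, and each inequality of the fiber product comes from one of
the two polytopes, where the corresponding monomial tends to `0`. -/
theorem tendsto_of_tendsto (H : IsFib π f fst snd)
    (hπ : ∀ p : C, Function.Surjective (π.differential p) ∧
      Set.SurjOn (π.differential p) {v | v.IsIntegral} {v | v.IsIntegral}) {l : Filter X} {x : X}
    (h1 : Tendsto fst l (𝓝 (fst x))) (h2 : Tendsto snd l (𝓝 (snd x))) : l ≤ 𝓝 x := by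
  obtain ⟨D⟩ := nonempty_localData (H.comm x) (hπ _).1 (hπ _).2
  obtain ⟨κ, hU, hκ⟩ := H.exists_chart x D
  have e1 : ∀ᶠ x' in l, fst x' ∈ D.κ.U := h1.eventually (D.κ.U.isOpen.mem_nhds D.κ.mem)
  have e2 : ∀ᶠ x' in l, snd x' ∈ D.ν.U := h2.eventually (D.ν.U.isOpen.mem_nhds D.ν.mem)
  have hev : ∀ᶠ x' in l, x' ∈ κ.U := by
    filter_upwards [e1, e2] with x' h1 h2
    exact (hU x').2 ⟨h1, h2⟩
  have key : Tendsto κ.map l (𝓝 (κ.map x)) := by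
    obtain ⟨-, s, s', hP⟩ := D.hP
    obtain ⟨-, r, r', hR⟩ := D.hR
    have hS : κ.ordc x ∈ interior D.S := by
      have h : κ.ordc x = fun i => (D.zcoord (fst x) (snd x) i).order :=
        congrArg (fun z i => Number.order (z i)) (hκ x κ.mem).2
      rw [h]
      exact D.order_mem_interior_S (H.comm x)
    refine ModelPoint.tendsto_of_interior (D.S_eq hP hR) hS ?_ fun c hc h0 => ?_
    · have hx : Tendsto (fun x' => D.xcoord (fst x') (snd x')) l
          (𝓝 (D.xcoord (fst x) (snd x))) := by
        refine tendsto_pi_nhds.2 fun i => ?_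
        refine Fin.addCases (fun i => ?_) (fun i => ?_) i
        · simp only [LocalData.xcoord, Fin.append_left]
          exact (((continuous_apply _).comp ModelPoint.continuous_x).tendsto _).comp
            (D.κ.tendsto_map.comp h1)
        · simp only [LocalData.xcoord, Fin.append_right]
          exact (((continuous_apply _).comp ModelPoint.continuous_x).tendsto _).comp
            (D.ν.tendsto_map.comp h2)
      have hx0 : ModelPoint.x (κ.map x) = D.xcoord (fst x) (snd x) := (hκ x κ.mem).1
      rw [hx0]
      refine hx.congr' ?_
      filter_upwards [hev] with x' hx'
      exact (hκ x' hx').1.symm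
    · have hcase : (∃ c' ∈ r ∪ r', pullIneq 0 D.baseMatrix c' = c) ∨
          ∃ c' ∈ s ∪ s', pullIneq (Fin.append D.a 0) D.totalMatrix c' = c := by
        simp only [Finset.mem_union, Finset.mem_image] at hc ⊢
        grind
      rcases hcase with ⟨c', hc', rfl⟩ | ⟨c', hc', rfl⟩
      · have h0' : c'.2 ≠ 0 := fun h => h0 (by rw [pullIneq, h, Matrix.zero_vecMul])
        refine ((D.ν.tendsto_smoothPart_monomial hR D.hν hc' h0').comp h2).congr' ?_
        filter_upwards [hev] with x' hx'
        have hz : (ModelPoint.pt (κ.map x')).z = _ := (hκ x' hx').2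
        rw [hz, Function.comp_apply, ← D.monMap_baseMatrix (fst x') (snd x'),
          smoothPart_monomial_monMap (D.zcoord_coeff_ne_zero _ _)]
        simp
      · have h0' : c'.2 ≠ 0 := fun h => h0 (by rw [pullIneq, h, Matrix.zero_vecMul])
        have hC := (D.κ.tendsto_smoothPart_monomial hP D.hκ hc' h0').comp h1
        -- The coordinates of `C` are monomials in the product coordinates with coefficients `ψ`.
        -- The monomials of `C` and of the fiber product therefore differ by a factor with a nonzero
        -- limit.
        let w : X → Fin (D.j + D.d) → ℂ := fun x' => Fin.append (fun i => D.ψ i (snd x')) fun _ => 1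
        have hw0 : ∀ i, w x i ≠ 0 := by
          refine Fin.addCases (fun i => ?_) (fun i => ?_)
          · simp only [w, Fin.append_left]
            exact D.ψ_ne_zero i
          · simp only [w, Fin.append_right]
            exact one_ne_zero
        have hw : ∀ i, Tendsto (fun x' => w x' i) l (𝓝 (w x i)) := by
          refine Fin.addCases (fun i => ?_) (fun i => ?_)
          · simp only [w, Fin.append_left]
            exact ((D.smAt_ψ i).continuousAt (G.isModeled _)).tendsto.comp h2
          · simp only [w, Fin.append_right]
            exact tendsto_const_nhds
        have hprod : Tendsto (fun x' => ∏ i, w x' i ^ c'.2 i) l (𝓝 (∏ i, w x i ^ c'.2 i)) :=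
          tendsto_finsetProd _ fun i _ => (hw i).zpow₀ _ (Or.inl (hw0 i))
        have hprod0 : ∏ i, w x i ^ c'.2 i ≠ 0 :=
          Finset.prod_ne_zero_iff.2 fun i _ => zpow_ne_zero _ (hw0 i)
        have hlim := (hprod.inv₀ hprod0).mul hC
        rw [mul_zero] at hlim
        refine hlim.congr' ?_
        filter_upwards [hev, e1, e2, hprod.eventually (isOpen_ne.mem_nhds hprod0)] with x' hx' hx1 hx2 hne
        have hz : (ModelPoint.pt (κ.map x')).z = _ := (hκ x' hx').2
        rw [hz, Function.comp_apply, ← D.monMap_totalMatrix (H.comm x') hx1 hx2,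
          smoothPart_monomial_monMap (D.zcoord_coeff_ne_zero _ _)]
        exact inv_mul_cancel_left₀ hne _
  have h := κ.tendsto_symm.comp key
  have h' : Tendsto (fun x' => x') l (𝓝 x) := by
    refine h.congr' ?_
    filter_upwards [hev] with x' hx'
    exact κ.left x' hx'
  exact h'

/-- Properness of `π` gives a limit in `C` lying over `f g` only up to indistinguishability. Moving
it to an indistinguishable point exactly over `f g` does not change the limits of ultrafilters and
produces a point of the fiber product. -/
theorem isProper (H : IsFib π f fst snd)
    (hπ : ∀ p : C, Function.Surjective (π.differential p) ∧
      Set.SurjOn (π.differential p) {v | v.IsIntegral} {v | v.IsIntegral})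
    (hc : ∀ l : ℝ, 0 < l → ∀ γ : Hom (interval (Set.Ioo 0 l)) C.toSpace,
      Extends γ ↔ Extends (γ.comp π)) (hp : π.IsProper) : snd.IsProper := by
  rw [Hom.isProper_iff] at hp ⊢
  intro 𝒱 g hg
  have hfst : Tendsto π (𝒱.map fst) (𝓝 (f g)) := by
    refine tendsto_map'_iff.2 (((f.continuous.tendsto g).comp hg).congr fun x => ?_)
    exact (H.comm x).symm
  obtain ⟨c, hc1, hc2⟩ := hp _ _ hfst
  obtain ⟨c', hcc', hc'⟩ := exists_inseparable_lift π hπ hc c (f g) hc1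
  obtain ⟨x, rfl, rfl⟩ := H.exists_point c' g hc'
  refine ⟨x, Inseparable.refl _, H.tendsto_of_tendsto hπ ?_ hg⟩
  rw [hcc'.nhds_eq] at hc2
  exact hc2

end IsFib

theorem isFamily_of_isPullback {C F G X : Manifold.{u}} {π : C ⟶ F} (hπ : IsFamily π) {f : G ⟶ F}
    {fst : X ⟶ C} {snd : X ⟶ G} (H : IsPullback fst snd π f) : IsFamily snd := by
  have hfib := IsFib.of_isPullback (fun p => hπ.2 p) H
  refine ⟨⟨hfib.isProper (fun p => hπ.2 p) hπ.1.2 hπ.1.1, fun l hl γ =>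
    hfib.extends_iff (fun p => hπ.2 p) hl (hπ.1.2 l hl) γ⟩, fun x => ⟨fun v => ?_, fun v hv => ?_⟩⟩
  · obtain ⟨V, hV, -⟩ := hfib.exists_tangentVector (fun p => hπ.2 p) x v
    exact ⟨V, hV⟩
  · obtain ⟨V, hV, hV'⟩ := hfib.exists_tangentVector (fun p => hπ.2 p) x v
    exact ⟨V, hV' hv, hV⟩

end

end Exploded

theorem mainTheorem7 {C F G : Exploded.Manifold.{u}} (π : C ⟶ F) (hπ : Exploded.IsFamily π)
    (f : G ⟶ F) :
    CategoryTheory.Limits.HasPullback π f ∧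
      ∀ (X : Exploded.Manifold.{u}) (fst : X ⟶ C) (π' : X ⟶ G),
        CategoryTheory.IsPullback fst π' π f → Exploded.IsFamily π' :=
  ⟨(Exploded.isPullback_fibManifold π (fun p => hπ.2 p) f).hasPullback,
    fun _ _ _ H => Exploded.isFamily_of_isPullback hπ H⟩
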